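/- **Conventions.** Let $A$ be a polynomial ring over $\mathbb{C}$ in $N$ variables $x_1,\dots,x_N$, let $W\in A$, and let $G$ be a finite subgroup of the group $G_W$ of diagonal symmetries of $W$, i.e. of the group of all $(\lambda_1,\dots,\lambda_N)\in(\mathbb{C}^\times)^N$ with $W(\lambda_1x_1,\dots,\lambda_Nx_N)=W(x_1,\dots,x_N)$. Such an element acts on $A$ by $x_i\mapsto\lambda_ix_i$. Let $A[G]=\bigoplus_{g\in G}Ag$ be the crossed product algebra, with $(ag)(bh)=a\,g(b)\,gh$. The compact type $G$-twisted Hochschild cohomology $\mathsf{HH}_c(A_W,A_W[G])$ of the curved algebra $A_W=(A,W)$ is the cohomology of $$\Big(\bigoplus_{p\ge 0}\mathrm{Hom}_{\mathbb{C}}(A^{\otimes p},A[G]),\ \partial_H+\mathsf{d}_W\Big),$$ where, for $\varphi\in\mathrm{Hom}_{\mathbb{C}}(A^{\otimes p},A[G])$, $$(\partial_H\varphi)(a_0,\dots,a_p)=a_0\,\varphi(a_1,\dots,a_p)+\sum_{i=0}^{p-1}(-1)^{i+1}\varphi(a_0,\dots,a_ia_{i+1},\dots,a_p)+(-1)^{p+1}\varphi(a_0,\dots,a_{p-1})\,a_p,$$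 $$(\mathsf{d}_W\varphi)(a_1,\dots,a_{p-1})=\sum_{i=0}^{p-1}(-1)^{i}\varphi(a_1,\dots,a_i,W,a_{i+1},\dots,a_{p-1}),$$ and $\mathsf{d}_W\varphi=0$ if $p=0$. It is a $\mathbb{Z}/2\mathbb{Z}$-graded $\mathbb{C}$-algebra: the grading is by the parity of $p$, and the product is induced by the cup product $(\varphi\cup\psi)(a_1,\dots,a_{p+q})=\varphi(a_1,\dots,a_p)\,\psi(a_{p+1},\dots,a_{p+q})$, the product on the right being taken in $A[G]$. An elementary invertible polynomial is one of the following, where all exponents $n,n_i$ are at least $2$: Fermat type $x_1^n$ (with $N=1$); loop type $x_1^{n_1}x_2+x_2^{n_2}x_3+\cdots+x_N^{n_N}x_1$ (with $N\ge2$); chain type $x_1^{n_1}x_2+x_2^{n_2}x_3+\cdots+x_{N-1}^{n_{N-1}}x_N+x_N^{n_N}$ (with $N\ge2$). **Proposition.** For $k=1,\dots,r$ let $W_k$ be an elementary invertible polynomial in $N_k$ variables, $A_k$ the polynomial ring over $\mathbb{C}$ in these variables, and $G_k$ a finite subgroup of $G_{W_k}$. Let $A=A_1\otimes\cdots\otimes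 A_r$ be the polynomial ring in all the variables, $W=W_1\oplus\cdots\oplus W_r\in A$ the sum of the $W_k$ in disjoint sets of variables, and $G=G_1\times\cdots\times G_r$, where $G_k$ acts on the variables of $A_k$. Then there is an isomorphism of $\mathbb{Z}/2\mathbb{Z}$-graded $\mathbb{C}$-algebras $$\mathsf{HH}_c(A_W,A_W[G])\;\cong\;\mathsf{HH}_c\big((A_1)_{W_1},(A_1)_{W_1}[G_1]\big)\otimes\cdots\otimes\mathsf{HH}_c\big((A_r)_{W_r},(A_r)_{W_r}[G_r]\big),$$ where the right hand side is the graded tensor product: the tensor product over $\mathbb{C}$, graded by the sum of the parities, with the multiplication $$(a_1\otimes\cdots\otimes a_r)(b_1\otimes\cdots\otimes b_r)=(-1)^{\sum_{j<i}|a_i||b_j|}\,a_1b_1\otimes\cdots\otimes a_rb_r$$ on homogeneous elements. -/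

import Mathlib

open scoped DirectSum TensorProduct

set_option linter.all false

noncomputable section

namespace TwistedHochschild

/-- A family of submodules with compatible projections is a direct sum decomposition. -/
@[reducible]
def decompositionOfProjections {k M : Type*} [CommRing k] [AddCommGroup M] [Module k M]
    (S : ZMod 2 → Submodule k M) (P : ZMod 2 → M →ₗ[k] M)
    (hmem : ∀ d x, P d x ∈ S d) (hsum : ∀ x, ∑ d, P d x = x)
    (hself : ∀ d, ∀ x ∈ S d, P d x = x) (hne : ∀ d e, d ≠ e → ∀ x ∈ S e, P d x = 0) :
    DirectSum.Decomposition S :=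
  DirectSum.Decomposition.ofLinearMap S
    (∑ d, DirectSum.lof k (ZMod 2) (fun d => S d) d ∘ₗ (P d).codRestrict (S d) (hmem d))
    (by
      refine LinearMap.ext fun x => ?_
      simp only [LinearMap.comp_apply, LinearMap.sum_apply, map_sum,
        DirectSum.coeLinearMap_lof, LinearMap.codRestrict_apply, hsum, LinearMap.id_apply])
    (by
      refine DirectSum.linearMap_ext k fun e => LinearMap.ext fun x => ?_
      simp only [LinearMap.comp_apply, LinearMap.sum_apply,
        DirectSum.coeLinearMap_lof, LinearMap.id_apply]
      rw [Finset.sum_eq_single e]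
      · congr 1
        exact Subtype.ext (hself e x x.2)
      · intro d _ hd
        have : (P d).codRestrict (S d) (hmem d) x = 0 := Subtype.ext (hne d e hd x x.2)
        rw [this, map_zero]
      · simp)


section Cochains

variable (k A B : Type*) [CommRing k] [Ring A] [Algebra k A] [Ring B] [Algebra k B]

/-- `C^p(A, B) = Hom_k(A^{⊗ p}, B)`, as `k`-multilinear maps in `p` variables. -/
def Cochain (p : ℕ) : Type _ := MultilinearMap k (fun _ : Fin p => A) B

instance (p : ℕ) : AddCommGroup (Cochain k A B p) :=
  inferInstanceAs (AddCommGroup (MultilinearMap k (fun _ : Fin p => A) B))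

instance (p : ℕ) : Module k (Cochain k A B p) :=
  inferInstanceAs (Module k (MultilinearMap k (fun _ : Fin p => A) B))

instance (p : ℕ) : FunLike (Cochain k A B p) (Fin p → A) B :=
  inferInstanceAs (FunLike (MultilinearMap k (fun _ : Fin p => A) B) (Fin p → A) B)

/-- Cochains of compact type: the direct sum (not the product) of all `C^p(A, B)`. -/
abbrev CompactCochains : Type _ := ⨁ p : ℕ, Cochain k A B p

variable {k A B}

@[ext] theorem Cochain.ext {p : ℕ} {φ ψ : Cochain k A B p} (h : ∀ v, φ v = ψ v) : φ = ψ :=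
  DFunLike.ext _ _ h

theorem Cochain.map_update_add {p : ℕ} (φ : Cochain k A B p) (v : Fin p → A) (i : Fin p)
    (x y : A) : φ (Function.update v i (x + y)) =
      φ (Function.update v i x) + φ (Function.update v i y) :=
  MultilinearMap.map_update_add _ v i x y

theorem Cochain.map_update_smul {p : ℕ} (φ : Cochain k A B p) (v : Fin p → A) (i : Fin p)
    (c : k) (x : A) : φ (Function.update v i (c • x)) = c • φ (Function.update v i x) :=
  MultilinearMap.map_update_smul _ v i c x

theorem Cochain.add_apply {p : ℕ} (φ ψ : Cochain k A B p) (v : Fin p → A) :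
    (φ + ψ) v = φ v + ψ v := rfl

theorem Cochain.smul_apply {p : ℕ} (c : k) (φ : Cochain k A B p) (v : Fin p → A) :
    (c • φ) v = c • φ v := rfl

/-- The cup product `(φ ∪ ψ)(a₁, …, a_{p+q}) = φ(a₁, …, a_p) ψ(a_{p+1}, …, a_{p+q})`. -/
def cup {p q : ℕ} (φ : Cochain k A B p) (ψ : Cochain k A B q) : Cochain k A B (p + q) :=
  MultilinearMap.mk'
    (fun v => φ (fun i => v (Fin.castAdd q i)) * ψ (fun j => v (Fin.natAdd p j)))
    (by
      intro v i x y
      refine Fin.addCases (fun i => ?_) (fun i => ?_) i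
      · have h1 : ∀ z, (fun j => Function.update v (Fin.castAdd q i) z (Fin.castAdd q j)) =
            Function.update (fun j => v (Fin.castAdd q j)) i z := fun z =>
          Function.update_comp_eq_of_injective v (Fin.castAdd_injective p q) i z
        have h2 : ∀ z, (fun j => Function.update v (Fin.castAdd q i) z (Fin.natAdd p j)) =
            fun j => v (Fin.natAdd p j) := fun z =>
          Function.update_comp_eq_of_forall_ne v z (fun j h => by
            have := congrArg Fin.val h; simp at this; omega)
        simp only [h1, h2, Cochain.map_update_add, add_mul]
      · have h1 : ∀ z, (fun j => Function.update v (Fin.natAdd p i) z (Fin.natAdd p j)) =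
            Function.update (fun j => v (Fin.natAdd p j)) i z := fun z =>
          Function.update_comp_eq_of_injective v (Fin.natAdd_injective q p) i z
        have h2 : ∀ z, (fun j => Function.update v (Fin.natAdd p i) z (Fin.castAdd q j)) =
            fun j => v (Fin.castAdd q j) := fun z =>
          Function.update_comp_eq_of_forall_ne v z (fun j h => by
            have := congrArg Fin.val h; simp at this; omega)
        simp only [h1, h2, Cochain.map_update_add, mul_add])
    (by
      intro v i c x
      refine Fin.addCases (fun i => ?_) (fun i => ?_) i
      · have h1 : ∀ z, (fun j => Function.update v (Fin.castAdd q i) z (Fin.castAdd q j)) =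
            Function.update (fun j => v (Fin.castAdd q j)) i z := fun z =>
          Function.update_comp_eq_of_injective v (Fin.castAdd_injective p q) i z
        have h2 : ∀ z, (fun j => Function.update v (Fin.castAdd q i) z (Fin.natAdd p j)) =
            fun j => v (Fin.natAdd p j) := fun z =>
          Function.update_comp_eq_of_forall_ne v z (fun j h => by
            have := congrArg Fin.val h; simp at this; omega)
        simp only [h1, h2, Cochain.map_update_smul, smul_mul_assoc]
      · have h1 : ∀ z, (fun j => Function.update v (Fin.natAdd p i) z (Fin.natAdd p j)) =
            Function.update (fun j => v (Fin.natAdd p j)) i z := fun z =>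
          Function.update_comp_eq_of_injective v (Fin.natAdd_injective q p) i z
        have h2 : ∀ z, (fun j => Function.update v (Fin.natAdd p i) z (Fin.castAdd q j)) =
            fun j => v (Fin.castAdd q j) := fun z =>
          Function.update_comp_eq_of_forall_ne v z (fun j h => by
            have := congrArg Fin.val h; simp at this; omega)
        simp only [h1, h2, Cochain.map_update_smul, mul_smul_comm])

@[simp] theorem cup_apply {p q : ℕ} (φ : Cochain k A B p) (ψ : Cochain k A B q)
    (v : Fin (p + q) → A) :
    cup φ ψ v = φ (fun i => v (Fin.castAdd q i)) * ψ (fun j => v (Fin.natAdd p j)) := rfl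

/-- The `0`-cochain with value `b`. -/
def const (b : B) : Cochain k A B 0 := MultilinearMap.constOfIsEmpty k _ b

@[simp] theorem const_apply (b : B) (v : Fin 0 → A) : (const b : Cochain k A B 0) v = b := rfl

theorem mk_eq {p q : ℕ} (h : p = q) (φ : Cochain k A B p) (ψ : Cochain k A B q)
    (H : ∀ v : Fin q → A, φ (fun i => v (Fin.cast h i)) = ψ v) :
    GradedMonoid.mk (A := Cochain k A B) p φ = GradedMonoid.mk q ψ := by
  subst h
  congr 1
  ext v
  exact H v

instance : GradedMonoid.GOne (Cochain k A B) where
  one := const 1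

instance : GradedMonoid.GMul (Cochain k A B) where
  mul φ ψ := cup φ ψ

instance : GradedMonoid.GMonoid (Cochain k A B) where
  one_mul := fun ⟨p, φ⟩ => mk_eq (Nat.zero_add p) _ _ fun v =>
    (one_mul _).trans (congrArg φ (funext fun i => congrArg v (Fin.ext (Nat.zero_add _))))
  mul_one := fun ⟨p, φ⟩ => mk_eq (Nat.add_zero p) _ _ fun v => mul_one _
  mul_assoc := fun ⟨p, φ⟩ ⟨q, ψ⟩ ⟨r, χ⟩ => mk_eq (Nat.add_assoc p q r) _ _ fun v =>
    (mul_assoc _ _ _).trans (congrArg₂ _ rfl (congrArg₂ _ rfl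
      (congrArg χ (funext fun i => congrArg v (Fin.ext (Nat.add_assoc _ _ _))))))

/-- The cup product makes the compact type cochains a (unital, associative, graded) ring. -/
instance : DirectSum.GRing (Cochain k A B) where
  mul_zero φ := Cochain.ext fun v => mul_zero _
  zero_mul φ := Cochain.ext fun v => zero_mul _
  mul_add φ ψ χ := Cochain.ext fun v => mul_add _ _ _
  add_mul φ ψ χ := Cochain.ext fun v => add_mul _ _ _
  natCast n := const n
  natCast_zero := Cochain.ext fun v => Nat.cast_zero
  natCast_succ n := Cochain.ext fun v => Nat.cast_succ n
  intCast n := const n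
  intCast_ofNat n := Cochain.ext fun v => Int.cast_natCast n
  intCast_negSucc_ofNat n := Cochain.ext fun v => Int.cast_negSucc n

instance : DirectSum.GAlgebra k (Cochain k A B) where
  toFun :=
    { toFun := fun c => const (algebraMap k B c)
      map_zero' := Cochain.ext fun v => map_zero (algebraMap k B)
      map_add' := fun a b => Cochain.ext fun v => map_add (algebraMap k B) a b }
  map_one := Cochain.ext fun v => map_one (algebraMap k B)
  map_mul r s := mk_eq rfl _ _ fun v => map_mul (algebraMap k B) r s
  commutes := fun r ⟨p, φ⟩ => mk_eq (Nat.add_comm 0 p) _ _ fun v =>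
    (Algebra.commutes r _).trans (congrArg₂ _
      (congrArg φ (funext fun i => congrArg v (Fin.ext (Nat.zero_add _)))) rfl)
  smul_def := fun r ⟨p, φ⟩ => mk_eq (Nat.zero_add p).symm _ _ fun v =>
    (Algebra.smul_def r _).trans (congrArg₂ _ rfl
      (congrArg φ (funext fun i => congrArg v (Fin.ext (Nat.zero_add _).symm))))

theorem of_mul_of {p q : ℕ} (φ : Cochain k A B p) (ψ : Cochain k A B q) :
    (DirectSum.of (Cochain k A B) p φ * DirectSum.of (Cochain k A B) q ψ : CompactCochains k A B) =
      DirectSum.of (Cochain k A B) (p + q) (cup φ ψ) := DirectSum.of_mul_of _ _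

theorem contractNth_update {p : ℕ} (i : Fin p) (v : Fin (p + 1) → A) (j : Fin (p + 1)) :
    ∃ (j' : Fin p) (L : A →ₗ[k] A), ∀ z,
      Fin.contractNth i.castSucc (· * ·) (Function.update v j z) =
        Function.update (Fin.contractNth i.castSucc (· * ·) v) j' (L z) := by
  rcases lt_trichotomy (j : ℕ) i with h | h | h
  · refine ⟨⟨j, by omega⟩, LinearMap.id, fun z => funext fun x => ?_⟩
    simp only [Fin.contractNth, Function.update_apply, Fin.ext_iff, Fin.val_castSucc, Fin.val_succ,
      LinearMap.id_apply]
    split_ifs <;> first | rfl | omega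
  · refine ⟨⟨j, by omega⟩, LinearMap.mulRight k (v i.succ), fun z => funext fun x => ?_⟩
    simp only [Fin.contractNth, Function.update_apply, Fin.ext_iff, Fin.val_castSucc, Fin.val_succ,
      LinearMap.mulRight_apply]
    split_ifs <;> first | rfl | omega | skip
    congr 2
    ext
    simp only [Fin.val_succ]
    omega
  · rcases Nat.lt_or_ge (i + 1) j with h' | h'
    · refine ⟨⟨j - 1, by omega⟩, LinearMap.id, fun z => funext fun x => ?_⟩
      simp only [Fin.contractNth, Function.update_apply, Fin.ext_iff, Fin.val_castSucc,
        Fin.val_succ, LinearMap.id_apply]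
      split_ifs <;> first | rfl | omega
    · refine ⟨⟨j - 1, by omega⟩, LinearMap.mulLeft k (v i.castSucc), fun z => funext fun x => ?_⟩
      simp only [Fin.contractNth, Function.update_apply, Fin.ext_iff, Fin.val_castSucc,
        Fin.val_succ, LinearMap.mulLeft_apply]
      split_ifs <;> first | rfl | omega | skip
      congr 2
      ext
      simp only [Fin.val_castSucc]
      omega

/-- Multiplying two neighbouring arguments:
`(a₀, …, a_p) ↦ φ(a₀, …, a_i a_{i+1}, …, a_p)`. -/
def contract {p : ℕ} (i : Fin p) : Cochain k A B p →ₗ[k] Cochain k A B (p + 1) where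
  toFun φ := MultilinearMap.mk' (fun v => φ (Fin.contractNth i.castSucc (· * ·) v))
    (by
      intro v j x y
      obtain ⟨j', L, hL⟩ := contractNth_update (k := k) i v j
      simp only [hL, map_add, Cochain.map_update_add])
    (by
      intro v j c x
      obtain ⟨j', L, hL⟩ := contractNth_update (k := k) i v j
      simp only [hL, map_smul, Cochain.map_update_smul])
  map_add' _ _ := rfl
  map_smul' _ _ := rfl

theorem contract_apply {p : ℕ} (i : Fin p) (φ : Cochain k A B p) (v : Fin (p + 1) → A) :
    contract i φ v = φ (Fin.contractNth i.castSucc (· * ·) v) := rfl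

/-- Inserting `W` as the `i`-th argument:
`(a₀, …, a_{p-1}) ↦ φ(a₀, …, a_{i-1}, W, a_i, …, a_{p-1})` for `φ` of degree `p + 1`. -/
def insert (W : A) : {p : ℕ} → Fin p → Cochain k A B p →ₗ[k] Cochain k A B (p - 1)
  | 0, i => i.elim0
  | _ + 1, i =>
    { toFun := fun φ => MultilinearMap.curryMid i φ W
      map_add' := fun _ _ => rfl
      map_smul' := fun _ _ => rfl }

theorem insert_apply_insertNth {p : ℕ} (W : A) (i : Fin (p + 1)) (φ : Cochain k A B (p + 1))
    (v : Fin p → A) : insert W i φ v = φ (i.insertNth W v) := rfl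

theorem insert_apply {p : ℕ} (W : A) (i : Fin p) (φ : Cochain k A B p) (v : Fin (p - 1) → A) :
    insert W i φ v = φ (fun j => if h : (j : ℕ) < i then v ⟨j, by omega⟩ else
      if h' : (i : ℕ) < j then v ⟨j - 1, by omega⟩ else W) := by
  cases p with
  | zero => exact i.elim0
  | succ p =>
    refine congrArg φ (funext fun j => ?_)
    refine Fin.succAboveCases i ?_ (fun j => ?_) j
    · simp
    · rw [Fin.insertNth_apply_succAbove]
      rcases Nat.lt_or_ge j i with h | h
      · have : (i.succAbove j : ℕ) = j := by
          rw [Fin.succAbove_of_castSucc_lt _ _ (by rw [Fin.lt_def]; exact h)]; rfl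
        simp [this, h]
      · have : (i.succAbove j : ℕ) = j + 1 := by
          rw [Fin.succAbove_of_le_castSucc _ _ (by rw [Fin.le_def]; exact h)]; rfl
        simp [this, Nat.lt_succ_of_le h, show ¬ ((j : ℕ) + 1 < i) by omega]

variable (k A B) in
/-- The involution multiplying a cochain of degree `p` by `(-1)^p`. -/
def signInv : CompactCochains k A B →ₗ[k] CompactCochains k A B :=
  DirectSum.toModule k ℕ _ fun p => (-1 : k) ^ p • DirectSum.lof k ℕ (Cochain k A B) p

variable (k A B) in
/-- `φ{m₂} = ∑ᵢ (-1)^i φ(a₀, …, a_i a_{i+1}, …, a_p)` for `φ` of degree `p`. -/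
def braceProduct : CompactCochains k A B →ₗ[k] CompactCochains k A B :=
  DirectSum.toModule k ℕ _ fun p =>
    DirectSum.lof k ℕ (Cochain k A B) (p + 1) ∘ₗ ∑ i : Fin p, (-1 : k) ^ (i : ℕ) • contract i

variable (k B) in
/-- The curving differential `d_W φ = φ{m₀}`, where `m₀` is the `0`-cochain `W`:
`(d_W φ)(a₀, …, a_{p-2}) = ∑ᵢ (-1)^i φ(a₀, …, a_{i-1}, W, a_i, …, a_{p-2})` for `φ` of degree `p`.
It vanishes on `0`-cochains. -/
def curvingDifferential (W : A) : CompactCochains k A B →ₗ[k] CompactCochains k A B :=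
  DirectSum.toModule k ℕ _ fun p =>
    DirectSum.lof k ℕ (Cochain k A B) (p - 1) ∘ₗ ∑ i : Fin p, (-1 : k) ^ (i : ℕ) • insert W i

/-- The structure map `A → B`, as a `1`-cochain. -/
def structureMap (η : A →ₐ[k] B) : Cochain k A B 1 :=
  MultilinearMap.ofSubsingleton k A B (0 : Fin 1) η.toLinearMap

theorem structureMap_apply (η : A →ₐ[k] B) (v : Fin 1 → A) : structureMap η v = η (v 0) := rfl

/-- The structure map `A → B`, as an element of the cochain algebra. -/
def structureCochain (η : A →ₐ[k] B) : CompactCochains k A B :=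
  DirectSum.of (Cochain k A B) 1 (structureMap η)

/-- The Hochschild differential of cochains with values in `B`, an `A`-bimodule through `η`:
`∂φ = (-1)^{p-1} m₂{φ} - φ{m₂} = η ∪ φ - (-1)^p φ ∪ η - φ{m₂}` for `φ` of degree `p`.
The textbook formula is `hochschildDifferential_of` below. -/
def hochschildDifferential (η : A →ₐ[k] B) : CompactCochains k A B →ₗ[k] CompactCochains k A B :=
  LinearMap.mulLeft k (structureCochain η) -
    LinearMap.mulRight k (structureCochain η) ∘ₗ signInv k A B - braceProduct k A B

/-- The curved Hochschild differential `∂ + d_W`. -/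
def curvedDifferential (η : A →ₐ[k] B) (W : A) :
    CompactCochains k A B →ₗ[k] CompactCochains k A B :=
  hochschildDifferential η + curvingDifferential k B W

theorem signInv_of {p : ℕ} (φ : Cochain k A B p) :
    signInv k A B (DirectSum.of _ p φ) = (-1 : k) ^ p • DirectSum.of (Cochain k A B) p φ := by
  simp [signInv, ← DirectSum.lof_eq_of k]

theorem braceProduct_of {p : ℕ} (φ : Cochain k A B p) :
    braceProduct k A B (DirectSum.of _ p φ) =
      ∑ i : Fin p, (-1 : k) ^ (i : ℕ) • DirectSum.of (Cochain k A B) (p + 1) (contract i φ) := by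
  simp [braceProduct, ← DirectSum.lof_eq_of k]

theorem curvingDifferential_of (W : A) {p : ℕ} (φ : Cochain k A B p) :
    curvingDifferential k B W (DirectSum.of _ p φ) =
      ∑ i : Fin p, (-1 : k) ^ (i : ℕ) • DirectSum.of (Cochain k A B) (p - 1) (insert W i φ) := by
  simp [curvingDifferential, ← DirectSum.lof_eq_of k]

theorem of_eq_of {p q : ℕ} (h : p = q) (φ : Cochain k A B p) (ψ : Cochain k A B q)
    (H : ∀ v : Fin q → A, φ (fun i => v (Fin.cast h i)) = ψ v) :
    DirectSum.of (Cochain k A B) p φ = DirectSum.of (Cochain k A B) q ψ :=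
  DirectSum.of_eq_of_gradedMonoid_eq (mk_eq h φ ψ H)

/-- The textbook formula for the Hochschild differential: for `φ` of degree `p`, `∂φ` is the cochain
`ψ` of degree `p + 1` with
`ψ(a₀, …, a_p) = a₀ φ(a₁, …, a_p) + ∑_{i < p} (-1)^{i+1} φ(a₀, …, a_i a_{i+1}, …, a_p)
  + (-1)^{p+1} φ(a₀, …, a_{p-1}) a_p`. -/
theorem hochschildDifferential_of (η : A →ₐ[k] B) {p : ℕ} (φ : Cochain k A B p)
    (ψ : Cochain k A B (p + 1))
    (hψ : ∀ v : Fin (p + 1) → A, ψ v = η (v 0) * φ (Fin.tail v) +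
      ∑ i : Fin p, (-1 : k) ^ ((i : ℕ) + 1) • φ (Fin.contractNth i.castSucc (· * ·) v) +
      (-1 : k) ^ (p + 1) • (φ (Fin.init v) * η (v (Fin.last p)))) :
    hochschildDifferential η (DirectSum.of _ p φ) = DirectSum.of (Cochain k A B) (p + 1) ψ := by
  obtain ⟨ξ, hξ⟩ : ∃ ξ : Cochain k A B (p + 1),
      ∀ v : Fin (1 + p) → A, ξ (fun i => v (Fin.cast (Nat.add_comm 1 p).symm i)) =
        cup (structureMap η) φ v := by
    have : ∀ (n : ℕ) (h : 1 + p = n) (χ : Cochain k A B (1 + p)), ∃ ξ : Cochain k A B n,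
        ∀ v : Fin (1 + p) → A, ξ (fun i => v (Fin.cast h.symm i)) = χ v := by
      rintro n rfl χ
      exact ⟨χ, fun v => rfl⟩
    exact this _ (Nat.add_comm 1 p) _
  have h1 := of_eq_of (Nat.add_comm p 1) ξ _ hξ
  have h2 : ψ = ξ - (-1 : k) ^ p • cup φ (structureMap η) -
      ∑ i : Fin p, (-1 : k) ^ (i : ℕ) • contract i φ := by
    ext v
    have h3 : ξ v = η (v 0) * φ (Fin.tail v) := by
      have := hξ (fun i => v (Fin.cast (Nat.add_comm 1 p) i))
      refine Eq.trans ?_ (this.trans ?_)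
      · rfl
      · rw [cup_apply, structureMap_apply]
        refine congrArg₂ _ rfl (congrArg φ (funext fun i => congrArg v (Fin.ext ?_)))
        simp [Nat.add_comm]
    have h4 : ∀ (S : Finset (Fin p)) (f : Fin p → Cochain k A B (p + 1)),
        (∑ i ∈ S, f i) v = ∑ i ∈ S, f i v := by
      intro S f
      classical
      induction S using Finset.induction_on with
      | empty => rfl
      | insert i S hi hS => rw [Finset.sum_insert hi, Finset.sum_insert hi, ← hS]; rfl
    rw [hψ]
    change _ = ξ v - (-1 : k) ^ p • cup φ (structureMap η) v -
      (∑ i : Fin p, (-1 : k) ^ (i : ℕ) • contract i φ) v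
    rw [h3, h4, cup_apply, structureMap_apply]
    have h5 : ∀ i : Fin p, ((-1 : k) ^ (i : ℕ) • contract i φ) v =
        (-1 : k) ^ (i : ℕ) • φ (Fin.contractNth i.castSucc (· * ·) v) := fun i => rfl
    simp only [h5, pow_succ, mul_neg, mul_one, neg_smul, Finset.sum_neg_distrib]
    have h6 : φ (Fin.init v) * η (v (Fin.last p)) =
        φ (fun i => v (Fin.castAdd 1 i)) * η (v (Fin.natAdd p 0)) := rfl
    rw [h6]
    abel
  rw [h2, hochschildDifferential]
  simp only [LinearMap.sub_apply, LinearMap.comp_apply, LinearMap.mulLeft_apply,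
    LinearMap.mulRight_apply, structureCochain, signInv_of, smul_mul_assoc, of_mul_of,
    braceProduct_of, map_sub, map_sum, DirectSum.of_smul, ← h1]

/-- The formula for the curving differential in positive degrees. -/
theorem curvingDifferential_of_succ (W : A) {p : ℕ} (φ : Cochain k A B (p + 1))
    (ψ : Cochain k A B p)
    (hψ : ∀ v : Fin p → A, ψ v = ∑ i : Fin (p + 1), (-1 : k) ^ (i : ℕ) • φ (i.insertNth W v)) :
    curvingDifferential k B W (DirectSum.of _ (p + 1) φ) = DirectSum.of (Cochain k A B) p ψ := by
  have : ψ = ∑ i : Fin (p + 1), (-1 : k) ^ (i : ℕ) • insert W i φ := by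
    ext v
    have h4 : ∀ (S : Finset (Fin (p + 1))) (f : Fin (p + 1) → Cochain k A B p),
        (∑ i ∈ S, f i) v = ∑ i ∈ S, f i v := by
      intro S f
      classical
      induction S using Finset.induction_on with
      | empty => rfl
      | insert i S hi hS => rw [Finset.sum_insert hi, Finset.sum_insert hi, ← hS]; rfl
    rw [hψ]
    exact (h4 Finset.univ (fun i => (-1 : k) ^ (i : ℕ) • insert W i φ)).symm
  rw [this, curvingDifferential_of, map_sum]
  simp only [DirectSum.of_smul]
  rfl

/-- The curving differential vanishes on `0`-cochains. -/
theorem curvingDifferential_of_zero (W : A) (φ : Cochain k A B 0) :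
    curvingDifferential k B W (DirectSum.of _ 0 φ) = 0 := by
  rw [curvingDifferential_of, Finset.univ_eq_empty, Finset.sum_empty]

/-- An operator on cochains that is a graded derivation on homogeneous elements is one. -/
theorem leibniz_of (D : CompactCochains k A B →ₗ[k] CompactCochains k A B)
    (h : ∀ (p q : ℕ) (φ : Cochain k A B p) (ψ : Cochain k A B q),
      D (DirectSum.of (Cochain k A B) p φ * DirectSum.of (Cochain k A B) q ψ) =
        D (DirectSum.of _ p φ) * DirectSum.of (Cochain k A B) q ψ +
          signInv k A B (DirectSum.of _ p φ) * D (DirectSum.of _ q ψ))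
    (x y : CompactCochains k A B) : D (x * y) = D x * y + signInv k A B x * D y := by
  induction x using DirectSum.induction_on with
  | zero => simp
  | add x x' hx hx' => simp only [add_mul, map_add, hx, hx']; abel
  | of p φ =>
    induction y using DirectSum.induction_on with
    | zero => simp
    | add y y' hy hy' => simp only [mul_add, map_add, hy, hy']; abel
    | of q ψ => exact h p q φ ψ

theorem braceProduct_mul (x y : CompactCochains k A B) :
    braceProduct k A B (x * y) = braceProduct k A B x * y + signInv k A B x * braceProduct k A B y := by
  refine leibniz_of _ (fun p q φ ψ => ?_) x y
  rw [of_mul_of, braceProduct_of, Fin.sum_univ_add, braceProduct_of, braceProduct_of, signInv_of,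
    Finset.sum_mul, Finset.mul_sum]
  congr 1
  · refine Finset.sum_congr rfl fun i _ => ?_
    rw [smul_mul_assoc, of_mul_of, Fin.val_castAdd]
    congr 1
    refine of_eq_of (by omega) _ _ fun v => ?_
    simp only [contract_apply, cup_apply]
    refine congrArg₂ _ (congrArg φ (funext fun j => ?_)) (congrArg ψ (funext fun j => ?_))
    · simp only [Fin.contractNth, Fin.val_castSucc, Fin.val_castAdd, Fin.val_natAdd]
      split_ifs <;> first
        | (exfalso; omega)
        | exact congrArg v (Fin.ext (by
            simp only [Fin.val_castSucc, Fin.val_castAdd, Fin.val_natAdd, Fin.val_cast,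
              Fin.val_succ] <;> omega))
        | exact congrArg₂ (· * ·)
            (congrArg v (Fin.ext (by
              simp only [Fin.val_castSucc, Fin.val_castAdd, Fin.val_natAdd, Fin.val_cast,
                Fin.val_succ] <;> omega)))
            (congrArg v (Fin.ext (by
              simp only [Fin.val_castSucc, Fin.val_castAdd, Fin.val_natAdd, Fin.val_cast,
                Fin.val_succ] <;> omega)))
    · simp only [Fin.contractNth, Fin.val_castSucc, Fin.val_castAdd, Fin.val_natAdd]
      split_ifs <;> first
        | (exfalso; omega)
        | exact congrArg v (Fin.ext (by
            simp only [Fin.val_castSucc, Fin.val_castAdd, Fin.val_natAdd, Fin.val_cast,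
              Fin.val_succ] <;> omega))
        | exact congrArg₂ (· * ·)
            (congrArg v (Fin.ext (by
              simp only [Fin.val_castSucc, Fin.val_castAdd, Fin.val_natAdd, Fin.val_cast,
                Fin.val_succ] <;> omega)))
            (congrArg v (Fin.ext (by
              simp only [Fin.val_castSucc, Fin.val_castAdd, Fin.val_natAdd, Fin.val_cast,
                Fin.val_succ] <;> omega)))
  · refine Finset.sum_congr rfl fun i _ => ?_
    rw [smul_mul_assoc, mul_smul_comm, smul_smul, of_mul_of, Fin.val_natAdd, pow_add]
    congr 1
    refine of_eq_of (by omega) _ _ fun v => ?_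
    simp only [contract_apply, cup_apply]
    refine congrArg₂ _ (congrArg φ (funext fun j => ?_)) (congrArg ψ (funext fun j => ?_))
    · simp only [Fin.contractNth, Fin.val_castSucc, Fin.val_castAdd, Fin.val_natAdd]
      split_ifs <;> first
        | (exfalso; omega)
        | exact congrArg v (Fin.ext (by
            simp only [Fin.val_castSucc, Fin.val_castAdd, Fin.val_natAdd, Fin.val_cast,
              Fin.val_succ] <;> omega))
        | exact congrArg₂ (· * ·)
            (congrArg v (Fin.ext (by
              simp only [Fin.val_castSucc, Fin.val_castAdd, Fin.val_natAdd, Fin.val_cast,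
                Fin.val_succ] <;> omega)))
            (congrArg v (Fin.ext (by
              simp only [Fin.val_castSucc, Fin.val_castAdd, Fin.val_natAdd, Fin.val_cast,
                Fin.val_succ] <;> omega)))
    · simp only [Fin.contractNth, Fin.val_castSucc, Fin.val_castAdd, Fin.val_natAdd]
      split_ifs <;> first
        | (exfalso; omega)
        | exact congrArg v (Fin.ext (by
            simp only [Fin.val_castSucc, Fin.val_castAdd, Fin.val_natAdd, Fin.val_cast,
              Fin.val_succ] <;> omega))
        | exact congrArg₂ (· * ·)
            (congrArg v (Fin.ext (by
              simp only [Fin.val_castSucc, Fin.val_castAdd, Fin.val_natAdd, Fin.val_cast,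
                Fin.val_succ] <;> omega)))
            (congrArg v (Fin.ext (by
              simp only [Fin.val_castSucc, Fin.val_castAdd, Fin.val_natAdd, Fin.val_cast,
                Fin.val_succ] <;> omega)))

theorem curvingDifferential_mul (W : A) (x y : CompactCochains k A B) :
    curvingDifferential k B W (x * y) =
      curvingDifferential k B W x * y + signInv k A B x * curvingDifferential k B W y := by
  refine leibniz_of _ (fun p q φ ψ => ?_) x y
  rw [of_mul_of, curvingDifferential_of, Fin.sum_univ_add, curvingDifferential_of,
    curvingDifferential_of, signInv_of, Finset.sum_mul, Finset.mul_sum]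
  congr 1
  · refine Finset.sum_congr rfl fun i _ => ?_
    rw [smul_mul_assoc, of_mul_of, Fin.val_castAdd]
    congr 1
    refine of_eq_of (by have := i.isLt; omega) _ _ fun v => ?_
    simp only [insert_apply, cup_apply]
    refine congrArg₂ _ (congrArg φ (funext fun j => ?_)) (congrArg ψ (funext fun j => ?_))
    · simp only [Fin.val_castAdd, Fin.val_natAdd]
      split_ifs <;> first
        | rfl
        | (exfalso; omega)
        | exact congrArg v (Fin.ext (by
            simp only [Fin.val_castAdd, Fin.val_natAdd, Fin.val_cast] <;> omega))
    · simp only [Fin.val_castAdd, Fin.val_natAdd]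
      split_ifs <;> first
        | rfl
        | (exfalso; omega)
        | exact congrArg v (Fin.ext (by
            simp only [Fin.val_castAdd, Fin.val_natAdd, Fin.val_cast] <;> omega))
  · refine Finset.sum_congr rfl fun i _ => ?_
    rw [smul_mul_assoc, mul_smul_comm, smul_smul, of_mul_of, Fin.val_natAdd, pow_add]
    congr 1
    refine of_eq_of (by have := i.isLt; omega) _ _ fun v => ?_
    simp only [insert_apply, cup_apply]
    refine congrArg₂ _ (congrArg φ (funext fun j => ?_)) (congrArg ψ (funext fun j => ?_))
    · simp only [Fin.val_castAdd, Fin.val_natAdd]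
      split_ifs <;> first
        | rfl
        | (exfalso; omega)
        | exact congrArg v (Fin.ext (by
            simp only [Fin.val_castAdd, Fin.val_natAdd, Fin.val_cast] <;> omega))
    · simp only [Fin.val_castAdd, Fin.val_natAdd]
      split_ifs <;> first
        | rfl
        | (exfalso; omega)
        | exact congrArg v (Fin.ext (by
            simp only [Fin.val_castAdd, Fin.val_natAdd, Fin.val_cast] <;> omega))

theorem signInv_mul (x y : CompactCochains k A B) :
    signInv k A B (x * y) = signInv k A B x * signInv k A B y := by
  induction x using DirectSum.induction_on with
  | zero => simp
  | add x x' hx hx' => simp only [add_mul, map_add, hx, hx']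
  | of p φ =>
    induction y using DirectSum.induction_on with
    | zero => simp
    | add y y' hy hy' => simp only [mul_add, map_add, hy, hy']
    | of q ψ =>
      simp only [of_mul_of, signInv_of, smul_mul_assoc, mul_smul_comm, smul_smul, pow_add]
      rw [mul_comm]

theorem signInv_signInv (x : CompactCochains k A B) : signInv k A B (signInv k A B x) = x := by
  induction x using DirectSum.induction_on with
  | zero => simp
  | add x x' hx hx' => simp only [map_add, hx, hx']
  | of p φ => simp [signInv_of, smul_smul, ← mul_pow]

/-- The curved Hochschild differential is a graded derivation of the cup product. -/
theorem curvedDifferential_mul (η : A →ₐ[k] B) (W : A) (x y : CompactCochains k A B) :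
    curvedDifferential η W (x * y) =
      curvedDifferential η W x * y + signInv k A B x * curvedDifferential η W y := by
  simp only [curvedDifferential, hochschildDifferential, LinearMap.add_apply, LinearMap.sub_apply,
    LinearMap.comp_apply, LinearMap.mulLeft_apply, LinearMap.mulRight_apply, braceProduct_mul,
    curvingDifferential_mul, signInv_mul]
  noncomm_ring

variable (k A B) in
/-- The projection of cochains to the part of parity `d`. -/
def cochainProj (d : ZMod 2) : CompactCochains k A B →ₗ[k] CompactCochains k A B :=
  DirectSum.toModule k ℕ _ fun p =>
    if (p : ZMod 2) = d then DirectSum.lof k ℕ (Cochain k A B) p else 0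

variable (k A B) in
/-- The cochains of parity `d`: those whose components of degree `p ≢ d mod 2` vanish. -/
def cochainParity (d : ZMod 2) : Submodule k (CompactCochains k A B) where
  carrier := {x | ∀ p : ℕ, (p : ZMod 2) ≠ d → x p = 0}
  zero_mem' := fun _ _ => rfl
  add_mem' := fun hx hy p hp => by rw [DirectSum.add_apply, hx p hp, hy p hp, add_zero]
  smul_mem' := fun c x hx p hp => by rw [DirectSum.smul_apply, hx p hp, smul_zero]

theorem cochainProj_of (d : ZMod 2) {p : ℕ} (φ : Cochain k A B p) :
    cochainProj k A B d (DirectSum.of _ p φ) =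
      if (p : ZMod 2) = d then DirectSum.of (Cochain k A B) p φ else 0 := by
  rw [cochainProj, ← DirectSum.lof_eq_of k, DirectSum.toModule_lof]
  split_ifs <;> rfl

theorem cochainProj_apply (d : ZMod 2) (x : CompactCochains k A B) (p : ℕ) :
    cochainProj k A B d x p = if (p : ZMod 2) = d then x p else 0 := by
  induction x using DirectSum.induction_on with
  | zero => simp
  | add x y hx hy => rw [map_add, DirectSum.add_apply, hx, hy, DirectSum.add_apply]; split_ifs <;> simp
  | of q φ =>
    rw [cochainProj_of]
    by_cases h : q = p
    · subst h; split_ifs <;> simp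
    · split_ifs <;> simp [DirectSum.of_eq_of_ne _ _ _ (Ne.symm h)]

theorem cochainProj_mem (d : ZMod 2) (x : CompactCochains k A B) :
    cochainProj k A B d x ∈ cochainParity k A B d := fun p hp => by
  rw [cochainProj_apply, if_neg hp]

theorem cochainProj_of_mem {d e : ZMod 2} {x : CompactCochains k A B}
    (hx : x ∈ cochainParity k A B e) : cochainProj k A B d x = if e = d then x else 0 := by
  refine DFinsupp.ext fun p => ?_
  change cochainProj k A B d x p = _
  rw [cochainProj_apply]
  by_cases h : e = d
  · rw [if_pos h]
    split_ifs with h'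
    · rfl
    · exact (hx p (h ▸ h')).symm
  · rw [if_neg h]
    split_ifs with h'
    · exact hx p (fun h'' => h (h''.symm.trans h'))
    · rfl

theorem sum_cochainProj (x : CompactCochains k A B) : ∑ d, cochainProj k A B d x = x := by
  induction x using DirectSum.induction_on with
  | zero => simp
  | add x y hx hy => simp only [map_add, Finset.sum_add_distrib, hx, hy]
  | of p φ => simp [cochainProj_of]

/-- The curved Hochschild differential is odd. -/
theorem curvedDifferential_cochainProj (η : A →ₐ[k] B) (W : A) (d : ZMod 2)
    (x : CompactCochains k A B) :
    curvedDifferential η W (cochainProj k A B d x) =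
      cochainProj k A B (d + 1) (curvedDifferential η W x) := by
  induction x using DirectSum.induction_on with
  | zero => simp
  | add x y hx hy => simp only [map_add, hx, hy]
  | of p φ =>
    have h1 : ((p + 1 : ℕ) : ZMod 2) = d + 1 ↔ (p : ZMod 2) = d := by simp
    have h1' : ((1 + p : ℕ) : ZMod 2) = d + 1 ↔ (p : ZMod 2) = d := by simp [add_comm]
    have h2 : ∀ i : Fin p, ((p - 1 : ℕ) : ZMod 2) = d + 1 ↔ (p : ZMod 2) = d := fun i => by
      have h : ((p - 1 : ℕ) : ZMod 2) + 1 = p := by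
        have : p - 1 + 1 = p := by have := i.isLt; omega
        exact_mod_cast congrArg (Nat.cast (R := ZMod 2)) this
      have h' : ∀ a b c : ZMod 2, a + 1 = b → (a = c + 1 ↔ b = c) := by decide
      exact h' _ _ _ h
    have hH : hochschildDifferential η (cochainProj k A B d (DirectSum.of _ p φ)) =
        cochainProj k A B (d + 1) (hochschildDifferential η (DirectSum.of _ p φ)) := by
      simp only [hochschildDifferential, LinearMap.sub_apply, LinearMap.comp_apply,
        LinearMap.mulLeft_apply, LinearMap.mulRight_apply, structureCochain, signInv_of,
        mul_smul_comm, smul_mul_assoc, of_mul_of, braceProduct_of, cochainProj_of, map_sub,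
        map_sum, map_smul, h1, h1']
      split_ifs with h
      · simp [signInv_of, of_mul_of, braceProduct_of]
      · simp
    have hW : curvingDifferential k B W (cochainProj k A B d (DirectSum.of _ p φ)) =
        cochainProj k A B (d + 1) (curvingDifferential k B W (DirectSum.of _ p φ)) := by
      rw [cochainProj_of, curvingDifferential_of, map_sum]
      simp only [map_smul, cochainProj_of]
      rw [Finset.sum_congr rfl fun i _ => by rw [if_congr (h2 i) rfl rfl]]
      by_cases h : (p : ZMod 2) = d
      · simp only [if_pos h, curvingDifferential_of]
      · simp only [if_neg h, map_zero, smul_zero, Finset.sum_const_zero]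
    simp only [curvedDifferential, LinearMap.add_apply, map_add, hH, hW]

theorem cochainParity_one_mem : (1 : CompactCochains k A B) ∈ cochainParity k A B 0 := by
  intro p hp
  refine DirectSum.of_eq_of_ne (β := Cochain k A B) 0 p _ ?_
  rintro rfl
  exact hp rfl

theorem cochainParity_of_mem {p : ℕ} (φ : Cochain k A B p) :
    DirectSum.of (Cochain k A B) p φ ∈ cochainParity k A B p := by
  have := cochainProj_mem (p : ZMod 2) (DirectSum.of (Cochain k A B) p φ)
  rwa [cochainProj_of, if_pos rfl] at this

theorem cochainParity_mul_mem {d e : ZMod 2} {x y : CompactCochains k A B}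
    (hx : x ∈ cochainParity k A B d) (hy : y ∈ cochainParity k A B e) :
    x * y ∈ cochainParity k A B (d + e) := by
  have key : ∀ x y : CompactCochains k A B,
      cochainProj k A B d x * cochainProj k A B e y ∈ cochainParity k A B (d + e) := by
    intro x y
    induction x using DirectSum.induction_on with
    | zero => rw [map_zero, zero_mul]; exact zero_mem _
    | add x x' hx hx' => rw [map_add, add_mul]; exact add_mem hx hx'
    | of p φ =>
      induction y using DirectSum.induction_on with
      | zero => rw [map_zero, mul_zero]; exact zero_mem _
      | add y y' hy hy' => rw [map_add, mul_add]; exact add_mem hy hy'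
      | of q ψ =>
        rw [cochainProj_of, cochainProj_of]
        split_ifs with h h'
        · rw [of_mul_of, ← h, ← h', ← Nat.cast_add]
          exact cochainParity_of_mem _
        all_goals simp
  have := key x y
  rwa [cochainProj_of_mem hx, cochainProj_of_mem hy, if_pos rfl, if_pos rfl] at this

end Cochains

section Cohomology

variable {k A B : Type*} [CommRing k] [Ring A] [Algebra k A] [Ring B] [Algebra k B]
  (η : A →ₐ[k] B) (W : A)

/-- The cocycles of `∂ + d_W`, a subalgebra for the cup product. -/
def cocycles : Subalgebra k (CompactCochains k A B) where
  carrier := {x | curvedDifferential η W x = 0}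
  mul_mem' := fun {x y} hx hy => by
    rw [Set.mem_setOf_eq] at *
    rw [curvedDifferential_mul, hx, hy, zero_mul, mul_zero, add_zero]
  add_mem' := fun {x y} hx hy => by
    rw [Set.mem_setOf_eq] at *
    rw [map_add, hx, hy, add_zero]
  algebraMap_mem' := fun c => by
    have h1 : signInv k A B 1 = 1 := by
      change signInv k A B (DirectSum.of _ 0 (const 1)) = DirectSum.of _ 0 (const 1)
      rw [signInv_of, pow_zero, one_smul]
    have h : curvedDifferential η W 1 = 0 := by
      have := curvedDifferential_mul η W 1 1
      rw [h1, one_mul, one_mul, mul_one] at this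
      exact left_eq_add.1 this
    rw [Set.mem_setOf_eq, Algebra.algebraMap_eq_smul_one, map_smul, h, smul_zero]

theorem mem_cocycles {x : CompactCochains k A B} :
    x ∈ cocycles η W ↔ curvedDifferential η W x = 0 := Iff.rfl

theorem signInv_mem_cocycles {x : CompactCochains k A B} (hx : x ∈ cocycles η W) :
    signInv k A B x ∈ cocycles η W := by
  have h : ∀ y : CompactCochains k A B,
      signInv k A B y = cochainProj k A B 0 y - cochainProj k A B 1 y := fun y => by
    induction y using DirectSum.induction_on with
    | zero => simp
    | add x y hx hy => simp only [map_add, hx, hy]; abel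
    | of p φ =>
      rw [signInv_of, cochainProj_of, cochainProj_of]
      rcases Nat.even_or_odd p with hp | hp
      · have : (p : ZMod 2) = 0 := (ZMod.natCast_eq_zero_iff_even).2 hp
        simp [this, hp.neg_one_pow]
      · have : (p : ZMod 2) = 1 := (ZMod.natCast_eq_one_iff_odd).2 hp
        simp [this, hp.neg_one_pow]
  rw [mem_cocycles] at *
  rw [h, map_sub, curvedDifferential_cochainProj, curvedDifferential_cochainProj, hx]
  simp

/-- The coboundaries of `∂ + d_W`, a two-sided ideal in the algebra of cocycles. -/
def coboundaries : Ideal (cocycles η W) where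
  carrier := {z | ∃ y, curvedDifferential η W y = z}
  zero_mem' := ⟨0, by simp⟩
  add_mem' := by
    rintro _ _ ⟨y, hy⟩ ⟨y', hy'⟩
    exact ⟨y + y', by simp [hy, hy']⟩
  smul_mem' := by
    rintro c _ ⟨y, hy⟩
    refine ⟨signInv k A B c * y, ?_⟩
    rw [curvedDifferential_mul, signInv_signInv, hy,
      (mem_cocycles η W).1 (signInv_mem_cocycles η W c.2), zero_mul, zero_add]
    rfl

instance : (coboundaries η W).IsTwoSided where
  mul_mem_of_left := by
    rintro _ b ⟨y, hy⟩
    refine ⟨y * b, ?_⟩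
    rw [curvedDifferential_mul, (mem_cocycles η W).1 b.2, mul_zero, add_zero, hy]
    rfl

/-- The cohomology of the compact type cochains with respect to `∂ + d_W`, with the cup product. -/
def Cohomology : Type _ := cocycles η W ⧸ coboundaries η W

namespace Cohomology

instance : Ring (Cohomology η W) := inferInstanceAs (Ring (cocycles η W ⧸ coboundaries η W))

instance : Algebra k (Cohomology η W) :=
  inferInstanceAs (Algebra k (cocycles η W ⧸ coboundaries η W))

/-- The class of a cocycle. -/
def mk : cocycles η W →ₐ[k] Cohomology η W := Ideal.Quotient.mkₐ k (coboundaries η W)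

theorem mk_surjective : Function.Surjective (mk η W) := Ideal.Quotient.mkₐ_surjective _ _

theorem mk_eq_zero {z : cocycles η W} :
    mk η W z = 0 ↔ ∃ y, curvedDifferential η W y = z := Ideal.Quotient.eq_zero_iff_mem

/-- The classes of the cocycles of parity `d`. -/
def parity (d : ZMod 2) : Submodule k (Cohomology η W) :=
  ((cochainParity k A B d).comap (cocycles η W).val.toLinearMap).map (mk η W).toLinearMap

/-- The projection of cocycles to the part of parity `d`. -/
def cocycleProj (d : ZMod 2) : cocycles η W →ₗ[k] cocycles η W :=
  LinearMap.restrict (cochainProj k A B d) (p := (cocycles η W).toSubmodule)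
    (q := (cocycles η W).toSubmodule) fun x hx => by
      change curvedDifferential η W _ = 0
      rw [curvedDifferential_cochainProj, (mem_cocycles η W).1 hx, map_zero]

/-- The projection of cohomology to the part of parity `d`. -/
def parityProj (d : ZMod 2) : Cohomology η W →ₗ[k] Cohomology η W :=
  Submodule.mapQ ((coboundaries η W).restrictScalars k) ((coboundaries η W).restrictScalars k)
    (cocycleProj η W d) (by
      rintro z ⟨y, hy⟩
      refine ⟨cochainProj k A B (d + 1) y, ?_⟩
      rw [curvedDifferential_cochainProj, hy, add_assoc, show (1 + 1 : ZMod 2) = 0 from rfl,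
        add_zero]
      rfl)

theorem parityProj_mk (d : ZMod 2) (z : cocycles η W) :
    parityProj η W d (mk η W z) = mk η W (cocycleProj η W d z) := rfl

theorem parityProj_mem (d : ZMod 2) (x : Cohomology η W) : parityProj η W d x ∈ parity η W d := by
  obtain ⟨z, rfl⟩ := mk_surjective η W x
  exact ⟨cocycleProj η W d z, cochainProj_mem d (z : CompactCochains k A B), rfl⟩

theorem sum_parityProj (x : Cohomology η W) : ∑ d, parityProj η W d x = x := by
  obtain ⟨z, rfl⟩ := mk_surjective η W x
  simp only [parityProj_mk, ← map_sum]
  congr 1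
  refine Subtype.ext ?_
  rw [AddSubmonoidClass.coe_finset_sum]
  exact sum_cochainProj (z : CompactCochains k A B)

theorem parityProj_of_mem {d e : ZMod 2} {x : Cohomology η W} (hx : x ∈ parity η W e) :
    parityProj η W d x = if e = d then x else 0 := by
  obtain ⟨z, hz, rfl⟩ := hx
  change parityProj η W d (mk η W z) = _
  rw [parityProj_mk]
  have : (cocycleProj η W d z : CompactCochains k A B) =
      if e = d then (z : CompactCochains k A B) else 0 := cochainProj_of_mem hz
  split_ifs with h
  · rw [if_pos h] at this
    exact congrArg (mk η W) (Subtype.ext this)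
  · rw [if_neg h] at this
    rw [show cocycleProj η W d z = 0 from Subtype.ext this, map_zero]

instance : SetLike.GradedMonoid (parity η W) where
  one_mem := ⟨1, cochainParity_one_mem, map_one (mk η W)⟩
  mul_mem := by
    rintro d e _ _ ⟨x, hx, rfl⟩ ⟨y, hy, rfl⟩
    exact ⟨x * y, cochainParity_mul_mem hx hy, map_mul (mk η W) x y⟩

/-- `HH` is a `ℤ/2`-graded algebra. -/
instance : GradedAlgebra (parity η W) where
  __ := (inferInstance : SetLike.GradedMonoid (parity η W))
  __ := decompositionOfProjections (parity η W) (parityProj η W) (parityProj_mem η W)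
    (sum_parityProj η W) (fun d x hx => by rw [parityProj_of_mem η W hx, if_pos rfl])
    (fun d e h x hx => by rw [parityProj_of_mem η W hx, if_neg h.symm])

end Cohomology

end Cohomology

section GradedTensor

variable {k : Type*} [CommRing k] {ι : Type*} [Fintype ι] [LinearOrder ι]
  {A : ι → Type*} [∀ i, Ring (A i)] [∀ i, Algebra k (A i)]

/-- The Koszul sign `(-1)^{∑_{j < i} p_i q_j}` of moving homogeneous elements `b_j` of parities `q_j`
to the left past homogeneous elements `a_i`, `j < i`, of parities `p_i`. -/
def koszulSign (k : Type*) [CommRing k] {ι : Type*} [Fintype ι] [LinearOrder ι]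
    (p q : ι → ZMod 2) : k :=
  ∏ i, ∏ j with j < i, if p i = 1 ∧ q j = 1 then -1 else 1

theorem koszulSign_add_left (p p' q : ι → ZMod 2) :
    koszulSign k (p + p') q = koszulSign k p q * koszulSign k p' q := by
  simp only [koszulSign, ← Finset.prod_mul_distrib]
  refine Finset.prod_congr rfl fun i _ => Finset.prod_congr rfl fun j _ => ?_
  have : ∀ a : ZMod 2, a = 0 ∨ a = 1 := by decide
  have h2 : (1 + 1 : ZMod 2) = 0 := rfl
  rcases this (p i) with h | h <;> rcases this (p' i) with h' | h' <;>
    rcases this (q j) with h'' | h'' <;> simp [h, h', h'', h2]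

theorem koszulSign_add_right (p q q' : ι → ZMod 2) :
    koszulSign k p (q + q') = koszulSign k p q * koszulSign k p q' := by
  simp only [koszulSign, ← Finset.prod_mul_distrib]
  refine Finset.prod_congr rfl fun i _ => Finset.prod_congr rfl fun j _ => ?_
  have : ∀ a : ZMod 2, a = 0 ∨ a = 1 := by decide
  have h2 : (1 + 1 : ZMod 2) = 0 := rfl
  rcases this (q j) with h | h <;> rcases this (q' j) with h' | h' <;>
    rcases this (p i) with h'' | h'' <;> simp [h, h', h'', h2]

theorem koszulSign_zero_left (q : ι → ZMod 2) : koszulSign k 0 q = 1 := by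
  simp [koszulSign]

theorem koszulSign_zero_right (p : ι → ZMod 2) : koszulSign k p 0 = 1 := by
  simp [koszulSign]

/-- The graded tensor product `⨂ᵢ Aᵢ` of finitely many `ℤ/2`-graded algebras, taken in the order of
the index set. Its underlying module is the tensor product; the multiplication is
`(⨂ᵢ aᵢ)(⨂ᵢ bᵢ) = (-1)^{∑_{j < i} |aᵢ||bⱼ|} ⨂ᵢ aᵢbᵢ` on homogeneous elements. -/
def GradedPiTensor (𝒜 : ∀ i, ZMod 2 → Submodule k (A i)) : Type _ := ⨂[k] i, A i

namespace GradedPiTensor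

variable (𝒜 : ∀ i, ZMod 2 → Submodule k (A i))

instance : AddCommGroup (GradedPiTensor 𝒜) := inferInstanceAs (AddCommGroup (⨂[k] i, A i))

instance : Module k (GradedPiTensor 𝒜) := inferInstanceAs (Module k (⨂[k] i, A i))

/-- Pure tensors. -/
def tprod : MultilinearMap k A (GradedPiTensor 𝒜) := PiTensorProduct.tprod k

variable [∀ i, GradedAlgebra (𝒜 i)]

/-- The multiplication of the graded tensor product, on the underlying tensor product: extended
bilinearly to inhomogeneous elements through the projections to the homogeneous parts. -/
def mulAux : (⨂[k] i, A i) →ₗ[k] (⨂[k] i, A i) →ₗ[k] (⨂[k] i, A i) :=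
  ∑ p : ι → ZMod 2, ∑ q : ι → ZMod 2, koszulSign k p q •
    PiTensorProduct.map₂ fun i => (LinearMap.mul k (A i)).compl₁₂
      (GradedAlgebra.proj (𝒜 i) (p i)) (GradedAlgebra.proj (𝒜 i) (q i))

/-- The multiplication of the graded tensor product. -/
def mulHom : GradedPiTensor 𝒜 →ₗ[k] GradedPiTensor 𝒜 →ₗ[k] GradedPiTensor 𝒜 := mulAux 𝒜

theorem proj_of_mem {i : ι} {d e : ZMod 2} {x : A i} (hx : x ∈ 𝒜 i e) :
    GradedAlgebra.proj (𝒜 i) d x = if e = d then x else 0 := by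
  rw [GradedAlgebra.proj_apply, DirectSum.decompose_of_mem _ hx, DirectSum.coe_of_apply]
  split_ifs <;> rfl

theorem one_mem (i : ι) : (1 : ∀ i, A i) i ∈ 𝒜 i ((0 : ι → ZMod 2) i) :=
  SetLike.one_mem_graded (𝒜 i)

theorem mul_mem {p q : ι → ZMod 2} {a b : ∀ i, A i} {i : ι} (ha : a i ∈ 𝒜 i (p i))
    (hb : b i ∈ 𝒜 i (q i)) : (a * b) i ∈ 𝒜 i ((p + q) i) :=
  show a i * b i ∈ 𝒜 i (p i + q i) from SetLike.mul_mem_graded ha hb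

theorem mulAux_tprod (p q : ι → ZMod 2) (a b : ∀ i, A i) (ha : ∀ i, a i ∈ 𝒜 i (p i))
    (hb : ∀ i, b i ∈ 𝒜 i (q i)) :
    mulAux 𝒜 (PiTensorProduct.tprod k a) (PiTensorProduct.tprod k b) =
      koszulSign k p q • PiTensorProduct.tprod k (a * b) := by
  have key : ∀ p' q' : ι → ZMod 2,
      (PiTensorProduct.map₂ (fun i => (LinearMap.mul k (A i)).compl₁₂
        (GradedAlgebra.proj (𝒜 i) (p' i)) (GradedAlgebra.proj (𝒜 i) (q' i))) :
        (⨂[k] i, A i) →ₗ[k] (⨂[k] i, A i) →ₗ[k] (⨂[k] i, A i))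
        (PiTensorProduct.tprod k a) (PiTensorProduct.tprod k b) =
      if p' = p ∧ q' = q then PiTensorProduct.tprod k (a * b) else 0 := by
    intro p' q'
    rw [PiTensorProduct.map₂_tprod_tprod]
    simp only [LinearMap.compl₁₂_apply, LinearMap.mul_apply', proj_of_mem 𝒜 (ha _),
      proj_of_mem 𝒜 (hb _)]
    split_ifs with h
    · obtain ⟨rfl, rfl⟩ := h
      simp; rfl
    · rw [not_and_or] at h
      rcases h with h | h
      · obtain ⟨i, hi⟩ := Function.ne_iff.1 h
        exact (PiTensorProduct.tprod k).map_coord_zero i (by simp [Ne.symm hi])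
      · obtain ⟨i, hi⟩ := Function.ne_iff.1 h
        exact (PiTensorProduct.tprod k).map_coord_zero i (by simp [Ne.symm hi])
  simp only [mulAux, LinearMap.sum_apply, LinearMap.smul_apply, key]
  rw [Finset.sum_eq_single p, Finset.sum_eq_single q]
  · simp
  · intro q' _ h; simp [h]
  · simp
  · intro p' _ h; simp [h]
  · simp

theorem mulHom_tprod (p q : ι → ZMod 2) (a b : ∀ i, A i) (ha : ∀ i, a i ∈ 𝒜 i (p i))
    (hb : ∀ i, b i ∈ 𝒜 i (q i)) :
    mulHom 𝒜 (tprod 𝒜 a) (tprod 𝒜 b) = koszulSign k p q • tprod 𝒜 (a * b) :=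
  mulAux_tprod 𝒜 p q a b ha hb

/-- The homogeneous part of parity `d`, spanned by the pure tensors of homogeneous elements whose
parities sum to `d`. -/
def parityPart (d : ZMod 2) : Submodule k (GradedPiTensor 𝒜) :=
  Submodule.span k {x | ∃ (p : ι → ZMod 2) (a : ∀ i, A i),
    ∑ i, p i = d ∧ (∀ i, a i ∈ 𝒜 i (p i)) ∧ tprod 𝒜 a = x}

/-- The projection to the homogeneous part of parity `d`, on the underlying tensor product. -/
def projAux (d : ZMod 2) : (⨂[k] i, A i) →ₗ[k] (⨂[k] i, A i) :=
  ∑ p : ι → ZMod 2 with ∑ i, p i = d, PiTensorProduct.map fun i => GradedAlgebra.proj (𝒜 i) (p i)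

/-- The projection to the homogeneous part of parity `d`. -/
def parityProj (d : ZMod 2) : GradedPiTensor 𝒜 →ₗ[k] GradedPiTensor 𝒜 := projAux 𝒜 d

theorem tprod_eq_sum (a : ∀ i, A i) :
    tprod 𝒜 a = ∑ p : ι → ZMod 2, tprod 𝒜 (fun i => GradedAlgebra.proj (𝒜 i) (p i) (a i)) := by
  have : a = fun i => ∑ d : ZMod 2, GradedAlgebra.proj (𝒜 i) d (a i) := by
    funext i
    classical
    conv_lhs => rw [← DirectSum.sum_support_decompose (𝒜 i) (a i)]
    refine Finset.sum_subset (Finset.subset_univ _) fun d _ hd => ?_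
    simpa using hd
  conv_lhs => rw [this]
  rw [MultilinearMap.map_sum]

theorem proj_mem {i : ι} (d : ZMod 2) (x : A i) : GradedAlgebra.proj (𝒜 i) d x ∈ 𝒜 i d := by
  rw [GradedAlgebra.proj_apply]; exact SetLike.coe_mem _

/-- Homogeneous pure tensors span. -/
theorem induction_on {motive : GradedPiTensor 𝒜 → Prop} (x : GradedPiTensor 𝒜)
    (zero : motive 0) (add : ∀ x y, motive x → motive y → motive (x + y))
    (smul : ∀ (c : k) x, motive x → motive (c • x))
    (tmul : ∀ (p : ι → ZMod 2) (a : ∀ i, A i), (∀ i, a i ∈ 𝒜 i (p i)) → motive (tprod 𝒜 a)) :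
    motive x := by
  refine PiTensorProduct.induction_on (R := k) (motive := motive) x (fun c a => ?_) add
  refine smul c _ ?_
  have : motive (tprod 𝒜 a) := by
    rw [tprod_eq_sum]
    exact Finset.sum_induction _ motive add zero
      fun p _ => tmul p _ fun i => proj_mem 𝒜 _ _
  exact this

instance : Mul (GradedPiTensor 𝒜) := ⟨fun x y => mulHom 𝒜 x y⟩

instance : One (GradedPiTensor 𝒜) := ⟨tprod 𝒜 1⟩

theorem mul_def (x y : GradedPiTensor 𝒜) : x * y = mulHom 𝒜 x y := rfl

theorem one_def : (1 : GradedPiTensor 𝒜) = tprod 𝒜 1 := rfl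

theorem tprod_mul_tprod (p q : ι → ZMod 2) (a b : ∀ i, A i) (ha : ∀ i, a i ∈ 𝒜 i (p i))
    (hb : ∀ i, b i ∈ 𝒜 i (q i)) :
    tprod 𝒜 a * tprod 𝒜 b = koszulSign k p q • tprod 𝒜 (a * b) := mulHom_tprod 𝒜 p q a b ha hb

protected theorem one_mul (x : GradedPiTensor 𝒜) : 1 * x = x := by
  induction x using induction_on with
  | zero => exact map_zero (mulHom 𝒜 1)
  | add x y hx hy => exact (map_add (mulHom 𝒜 1) x y).trans (congrArg₂ _ hx hy)
  | smul c x hx => exact (map_smul (mulHom 𝒜 1) c x).trans (congrArg _ hx)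
  | tmul p a ha =>
    rw [one_def, tprod_mul_tprod 𝒜 0 p 1 a (fun i => one_mem 𝒜 i) ha,
      koszulSign_zero_left, one_mul, one_smul]

protected theorem mul_one (x : GradedPiTensor 𝒜) : x * 1 = x := by
  induction x using induction_on with
  | zero => exact LinearMap.map_zero₂ (mulHom 𝒜) 1
  | add x y hx hy => exact (LinearMap.map_add₂ (mulHom 𝒜) x y 1).trans (congrArg₂ _ hx hy)
  | smul c x hx => exact (LinearMap.map_smul₂ (mulHom 𝒜) c x 1).trans (congrArg _ hx)
  | tmul p a ha =>
    rw [one_def, tprod_mul_tprod 𝒜 p 0 a 1 ha (fun i => one_mem 𝒜 i),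
      koszulSign_zero_right, mul_one, one_smul]

protected theorem mul_assoc (x y z : GradedPiTensor 𝒜) : x * y * z = x * (y * z) := by
  simp only [mul_def]
  induction x using induction_on with
  | zero => simp
  | add x x' hx hx' => simp only [map_add, LinearMap.add_apply, hx, hx']
  | smul c x hx => simp only [map_smul, LinearMap.smul_apply, hx]
  | tmul p a ha =>
    induction y using induction_on with
    | zero => simp
    | add y y' hy hy' => simp only [map_add, LinearMap.add_apply, hy, hy']
    | smul c y hy => simp only [map_smul, LinearMap.smul_apply, hy]
    | tmul q b hb =>
      induction z using induction_on with
      | zero => simp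
      | add z z' hz hz' => simp only [map_add, hz, hz']
      | smul c z hz => simp only [map_smul, hz]
      | tmul r c hc =>
        rw [mulHom_tprod 𝒜 p q a b ha hb, mulHom_tprod 𝒜 q r b c hb hc, map_smul, map_smul,
          LinearMap.smul_apply, mulHom_tprod 𝒜 (p + q) r _ c
            (fun i => mul_mem 𝒜 (ha i) (hb i)) hc,
          mulHom_tprod 𝒜 p (q + r) a _ ha (fun i => mul_mem 𝒜 (hb i) (hc i)),
          smul_smul, smul_smul, koszulSign_add_left, koszulSign_add_right, mul_assoc a b c]
        congr 1
        ring

instance : Ring (GradedPiTensor 𝒜) where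
  __ := (inferInstance : AddCommGroup (GradedPiTensor 𝒜))
  mul_assoc := GradedPiTensor.mul_assoc 𝒜
  one_mul := GradedPiTensor.one_mul 𝒜
  mul_one := GradedPiTensor.mul_one 𝒜
  left_distrib x := map_add (mulHom 𝒜 x)
  right_distrib := LinearMap.map_add₂ (mulHom 𝒜)
  zero_mul := LinearMap.map_zero₂ (mulHom 𝒜)
  mul_zero x := map_zero (mulHom 𝒜 x)

instance : Algebra k (GradedPiTensor 𝒜) :=
  Algebra.ofModule (LinearMap.map_smul₂ (mulHom 𝒜)) (fun c x y => map_smul (mulHom 𝒜 x) c y)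

theorem parityProj_tprod (d : ZMod 2) (p : ι → ZMod 2) (a : ∀ i, A i)
    (ha : ∀ i, a i ∈ 𝒜 i (p i)) :
    parityProj 𝒜 d (tprod 𝒜 a) = if ∑ i, p i = d then tprod 𝒜 a else 0 := by
  have key : ∀ p' : ι → ZMod 2,
      (PiTensorProduct.map (fun i => GradedAlgebra.proj (𝒜 i) (p' i)) :
        (⨂[k] i, A i) →ₗ[k] (⨂[k] i, A i)) (PiTensorProduct.tprod k a) =
      if p' = p then PiTensorProduct.tprod k a else 0 := by
    intro p'
    rw [PiTensorProduct.map_tprod]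
    simp only [proj_of_mem 𝒜 (ha _)]
    split_ifs with h
    · subst h; simp
    · obtain ⟨i, hi⟩ := Function.ne_iff.1 h
      exact (PiTensorProduct.tprod k).map_coord_zero i (by simp [Ne.symm hi])
  have h2 : projAux 𝒜 d (PiTensorProduct.tprod k a) =
      if ∑ i, p i = d then PiTensorProduct.tprod k a else 0 := by
    simp only [projAux, LinearMap.sum_apply, key, Finset.sum_ite_eq', Finset.mem_filter,
      Finset.mem_univ, true_and]
  exact h2

theorem parityProj_mem (d : ZMod 2) (x : GradedPiTensor 𝒜) : parityProj 𝒜 d x ∈ parityPart 𝒜 d := by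
  induction x using induction_on with
  | zero => simp
  | add x y hx hy => rw [map_add]; exact add_mem hx hy
  | smul c x hx => rw [map_smul]; exact Submodule.smul_mem _ _ hx
  | tmul p a ha =>
    rw [parityProj_tprod 𝒜 d p a ha]
    split_ifs with h
    · exact Submodule.subset_span ⟨p, a, h, ha, rfl⟩
    · exact zero_mem _

theorem sum_parityProj (x : GradedPiTensor 𝒜) : ∑ d, parityProj 𝒜 d x = x := by
  induction x using induction_on with
  | zero => simp
  | add x y hx hy => simp only [map_add, Finset.sum_add_distrib, hx, hy]
  | smul c x hx => simp only [map_smul, ← Finset.smul_sum, hx]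
  | tmul p a ha => simp [parityProj_tprod 𝒜 _ p a ha]

theorem parityProj_of_mem {d e : ZMod 2} {x : GradedPiTensor 𝒜} (hx : x ∈ parityPart 𝒜 e) :
    parityProj 𝒜 d x = if e = d then x else 0 := by
  induction hx using Submodule.span_induction with
  | mem x h =>
    obtain ⟨p, a, rfl, ha, rfl⟩ := h
    exact parityProj_tprod 𝒜 d p a ha
  | zero => simp
  | add x y _ _ hx hy => rw [map_add, hx, hy]; split_ifs <;> simp
  | smul c x _ hx => rw [map_smul, hx]; split_ifs <;> simp

instance : SetLike.GradedMonoid (parityPart 𝒜) where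
  one_mem := Submodule.subset_span
    ⟨0, 1, by simp, fun i => one_mem 𝒜 i, rfl⟩
  mul_mem := by
    intro d e x y hx hy
    induction hx using Submodule.span_induction with
    | zero => rw [zero_mul]; exact zero_mem _
    | add x x' _ _ hx hx' => rw [add_mul]; exact add_mem hx hx'
    | smul c x _ hx => rw [smul_mul_assoc]; exact Submodule.smul_mem _ _ hx
    | mem x h =>
      obtain ⟨p, a, rfl, ha, rfl⟩ := h
      induction hy using Submodule.span_induction with
      | zero => rw [mul_zero]; exact zero_mem _
      | add y y' _ _ hy hy' => rw [mul_add]; exact add_mem hy hy'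
      | smul c y _ hy => rw [mul_smul_comm]; exact Submodule.smul_mem _ _ hy
      | mem y h =>
        obtain ⟨q, b, rfl, hb, rfl⟩ := h
        rw [tprod_mul_tprod 𝒜 p q a b ha hb]
        exact Submodule.smul_mem _ _ (Submodule.subset_span ⟨p + q, a * b,
          by simp [Finset.sum_add_distrib], fun i => mul_mem 𝒜 (ha i) (hb i), rfl⟩)

/-- The graded tensor product is a `ℤ/2`-graded algebra. -/
instance : GradedAlgebra (parityPart 𝒜) where
  __ := (inferInstance : SetLike.GradedMonoid (parityPart 𝒜))
  __ := decompositionOfProjections (parityPart 𝒜) (parityProj 𝒜) (parityProj_mem 𝒜)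
    (sum_parityProj 𝒜) (fun d x hx => by rw [parityProj_of_mem 𝒜 hx, if_pos rfl])
    (fun d e h x hx => by rw [parityProj_of_mem 𝒜 hx, if_neg h.symm])

end GradedPiTensor
end GradedTensor

section Orbifold

/-- The inclusion `a ↦ a e` of `A` into the crossed product algebra `A[G]`, whose multiplication is
`(a g)(b h) = a (g • b) gh`. -/
def crossedInclusion (k A G : Type*) [CommRing k] [Ring A] [Algebra k A] [Group G]
    [MulSemiringAction G A] [SMulCommClass G k A] : A →ₐ[k] SkewMonoidAlgebra A G where
  __ := SkewMonoidAlgebra.singleOneRingHom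
  commutes' _ := rfl

theorem crossedInclusion_apply (k A G : Type*) [CommRing k] [Ring A] [Algebra k A] [Group G]
    [MulSemiringAction G A] [SMulCommClass G k A] (a : A) :
    crossedInclusion k A G a = SkewMonoidAlgebra.single 1 a := rfl

/-- The compact type `G`-twisted Hochschild cohomology `HH_c(A_W, A_W[G])` of the curved algebra
`(A, W)`. -/
abbrev HHc (k A G : Type*) [CommRing k] [Ring A] [Algebra k A] [Group G]
    [MulSemiringAction G A] [SMulCommClass G k A] (W : A) : Type _ :=
  Cohomology (crossedInclusion k A G) W

/-- The `ℤ/2`-grading of `HH_c(A_W, A_W[G])` by the parity of the degree of cochains. -/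
abbrev HHcParity (k A G : Type*) [CommRing k] [Ring A] [Algebra k A] [Group G]
    [MulSemiringAction G A] [SMulCommClass G k A] (W : A) :
    ZMod 2 → Submodule k (HHc k A G W) :=
  Cohomology.parity (crossedInclusion k A G) W

/-- The group `(ℂˣ)^σ` of diagonal symmetries of `ℂ[x_i : i ∈ σ]`. -/
abbrev Torus (σ : Type*) : Type _ := σ → ℂˣ

/-- The torus acts on polynomials by `x_i ↦ λ_i x_i`. -/
instance torusAction (σ : Type*) : MulSemiringAction (Torus σ) (MvPolynomial σ ℂ) where
  smul l := MvPolynomial.aeval fun i => MvPolynomial.C (l i : ℂ) * MvPolynomial.X i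
  one_smul f := by
    change MvPolynomial.aeval _ f = f
    simp
  mul_smul l m f := by
    change MvPolynomial.aeval _ f = MvPolynomial.aeval _ (MvPolynomial.aeval _ f)
    rw [← AlgHom.comp_apply]
    congr 1
    refine MvPolynomial.algHom_ext fun i => ?_
    simp [MvPolynomial.algHom_C]
    ring
  smul_zero l := map_zero (MvPolynomial.aeval _)
  smul_add l := map_add (MvPolynomial.aeval _)
  smul_one l := map_one (MvPolynomial.aeval _)
  smul_mul l := map_mul (MvPolynomial.aeval _)

theorem torus_smul_def {σ : Type*} (l : Torus σ) (f : MvPolynomial σ ℂ) :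
    l • f = MvPolynomial.aeval (fun i => MvPolynomial.C (l i : ℂ) * MvPolynomial.X i) f := rfl

instance (σ : Type*) : SMulCommClass (Torus σ) ℂ (MvPolynomial σ ℂ) :=
  ⟨fun l c f => map_smul (MvPolynomial.aeval _) c f⟩

/-- `G_W`: the diagonal symmetries `λ` with `W(λ₁x₁, …, λ_N x_N) = W(x₁, …, x_N)`. -/
def symmetryGroup {σ : Type*} (W : MvPolynomial σ ℂ) : Subgroup (Torus σ) :=
  MulAction.stabilizer (Torus σ) W

/-- The elementary invertible polynomials of Fermat, loop and chain type. -/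
inductive IsElementaryInvertible : {N : ℕ} → MvPolynomial (Fin N) ℂ → Prop
  /-- `x₁^n` -/
  | fermat (n : ℕ) (hn : 2 ≤ n) :
      IsElementaryInvertible (MvPolynomial.X 0 ^ n : MvPolynomial (Fin 1) ℂ)
  /-- `x₁^{n₁} x₂ + x₂^{n₂} x₃ + ⋯ + x_N^{n_N} x₁` -/
  | loop {N : ℕ} (hN : 2 ≤ N) (n : Fin N → ℕ) (hn : ∀ i, 2 ≤ n i) :
      IsElementaryInvertible
        (∑ i, MvPolynomial.X i ^ n i * MvPolynomial.X (finRotate N i) : MvPolynomial (Fin N) ℂ)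
  /-- `x₁^{n₁} x₂ + x₂^{n₂} x₃ + ⋯ + x_{N-1}^{n_{N-1}} x_N + x_N^{n_N}` -/
  | chain {N : ℕ} (hN : 2 ≤ N) (n : Fin N → ℕ) (hn : ∀ i, 2 ≤ n i) :
      IsElementaryInvertible
        (∑ i : Fin N, MvPolynomial.X i ^ n i *
          (if h : (i : ℕ) + 1 < N then MvPolynomial.X ⟨i + 1, h⟩ else 1) :
            MvPolynomial (Fin N) ℂ)

variable {r : ℕ} {N : Fin r → ℕ}

/-- `W₁ ⊕ ⋯ ⊕ W_r`: the sum of the `W_s`, in disjoint sets of variables. -/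
def directSumPotential (W : ∀ s, MvPolynomial (Fin (N s)) ℂ) :
    MvPolynomial (Σ s, Fin (N s)) ℂ :=
  ∑ s, MvPolynomial.rename (Sigma.mk s) (W s)

/-- `G₁ × ⋯ × G_r`, with `G_s` acting on the `s`-th set of variables. -/
def productGroup (G : ∀ s, Subgroup (Torus (Fin (N s)))) : Subgroup (Torus (Σ s, Fin (N s))) where
  carrier := {l | ∀ s, (fun i => l ⟨s, i⟩) ∈ G s}
  one_mem' := fun s => (G s).one_mem
  mul_mem' := fun ha hb s => (G s).mul_mem (ha s) (hb s)
  inv_mem' := fun ha s => (G s).inv_mem (ha s)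

end Orbifold

end TwistedHochschild

end

/-! The theorem is a Künneth formula, proved for two factors and then iterated over the summands.

A cochain on a polynomial ring is determined by its values on monomials. A compact type cochain is
therefore a function on lists of exponent vectors that vanishes on long lists, and the differential
and the cup product become recursions on the head of the list (`ListCochain.diff`,
`ListCochain.cupHom`). The differential is `b + d`, where the Hochschild part `b` raises the degree
by one and the curving part `d` lowers it by one. Its square is left minus right multiplication by
`W`, which vanishes because the group fixes `W`.

For the uncurved differential `b`, the antisymmetrized values on variables define a chain map
`antisymm` onto the Koszul complex of the operators "left minus right multiplication by a variable".
Its kernel, with or without normalization, is acyclic (`exists_diff_eq_of_isKoszulKernel`). For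
coinduced coefficients both complexes have no cohomology in positive degrees, by explicit
contractions. General coefficients embed in coinduced ones, and dimension shifting applies. Linear
algebra over a field turns this into a homotopy of degree `-1` onto the Koszul complex
(`exists_koszul_homotopy`).

The curving does not raise the degree filtration and the homotopy lowers it. Since cochains have
bounded degree, contractions survive the perturbation by `d` after finitely many corrections
(`exact_of_filtered_contraction`). Consequently a filtered chain map compatible with retractions
onto a common Koszul complex has an acyclic cone for the curved differentials
(`exact_cone_of_retract`). This is used twice. Normalized cochains compute the same cohomology as
all cochains (`exact_cone_normalizedInclusion`). The external cup product from the tensor product of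
the normalized complexes of the factors to that of the product is a quasi-isomorphism
(`IsSplit.exact_cone_externalCup`): the crossed product of the sum is the tensor product of the
crossed products, and on Koszul complexes the external cup product is that tensor product
(`antisymm_cup_ext`). Normalization is what makes the external cup product a chain map, since a
monomial of the other potential looks like the argument `1`.

With the Künneth theorem over a field (`kunneth_bijective`), the tensor product of the cohomologies
of two factors maps bijectively to the cohomology of the product. Classes of each factor extend
multiplicatively. The sign in the graded tensor product comes from graded commutativity between the
factors, which holds up to an explicit homotopy of Gerstenhaber's type (`diff_brace`). Induction on
`r` splits off the first summand; with no variables left the cohomology is the ground field. -/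

noncomputable section

namespace TwistedHochschild

/-! ### Curved Hochschild cochains and cup products as functions on lists of monomials -/

/-- Commuting left and right actions of a commutative monoid by `k`-linear endomorphisms. -/
structure BiAct (k Mo M : Type*) [CommRing k] [AddCommMonoid Mo] [AddCommGroup M] [Module k M] where
  lam : Mo → M →ₗ[k] M
  rho : Mo → M →ₗ[k] M
  lam_zero : ∀ x, lam 0 x = x
  rho_zero : ∀ x, rho 0 x = x
  lam_add : ∀ a b x, lam (a + b) x = lam a (lam b x)
  rho_add : ∀ a b x, rho (a + b) x = rho a (rho b x)
  comm : ∀ a b x, lam a (rho b x) = rho b (lam a x)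

namespace ListCochain

variable {k Mo M M' : Type*} [CommRing k] [AddCommMonoid Mo] [AddCommGroup M] [Module k M]
  [AddCommGroup M'] [Module k M']

theorem ext_head {f g : List Mo → M} (h0 : f [] = g [])
    (h : ∀ a l, f (a :: l) = g (a :: l)) : f = g := by
  funext l
  cases l with
  | nil => exact h0
  | cons a l => exact h a l

variable (k M) in
/-- The head derivative `f ↦ f(a, -)`. -/
def head (a : Mo) : (List Mo → M) →ₗ[k] (List Mo → M) := LinearMap.funLeft k M (List.cons a)

@[simp] theorem head_apply (a : Mo) (f : List Mo → M) (l : List Mo) :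
    head k M a f l = f (a :: l) := rfl

variable (M) in
/-- Inserting the linear combination `W` of monomials as first argument. -/
def headSum (W : Mo →₀ k) : (List Mo → M) →ₗ[k] (List Mo → M) :=
  ∑ m ∈ W.support, W m • head k M m

theorem headSum_apply (W : Mo →₀ k) (f : List Mo → M) (l : List Mo) :
    headSum M W f l = ∑ m ∈ W.support, W m • f (m :: l) := by
  simp [headSum, LinearMap.sum_apply, Finset.sum_apply]

theorem headSum_eq (W : Mo →₀ k) (f : List Mo → M) :
    headSum M W f = ∑ m ∈ W.support, W m • head k M m f := by
  simp [headSum, LinearMap.sum_apply]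

theorem headSum_zero : headSum (k := k) (Mo := Mo) M 0 = 0 := by simp [headSum]

variable (S : BiAct k Mo M) (S' : BiAct k Mo M')

/-- Multiplying `a` into the first argument, or into the value if there is none. -/
def mergeHead (a : Mo) : (List Mo → M) →ₗ[k] (List Mo → M) where
  toFun f l := match l with
    | [] => S.rho a (f [])
    | b :: l => f ((a + b) :: l)
  map_add' f g := by funext l; cases l <;> simp
  map_smul' c f := by funext l; cases l <;> simp

@[simp] theorem mergeHead_nil (a : Mo) (f : List Mo → M) :
    mergeHead S a f [] = S.rho a (f []) := rfl

@[simp] theorem mergeHead_cons (a b : Mo) (f : List Mo → M) (l : List Mo) :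
    mergeHead S a f (b :: l) = f ((a + b) :: l) := rfl

/-- The curved Hochschild differential without its first term, on functions. -/
def innerFun (W : Mo →₀ k) : (List Mo → M) → List Mo → M
  | f, [] => headSum M W f []
  | f, a :: l => headSum M W f (a :: l) - mergeHead S a f l - innerFun W (head k M a f) l

/-- The curved Hochschild differential without its first term. -/
def inner (W : Mo →₀ k) : (List Mo → M) →ₗ[k] (List Mo → M) where
  toFun := innerFun S W
  map_add' f g := by
    funext l
    induction l generalizing f g with
    | nil => simp [innerFun]
    | cons a l ih =>
      have := ih (head k M a f) (head k M a g)
      simp only [innerFun, map_add, this, Pi.add_apply]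
      abel
  map_smul' c f := by
    funext l
    induction l generalizing f with
    | nil => simp [innerFun]
    | cons a l ih =>
      have := ih (head k M a f)
      simp only [innerFun, map_smul, this, Pi.smul_apply, RingHom.id_apply, smul_sub]

theorem inner_nil (W : Mo →₀ k) (f : List Mo → M) : inner S W f [] = headSum M W f [] := rfl

theorem inner_cons (W : Mo →₀ k) (f : List Mo → M) (a : Mo) (l : List Mo) :
    inner S W f (a :: l) = headSum M W f (a :: l) - mergeHead S a f l -
      inner S W (head k M a f) l := rfl

/-- The first term of the Hochschild differential. -/
def outer : (List Mo → M) →ₗ[k] (List Mo → M) where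
  toFun f l := match l with
    | [] => 0
    | a :: l => S.lam a (f l)
  map_add' f g := by funext l; cases l <;> simp
  map_smul' c f := by funext l; cases l <;> simp

@[simp] theorem outer_nil (f : List Mo → M) : outer S f [] = 0 := rfl

@[simp] theorem outer_cons (f : List Mo → M) (a : Mo) (l : List Mo) :
    outer S f (a :: l) = S.lam a (f l) := rfl

/-- The curved Hochschild differential. -/
def diff (W : Mo →₀ k) : (List Mo → M) →ₗ[k] (List Mo → M) := outer S + inner S W

theorem diff_apply (W : Mo →₀ k) (f : List Mo → M) (l : List Mo) :
    diff S W f l = outer S f l + inner S W f l := rfl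

theorem diff_eq (W : Mo →₀ k) (f : List Mo → M) : diff S W f = outer S f + inner S W f := rfl

/-- Applying a linear map to the values. -/
def postcomp (g : M →ₗ[k] M') : (List Mo → M) →ₗ[k] (List Mo → M') := g.compLeft (List Mo)

@[simp] theorem postcomp_apply (g : M →ₗ[k] M') (f : List Mo → M) (l : List Mo) :
    postcomp g f l = g (f l) := rfl

theorem headSum_postcomp (W : Mo →₀ k) (g : M →ₗ[k] M') (f : List Mo → M) (l : List Mo) :
    headSum M' W (postcomp g f) l = g (headSum M W f l) := by
  simp [headSum_apply, map_sum]

theorem inner_postcomp (W : Mo →₀ k) (g : M →ₗ[k] M') (hr : ∀ a x, g (S.rho a x) = S'.rho a (g x))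
    (f : List Mo → M) : inner S' W (postcomp g f) = postcomp g (inner S W f) := by
  funext l
  induction l generalizing f with
  | nil => simp [inner_nil, headSum_postcomp]
  | cons a l ih =>
    have h1 : mergeHead S' a (postcomp g f) l = g (mergeHead S a f l) := by
      cases l <;> simp [hr]
    have h2 := ih (head k M a f)
    have h3 : head k M' a (postcomp g f) = postcomp g (head k M a f) := rfl
    rw [inner_cons, h1, h3, h2, headSum_postcomp]
    simp [inner_cons]

theorem diff_postcomp (W : Mo →₀ k) (g : M →ₗ[k] M') (hl : ∀ a x, g (S.lam a x) = S'.lam a (g x))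
    (hr : ∀ a x, g (S.rho a x) = S'.rho a (g x)) (f : List Mo → M) :
    diff S' W (postcomp g f) = postcomp g (diff S W f) := by
  rw [diff_eq, diff_eq, map_add, inner_postcomp S S' W g hr]
  congr 1
  funext l
  cases l <;> simp [hl]

/-- The terms cancel pairwise as in the usual proof that the differential squares to zero; those
where `W` meets a neighbouring argument cancel because the monoid is commutative. What survives is
`W` inserted in the last place and then multiplied into the value from the right. -/
theorem inner_inner (W : Mo →₀ k) (f : List Mo → M) (l : List Mo) :
    inner S W (inner S W f) l = - ∑ m ∈ W.support, W m • S.rho m (f l) := by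
  have hW : ∀ (g : List Mo → M) (l : List Mo), headSum M W (inner S W g) l =
      headSum M W (headSum M W g) l - ∑ m ∈ W.support, W m • mergeHead S m g l -
        inner S W (headSum M W g) l := by
    intro g l
    rw [headSum_apply, headSum_apply, headSum_eq W g, map_sum]
    simp only [inner_cons, smul_sub, Finset.sum_sub_distrib, map_smul, Finset.sum_apply,
      Pi.smul_apply]
    rw [headSum_eq W g]
    simp
  induction l generalizing f with
  | nil =>
    rw [inner_nil, hW, inner_nil]
    simp
  | cons a l ih =>
    rw [inner_cons, hW, inner_cons]
    have h1 : head k M a (inner S W f) = head k M a (headSum M W f) - mergeHead S a f -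
      inner S W (head k M a f) := rfl
    rw [h1, map_sub, map_sub]
    simp only [Pi.sub_apply]
    rw [ih]
    -- These are all the terms in which `a`, or an inserted monomial, is merged with its right
    -- neighbour. Their cancellation is the point where `m + a = a + m` enters.
    have key : - (∑ m ∈ W.support, W m • mergeHead S m f (a :: l)) +
        mergeHead S a (headSum M W f) l - mergeHead S a (inner S W f) l +
        inner S W (mergeHead S a f) l = 0 := by
      cases l with
      | nil =>
        simp [inner_nil, headSum_apply, add_comm]
      | cons b l =>
        simp only [mergeHead_cons, inner_cons, headSum_apply]
        have h2 : mergeHead S b (mergeHead S a f) = mergeHead S (a + b) f := by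
          refine ext_head ?_ fun c l => ?_
          · simp [← S.rho_add, add_comm]
          · simp [add_assoc]
        have h3 : head k M b (mergeHead S a f) = head k M (a + b) f := rfl
        rw [h2, h3]
        simp [add_comm a]
        abel
    simp only [head_apply]
    linear_combination (norm := module) key

/-- The left action commutes with the inner differential, up to two effects at the front: merging
the first two arguments cancels `outer` applied twice, and `W` inserted first is multiplied into the
value from the left. -/
theorem outer_outer_add (W : Mo →₀ k) (f : List Mo → M) (l : List Mo) :
    outer S (outer S f) l + outer S (inner S W f) l + inner S W (outer S f) l =
      ∑ m ∈ W.support, W m • S.lam m (f l) := by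
  cases l with
  | nil => simp [inner_nil, headSum_apply]
  | cons a l =>
    have h1 : head k M a (outer S f) = postcomp (S.lam a) f := rfl
    rw [inner_cons, h1, inner_postcomp S S W _ (fun b x => S.comm a b x)]
    cases l with
    | nil => simp [headSum_apply]
    | cons b l => simp [headSum_apply, S.lam_add]

theorem diff_diff (W : Mo →₀ k) (f : List Mo → M) (l : List Mo) :
    diff S W (diff S W f) l =
      ∑ m ∈ W.support, W m • S.lam m (f l) - ∑ m ∈ W.support, W m • S.rho m (f l) := by
  rw [← outer_outer_add S W f l, sub_eq_add_neg, ← inner_inner S W f l]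
  simp only [diff_eq, map_add, Pi.add_apply]
  abel

theorem diff_zero_diff_zero (f : List Mo → M) : diff S 0 (diff S 0 f) = 0 := by
  funext l
  rw [diff_diff]
  simp

/-- The Hochschild part reads lists one shorter and the curving part lists one longer. The guard `W
≠ 0` lets the same lemma express that the uncurved differential reads shorter lists only. -/
theorem inner_congr (W : Mo →₀ k) {f g : List Mo → M} {l : List Mo}
    (h : ∀ l' : List Mo, l'.length + 1 = l.length → f l' = g l')
    (h' : ∀ l' : List Mo, l'.length = l.length + 1 → W ≠ 0 → f l' = g l') :
    inner S W f l = inner S W g l := by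
  have hs : headSum M W f l = headSum M W g l := by
    rw [headSum_apply, headSum_apply]
    by_cases hW : W = 0
    · simp [hW]
    · exact Finset.sum_congr rfl fun m _ => by rw [h' _ rfl hW]
  induction l generalizing f g with
  | nil => exact hs
  | cons a l ih =>
    rw [inner_cons, inner_cons, hs]
    congr 1
    · congr 1
      cases l with
      | nil => simp [h [] rfl]
      | cons b l => simp only [mergeHead_cons]; exact h _ rfl
    · have h1 : ∀ l' : List Mo, l'.length = l.length + 1 → W ≠ 0 →
          head k M a f l' = head k M a g l' := fun l' hl hW =>
        h' _ (by simp [hl]) hW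
      refine ih (fun l' hl => h _ (by simp [hl])) h1 ?_
      rw [headSum_apply, headSum_apply]
      by_cases hW : W = 0
      · simp [hW]
      · exact Finset.sum_congr rfl fun m _ => by rw [h1 _ rfl hW]

theorem diff_congr (W : Mo →₀ k) {f g : List Mo → M} {l : List Mo}
    (h : ∀ l' : List Mo, l'.length + 1 = l.length → f l' = g l')
    (h' : ∀ l' : List Mo, l'.length = l.length + 1 → W ≠ 0 → f l' = g l') :
    diff S W f l = diff S W g l := by
  rw [diff_apply, diff_apply, inner_congr S W h h']
  congr 1
  cases l with
  | nil => rfl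
  | cons a l => simp [h l rfl]

/-- Above the top degree of a cochain the curving has nothing to read. This is the reason why the
perturbation does not raise the degree filtration. -/
theorem diff_eq_diff_zero (W : Mo →₀ k) {f : List Mo → M} {l : List Mo}
    (h : ∀ l' : List Mo, l'.length = l.length + 1 → f l' = 0) :
    diff S W f l = diff S 0 f l := by
  rw [diff_apply, diff_apply]
  congr 1
  have hs : headSum M W f l = 0 := by
    rw [headSum_apply]
    exact Finset.sum_eq_zero fun m _ => by rw [h _ rfl, smul_zero]
  induction l generalizing f with
  | nil => rw [inner_nil, inner_nil, hs, headSum_zero]; rfl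
  | cons a l ih =>
    have h1 : ∀ l' : List Mo, l'.length = l.length + 1 → head k M a f l' = 0 :=
      fun l' hl => h _ (by simp [hl])
    rw [inner_cons, inner_cons, hs, headSum_zero, ih h1]
    · rfl
    · rw [headSum_apply]
      exact Finset.sum_eq_zero fun m _ => by rw [h1 _ rfl, smul_zero]

/-- Cochains vanishing as soon as one of the arguments is `1`. -/
def IsNormalized (f : List Mo → M) : Prop := ∀ l, 0 ∈ l → f l = 0

theorem IsNormalized.head {f : List Mo → M} (hf : IsNormalized f) (a : Mo) :
    IsNormalized (head k M a f) := fun l hl => hf _ (List.mem_cons_of_mem _ hl)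

theorem IsNormalized.head_zero {f : List Mo → M} (hf : IsNormalized f) :
    ListCochain.head k M 0 f = 0 := funext fun l => hf _ (by simp)

theorem IsNormalized.headSum {f : List Mo → M} (hf : IsNormalized f) (W : Mo →₀ k) :
    IsNormalized (headSum M W f) := fun l hl => by
  rw [headSum_apply]
  exact Finset.sum_eq_zero fun m _ => by rw [hf _ (List.mem_cons_of_mem _ hl), smul_zero]

/-- An argument `1` is absorbed by its left and by its right neighbour with opposite signs, where at
the two ends the neighbour is the value; every other term still has an argument `1`. -/
theorem IsNormalized.diff {f : List Mo → M} (hf : IsNormalized f) (W : Mo →₀ k) :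
    IsNormalized (diff S W f) := by
  intro l hl
  induction l generalizing f with
  | nil => simp at hl
  | cons a l ih =>
    rw [diff_apply, outer_cons, inner_cons, hf.headSum W _ hl]
    cases l with
    | nil =>
      obtain rfl : a = 0 := (List.mem_singleton.1 hl).symm
      have : ListCochain.head k M 0 f = 0 := hf.head_zero
      rw [this]
      simp [S.lam_zero, S.rho_zero]
    | cons b l =>
      have ih' : 0 ∈ b :: l → _ := fun h => ih (hf.head (k := k) a) h
      simp only [diff_apply, outer_cons, head_apply] at ih'
      rw [mergeHead_cons]
      by_cases h0 : (0 : Mo) ∈ l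
      · have e := ih' (by simp [h0])
        rw [hf _ (by simp [h0]), map_zero, zero_add] at e
        rw [e, hf _ (by simp [h0]), hf _ (by simp [h0])]
        simp
      · rcases List.mem_cons.1 hl with rfl | h
        · have : ListCochain.head k M 0 f = 0 := hf.head_zero
          rw [this]
          simp [S.lam_zero]
        -- The only `0` in the tail is now the second argument. The term merging it into `a` cancels
        -- the outer term contained in the induction hypothesis for `f(a, -)`.
        · obtain rfl : 0 = b := by simpa [h0] using h
          have e := ih' (by simp)
          rw [S.lam_zero] at e
          rw [eq_neg_of_add_eq_zero_right e, hf _ (by simp)]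
          simp

variable (k Mo M) in
/-- Multiplying by `(-1)^p` in degree `p`. -/
def parSign : (List Mo → M) →ₗ[k] (List Mo → M) where
  toFun f l := (-1 : k) ^ l.length • f l
  map_add' f g := by funext l; simp
  map_smul' c f := funext fun l => smul_comm _ _ _

theorem parSign_apply (f : List Mo → M) (l : List Mo) :
    parSign k Mo M f l = (-1 : k) ^ l.length • f l := rfl

theorem parSign_parSign (f : List Mo → M) : parSign k Mo M (parSign k Mo M f) = f := by
  funext l
  simp [parSign_apply, smul_smul, ← mul_pow]

theorem headSum_parSign (W : Mo →₀ k) (f : List Mo → M) (l : List Mo) :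
    headSum M W (parSign k Mo M f) l = - parSign k Mo M (headSum M W f) l := by
  simp only [headSum_apply, parSign_apply, Finset.smul_sum, ← Finset.sum_neg_distrib]
  refine Finset.sum_congr rfl fun m _ => ?_
  rw [smul_comm, List.length_cons, pow_succ]
  simp

theorem inner_parSign (W : Mo →₀ k) (f : List Mo → M) (l : List Mo) :
    inner S W (parSign k Mo M f) l = - parSign k Mo M (inner S W f) l := by
  induction l generalizing f with
  | nil => simp only [inner_nil, headSum_parSign, parSign_apply]
  | cons a l ih =>
    have h1 : head k M a (parSign k Mo M f) = - parSign k Mo M (head k M a f) := by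
      funext l; simp [parSign_apply, pow_succ]
    have h2 : mergeHead S a (parSign k Mo M f) l = parSign k Mo M (mergeHead S a f) l := by
      cases l <;> simp [parSign_apply, pow_succ]
    rw [inner_cons, h1, h2, map_neg, Pi.neg_apply, ih, headSum_parSign]
    simp only [parSign_apply, inner_cons, List.length_cons, pow_succ]
    module

theorem diff_parSign (W : Mo →₀ k) (f : List Mo → M) :
    diff S W (parSign k Mo M f) = - parSign k Mo M (diff S W f) := by
  funext l
  rw [diff_apply, inner_parSign]
  cases l with
  | nil => simp [parSign_apply, diff_apply]
  | cons a l => simp [parSign_apply, diff_apply, pow_succ]; abel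

section Cup

variable {B : Type*} [Ring B] [Algebra k B]

/-- The cup product of functions on lists. -/
def cup : (List Mo → B) → (List Mo → B) → List Mo → B
  | f, g, [] => f [] * g []
  | f, g, a :: l => f [] * g (a :: l) + cup (head k B a f) g l

theorem cup_nil (f g : List Mo → B) : cup (k := k) f g [] = f [] * g [] := rfl

theorem cup_cons (f g : List Mo → B) (a : Mo) (l : List Mo) :
    cup (k := k) f g (a :: l) = f [] * g (a :: l) + cup (k := k) (head k B a f) g l := rfl

variable (k Mo B) in
/-- The cup product as a bilinear map. -/
def cupHom : (List Mo → B) →ₗ[k] (List Mo → B) →ₗ[k] (List Mo → B) :=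
  LinearMap.mk₂ k (cup (k := k))
    (fun f f' g => by
      funext l
      induction l generalizing f f' with
      | nil => simp [cup_nil, add_mul]
      | cons a l ih => simp only [cup_cons, map_add, Pi.add_apply, ih, add_mul]; abel)
    (fun c f g => by
      funext l
      induction l generalizing f with
      | nil => simp [cup_nil]
      | cons a l ih => simp only [cup_cons, map_smul, Pi.smul_apply, ih, smul_mul_assoc, smul_add])
    (fun f g g' => by
      funext l
      induction l generalizing f with
      | nil => simp [cup_nil, mul_add]
      | cons a l ih => simp only [cup_cons, Pi.add_apply, ih, mul_add]; abel)
    (fun c f g => by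
      funext l
      induction l generalizing f with
      | nil => simp [cup_nil]
      | cons a l ih => simp only [cup_cons, Pi.smul_apply, ih, mul_smul_comm, smul_add])

theorem cupHom_nil (f g : List Mo → B) : cupHom k Mo B f g [] = f [] * g [] := rfl

theorem cupHom_cons (f g : List Mo → B) (a : Mo) (l : List Mo) :
    cupHom k Mo B f g (a :: l) = f [] * g (a :: l) + cupHom k Mo B (head k B a f) g l := rfl

theorem cupHom_eq_sum (f g : List Mo → B) (l : List Mo) :
    cupHom k Mo B f g l = ∑ i ∈ Finset.range (l.length + 1), f (l.take i) * g (l.drop i) := by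
  induction l generalizing f with
  | nil => simp [cupHom_nil]
  | cons a l ih =>
    rw [cupHom_cons, ih, List.length_cons, Finset.sum_range_succ' _ (l.length + 1)]
    simp [add_comm]

theorem IsNormalized.cupHom {f g : List Mo → B} (hf : IsNormalized f) (hg : IsNormalized g) :
    IsNormalized (cupHom k Mo B f g) := by
  intro l hl
  rw [cupHom_eq_sum]
  refine Finset.sum_eq_zero fun i _ => ?_
  rw [← List.take_append_drop i l, List.mem_append] at hl
  rcases hl with h | h
  · rw [hf _ h, zero_mul]
  · rw [hg _ h, mul_zero]

theorem cupHom_mul_left (b : B) (f g : List Mo → B) (l : List Mo) :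
    cupHom k Mo B (fun l => b * f l) g l = b * cupHom k Mo B f g l := by
  simp only [cupHom_eq_sum, Finset.mul_sum, mul_assoc]

/-- The two actions of a monoid on an algebra by multiplication through a monoid morphism. -/
def mulAct (u : Multiplicative Mo →* B) : BiAct k Mo B where
  lam a := LinearMap.mulLeft k (u (.ofAdd a))
  rho a := LinearMap.mulRight k (u (.ofAdd a))
  lam_zero x := by simp
  rho_zero x := by simp
  lam_add a b x := by simp [mul_assoc]
  rho_add a b x := by rw [add_comm a b]; simp [mul_assoc]
  comm a b x := by simp [mul_assoc]

@[simp] theorem mulAct_lam (u : Multiplicative Mo →* B) (a : Mo) (x : B) :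
    (mulAct (k := k) u).lam a x = u (.ofAdd a) * x := rfl

@[simp] theorem mulAct_rho (u : Multiplicative Mo →* B) (a : Mo) (x : B) :
    (mulAct (k := k) u).rho a x = x * u (.ofAdd a) := rfl

theorem inner_mul_left (u : Multiplicative Mo →* B) (W : Mo →₀ k) (b : B) (f : List Mo → B) :
    inner (mulAct u) W (fun l => b * f l) = fun l => b * inner (mulAct u) W f l :=
  inner_postcomp (mulAct (k := k) u) (mulAct (k := k) u) W (LinearMap.mulLeft k b) (fun a x => (mul_assoc _ _ _).symm) f

theorem headSum_cupHom (W : Mo →₀ k) (f g : List Mo → B) (l : List Mo) :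
    headSum B W (cupHom k Mo B f g) l =
      f [] * headSum B W g l + cupHom k Mo B (headSum B W f) g l := by
  have : cupHom k Mo B (headSum B W f) g l =
      ∑ m ∈ W.support, W m • cupHom k Mo B (head k B m f) g l := by
    rw [headSum_eq W f, map_sum, LinearMap.sum_apply, Finset.sum_apply]
    simp
  rw [this, headSum_apply, headSum_apply, Finset.mul_sum, ← Finset.sum_add_distrib]
  exact Finset.sum_congr rfl fun m _ => by rw [cupHom_cons, smul_add, mul_smul_comm]

/-- At the seam between `f` and `g`, the right multiplication ending the differential of `f` cancels
the left multiplication starting the differential of `g`. Hence the full differential of `g`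
appears, while `f` contributes only its inner part. -/
theorem inner_cupHom (u : Multiplicative Mo →* B) (W : Mo →₀ k) (f g : List Mo → B)
    (l : List Mo) :
    inner (mulAct u) W (cupHom k Mo B f g) l =
      cupHom k Mo B (inner (mulAct u) W f) g l +
        cupHom k Mo B (parSign k Mo B f) (diff (mulAct u) W g) l := by
  induction l generalizing f with
  | nil =>
    simp [inner_nil, headSum_cupHom, cupHom_nil, diff_apply, parSign_apply]
    abel
  | cons a l ih =>
    have h1 : head k B a (cupHom k Mo B f g) =
        (fun l => f [] * head k B a g l) + cupHom k Mo B (head k B a f) g := rfl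
    have h2 : mergeHead (mulAct (k := k) u) a (cupHom k Mo B f g) l =
        f [] * mergeHead (mulAct (k := k) u) a g l +
          cupHom k Mo B (mergeHead (mulAct (k := k) u) a f) g l - f [] * (u (.ofAdd a) * g l) := by
      cases l with
      | nil => simp [cupHom_nil, mul_assoc]
      | cons b l =>
        simp only [mergeHead_cons, cupHom_cons, mergeHead_nil, mulAct_rho]
        have : head k B b (mergeHead (mulAct (k := k) u) a f) = head k B (a + b) f := rfl
        rw [this, mul_assoc]
        abel
    have h3 : head k B a (inner (mulAct u) W f) = head k B a (headSum B W f) -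
        mergeHead (mulAct u) a f - inner (mulAct u) W (head k B a f) := rfl
    have h4 : head k B a (parSign k Mo B f) = - parSign k Mo B (head k B a f) := by
      funext l; simp [parSign_apply, pow_succ]
    rw [inner_cons, h1, map_add, inner_mul_left, Pi.add_apply, ih, h2, headSum_cupHom, cupHom_cons,
      cupHom_cons, cupHom_cons, h3, h4]
    simp only [map_sub, map_neg, LinearMap.sub_apply, LinearMap.neg_apply, Pi.sub_apply,
      Pi.neg_apply, diff_apply, outer_cons, mulAct_lam, inner_cons, inner_nil]
    have h5 : parSign k Mo B f [] = f [] := by simp [parSign_apply]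
    rw [h5]
    noncomm_ring

theorem diff_cupHom (u : Multiplicative Mo →* B) (W : Mo →₀ k) (f g : List Mo → B) :
    diff (mulAct u) W (cupHom k Mo B f g) = cupHom k Mo B (diff (mulAct u) W f) g +
      cupHom k Mo B (parSign k Mo B f) (diff (mulAct u) W g) := by
  funext l
  rw [diff_apply, inner_cupHom, diff_eq (mulAct u) W f, map_add, LinearMap.add_apply]
  have : outer (mulAct (k := k) u) (cupHom k Mo B f g) l =
      cupHom k Mo B (outer (mulAct (k := k) u) f) g l := by
    cases l with
    | nil => simp [cupHom_nil]
    | cons a l =>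
      have : head k B a (outer (mulAct (k := k) u) f) = fun l => u (.ofAdd a) * f l := rfl
      rw [cupHom_cons, this, cupHom_mul_left]
      simp
  rw [this]
  simp [add_assoc]

end Cup

end ListCochain
-- The Koszul complex and antisymmetrization
namespace ListCochain

section Koszul

variable {k σ M M' : Type*} [CommRing k] [LinearOrder σ] [AddCommGroup M] [Module k M]
  [AddCommGroup M'] [Module k M']

/-- The sign of moving `i` to the front of `S`. -/
def frontSign (k : Type*) [CommRing k] (i : σ) (S : Finset σ) : k := (-1) ^ (S.filter (· < i)).card

theorem frontSign_mul_self (i : σ) (S : Finset σ) : frontSign k i S * frontSign k i S = 1 := by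
  rw [frontSign, ← mul_pow]; simp

/-- Removing the smaller element shifts the position of the larger one by one; removing the larger
does not move the smaller. -/
theorem frontSign_swap {i j : σ} {S : Finset σ} (hi : i ∈ S) (hj : j ∈ S) (hij : i ≠ j) :
    frontSign k i S * frontSign k j (S.erase i) = -(frontSign k j S * frontSign k i (S.erase j)) := by
  have key : ∀ {i j : σ}, i ∈ S → j ∈ S → i < j →
      frontSign k i S * frontSign k j (S.erase i) =
        -(frontSign k j S * frontSign k i (S.erase j)) := by
    intro i j hi hj h
    have h1 : (S.erase j).filter (· < i) = S.filter (· < i) := by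
      ext l
      simp only [Finset.mem_filter, Finset.mem_erase]
      exact ⟨fun h => ⟨h.1.2, h.2⟩, fun h' => ⟨⟨(h'.2.trans h).ne, h'.1⟩, h'.2⟩⟩
    have h2 : (S.erase i).filter (· < j) = (S.filter (· < j)).erase i := by
      rw [Finset.filter_erase]
    have h3 : i ∈ S.filter (· < j) := by simp [hi, h]
    have h4 := Finset.card_erase_add_one h3
    rw [frontSign, frontSign, frontSign, frontSign, h1, h2, ← h4, pow_succ]
    ring
  rcases lt_or_gt_of_ne hij with h | h
  · exact key hi hj h
  · rw [key hj hi h, neg_neg]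

theorem sum_erase_comm (T : Finset σ) (F : σ → σ → M) :
    ∑ i ∈ T, ∑ j ∈ T.erase i, F i j = ∑ j ∈ T, ∑ i ∈ T.erase j, F i j := by
  refine Finset.sum_comm' fun i j => ?_
  simp only [Finset.mem_erase]
  tauto

theorem sum_erase_antisymm (T : Finset σ) (F : σ → σ → M)
    (h : ∀ i ∈ T, ∀ j ∈ T, i ≠ j → F i j + F j i = 0) :
    ∑ i ∈ T, ∑ j ∈ T.erase i, F i j = 0 := by
  rw [Finset.sum_sigma']
  refine Finset.sum_involution (fun x _ => ⟨x.2, x.1⟩) ?_ ?_ ?_ ?_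
  · rintro ⟨i, j⟩ hx
    simp only [Finset.mem_sigma, Finset.mem_erase] at hx
    exact h i hx.1 j hx.2.2 (Ne.symm hx.2.1)
  · rintro ⟨i, j⟩ hx - he
    simp only [Finset.mem_sigma, Finset.mem_erase] at hx
    exact hx.2.1 (congrArg Sigma.fst he)
  · rintro ⟨i, j⟩ hx
    simp only [Finset.mem_sigma, Finset.mem_erase] at hx ⊢
    exact ⟨hx.2.2, Ne.symm hx.2.1, hx.1⟩
  · rintro ⟨i, j⟩ hx
    rfl

/-- The antisymmetrization of a cochain on the variables, with fuel. -/
def antisymmAux : ℕ → (List (σ →₀ ℕ) → M) → Finset σ → M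
  | 0, f, _ => f []
  | n + 1, f, T => ∑ i ∈ T, frontSign k i T •
      antisymmAux n (head k M (Finsupp.single i 1) f) (T.erase i)

variable (k σ M) in
/-- The restriction of a cochain to the Koszul complex: its antisymmetrized values on variables. -/
def antisymm : (List (σ →₀ ℕ) → M) →ₗ[k] (Finset σ → M) where
  toFun f T := antisymmAux (k := k) T.card f T
  map_add' f g := by
    funext T
    change _ = antisymmAux (k := k) T.card f T + antisymmAux (k := k) T.card g T
    generalize T.card = n
    induction n generalizing f g T with
    | zero => rfl
    | succ n ih => simp only [antisymmAux, map_add, ih, smul_add, Finset.sum_add_distrib]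
  map_smul' c f := by
    funext T
    change _ = c • antisymmAux (k := k) T.card f T
    generalize T.card = n
    induction n generalizing f T with
    | zero => rfl
    | succ n ih =>
      simp only [antisymmAux, map_smul, ih, Finset.smul_sum]
      exact Finset.sum_congr rfl fun i _ => smul_comm _ _ _

theorem antisymm_empty (f : List (σ →₀ ℕ) → M) : antisymm k σ M f ∅ = f [] := rfl

theorem antisymm_of_nonempty (f : List (σ →₀ ℕ) → M) {T : Finset σ} (hT : T.Nonempty) :
    antisymm k σ M f T = ∑ i ∈ T, frontSign k i T •
      antisymm k σ M (head k M (Finsupp.single i 1) f) (T.erase i) := by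
  change antisymmAux (k := k) T.card f T = _
  obtain ⟨n, hn⟩ : ∃ n, T.card = n + 1 := ⟨T.card - 1, by have := hT.card_pos; omega⟩
  rw [hn, antisymmAux]
  refine Finset.sum_congr rfl fun i hi => ?_
  change _ = frontSign k i T • antisymmAux (k := k) (T.erase i).card _ _
  rw [Finset.card_erase_of_mem hi, hn, Nat.add_sub_cancel]

theorem antisymm_congr {f g : List (σ →₀ ℕ) → M} {T : Finset σ}
    (h : ∀ l : List (σ →₀ ℕ), l.length = T.card → f l = g l) :
    antisymm k σ M f T = antisymm k σ M g T := by
  induction hn : T.card generalizing f g T with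
  | zero =>
    obtain rfl := Finset.card_eq_zero.1 hn
    exact h [] rfl
  | succ n ih =>
    have hT : T.Nonempty := Finset.card_pos.1 (by omega)
    rw [antisymm_of_nonempty _ hT, antisymm_of_nonempty _ hT]
    refine Finset.sum_congr rfl fun i hi => ?_
    have hc := Finset.card_erase_of_mem hi
    exact congrArg _ (ih (fun l hl => h _ (by rw [List.length_cons, hl]; omega)) (by omega))

theorem antisymm_postcomp (g : M →ₗ[k] M') (f : List (σ →₀ ℕ) → M) (T : Finset σ) :
    antisymm k σ M' (postcomp g f) T = g (antisymm k σ M f T) := by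
  induction hn : T.card generalizing f T with
  | zero =>
    obtain rfl := Finset.card_eq_zero.1 hn
    rfl
  | succ n ih =>
    have hT : T.Nonempty := Finset.card_pos.1 (by omega)
    rw [antisymm_of_nonempty _ hT, antisymm_of_nonempty _ hT, map_sum]
    refine Finset.sum_congr rfl fun i hi => ?_
    rw [map_smul, ← ih _ _ (by rw [Finset.card_erase_of_mem hi]; omega)]
    rfl

/-- The differential of the Koszul complex. -/
def koszulDiff (D : σ → M →ₗ[k] M) : (Finset σ → M) →ₗ[k] (Finset σ → M) where
  toFun u T := ∑ i ∈ T, frontSign k i T • D i (u (T.erase i))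
  map_add' u v := by funext T; simp [Finset.sum_add_distrib]
  map_smul' c u := by
    funext T
    simp only [Pi.smul_apply, map_smul, Finset.smul_sum, RingHom.id_apply]
    exact Finset.sum_congr rfl fun i _ => smul_comm _ _ _

theorem koszulDiff_apply (D : σ → M →ₗ[k] M) (u : Finset σ → M) (T : Finset σ) :
    koszulDiff D u T = ∑ i ∈ T, frontSign k i T • D i (u (T.erase i)) := rfl

variable (S : BiAct k (σ →₀ ℕ) M)

/-- Terms with a product of two neighbouring variables are symmetric in them and die under
antisymmetrization. Only the right multiplication of the last variable into the value remains. -/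
theorem antisymm_inner (f : List (σ →₀ ℕ) → M) (T : Finset σ) :
    antisymm k σ M (inner S 0 f) T =
      -∑ i ∈ T, frontSign k i T • S.rho (Finsupp.single i 1) (antisymm k σ M f (T.erase i)) := by
  induction hn : T.card generalizing f T with
  | zero =>
    obtain rfl := Finset.card_eq_zero.1 hn
    simp [antisymm_empty, inner_nil, headSum_zero]
  | succ n ih =>
    have hT : T.Nonempty := Finset.card_pos.1 (by omega)
    have h1 : ∀ i, head k M (Finsupp.single i 1) (inner S 0 f) =
        - mergeHead S (Finsupp.single i 1) f - inner S 0 (head k M (Finsupp.single i 1) f) := by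
      intro i
      funext l
      simp [inner_cons, headSum_zero]
    have hc : ∀ i ∈ T, (T.erase i).card = n := fun i hi => by
      rw [Finset.card_erase_of_mem hi]; omega
    rw [antisymm_of_nonempty _ hT]
    simp only [h1, map_sub, map_neg, Pi.sub_apply, Pi.neg_apply, smul_sub, smul_neg,
      Finset.sum_sub_distrib, Finset.sum_neg_distrib]
    rcases Nat.eq_zero_or_pos n with rfl | hpos
    · have h2 : ∑ i ∈ T, frontSign k i T • antisymm k σ M
          (inner S 0 (head k M (Finsupp.single i 1) f)) (T.erase i) = 0 := by
        refine Finset.sum_eq_zero fun i hi => ?_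
        rw [Finset.card_eq_zero.1 (hc i hi), antisymm_empty, inner_nil, headSum_zero]
        simp
      rw [h2, sub_zero]
      congr 1
      refine Finset.sum_congr rfl fun i hi => ?_
      rw [Finset.card_eq_zero.1 (hc i hi), antisymm_empty, antisymm_empty, mergeHead_nil]
    · have hne : ∀ i ∈ T, (T.erase i).Nonempty := fun i hi =>
        Finset.card_pos.1 (by rw [hc i hi]; exact hpos)
      have h2 : ∑ i ∈ T, frontSign k i T • antisymm k σ M
          (mergeHead S (Finsupp.single i 1) f) (T.erase i) = 0 := by
        have : ∀ i ∈ T, frontSign k i T • antisymm k σ M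
            (mergeHead S (Finsupp.single i 1) f) (T.erase i) =
            ∑ j ∈ T.erase i, (frontSign k i T * frontSign k j (T.erase i)) • antisymm k σ M
              (head k M (Finsupp.single i 1 + Finsupp.single j 1) f) ((T.erase i).erase j) := by
          intro i hi
          rw [antisymm_of_nonempty _ (hne i hi), Finset.smul_sum]
          exact Finset.sum_congr rfl fun j hj => by rw [smul_smul]; rfl
        rw [Finset.sum_congr rfl this]
        -- The sign changes when `i` and `j` are exchanged, while the argument `x_i x_j` and the
        -- remaining set do not.
        refine sum_erase_antisymm T _ fun i hi j hj hij => ?_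
        rw [frontSign_swap hi hj hij, add_comm (Finsupp.single i 1), Finset.erase_right_comm,
          neg_smul, neg_add_cancel]
      rw [h2, neg_zero, zero_sub]
      congr 1
      have h3 : ∀ i ∈ T, frontSign k i T • antisymm k σ M
          (inner S 0 (head k M (Finsupp.single i 1) f)) (T.erase i) =
          ∑ j ∈ T.erase i, (frontSign k j T * frontSign k i (T.erase j)) •
            S.rho (Finsupp.single j 1) (antisymm k σ M (head k M (Finsupp.single i 1) f)
              ((T.erase j).erase i)) := by
        intro i hi
        rw [ih _ _ (hc i hi), smul_neg, Finset.smul_sum, ← Finset.sum_neg_distrib]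
        refine Finset.sum_congr rfl fun j hj => ?_
        have hj' := Finset.mem_erase.1 hj
        rw [smul_smul, frontSign_swap hi hj'.2 (Ne.symm hj'.1), neg_smul, neg_neg,
          Finset.erase_right_comm]
      rw [Finset.sum_congr rfl h3, sum_erase_comm]
      refine Finset.sum_congr rfl fun j hj => ?_
      rw [antisymm_of_nonempty _ (hne j hj), map_sum, Finset.smul_sum]
      exact Finset.sum_congr rfl fun i hi => by rw [map_smul, smul_smul]

/-- The difference of the two actions of a variable. -/
def varDiff (i : σ) : M →ₗ[k] M := S.lam (Finsupp.single i 1) - S.rho (Finsupp.single i 1)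

/-- Antisymmetrization is a chain map: the outer term supplies the left actions of the variables,
the inner differential the right actions, and their difference is `varDiff`. -/
theorem antisymm_diff (f : List (σ →₀ ℕ) → M) :
    antisymm k σ M (diff S 0 f) = koszulDiff (varDiff S) (antisymm k σ M f) := by
  funext T
  rw [diff_eq, map_add, Pi.add_apply, antisymm_inner, koszulDiff_apply]
  have : antisymm k σ M (outer S f) T =
      ∑ i ∈ T, frontSign k i T • S.lam (Finsupp.single i 1) (antisymm k σ M f (T.erase i)) := by
    rcases T.eq_empty_or_nonempty with rfl | hT
    · rfl
    · rw [antisymm_of_nonempty _ hT]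
      refine Finset.sum_congr rfl fun i hi => ?_
      rw [← antisymm_postcomp]
      rfl
  rw [this, ← sub_eq_add_neg, ← Finset.sum_sub_distrib]
  exact Finset.sum_congr rfl fun i _ => by simp [varDiff, smul_sub]

/-- Dual cochains for the restriction to the Koszul complex. -/
theorem exists_antisymm_dual (T : Finset σ) : ∃ c : List (σ →₀ ℕ) → k,
    (∀ l, c l ≠ 0 → l.length = T.card ∧ 0 ∉ l) ∧
      ∀ T', antisymm k σ k c T' = if T' = T then 1 else 0 := by
  classical
  induction T using Finset.induction_on with
  | empty =>
    refine ⟨fun l => if l = [] then 1 else 0, fun l hl => ?_, fun T' => ?_⟩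
    · have : l = [] := by by_contra h; exact hl (if_neg h)
      simp [this]
    · rcases T'.eq_empty_or_nonempty with rfl | hT
      · rfl
      · rw [antisymm_of_nonempty _ hT, if_neg hT.ne_empty]
        refine Finset.sum_eq_zero fun i _ => ?_
        have : head k k (Finsupp.single i 1) (fun l : List (σ →₀ ℕ) => if l = [] then (1 : k) else 0) =
          0 := by funext l; simp
        rw [this, map_zero, Pi.zero_apply, smul_zero]
  | insert i T hi ih =>
    obtain ⟨c, hc, hT⟩ := ih
    -- The dual cochain of `insert i T` is supported on one list of variables, starting with `x_i`.
    -- The factor `frontSign` cancels the sign with which this ordering enters `antisymm`.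
    refine ⟨fun l => match l with
      | [] => 0
      | a :: l => if a = Finsupp.single i 1 then frontSign k i (Insert.insert i T) * c l else 0,
      fun l hl => ?_, fun T' => ?_⟩
    · cases l with
      | nil => exact absurd rfl hl
      | cons a l =>
        simp only at hl
        have ha : a = Finsupp.single i 1 := by by_contra h; exact hl (if_neg h)
        rw [if_pos ha] at hl
        obtain ⟨h1, h2⟩ := hc l (right_ne_zero_of_mul hl)
        refine ⟨by simp [h1, Finset.card_insert_of_notMem hi], ?_⟩
        simp [h2, ha, eq_comm (a := (0 : σ →₀ ℕ))]
    · rcases T'.eq_empty_or_nonempty with rfl | hT'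
      · rw [if_neg (Finset.insert_nonempty i T).ne_empty.symm]; rfl
      · rw [antisymm_of_nonempty _ hT']
        have h1 : ∀ j, head k k (Finsupp.single j 1) (fun l => match l with
            | [] => 0
            | a :: l => if a = Finsupp.single i 1 then frontSign k i (Insert.insert i T) * c l else 0) =
            if j = i then frontSign k i (Insert.insert i T) • c else 0 := by
          intro j
          funext l
          by_cases hj : j = i
          · simp [hj]
          · have : (Finsupp.single j 1 : σ →₀ ℕ) ≠ Finsupp.single i 1 := fun h =>
              hj (Finsupp.single_left_injective one_ne_zero h)
            simp [hj, this]
        simp only [h1]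
        by_cases hiT : i ∈ T'
        · rw [Finset.sum_eq_single i]
          · rw [if_pos rfl, map_smul, Pi.smul_apply, hT]
            by_cases h : T' = Insert.insert i T
            · have h' : T'.erase i = T := by rw [h, Finset.erase_insert hi]
              rw [if_pos h, if_pos h', h]
              simp [frontSign_mul_self]
            · have h' : T'.erase i ≠ T := fun h' => h (by rw [← h', Finset.insert_erase hiT])
              rw [if_neg h, if_neg h']
              simp
          · intro j _ hj; simp [hj]
          · exact fun h => absurd hiT h
        · rw [if_neg (fun h => hiT (by rw [h]; exact Finset.mem_insert_self i T))]
          refine Finset.sum_eq_zero fun j hj => ?_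
          have : j ≠ i := fun h => hiT (h ▸ hj)
          simp [this]

end Koszul

end ListCochain
-- Exactness of Koszul complexes, and coinduced bimodules
namespace ListCochain

section KoszulExact

variable {k σ V : Type*} [CommRing k] [LinearOrder σ] [AddCommGroup V] [Module k V]

/-- The contraction of the Koszul complex in the direction of the variable `i`. -/
def koszulContraction (s : σ → V →ₗ[k] V) (i : σ) (u : Finset σ → V) (T : Finset σ) : V :=
  if i ∈ T then 0 else frontSign k i (Insert.insert i T) • s i (u (Insert.insert i T))

/-- In components containing `i`, only the summand that removes `i` is nonzero, and `D i` undoes `s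
i`. In the others, closedness in the component `insert i T` rewrites the sum over `j` as `s i (D i
(u T))`. -/
theorem koszulDiff_contraction (D s : σ → V →ₗ[k] V) (hDs : ∀ i x, D i (s i x) = x)
    (hcomm : ∀ i j, i ≠ j → ∀ x, s i (D j x) = D j (s i x)) (i : σ) (u : Finset σ → V)
    (hu : koszulDiff D u = 0) (T : Finset σ) :
    koszulDiff D (koszulContraction s i u) T = u T - if i ∈ T then 0 else u T - s i (D i (u T)) := by
  rw [koszulDiff_apply]
  by_cases hi : i ∈ T
  · rw [if_pos hi, sub_zero, Finset.sum_eq_single i]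
    · rw [koszulContraction, if_neg (Finset.notMem_erase i T), Finset.insert_erase hi, map_smul,
        smul_smul, frontSign_mul_self, one_smul, hDs]
    · intro j hj hji
      rw [koszulContraction, if_pos (Finset.mem_erase.2 ⟨hji.symm, hi⟩), map_zero, smul_zero]
    · exact fun h => absurd hi h
  · rw [if_neg hi, sub_sub_cancel]
    have h1 := congrFun hu (Insert.insert i T)
    rw [koszulDiff_apply, Finset.sum_insert hi, Finset.erase_insert hi, Pi.zero_apply] at h1
    -- Applying `s i` to the closedness relation isolates `s i (D i (u T))`, which is to be
    -- expressed by the terms with `j ≠ i`.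
    have h2 := congrArg (fun x => frontSign k i (Insert.insert i T) • s i x) h1
    simp only [map_add, map_smul, smul_add, smul_smul, frontSign_mul_self, one_smul, map_zero,
      smul_zero, map_sum, Finset.smul_sum] at h2
    rw [eq_neg_of_add_eq_zero_left h2, ← Finset.sum_neg_distrib]
    refine Finset.sum_congr rfl fun j hj => ?_
    have hji : j ≠ i := fun h => hi (h ▸ hj)
    have hm : i ∉ T.erase j := fun h => hi (Finset.mem_of_mem_erase h)
    rw [koszulContraction, if_neg hm, hcomm i j hji.symm, map_smul, smul_smul, ← neg_smul]
    have h3 : Insert.insert i (T.erase j) = (Insert.insert i T).erase j :=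
      (Finset.erase_insert_of_ne hji.symm).symm
    rw [h3]
    congr 1
    have h4 := frontSign_swap (k := k) (Finset.mem_insert_self i T) (Finset.mem_insert_of_mem hj)
      hji.symm
    rw [Finset.erase_insert hi] at h4
    have h5 := frontSign_mul_self (k := k) i (Insert.insert i T)
    have h6 := frontSign_mul_self (k := k) i ((Insert.insert i T).erase j)
    linear_combination frontSign k i (Insert.insert i T) *
      frontSign k i ((Insert.insert i T).erase j) * h4 -
      frontSign k j T * frontSign k i ((Insert.insert i T).erase j) * h5 -
      frontSign k i (Insert.insert i T) * frontSign k j (Insert.insert i T) * h6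

theorem koszulDiff_koszulDiff (D : σ → V →ₗ[k] V) (hD : ∀ i j x, D i (D j x) = D j (D i x))
    (u : Finset σ → V) : koszulDiff D (koszulDiff D u) = 0 := by
  funext T
  rw [koszulDiff_apply]
  simp only [koszulDiff_apply, map_sum, map_smul, Finset.smul_sum, smul_smul]
  refine sum_erase_antisymm T _ fun i hi j hj hij => ?_
  rw [frontSign_swap hi hj hij, hD i j, Finset.erase_right_comm, neg_smul, neg_add_cancel]

/-- A Koszul complex is exact in positive degrees if the operators have compatible right inverses. -/
theorem koszulDiff_exact [Fintype σ] (D s : σ → V →ₗ[k] V)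
    (hD : ∀ i j x, D i (D j x) = D j (D i x)) (hDs : ∀ i x, D i (s i x) = x)
    (hcomm : ∀ i j, i ≠ j → ∀ x, s i (D j x) = D j (s i x)) (n : ℕ) (u : Finset σ → V)
    (hu : koszulDiff D u = 0) (hn : ∀ T, T.card ≠ n + 1 → u T = 0) :
    ∃ v, koszulDiff D v = u ∧ ∀ T, T.card ≠ n → v T = 0 := by
  -- Induction on the set `A` of indices that may occur in the support of `u`. Subtracting the
  -- differential of the contraction in direction `i` leaves a cocycle with no component containing
  -- `i`.
  suffices H : ∀ (A : Finset σ) (u : Finset σ → V), koszulDiff D u = 0 →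
      (∀ T, T.card ≠ n + 1 → u T = 0) → (∀ T, u T ≠ 0 → T ⊆ A) →
      ∃ v, koszulDiff D v = u ∧ ∀ T, T.card ≠ n → v T = 0 from
    H Finset.univ u hu hn fun T _ => Finset.subset_univ T
  clear hu hn u
  intro A
  induction A using Finset.induction_on with
  | empty =>
    intro u hu hn hA
    refine ⟨0, ?_, fun _ _ => rfl⟩
    rw [map_zero]
    funext T
    by_contra h
    have h1 := Finset.subset_empty.1 (hA T (Ne.symm h))
    exact Ne.symm h (hn T (by simp [h1]))
  | insert i A hi ih =>
    intro u hu hn hA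
    have hP : u - koszulDiff D (koszulContraction s i u) =
        fun T => if i ∈ T then 0 else u T - s i (D i (u T)) := by
      funext T
      rw [Pi.sub_apply, koszulDiff_contraction D s hDs hcomm i u hu, sub_sub_cancel]
    obtain ⟨v, hv, hv'⟩ := ih (u - koszulDiff D (koszulContraction s i u))
      (by rw [map_sub, hu, koszulDiff_koszulDiff D hD, sub_zero])
      (fun T hT => by rw [hP]; simp [hn T hT])
      (fun T hT => by
        rw [hP] at hT
        simp only at hT
        have h1 : i ∉ T := fun h => hT (if_pos h)
        have h2 : u T ≠ 0 := fun h => hT (by simp [h])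
        intro j hj
        rcases Finset.mem_insert.1 (hA T h2 hj) with rfl | h
        · exact absurd hj h1
        · exact h)
    refine ⟨v + koszulContraction s i u, by rw [map_add, hv, sub_add_cancel], fun T hT => ?_⟩
    rw [Pi.add_apply, hv' T hT, zero_add, koszulContraction]
    split_ifs with h
    · rfl
    · rw [hn _ (by rw [Finset.card_insert_of_notMem h]; omega), map_zero, smul_zero]

end KoszulExact

section Coinduced

variable {k Mo M : Type*} [CommRing k] [AddCommMonoid Mo] [AddCommGroup M] [Module k M]

/-- The coinduced bimodule. -/
def coind (S : BiAct k Mo M) : BiAct k Mo (Mo → M) where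
  lam a := (S.lam a).compLeft Mo
  rho a := LinearMap.funLeft k M (a + ·)
  lam_zero f := funext fun x => S.lam_zero _
  rho_zero f := funext fun x => congrArg f (zero_add x)
  lam_add a b f := funext fun x => S.lam_add a b _
  rho_add a b f := funext fun x => congrArg f (show a + b + x = b + (a + x) by rw [← add_assoc, add_comm b a])
  comm a b f := rfl

@[simp] theorem coind_lam (S : BiAct k Mo M) (a : Mo) (f : Mo → M) (x : Mo) :
    (coind S).lam a f x = S.lam a (f x) := rfl

@[simp] theorem coind_rho (S : BiAct k Mo M) (a : Mo) (f : Mo → M) (x : Mo) :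
    (coind S).rho a f x = f (a + x) := rfl

/-- The contraction of cochains with coinduced coefficients. -/
def coindContraction (f : List Mo → Mo → M) (l : List Mo) (m : Mo) : M := f (l ++ [m]) 0

/-- Evaluated at `0` with `m` appended, the last term of the differential is right translation by
`m`, which gives back `f l m`. All earlier terms form the differential of the contraction. -/
theorem inner_coindContraction (S : BiAct k Mo M) (f : List Mo → Mo → M) (l : List Mo) (m : Mo) :
    inner (coind S) 0 f (l ++ [m]) 0 =
      inner (coind S) 0 (coindContraction f) l m - (-1 : k) ^ l.length • f l m := by
  induction l generalizing f with
  | nil =>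
    simp [inner_cons, inner_nil, headSum_zero]
  | cons a l ih =>
    have h1 : mergeHead (coind S) a f (l ++ [m]) 0 =
        mergeHead (coind S) a (coindContraction f) l m := by
      cases l <;> simp [coindContraction]
    have h2 : head k (Mo → M) a (coindContraction f) = coindContraction (head k _ a f) := rfl
    rw [List.cons_append, inner_cons, inner_cons, h2, headSum_zero]
    simp only [Pi.sub_apply, h1, ih, LinearMap.zero_apply, Pi.zero_apply, List.length_cons, pow_succ,
      head_apply]
    module

/-- A coinduced bimodule has no cohomology in positive degrees. The empty list is excluded because
`outer` vanishes there, whereas on `[m]` it is the left action of `m`. -/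
theorem diff_coindContraction (S : BiAct k Mo M) (f : List Mo → Mo → M)
    (hf : diff (coind S) 0 f = 0) {l : List Mo} (hl : l ≠ []) :
    diff (coind S) 0 (coindContraction f) l = (-1 : k) ^ l.length • f l := by
  funext m
  have h := congrFun (congrFun hf (l ++ [m])) 0
  obtain ⟨a, l, rfl⟩ := List.exists_cons_of_ne_nil hl
  rw [diff_apply, Pi.add_apply, inner_coindContraction] at h
  rw [diff_apply]
  have h2 : outer (coind S) f (a :: l ++ [m]) 0 =
    outer (coind S) (coindContraction f) (a :: l) m := rfl
  rw [h2] at h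
  simp only [Pi.add_apply, Pi.smul_apply, Pi.zero_apply] at h ⊢
  rw [← sub_eq_zero, ← h]
  abel

end Coinduced

section CoinducedPoly

variable {k σ M : Type*} [CommRing k] [LinearOrder σ] [AddCommGroup M] [Module k M]
  (S : BiAct k (σ →₀ ℕ) M)

/-- The values of the right inverse of `varDiff (coind S) i` along the line through `y`. -/
def varDiffInvAux (i : σ) (g : (σ →₀ ℕ) → M) (y : σ →₀ ℕ) : ℕ → M
  | 0 => 0
  | n + 1 => S.lam (Finsupp.single i 1) (varDiffInvAux i g y n) - g (y + Finsupp.single i n)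

/-- A right inverse of `varDiff (coind S) i`. -/
def varDiffInv (i : σ) : ((σ →₀ ℕ) → M) →ₗ[k] ((σ →₀ ℕ) → M) where
  toFun g x := varDiffInvAux S i g (x.erase i) (x i)
  map_add' f g := by
    funext x
    change _ = varDiffInvAux S i f (x.erase i) (x i) + varDiffInvAux S i g (x.erase i) (x i)
    generalize x i = n
    induction n with
    | zero => simp [varDiffInvAux]
    | succ n ih => simp only [varDiffInvAux, ih, map_add, Pi.add_apply]; abel
  map_smul' c f := by
    funext x
    change _ = c • varDiffInvAux S i f (x.erase i) (x i)
    generalize x i = n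
    induction n with
    | zero => simp [varDiffInvAux]
    | succ n ih => simp only [varDiffInvAux, ih, map_smul, Pi.smul_apply, smul_sub]

theorem varDiffInv_apply (i : σ) (g : (σ →₀ ℕ) → M) (x : σ →₀ ℕ) :
    varDiffInv S i g x = varDiffInvAux S i g (x.erase i) (x i) := rfl

theorem varDiff_coind_apply (i : σ) (f : (σ →₀ ℕ) → M) (x : σ →₀ ℕ) :
    varDiff (coind S) i f x =
      S.lam (Finsupp.single i 1) (f x) - f (Finsupp.single i 1 + x) := rfl

/-- The recursion for `varDiffInvAux` is the equation itself, solved for the value at `x + e_i`,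
with initial value `0` where the exponent of `x_i` is zero. -/
theorem varDiff_varDiffInv (i : σ) (g : (σ →₀ ℕ) → M) :
    varDiff (coind S) i (varDiffInv S i g) = g := by
  funext x
  rw [varDiff_coind_apply, varDiffInv_apply, varDiffInv_apply]
  have h1 : (Finsupp.single i 1 + x).erase i = x.erase i := by
    rw [Finsupp.erase_add, Finsupp.erase_single, zero_add]
  have h2 : (Finsupp.single i 1 + x : σ →₀ ℕ) i = x i + 1 := by
    rw [Finsupp.add_apply, Finsupp.single_eq_same, add_comm]
  rw [h1, h2, varDiffInvAux, Finsupp.erase_add_single]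
  abel

/-- The recursion runs along direction `i` with coefficients given by the left action of `x_i`,
which commutes with translation along, and with the left action of, another variable. -/
theorem varDiffInv_varDiff {i j : σ} (hij : i ≠ j) (g : (σ →₀ ℕ) → M) :
    varDiffInv S i (varDiff (coind S) j g) = varDiff (coind S) j (varDiffInv S i g) := by
  funext x
  rw [varDiff_coind_apply, varDiffInv_apply, varDiffInv_apply, varDiffInv_apply]
  have h1 : (Finsupp.single j 1 + x).erase i = Finsupp.single j 1 + x.erase i := by
    rw [Finsupp.erase_add, Finsupp.erase_single_ne hij]
  have h2 : (Finsupp.single j 1 + x : σ →₀ ℕ) i = x i := by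
    rw [Finsupp.add_apply, Finsupp.single_eq_of_ne hij, zero_add]
  rw [h1, h2]
  generalize x i = n
  induction n with
  | zero => simp [varDiffInvAux]
  | succ n ih =>
    simp only [varDiffInvAux, ih, map_sub, varDiff_coind_apply, add_assoc]
    rw [← S.lam_add, ← S.lam_add, add_comm (Finsupp.single i 1)]
    abel

end CoinducedPoly

end ListCochain
-- Acyclicity of the kernel of the restriction to the Koszul complex
namespace ListCochain

section Exactness

variable {k σ : Type} [Field k] [LinearOrder σ] [Fintype σ]

/-- The cochains of degree `n`, normalized if `nrm` holds, that restrict to zero on the Koszul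
complex. -/
structure IsKoszulKernel (k : Type) [Field k] {M : Type*} [AddCommGroup M] [Module k M]
    (nrm : Prop) (n : ℕ) (f : List (σ →₀ ℕ) → M) : Prop where
  degree : ∀ l, l.length ≠ n → f l = 0
  normalized : nrm → IsNormalized f
  antisymm_eq : antisymm k σ M f = 0

variable {M : Type*} [AddCommGroup M] [Module k M]

theorem IsKoszulKernel.eq_zero {nrm : Prop} {f : List (σ →₀ ℕ) → M}
    (hf : IsKoszulKernel k nrm 0 f) : f = 0 := by
  funext l
  cases l with
  | nil => exact congrFun hf.antisymm_eq ∅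
  | cons a l => exact hf.degree _ (by simp)

theorem IsKoszulKernel.postcomp {M' : Type*} [AddCommGroup M'] [Module k M'] {nrm : Prop} {n : ℕ}
    {f : List (σ →₀ ℕ) → M} (hf : IsKoszulKernel k nrm n f) (g : M →ₗ[k] M') :
    IsKoszulKernel k nrm n (postcomp g f) where
  degree l hl := by rw [postcomp_apply, hf.degree l hl, map_zero]
  normalized h l hl := by rw [postcomp_apply, hf.normalized h l hl, map_zero]
  antisymm_eq := by
    funext T
    rw [antisymm_postcomp, hf.antisymm_eq, Pi.zero_apply, map_zero]; rfl

theorem diff_zero_degree (S : BiAct k (σ →₀ ℕ) M) {n : ℕ} {f : List (σ →₀ ℕ) → M}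
    (hf : ∀ l, l.length ≠ n → f l = 0) (l : List (σ →₀ ℕ)) (hl : l.length ≠ n + 1) :
    diff S 0 f l = 0 := by
  rw [diff_congr S 0 (g := 0) (fun l' h => hf _ (by omega)) (fun _ _ h => absurd rfl h), map_zero]
  rfl

theorem IsKoszulKernel.diff (S : BiAct k (σ →₀ ℕ) M) {nrm : Prop} {n : ℕ}
    {f : List (σ →₀ ℕ) → M} (hf : IsKoszulKernel k nrm n f) :
    IsKoszulKernel k nrm (n + 1) (diff S 0 f) where
  degree := diff_zero_degree S hf.degree
  normalized h := (hf.normalized h).diff S 0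
  antisymm_eq := by rw [antisymm_diff, hf.antisymm_eq, map_zero]

theorem IsKoszulKernel.sub {nrm : Prop} {n : ℕ} {f g : List (σ →₀ ℕ) → M}
    (hf : IsKoszulKernel k nrm n f) (hg : IsKoszulKernel k nrm n g) :
    IsKoszulKernel k nrm n (f - g) where
  degree l hl := by rw [Pi.sub_apply, hf.degree l hl, hg.degree l hl, sub_zero]
  normalized h l hl := by
    rw [Pi.sub_apply, hf.normalized h l hl, hg.normalized h l hl, sub_zero]
  antisymm_eq := by rw [map_sub, hf.antisymm_eq, hg.antisymm_eq, sub_zero]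

variable (k σ M) in
/-- A section of the restriction to the Koszul complex. -/
theorem exists_antisymm_section : ∃ j : (Finset σ → M) →ₗ[k] (List (σ →₀ ℕ) → M),
    (∀ u, antisymm k σ M (j u) = u) ∧ (∀ u, IsNormalized (j u)) ∧
      ∀ u l, (∀ T : Finset σ, T.card = l.length → u T = 0) → j u l = 0 := by
  choose c hc hc' using exists_antisymm_dual (k := k) (σ := σ)
  -- The section is the combination of the dual cochains with coefficients `u T`. They are
  -- normalized and supported in degree `T.card`, so the section preserves degrees.
  refine ⟨∑ T, (LinearMap.pi fun l => c T l • LinearMap.proj (R := k) (φ := fun _ => M) T),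
    fun u => ?_, fun u l hl => ?_, fun u l hl => ?_⟩
  · rw [LinearMap.sum_apply, map_sum]
    funext T'
    rw [Finset.sum_apply, Finset.sum_eq_single T']
    · have : LinearMap.pi (fun l => c T' l • LinearMap.proj (R := k) (φ := fun _ => M) T') u =
        postcomp (LinearMap.toSpanSingleton k M (u T')) (c T') := rfl
      rw [this, antisymm_postcomp, hc', if_pos rfl]; simp
    · intro T _ hT
      have : LinearMap.pi (fun l => c T l • LinearMap.proj (R := k) (φ := fun _ => M) T) u =
        postcomp (LinearMap.toSpanSingleton k M (u T)) (c T) := rfl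
      rw [this, antisymm_postcomp, hc', if_neg hT.symm]; simp
    · simp
  · rw [LinearMap.sum_apply, Finset.sum_apply]
    refine Finset.sum_eq_zero fun T _ => ?_
    have : c T l = 0 := by by_contra h; exact (hc T l h).2 hl
    simp [this]
  · rw [LinearMap.sum_apply, Finset.sum_apply]
    refine Finset.sum_eq_zero fun T _ => ?_
    by_cases h : c T l = 0
    · simp [h]
    · simp [hl T (hc T l h).1.symm]

/-- The variables generate the monomials. Thus a Koszul cocycle of degree zero is already a
Hochschild cocycle, which settles the lowest degree below. -/
theorem lam_eq_rho_of_varDiff (S : BiAct k (σ →₀ ℕ) M) (x : M) (hx : ∀ i, varDiff S i x = 0)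
    (a : σ →₀ ℕ) : S.lam a x = S.rho a x := by
  have h : ∀ i, S.lam (Finsupp.single i 1) x = S.rho (Finsupp.single i 1) x := fun i =>
    sub_eq_zero.1 (hx i)
  have h1 : ∀ a b, S.lam a x = S.rho a x → S.lam b x = S.rho b x →
      S.lam (a + b) x = S.rho (a + b) x := by
    intro a b ha hb
    rw [S.lam_add, hb, S.comm, ha, ← S.rho_add, add_comm]
  induction a using Finsupp.induction_linear with
  | zero => rw [S.lam_zero, S.rho_zero]
  | add a b ha hb => exact h1 a b ha hb
  | single i n =>
    induction n with
    | zero => rw [Finsupp.single_zero, S.lam_zero, S.rho_zero]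
    | succ n ih => rw [Finsupp.single_add]; exact h1 _ _ ih (h i)

theorem varDiff_comm (S : BiAct k (σ →₀ ℕ) M) (i j : σ) (x : M) :
    varDiff S i (varDiff S j x) = varDiff S j (varDiff S i x) := by
  simp only [varDiff, LinearMap.sub_apply, map_sub]
  rw [← S.lam_add, ← S.lam_add, ← S.rho_add, ← S.rho_add, S.comm, S.comm,
    add_comm (Finsupp.single i 1)]
  abel

/-- For coinduced coefficients neither the cochain complex nor the Koszul complex has cohomology in
positive degrees. A primitive of `f` therefore exists, and a Koszul primitive of its restriction
corrects it to lie in the kernel. -/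
theorem exists_diff_eq_of_coind (S : BiAct k (σ →₀ ℕ) M) {nrm : Prop} {n : ℕ}
    {f : List (σ →₀ ℕ) → (σ →₀ ℕ) → M} (hf : IsKoszulKernel k nrm (n + 1) f)
    (hd : diff (coind S) 0 f = 0) :
    ∃ g, IsKoszulKernel k nrm n g ∧ diff (coind S) 0 g = f := by
  obtain ⟨h, hdeg, hnor, hdiff⟩ : ∃ h : List (σ →₀ ℕ) → (σ →₀ ℕ) → M,
      (∀ l, l.length ≠ n → h l = 0) ∧ (nrm → IsNormalized h) ∧ diff (coind S) 0 h = f := by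
    -- The factor cancels the sign in `diff_coindContraction` on lists of length `n + 1`, the only
    -- ones where `f` is nonzero.
    refine ⟨(-1 : k) ^ (n + 1) • coindContraction f, fun l hl => ?_, fun hn l hl => ?_, ?_⟩
    · have : coindContraction f l = 0 := funext fun m => by
        rw [coindContraction, hf.degree _ (by simpa using hl)]; rfl
      rw [Pi.smul_apply, this, smul_zero]
    · have : coindContraction f l = 0 := funext fun m => by
        rw [coindContraction, hf.normalized hn _ (by simp [hl])]; rfl
      rw [Pi.smul_apply, this, smul_zero]
    · funext l
      rw [map_smul, Pi.smul_apply]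
      rcases eq_or_ne l [] with rfl | hl
      · rw [hf.degree [] (by simp), diff_apply, outer_nil, inner_nil, headSum_zero]; simp
      · rw [diff_coindContraction S f hd hl]
        by_cases hl' : l.length = n + 1
        · rw [hl', smul_smul, ← mul_pow]; simp
        · rw [hf.degree l hl', smul_zero, smul_zero]
  have hcl : koszulDiff (varDiff (coind S)) (antisymm k σ _ h) = 0 := by
    rw [← antisymm_diff, hdiff, hf.antisymm_eq]
  cases n with
  | zero =>
    -- In degree zero no correction is available. Instead `h []` is killed by every `varDiff`, hence
    -- by the Hochschild differential, and `f` itself is zero.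
    refine ⟨0, ⟨fun _ _ => rfl, fun _ _ _ => rfl, map_zero _⟩, ?_⟩
    rw [map_zero]
    have h0 : ∀ i, varDiff (coind S) i (h []) = 0 := by
      intro i
      have := congrFun hcl {i}
      rw [koszulDiff_apply, Finset.sum_singleton] at this
      have h2 : ({i} : Finset σ).erase i = ∅ := by simp
      rw [h2, antisymm_empty] at this
      simpa [frontSign, Finset.filter_singleton] using this
    symm
    funext l
    by_cases hl : l.length = 1
    · obtain ⟨a, rfl⟩ := List.length_eq_one_iff.1 hl
      have h1 := lam_eq_rho_of_varDiff (coind S) _ h0 a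
      rw [← hdiff, diff_apply, outer_cons, inner_cons, inner_nil, headSum_zero, mergeHead_nil, h1]
      simp
    · exact hf.degree _ (by simpa using hl)
  | succ n =>
    obtain ⟨v, hv, hv'⟩ := koszulDiff_exact (varDiff (coind S)) (varDiffInv S)
      (varDiff_comm (coind S)) (varDiff_varDiffInv S) (fun i j hij x => varDiffInv_varDiff S hij x)
      n _ hcl (fun T hT => by
        rw [antisymm_congr (g := 0) fun l hl => hdeg l (by omega), map_zero]; rfl)
    obtain ⟨j, hj, hj', hj''⟩ := exists_antisymm_section k σ ((σ →₀ ℕ) → M)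
    -- Subtracting the coboundary of a lift of `v` makes the restriction to the Koszul complex
    -- vanish without changing the differential.
    refine ⟨h - diff (coind S) 0 (j v), ⟨fun l hl => ?_, fun hn => ?_, ?_⟩, ?_⟩
    · rw [Pi.sub_apply, hdeg l hl, zero_sub, neg_eq_zero]
      exact diff_zero_degree (coind S)
        (fun l hl => hj'' v l fun T hT => hv' T (by omega)) l hl
    · intro l hl
      rw [Pi.sub_apply, hnor hn l hl, (hj' v).diff (coind S) 0 l hl, sub_zero]
    · rw [map_sub, antisymm_diff, hj, hv, sub_self]
    · rw [map_sub, hdiff, diff_zero_diff_zero, sub_zero]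

/-- The embedding of a bimodule in a coinduced one. -/
def coindEmb (S : BiAct k (σ →₀ ℕ) M) : M →ₗ[k] ((σ →₀ ℕ) → M) := LinearMap.pi fun x => S.rho x

theorem coindEmb_apply (S : BiAct k (σ →₀ ℕ) M) (m : M) (x : σ →₀ ℕ) :
    coindEmb S m x = S.rho x m := rfl

theorem coindEmb_lam (S : BiAct k (σ →₀ ℕ) M) (a : σ →₀ ℕ) (m : M) :
    coindEmb S (S.lam a m) = (coind S).lam a (coindEmb S m) :=
  funext fun x => (S.comm a x m).symm

theorem coindEmb_rho (S : BiAct k (σ →₀ ℕ) M) (a : σ →₀ ℕ) (m : M) :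
    coindEmb S (S.rho a m) = (coind S).rho a (coindEmb S m) :=
  funext fun x => by rw [coind_rho, coindEmb_apply, coindEmb_apply, ← S.rho_add, add_comm]

/-- The quotient of a coinduced bimodule by the bimodule it is coinduced from. -/
def coindQuot (S : BiAct k (σ →₀ ℕ) M) :
    BiAct k (σ →₀ ℕ) (((σ →₀ ℕ) → M) ⧸ LinearMap.range (coindEmb S)) where
  lam a := Submodule.mapQ _ _ ((coind S).lam a) (by
    rintro _ ⟨m, rfl⟩; exact ⟨S.lam a m, coindEmb_lam S a m⟩)
  rho a := Submodule.mapQ _ _ ((coind S).rho a) (by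
    rintro _ ⟨m, rfl⟩; exact ⟨S.rho a m, coindEmb_rho S a m⟩)
  lam_zero x := by
    obtain ⟨x, rfl⟩ := Submodule.mkQ_surjective _ x
    exact congrArg _ ((coind S).lam_zero x)
  rho_zero x := by
    obtain ⟨x, rfl⟩ := Submodule.mkQ_surjective _ x
    exact congrArg _ ((coind S).rho_zero x)
  lam_add a b x := by
    obtain ⟨x, rfl⟩ := Submodule.mkQ_surjective _ x
    exact congrArg _ ((coind S).lam_add a b x)
  rho_add a b x := by
    obtain ⟨x, rfl⟩ := Submodule.mkQ_surjective _ x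
    exact congrArg _ ((coind S).rho_add a b x)
  comm a b x := by
    obtain ⟨x, rfl⟩ := Submodule.mkQ_surjective _ x
    exact congrArg _ ((coind S).comm a b x)

end Exactness

section Main

variable {k σ : Type} [Field k] [LinearOrder σ] [Fintype σ]

/-- The kernel of the restriction to the Koszul complex is acyclic. -/
theorem exists_diff_eq_of_isKoszulKernel (nrm : Prop) (n : ℕ) :
    ∀ (M : Type) [AddCommGroup M] [Module k M] (S : BiAct k (σ →₀ ℕ) M)
      (f : List (σ →₀ ℕ) → M), IsKoszulKernel k nrm (n + 1) f → diff S 0 f = 0 →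
      ∃ g, IsKoszulKernel k nrm n g ∧ diff S 0 g = f := by
  induction n with
  | zero =>
    intro M _ _ S f hf hd
    obtain ⟨g, hg, hgf⟩ := exists_diff_eq_of_coind S (hf.postcomp (coindEmb S)) (by
      rw [diff_postcomp S (coind S) 0 _ (coindEmb_lam S) (coindEmb_rho S), hd, map_zero])
    -- In degree zero restriction to the Koszul complex loses nothing, so the primitive is zero and
    -- so is `f`.
    rw [hg.eq_zero, map_zero] at hgf
    refine ⟨0, ⟨fun _ _ => rfl, fun _ _ _ => rfl, map_zero _⟩, ?_⟩
    rw [map_zero]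
    funext l
    have := congrFun (congrFun hgf l) 0
    rw [postcomp_apply, coindEmb_apply, S.rho_zero] at this
    exact this
  | succ n ih =>
    intro M _ _ S f hf hd
    obtain ⟨g, hg, hgf⟩ := exists_diff_eq_of_coind S (hf.postcomp (coindEmb S)) (by
      rw [diff_postcomp S (coind S) 0 _ (coindEmb_lam S) (coindEmb_rho S), hd, map_zero])
    have hπ : ∀ h : List (σ →₀ ℕ) → (σ →₀ ℕ) → M,
        diff (coindQuot S) 0 (postcomp (Submodule.mkQ (LinearMap.range (coindEmb S))) h) =
          postcomp (Submodule.mkQ (LinearMap.range (coindEmb S))) (diff (coind S) 0 h) :=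
      diff_postcomp (coind S) (coindQuot S) 0 _ (fun a x => rfl) (fun a x => rfl)
    -- Dimension shifting: `g` is a primitive in the coinduced module, its image in the quotient is
    -- a cocycle one degree lower, and the induction hypothesis applies to the quotient bimodule.
    obtain ⟨h, hh, hhg⟩ := ih _ (coindQuot S) _
      (hg.postcomp (Submodule.mkQ (LinearMap.range (coindEmb S)))) (by
        rw [hπ, hgf]
        funext l
        rw [postcomp_apply, postcomp_apply, Submodule.mkQ_apply]
        exact (Submodule.Quotient.mk_eq_zero _).2 ⟨_, rfl⟩)
    -- The splitting is only `k`-linear. This suffices, since normalization and the vanishing of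
    -- `antisymm` involve the linear structure of the coefficients alone.
    obtain ⟨s, hs⟩ := LinearMap.exists_rightInverse_of_surjective
      (Submodule.mkQ (LinearMap.range (coindEmb S)))
      (LinearMap.range_eq_top.2 (Submodule.mkQ_surjective _))
    have hs' : postcomp (Submodule.mkQ (LinearMap.range (coindEmb S))) (postcomp s h) = h :=
      funext fun l => LinearMap.congr_fun hs (h l)
    have hk : IsKoszulKernel k nrm (n + 1) (g - diff (coind S) 0 (postcomp s h)) :=
      hg.sub ((hh.postcomp s).diff (coind S))
    -- The corrected primitive vanishes in the quotient, so its values come from `M`. Evaluation at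
    -- `0` recovers them, because `rho 0` is the identity.
    refine ⟨_, hk.postcomp (LinearMap.proj (R := k) (φ := fun _ => M) 0), ?_⟩
    have h1 : postcomp (coindEmb S) (postcomp (LinearMap.proj (R := k) (φ := fun _ => M) 0)
        (g - diff (coind S) 0 (postcomp s h))) = g - diff (coind S) 0 (postcomp s h) := by
      funext l
      have h2 : postcomp (Submodule.mkQ (LinearMap.range (coindEmb S)))
          (g - diff (coind S) 0 (postcomp s h)) l = 0 := by
        rw [map_sub, ← hπ, hs', hhg, sub_self]; rfl
      obtain ⟨m, hm⟩ := (Submodule.Quotient.mk_eq_zero _).1 h2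
      rw [postcomp_apply, postcomp_apply, ← hm]
      congr 1
      exact S.rho_zero m
    have h3 := congrArg (diff (coind S) 0) h1
    rw [diff_postcomp S (coind S) 0 _ (coindEmb_lam S) (coindEmb_rho S), map_sub (diff (coind S) 0), hgf,
      diff_zero_diff_zero, sub_zero] at h3
    funext l
    have := congrFun (congrFun h3 l) 0
    rw [postcomp_apply, coindEmb_apply, S.rho_zero, postcomp_apply, coindEmb_apply,
      S.rho_zero] at this
    exact this

end Main

end ListCochain

/-! ### Linear homotopies onto the Koszul complex -/

/-- Over a field, preimages can be chosen linearly. -/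
theorem exists_linear_lift {k V V' : Type*} [Field k] [AddCommGroup V] [Module k V]
    [AddCommGroup V'] [Module k V'] (D : V →ₗ[k] V') (P : Submodule k V) (Q : Submodule k V')
    (h : ∀ z ∈ Q, ∃ y ∈ P, D y = z) : ∃ t : V' →ₗ[k] V, ∀ z ∈ Q, t z ∈ P ∧ D (t z) = z := by
  -- Restricted to elements of `P` with image in `Q`, the map `D` is onto `Q`. A linear section of
  -- this restriction is extended arbitrarily to the whole space.
  let D' : (P ⊓ Q.comap D : Submodule k V) →ₗ[k] Q :=
    (D.domRestrict _).codRestrict Q fun x => x.2.2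
  have hD' : Function.Surjective D' := by
    rintro ⟨z, hz⟩
    obtain ⟨y, hy, rfl⟩ := h z hz
    exact ⟨⟨y, hy, hz⟩, rfl⟩
  obtain ⟨s, hs⟩ := D'.exists_rightInverse_of_surjective (LinearMap.range_eq_top.2 hD')
  obtain ⟨t, ht⟩ := LinearMap.exists_extend ((Submodule.subtype _).comp s)
  refine ⟨t, fun z hz => ?_⟩
  have h1 : t z = s ⟨z, hz⟩ := LinearMap.congr_fun ht ⟨z, hz⟩
  rw [h1]
  exact ⟨(s ⟨z, hz⟩).2.1, congrArg Subtype.val (LinearMap.congr_fun hs ⟨z, hz⟩)⟩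

namespace ListCochain

section Retract

variable {k σ M : Type} [Field k] [LinearOrder σ] [Fintype σ] [AddCommGroup M] [Module k M]

variable (k σ M) in
/-- The component of degree `n`. -/
def degreeProj (n : ℕ) : (List (σ →₀ ℕ) → M) →ₗ[k] (List (σ →₀ ℕ) → M) where
  toFun f l := if l.length = n then f l else 0
  map_add' f g := by funext l; by_cases h : l.length = n <;> simp [h]
  map_smul' c f := by funext l; by_cases h : l.length = n <;> simp [h]

theorem degreeProj_apply (n : ℕ) (f : List (σ →₀ ℕ) → M) (l : List (σ →₀ ℕ)) :
    degreeProj k σ M n f l = if l.length = n then f l else 0 := rfl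

theorem degreeProj_apply_of_eq {n : ℕ} (f : List (σ →₀ ℕ) → M) {l : List (σ →₀ ℕ)}
    (h : l.length = n) : degreeProj k σ M n f l = f l := if_pos h

theorem diff_degreeProj (S : BiAct k (σ →₀ ℕ) M) (n : ℕ) (f : List (σ →₀ ℕ) → M) :
    diff S 0 (degreeProj k σ M n f) = degreeProj k σ M (n + 1) (diff S 0 f) := by
  funext l
  rw [degreeProj_apply]
  split_ifs with h
  · exact diff_congr S 0 (fun l' h' => degreeProj_apply_of_eq f (by omega))
      fun _ _ h => absurd rfl h
  · exact diff_zero_degree S (fun l hl => if_neg hl) l h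

/-- The cochains that restrict to zero on the Koszul complex, normalized if `nrm` holds. -/
def koszulKernel (k : Type) [Field k] {σ M : Type} [LinearOrder σ] [AddCommGroup M]
    [Module k M] (nrm : Prop) : Submodule k (List (σ →₀ ℕ) → M) where
  carrier := {f | (nrm → IsNormalized f) ∧ antisymm k σ M f = 0}
  zero_mem' := ⟨fun _ _ _ => rfl, map_zero _⟩
  add_mem' := fun ⟨h1, h2⟩ ⟨h3, h4⟩ => ⟨fun h l hl => by
    rw [Pi.add_apply, h1 h l hl, h3 h l hl, add_zero], by rw [map_add, h2, h4, add_zero]⟩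
  smul_mem' := fun c f ⟨h1, h2⟩ => ⟨fun h l hl => by
    rw [Pi.smul_apply, h1 h l hl, smul_zero], by rw [map_smul, h2, smul_zero]⟩

variable {nrm : Prop}

theorem isKoszulKernel_degreeProj {f : List (σ →₀ ℕ) → M} (hf : f ∈ koszulKernel k nrm) (n : ℕ) :
    IsKoszulKernel k nrm n (degreeProj k σ M n f) where
  degree l hl := if_neg hl
  normalized h l hl := by rw [degreeProj_apply, hf.1 h l hl, ite_self]
  antisymm_eq := by
    funext T
    by_cases hT : T.card = n
    · rw [antisymm_congr fun l hl => degreeProj_apply_of_eq f (hl.trans hT), hf.2]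
    · have : ∀ l : List (σ →₀ ℕ), l.length = T.card →
          degreeProj k σ M n f l = (0 : List (σ →₀ ℕ) → M) l := fun l hl => if_neg (by omega)
      rw [antisymm_congr this, map_zero]

theorem diff_mem_koszulKernel (S : BiAct k (σ →₀ ℕ) M) {f : List (σ →₀ ℕ) → M}
    (hf : f ∈ koszulKernel k nrm) : diff S 0 f ∈ koszulKernel k nrm :=
  ⟨fun h => (hf.1 h).diff S 0, by rw [antisymm_diff, hf.2, map_zero]⟩

/-- Primitives in the acyclic kernel can be chosen linearly in each degree. The first property says
that the choice lowers the degree by exactly one, as the filtration argument requires. -/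
theorem exists_koszulKernel_lift (S : BiAct k (σ →₀ ℕ) M) (nrm : Prop) :
    ∃ t : (List (σ →₀ ℕ) → M) →ₗ[k] (List (σ →₀ ℕ) → M),
      (∀ f l, (∀ l', l'.length = l.length + 1 → f l' = 0) → t f l = 0) ∧
      ∀ f ∈ koszulKernel k nrm, diff S 0 f = 0 →
        t f ∈ koszulKernel k nrm ∧ diff S 0 (t f) = f := by
  have H : ∀ n, ∃ t : (List (σ →₀ ℕ) → M) →ₗ[k] (List (σ →₀ ℕ) → M), ∀ f,
      IsKoszulKernel k nrm (n + 1) f → diff S 0 f = 0 →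
      IsKoszulKernel k nrm n (t f) ∧ diff S 0 (t f) = f := by
    intro n
    let P : ℕ → Submodule k (List (σ →₀ ℕ) → M) := fun n =>
      koszulKernel k nrm ⊓ LinearMap.ker (LinearMap.id - degreeProj k σ M n)
    have hP : ∀ n f, f ∈ P n ↔ IsKoszulKernel k nrm n f := by
      intro n f
      constructor
      · rintro ⟨h1, h2⟩
        have h3 : f = degreeProj k σ M n f := sub_eq_zero.1 h2
        rw [h3]
        exact isKoszulKernel_degreeProj h1 n
      · intro h
        refine ⟨⟨h.normalized, h.antisymm_eq⟩, sub_eq_zero.2 ?_⟩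
        funext l
        rw [degreeProj_apply]
        split_ifs with hl
        · rfl
        · exact h.degree l hl
    obtain ⟨t, ht⟩ := exists_linear_lift (diff S 0) (P n) (P (n + 1) ⊓ LinearMap.ker (diff S 0))
      (fun z hz => by
        obtain ⟨g, hg, hgz⟩ := exists_diff_eq_of_isKoszulKernel nrm n M S z ((hP _ _).1 hz.1) hz.2
        exact ⟨g, (hP _ _).2 hg, hgz⟩)
    exact ⟨t, fun f hf hd => ⟨(hP _ _).1 (ht f ⟨(hP _ _).2 hf, hd⟩).1,
      (ht f ⟨(hP _ _).2 hf, hd⟩).2⟩⟩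
  choose t ht using H
  -- In degree `l.length` the assembled map uses only the component of `f` in degree `l.length + 1`.
  refine ⟨LinearMap.pi fun l => LinearMap.proj (R := k) (φ := fun _ => M) l ∘ₗ t l.length ∘ₗ
    degreeProj k σ M (l.length + 1), fun f l hl => ?_, fun f hf hd => ?_⟩
  · have : degreeProj k σ M (l.length + 1) f = 0 := by
      funext l'
      rw [degreeProj_apply]
      split_ifs with h
      · exact hl l' h
      · rfl
    rw [LinearMap.pi_apply, LinearMap.comp_apply, LinearMap.comp_apply, this, map_zero, map_zero]
  · have hk : ∀ n, IsKoszulKernel k nrm n (t n (degreeProj k σ M (n + 1) f)) ∧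
        diff S 0 (t n (degreeProj k σ M (n + 1) f)) = degreeProj k σ M (n + 1) f := fun n =>
      ht n _ (isKoszulKernel_degreeProj hf _) (by rw [diff_degreeProj, hd, map_zero])
    refine ⟨⟨fun hn l hl => (hk l.length).1.normalized hn l hl, ?_⟩, ?_⟩
    · funext T
      rw [antisymm_congr (g := t T.card (degreeProj k σ M (T.card + 1) f)) fun l hl => by
        rw [← hl]; rfl, (hk T.card).1.antisymm_eq]
    · funext l
      cases l with
      | nil =>
        have h1 : f [] = 0 := congrFun hf.2 ∅
        rw [h1, diff_apply, outer_nil, inner_nil, headSum_zero]; simp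
      | cons a l =>
        rw [diff_congr S 0 (g := t l.length (degreeProj k σ M (l.length + 1) f))
          (fun l' h' => ?_) (fun _ _ h => absurd rfl h), (hk l.length).2]
        · exact degreeProj_apply_of_eq f rfl
        · have : l'.length = l.length := by simpa using h'
          rw [← this]; rfl

/-- Cochains retract onto the Koszul complex by a homotopy of degree `-1`. -/
theorem exists_koszul_homotopy (S : BiAct k (σ →₀ ℕ) M) (nrm : Prop) :
    ∃ h : (List (σ →₀ ℕ) → M) →ₗ[k] (List (σ →₀ ℕ) → M),
      (∀ f l, (∀ l', l'.length = l.length + 1 → f l' = 0) → h f l = 0) ∧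
      (∀ f, (nrm → IsNormalized f) → nrm → IsNormalized (h f)) ∧
      (∀ f, (nrm → IsNormalized f) → antisymm k σ M f = 0 →
        diff S 0 (h f) + h (diff S 0 f) = f) ∧
      (∀ f, (nrm → IsNormalized f) →
        antisymm k σ M (diff S 0 (h f) + h (diff S 0 f)) = 0) := by
  obtain ⟨t, ht0, ht⟩ := exists_koszulKernel_lift S nrm
  obtain ⟨j, hj, hjn, hj0⟩ := exists_antisymm_section k σ M
  -- The map `t` inverts the differential on cocycles only. Since `f - t (diff f)` is a cocycle, `t
  -- ∘ (1 - t ∘ diff)` contracts the whole kernel.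
  have hs : ∀ f ∈ koszulKernel k nrm, t (f - t (diff S 0 f)) ∈ koszulKernel k nrm ∧
      diff S 0 (t (f - t (diff S 0 f))) +
        t (diff S 0 f - t (diff S 0 (diff S 0 f))) = f := by
    intro f hf
    have h1 := ht _ (diff_mem_koszulKernel S hf) (diff_zero_diff_zero S f)
    have h2 := ht _ (sub_mem hf h1.1) (by rw [map_sub, h1.2, sub_self])
    refine ⟨h2.1, ?_⟩
    rw [h2.2, diff_zero_diff_zero, map_zero, sub_zero, sub_add_cancel]
  -- Every cochain is projected to the kernel along the section `j` before it is contracted. The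
  -- homotopy thus takes values in the kernel, which gives the last claim, and on the kernel it is
  -- the contraction `s`.
  have hP : ∀ f, (nrm → IsNormalized f) → f - j (antisymm k σ M f) ∈ koszulKernel k nrm :=
    fun f hf => ⟨fun hn l hl => by
      rw [Pi.sub_apply, hf hn l hl, hjn _ l hl, sub_zero], by rw [map_sub, hj, sub_self]⟩
  let s := t ∘ₗ (LinearMap.id - t ∘ₗ diff S 0)
  let P := LinearMap.id - j ∘ₗ antisymm k σ M
  refine ⟨s ∘ₗ P, fun f l hl => ?_, fun f hf hn => ?_, fun f hf h0 => ?_, fun f hf => ?_⟩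
  · have h1 : ∀ l', l'.length = l.length + 1 → P f l' = 0 := by
      intro l' hl'
      have : j (antisymm k σ M f) l' = 0 := hj0 _ _ fun T hT => by
        rw [antisymm_congr (g := 0) fun l'' h => hl l'' (by omega), map_zero]; rfl
      change f l' - j (antisymm k σ M f) l' = 0
      rw [hl l' hl', this, sub_zero]
    refine ht0 _ _ fun l' hl' => ?_
    change P f l' - t (diff S 0 (P f)) l' = 0
    rw [h1 l' hl', zero_sub, neg_eq_zero]
    refine ht0 _ _ fun l'' hl'' => ?_
    rw [diff_congr S 0 (g := 0) (fun l3 h3 => h1 l3 (by omega)) fun _ _ h => absurd rfl h, map_zero]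
    rfl
  · exact (hs _ (hP f hf)).1.1 hn
  · have h1 : P f = f := by
      change f - j (antisymm k σ M f) = f
      rw [h0, map_zero, sub_zero]
    have h2 : P (diff S 0 f) = diff S 0 f := by
      change _ - j (antisymm k σ M (diff S 0 f)) = _
      rw [antisymm_diff, h0, map_zero, map_zero, sub_zero]; rfl
    change diff S 0 (s (P f)) + s (P (diff S 0 f)) = f
    rw [h1, h2]
    exact (hs f ⟨hf, h0⟩).2
  · have h1 : antisymm k σ M (s (P f)) = 0 := (hs _ (hP f hf)).1.2
    have h2 : antisymm k σ M (s (P (diff S 0 f))) = 0 :=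
      (hs _ (hP _ fun hn => (hf hn).diff S 0)).1.2
    change antisymm k σ M (diff S 0 (s (P f)) + s (P (diff S 0 f))) = 0
    rw [map_add, antisymm_diff, h1, h2, map_zero, add_zero]

end Retract

end ListCochain

/-! ### Perturbed contractions and mapping cones -/

section Perturbation

variable {k : Type*} [CommRing k]

/-- A contraction of a complex survives a perturbation of the differential that does not raise a
filtration lowered by the contraction. -/
theorem exact_of_filtered_contraction {C : Type*} [AddCommGroup C] [Module k C]
    (D b d S : C →ₗ[k] C) (hD : ∀ c, D c = b c + d c) (hDD : ∀ c, D (D c) = 0)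
    (hS : ∀ c, b (S c) + S (b c) = c) (F : ℕ → Submodule k C) (hF0 : F 0 = ⊥)
    (hd : ∀ n, ∀ c ∈ F n, d c ∈ F n) (hSF : ∀ n, ∀ c ∈ F (n + 1), S c ∈ F n)
    (hF : ∀ c, ∃ n, c ∈ F n) (c : C) (hc : D c = 0) : ∃ c', D c' = c := by
  obtain ⟨n, hn⟩ := hF c
  induction n generalizing c with
  | zero =>
    rw [hF0, Submodule.mem_bot] at hn
    exact ⟨0, by rw [map_zero, hn]⟩
  | succ n ih =>
    -- Replacing `c` by `c - D (S c)` stays in the same class. The `b`-part disappears and the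
    -- remaining terms each contain one `S` and one `d`, hence lie one step lower in the filtration.
    have h1 : c - D (S c) = -(d (S c) + S (d c)) := by
      have h2 : S (b c) = - S (d c) := by
        rw [hD] at hc
        rw [eq_neg_of_add_eq_zero_left hc, map_neg]
      have h3 := hS c
      rw [h2] at h3
      rw [hD]
      nth_rw 1 [← h3]
      abel
    obtain ⟨c', hc'⟩ := ih (c - D (S c)) (by rw [map_sub, hDD, hc, sub_zero]) (by
      rw [h1]
      exact neg_mem (add_mem (hd n _ (hSF n c hn)) (hSF n _ (hd _ c hn))))
    exact ⟨c' + S c, by rw [map_add, hc', sub_add_cancel]⟩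

variable {X Y K : Type*} [AddCommGroup X] [Module k X] [AddCommGroup Y] [Module k Y]
  [AddCommGroup K] [Module k K]

/-- A filtered chain map that is a homotopy equivalence for the unperturbed differentials is a
quasi-isomorphism for the perturbed ones. -/
theorem exact_cone_of_homotopyEquiv (DX bX dX : X →ₗ[k] X) (DY bY dY : Y →ₗ[k] Y)
    (Ψ : X →ₗ[k] Y) (G : Y →ₗ[k] X) (hX : X →ₗ[k] X) (hY : Y →ₗ[k] Y)
    (hDX : ∀ x, DX x = bX x + dX x) (hDY : ∀ y, DY y = bY y + dY y)
    (hDDX : ∀ x, DX (DX x) = 0) (hDDY : ∀ y, DY (DY y) = 0)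
    (hΨb : ∀ x, Ψ (bX x) = bY (Ψ x)) (hΨD : ∀ x, Ψ (DX x) = DY (Ψ x))
    (hGb : ∀ y, G (bY y) = bX (G y))
    (hhX : ∀ x, bX (hX x) + hX (bX x) = x - G (Ψ x))
    (hhY : ∀ y, bY (hY y) + hY (bY y) = y - Ψ (G y))
    (FX : ℕ → Submodule k X) (FY : ℕ → Submodule k Y) (hFX0 : FX 0 = ⊥) (hFY0 : FY 0 = ⊥)
    (hFXm : Monotone FX) (hFYm : Monotone FY)
    (hFX : ∀ x, ∃ n, x ∈ FX n) (hFY : ∀ y, ∃ n, y ∈ FY n)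
    (hdX : ∀ n, ∀ x ∈ FX n, dX x ∈ FX n) (hdY : ∀ n, ∀ y ∈ FY n, dY y ∈ FY n)
    (hhXF : ∀ n, ∀ x ∈ FX (n + 1), hX x ∈ FX n) (hhYF : ∀ n, ∀ y ∈ FY (n + 1), hY y ∈ FY n)
    (hΨF : ∀ n, ∀ x ∈ FX n, Ψ x ∈ FY n) (hGF : ∀ n, ∀ y ∈ FY n, G y ∈ FX n)
    (x : X) (y : Y) (hx : DX x = 0) (hxy : Ψ x = DY y) :
    ∃ x' y', DX x' = x ∧ Ψ x' - DY y' = y := by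
  let pX := LinearMap.fst k X Y
  let pY := LinearMap.snd k X Y
  -- The two homotopies are not compatible under `Ψ`. Their discrepancy `r` anticommutes with the
  -- differentials, and the terms with `r` in `S` make it an exact contraction of the cone.
  let r := hY ∘ₗ Ψ - Ψ ∘ₗ hX
  have hr : ∀ x, bY (r x) = - r (bX x) := by
    intro x
    have h1 := hhY (Ψ x)
    have h2 := congrArg Ψ (hhX x)
    rw [map_add, map_sub, hΨb] at h2
    change bY (hY (Ψ x) - Ψ (hX x)) = -(hY (Ψ (bX x)) - Ψ (hX (bX x)))
    rw [map_sub, hΨb, eq_sub_of_add_eq h1, eq_sub_of_add_eq h2]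
    abel
  let S : X × Y →ₗ[k] X × Y :=
    LinearMap.prod (G ∘ₗ pY + hX ∘ₗ pX + G ∘ₗ r ∘ₗ pX) (-(hY ∘ₗ pY + hY ∘ₗ r ∘ₗ pX))
  let D : X × Y →ₗ[k] X × Y := LinearMap.prod (DX ∘ₗ pX) (Ψ ∘ₗ pX - DY ∘ₗ pY)
  let b : X × Y →ₗ[k] X × Y := LinearMap.prod (bX ∘ₗ pX) (Ψ ∘ₗ pX - bY ∘ₗ pY)
  let d : X × Y →ₗ[k] X × Y := LinearMap.prod (dX ∘ₗ pX) (-(dY ∘ₗ pY))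
  have hrF : ∀ n, ∀ x ∈ FX (n + 1), r x ∈ FY n := fun n x hx =>
    sub_mem (hhYF n _ (hΨF _ x hx)) (hΨF n _ (hhXF n x hx))
  have hhYF' : ∀ n, ∀ y ∈ FY n, hY y ∈ FY (n - 1) := by
    intro n y hy
    cases n with
    | zero =>
      rw [hFY0, Submodule.mem_bot] at hy
      rw [hy, map_zero]; exact zero_mem _
    | succ n => exact hhYF n y hy
  obtain ⟨⟨x', y'⟩, h⟩ := exact_of_filtered_contraction D b d S
    (fun c => Prod.ext (hDX _) (show Ψ c.1 - DY c.2 = Ψ c.1 - bY c.2 + -dY c.2 by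
      rw [hDY]; abel))
    (fun c => Prod.ext (hDDX _) (show Ψ (DX c.1) - DY (Ψ c.1 - DY c.2) = 0 by
      rw [map_sub, hDDY, hΨD]; abel))
    (by
      rintro ⟨x, y⟩
      refine Prod.ext ?_ ?_
      · change bX (G y + hX x + G (r x)) +
          (G (Ψ x - bY y) + hX (bX x) + G (r (bX x))) = x
        simp only [map_add, map_sub, ← hGb, hr, map_neg]
        rw [← sub_eq_zero, ← sub_eq_zero.2 (hhX x)]
        abel
      · change Ψ (G y + hX x + G (r x)) - bY (-(hY y + hY (r x))) +
          -(hY (Ψ x - bY y) + hY (r (bX x))) = y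
        have h1 := hhY y
        have h2 := hhY (r x)
        rw [hr, map_neg] at h2
        have h3 : r x = hY (Ψ x) - Ψ (hX x) := rfl
        simp only [map_add, map_sub, map_neg]
        rw [← sub_eq_zero]
        have h4 : bY (hY y) = y - Ψ (G y) - hY (bY y) := eq_sub_of_add_eq h1
        have h5 : bY (hY (r x)) = r x - Ψ (G (r x)) + hY (r (bX x)) := by
          rw [← h2]; abel
        rw [h4, h5, h3]
        abel)
    -- The shift in the second component is needed because `S` contains `G`, which only preserves
    -- the filtrations; with it `S` still lowers the filtration of the cone.
    (fun n => (FX n).prod (FY (n - 1)))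
    (by
      rw [hFX0, Nat.zero_sub, hFY0]
      exact Submodule.prod_bot)
    (fun n c hc => ⟨hdX n _ hc.1, neg_mem (hdY _ _ hc.2)⟩)
    (fun n c hc => ⟨add_mem (add_mem (hGF n _ hc.2) (hhXF n _ hc.1)) (hGF n _ (hrF n _ hc.1)),
      neg_mem (add_mem (hhYF' n _ hc.2) (hhYF' n _ (hrF n _ hc.1)))⟩)
    (by
      rintro ⟨x, y⟩
      obtain ⟨n, hn⟩ := hFX x
      obtain ⟨m, hm⟩ := hFY y
      exact ⟨n + m + 1, hFXm (by omega) hn, hFYm (by omega) hm⟩)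
    (x, y) (Prod.ext hx (show Ψ x - DY y = 0 by rw [hxy, sub_self]))
  exact ⟨x', y', congrArg Prod.fst h, congrArg Prod.snd h⟩

/-- A filtered chain map compatible with retractions onto a common small complex is a
quasi-isomorphism for the perturbed differentials. -/
theorem exact_cone_of_retract (DX bX dX : X →ₗ[k] X) (DY bY dY : Y →ₗ[k] Y)
    (Ψ : X →ₗ[k] Y) (hX : X →ₗ[k] X) (hY : Y →ₗ[k] Y) (RX : X →ₗ[k] K) (RY : Y →ₗ[k] K)
    (j : K →ₗ[k] X)
    (hDX : ∀ x, DX x = bX x + dX x) (hDY : ∀ y, DY y = bY y + dY y)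
    (hDDX : ∀ x, DX (DX x) = 0) (hDDY : ∀ y, DY (DY y) = 0)
    (hbbX : ∀ x, bX (bX x) = 0)
    (hΨb : ∀ x, Ψ (bX x) = bY (Ψ x)) (hΨD : ∀ x, Ψ (DX x) = DY (Ψ x))
    (hRΨ : ∀ x, RY (Ψ x) = RX x) (hRj : ∀ u, RX (j u) = u)
    (hRbY : ∀ y, RY y = 0 → RY (bY y) = 0)
    (hhX : ∀ x, RX x = 0 → bX (hX x) + hX (bX x) = x)
    (hRhX : ∀ x, RX (bX (hX x) + hX (bX x)) = 0)
    (hhY : ∀ y, RY y = 0 → bY (hY y) + hY (bY y) = y)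
    (FX : ℕ → Submodule k X) (FY : ℕ → Submodule k Y) (hFX0 : FX 0 = ⊥) (hFY0 : FY 0 = ⊥)
    (hFXm : Monotone FX) (hFYm : Monotone FY)
    (hFX : ∀ x, ∃ n, x ∈ FX n) (hFY : ∀ y, ∃ n, y ∈ FY n)
    (hbX : ∀ n, ∀ x ∈ FX n, bX x ∈ FX (n + 1))
    (hdX : ∀ n, ∀ x ∈ FX n, dX x ∈ FX n) (hdY : ∀ n, ∀ y ∈ FY n, dY y ∈ FY n)
    (hhXF : ∀ n, ∀ x ∈ FX (n + 1), hX x ∈ FX n) (hhYF : ∀ n, ∀ y ∈ FY (n + 1), hY y ∈ FY n)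
    (hΨF : ∀ n, ∀ x ∈ FX n, Ψ x ∈ FY n) (hjF : ∀ n, ∀ y ∈ FY n, j (RY y) ∈ FX n)
    (x : X) (y : Y) (hx : DX x = 0) (hxy : Ψ x = DY y) :
    ∃ x' y', DX x' = x ∧ Ψ x' - DY y' = y := by
  -- This chain map kills the kernel of `RX` and leaves `RX` unchanged. Composed with the mere
  -- linear section `j` and with `RY`, it yields a chain map `G` back from `Y`.
  let e : X →ₗ[k] X := LinearMap.id - (bX ∘ₗ hX + hX ∘ₗ bX)
  have he : ∀ x, e x = x - (bX (hX x) + hX (bX x)) := fun _ => rfl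
  have he0 : ∀ x, RX x = 0 → e x = 0 := fun x h => by rw [he, hhX x h, sub_self]
  have hRe : ∀ x, RX (e x) = RX x := fun x => by rw [he, map_sub, hRhX, sub_zero]
  have heb : ∀ x, e (bX x) = bX (e x) := fun x => by
    rw [he, he, map_sub, map_add, hbbX, hbbX, map_zero]; abel
  have hejR : ∀ x, e (j (RX x)) = e x := fun x => by
    rw [← sub_eq_zero, ← map_sub]
    exact he0 _ (by rw [map_sub, hRj, sub_self])
  let G : Y →ₗ[k] X := e ∘ₗ j ∘ₗ RY
  have hG : ∀ y, G y = e (j (RY y)) := fun _ => rfl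
  have hRG : ∀ y, RY (Ψ (G y)) = RY y := fun y => by rw [hRΨ, hG, hRe, hRj]
  have hGb : ∀ y, G (bY y) = bX (G y) := fun y => by
    rw [hG, hG, ← heb, ← sub_eq_zero, ← map_sub]
    refine he0 _ ?_
    have h1 : RY (bY (y - Ψ (j (RY y)))) = 0 := hRbY _ (by rw [map_sub, hRΨ, hRj, sub_self])
    rw [map_sub, hRj, ← hRΨ (bX _), hΨb, ← map_sub, ← map_sub, h1]
  have hFhh : ∀ n, ∀ x ∈ FX n, bX (hX x) + hX (bX x) ∈ FX n := by
    intro n x hx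
    refine add_mem ?_ (hhXF n _ (hbX n x hx))
    cases n with
    | zero =>
      rw [hFX0, Submodule.mem_bot] at hx
      rw [hx, map_zero, map_zero]; exact zero_mem _
    | succ n => exact hbX n _ (hhXF n x hx)
  have hGF : ∀ n, ∀ y ∈ FY n, G y ∈ FX n := fun n y hy =>
    sub_mem (hjF n y hy) (hFhh n _ (hjF n y hy))
  -- The homotopy `hY` contracts only the kernel of `RY`, so it is preceded by `1 - Ψ ∘ G`, which
  -- maps into that kernel.
  refine exact_cone_of_homotopyEquiv DX bX dX DY bY dY Ψ G hX (hY ∘ₗ (LinearMap.id - Ψ ∘ₗ G))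
    hDX hDY hDDX hDDY hΨb hΨD hGb (fun x => ?_) (fun y => ?_) FX FY hFX0 hFY0 hFXm hFYm hFX hFY
    hdX hdY hhXF (fun n y hy => ?_) hΨF hGF x y hx hxy
  · rw [hG, hRΨ, hejR, he]; abel
  · have h1 := hhY (y - Ψ (G y)) (by rw [map_sub, hRG, sub_self])
    change bY (hY (y - Ψ (G y))) + hY (bY y - Ψ (G (bY y))) = _
    rwa [hGb, hΨb, ← map_sub]
  · exact hhYF n _ (sub_mem hy (hΨF _ _ (hGF _ y hy)))

end Perturbation

/-! ### Tensor products of complexes graded by parity -/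

section TensorComplex

variable {k X Y : Type*} [CommRing k] [AddCommGroup X] [Module k X] [AddCommGroup Y] [Module k Y]

/-- The differential of a tensor product of complexes. -/
def tensorDiff (σ D : X →ₗ[k] X) (E : Y →ₗ[k] Y) : X ⊗[k] Y →ₗ[k] X ⊗[k] Y :=
  TensorProduct.map D LinearMap.id + TensorProduct.map σ E

theorem tensorDiff_tmul (σ D : X →ₗ[k] X) (E : Y →ₗ[k] Y) (x : X) (y : Y) :
    tensorDiff σ D E (x ⊗ₜ y) = D x ⊗ₜ y + σ x ⊗ₜ E y := rfl

theorem tensorDiff_tensorDiff (σ D : X →ₗ[k] X) (E : Y →ₗ[k] Y) (hD : ∀ x, D (D x) = 0)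
    (hE : ∀ y, E (E y) = 0) (hσ : ∀ x, D (σ x) = - σ (D x)) (z : X ⊗[k] Y) :
    tensorDiff σ D E (tensorDiff σ D E z) = 0 := by
  induction z with
  | zero => simp
  | add z w hz hw => simp only [map_add, hz, hw, add_zero]
  | tmul x y =>
    simp only [tensorDiff_tmul, map_add, hD, hE, hσ, TensorProduct.zero_tmul,
      TensorProduct.tmul_zero, TensorProduct.neg_tmul]
    abel

/-- The homotopy on a tensor product of complexes built from homotopies on the factors. -/
def tensorHomotopy (σ D h : X →ₗ[k] X) (g : Y →ₗ[k] Y) : X ⊗[k] Y →ₗ[k] X ⊗[k] Y :=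
  TensorProduct.map h LinearMap.id +
    TensorProduct.map ((LinearMap.id - (D ∘ₗ h + h ∘ₗ D)) ∘ₗ σ) g

theorem tensorHomotopy_tmul (σ D h : X →ₗ[k] X) (g : Y →ₗ[k] Y) (x : X) (y : Y) :
    tensorHomotopy σ D h g (x ⊗ₜ y) =
      h x ⊗ₜ y + (σ x - (D (h (σ x)) + h (D (σ x)))) ⊗ₜ g y := rfl

/-- Set `e = 1 - (D h + h D)` and `e' = 1 - (E g + g E)`. The first summand contributes `1 - e ⊗ 1`
and the second `e ⊗ 1 - e ⊗ e'`; the cross terms cancel because `D` and `h` are odd for `σ`. -/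
theorem tensorHomotopy_spec (σ D h : X →ₗ[k] X) (E g : Y →ₗ[k] Y) (hD : ∀ x, D (D x) = 0)
    (hσ : ∀ x, D (σ x) = - σ (D x)) (hσσ : ∀ x, σ (σ x) = x) (hσh : ∀ x, h (σ x) = - σ (h x))
    (z : X ⊗[k] Y) :
    tensorDiff σ D E (tensorHomotopy σ D h g z) + tensorHomotopy σ D h g (tensorDiff σ D E z) =
      z - TensorProduct.map (LinearMap.id - (D ∘ₗ h + h ∘ₗ D))
        (LinearMap.id - (E ∘ₗ g + g ∘ₗ E)) z := by
  induction z with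
  | zero => simp
  | add z w hz hw =>
    simp only [map_add]
    rw [add_sub_add_comm, ← hz, ← hw]
    abel
  | tmul x y =>
    simp only [tensorDiff_tmul, tensorHomotopy_tmul, map_add, map_sub, hD, hσ, hσh, hσσ, map_neg,
      map_zero, TensorProduct.map_tmul, LinearMap.sub_apply, LinearMap.add_apply,
      LinearMap.comp_apply, LinearMap.id_apply, TensorProduct.add_tmul, TensorProduct.sub_tmul,
      TensorProduct.neg_tmul, TensorProduct.tmul_add, TensorProduct.tmul_sub, neg_neg,
      TensorProduct.zero_tmul]
    abel

/-- Over a field of characteristic not two, differentials have odd generalized inverses. -/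
theorem exists_odd_inverse {k X : Type*} [Field k] [CharZero k] [AddCommGroup X] [Module k X]
    (σ D : X →ₗ[k] X) (hσ : ∀ x, D (σ x) = - σ (D x)) (hσσ : ∀ x, σ (σ x) = x) :
    ∃ t : X →ₗ[k] X, (∀ x, D (t (D x)) = D x) ∧ ∀ x, t (σ x) = - σ (t x) := by
  obtain ⟨t, ht⟩ := exists_linear_lift D ⊤ (LinearMap.range D) (by
    rintro _ ⟨x, rfl⟩; exact ⟨x, trivial, rfl⟩)
  have ht' : ∀ x, D (t (D x)) = D x := fun x => (ht _ ⟨x, rfl⟩).2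
  -- This is the odd part of `t`. Conjugating by `σ` changes the sign of `D t D = D`, so the
  -- relation survives the averaging.
  refine ⟨(2 : k)⁻¹ • (t - σ ∘ₗ t ∘ₗ σ), fun x => ?_, fun x => ?_⟩
  · have h1 : D (σ (t (σ (D x)))) = - D x := by
      have h2 : σ (D x) = - D (σ x) := by rw [hσ, neg_neg]
      rw [hσ, h2, map_neg, map_neg, ht', hσ, neg_neg, hσσ]
    simp only [LinearMap.smul_apply, LinearMap.sub_apply, LinearMap.comp_apply, map_smul, map_sub,
      ht', h1, sub_neg_eq_add, ← two_smul k (D x)]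
    rw [smul_smul, inv_mul_cancel₀ two_ne_zero, one_smul]
  · simp only [LinearMap.smul_apply, LinearMap.sub_apply, LinearMap.comp_apply, map_smul, map_sub,
      hσσ, ← smul_neg]
    congr 1
    abel

end TensorComplex

/-! ### Extending cochains from one factor to a product -/

/-- Two algebras with commuting images in a third one, with compatible monoid morphisms to them. -/
structure ExternalProduct (k Mo₁ Mo₂ Mo B₁ B₂ B : Type*) [CommRing k] [AddCommMonoid Mo₁]
    [AddCommMonoid Mo₂] [AddCommMonoid Mo] [Ring B₁] [Algebra k B₁] [Ring B₂] [Algebra k B₂]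
    [Ring B] [Algebra k B] where
  p₁ : Mo →+ Mo₁
  p₂ : Mo →+ Mo₂
  i₁ : Mo₁ →+ Mo
  i₂ : Mo₂ →+ Mo
  p₁_i₁ : ∀ a, p₁ (i₁ a) = a
  p₂_i₁ : ∀ a, p₂ (i₁ a) = 0
  p₁_i₂ : ∀ a, p₁ (i₂ a) = 0
  p₂_i₂ : ∀ a, p₂ (i₂ a) = a
  u₁ : Multiplicative Mo₁ →* B₁
  u₂ : Multiplicative Mo₂ →* B₂
  u : Multiplicative Mo →* B
  j₁ : B₁ →ₐ[k] B
  j₂ : B₂ →ₐ[k] B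
  comm : ∀ x y, j₁ x * j₂ y = j₂ y * j₁ x
  u_eq : ∀ a, u (.ofAdd a) = j₁ (u₁ (.ofAdd (p₁ a))) * j₂ (u₂ (.ofAdd (p₂ a)))

namespace ExternalProduct

open ListCochain

variable {k Mo₁ Mo₂ Mo B₁ B₂ B : Type*} [CommRing k] [AddCommMonoid Mo₁]
    [AddCommMonoid Mo₂] [AddCommMonoid Mo] [Ring B₁] [Algebra k B₁] [Ring B₂] [Algebra k B₂]
    [Ring B] [Algebra k B]

/-- Exchanging the two factors. -/
def swap (E : ExternalProduct k Mo₁ Mo₂ Mo B₁ B₂ B) : ExternalProduct k Mo₂ Mo₁ Mo B₂ B₁ B where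
  p₁ := E.p₂
  p₂ := E.p₁
  i₁ := E.i₂
  i₂ := E.i₁
  p₁_i₁ := E.p₂_i₂
  p₂_i₁ := E.p₁_i₂
  p₁_i₂ := E.p₂_i₁
  p₂_i₂ := E.p₁_i₁
  u₁ := E.u₂
  u₂ := E.u₁
  u := E.u
  j₁ := E.j₂
  j₂ := E.j₁
  comm x y := (E.comm y x).symm
  u_eq a := (E.u_eq a).trans (E.comm _ _)

variable (E : ExternalProduct k Mo₁ Mo₂ Mo B₁ B₂ B)

/-- The image of the first component of a monomial. -/
def v₁ (a : Mo) : B := E.j₁ (E.u₁ (.ofAdd (E.p₁ a)))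

/-- The image of the second component of a monomial. -/
def v₂ (a : Mo) : B := E.j₂ (E.u₂ (.ofAdd (E.p₂ a)))

theorem swap_v₂ (a : Mo) : E.swap.v₂ a = E.v₁ a := rfl

theorem swap_j₁ : E.swap.j₁ = E.j₂ := rfl

theorem swap_p₁ : E.swap.p₁ = E.p₂ := rfl

theorem v₂_add (a b : Mo) : E.v₂ (a + b) = E.v₂ a * E.v₂ b := by simp [v₂]

theorem v₂_i₁ (a : Mo₁) : E.v₂ (E.i₁ a) = 1 := by simp [v₂, E.p₂_i₁]

theorem u_eq' (a : Mo) : E.u (.ofAdd a) = E.v₁ a * E.v₂ a := E.u_eq a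

theorem v₂_j₁ (a : Mo) (x : B₁) : E.v₂ a * E.j₁ x = E.j₁ x * E.v₂ a := (E.comm _ _).symm

/-- Extension of cochains from the first factor. -/
def ext₁ : (List Mo₁ → B₁) →ₗ[k] (List Mo → B) where
  toFun φ l := E.j₁ (φ (l.map E.p₁)) * E.v₂ l.sum
  map_add' f g := by funext l; simp [add_mul]
  map_smul' c f := by funext l; simp

theorem ext₁_apply (φ : List Mo₁ → B₁) (l : List Mo) :
    E.ext₁ φ l = E.j₁ (φ (l.map E.p₁)) * E.v₂ l.sum := rfl

theorem ext₁_nil (φ : List Mo₁ → B₁) : E.ext₁ φ [] = E.j₁ (φ []) := by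
  simp [ext₁_apply, v₂]

theorem ext₁_cons (φ : List Mo₁ → B₁) (a : Mo) (l : List Mo) :
    E.ext₁ φ (a :: l) = E.v₂ a * E.ext₁ (head k B₁ (E.p₁ a) φ) l := by
  rw [ext₁_apply, ext₁_apply, List.sum_cons, v₂_add, ← mul_assoc, ← mul_assoc, E.v₂_j₁]
  rfl

theorem head_ext₁ (φ : List Mo₁ → B₁) (a : Mo) :
    head k B a (E.ext₁ φ) = fun l => E.v₂ a * E.ext₁ (head k B₁ (E.p₁ a) φ) l :=
  funext fun l => E.ext₁_cons φ a l

theorem ext₁_mul_left (b : B₁) (φ : List Mo₁ → B₁) (l : List Mo) :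
    E.ext₁ (fun l => b * φ l) l = E.j₁ b * E.ext₁ φ l := by
  simp [ext₁_apply, mul_assoc]

theorem isNormalized_ext₁ {φ : List Mo₁ → B₁} (hφ : IsNormalized φ) : IsNormalized (E.ext₁ φ) :=
  fun l hl => by
    rw [ext₁_apply, hφ _ (List.mem_map.2 ⟨0, hl, map_zero _⟩), map_zero, zero_mul]

theorem parSign_ext₁ (φ : List Mo₁ → B₁) :
    parSign k Mo B (E.ext₁ φ) = E.ext₁ (parSign k Mo₁ B₁ φ) := by
  funext l
  simp [parSign_apply, ext₁_apply]

/-- The monomial factors from the second algebra commute past the values from the first, so they can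
be collected at the end. -/
theorem ext₁_cupHom (φ χ : List Mo₁ → B₁) :
    E.ext₁ (cupHom k Mo₁ B₁ φ χ) = cupHom k Mo B (E.ext₁ φ) (E.ext₁ χ) := by
  funext l
  induction l generalizing φ with
  | nil => simp [cupHom_nil, ext₁_nil]
  | cons a l ih =>
    have h1 : head k B₁ (E.p₁ a) (cupHom k Mo₁ B₁ φ χ) =
        (fun l => φ [] * head k B₁ (E.p₁ a) χ l) +
          cupHom k Mo₁ B₁ (head k B₁ (E.p₁ a) φ) χ := rfl
    rw [ext₁_cons, h1, map_add, Pi.add_apply, ih, ext₁_mul_left, cupHom_cons, head_ext₁,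
      cupHom_mul_left, ext₁_nil, ext₁_cons, mul_add, ← mul_assoc, ← mul_assoc, v₂_j₁]

/-- The sum of linear combinations of monomials of the two factors. -/
def potential (W₁ : Mo₁ →₀ k) (W₂ : Mo₂ →₀ k) : Mo →₀ k :=
  W₁.mapDomain E.i₁ + W₂.mapDomain E.i₂

theorem headSum_potential {M : Type*} [AddCommGroup M] [Module k M] (W₁ : Mo₁ →₀ k)
    (W₂ : Mo₂ →₀ k) (f : List Mo → M) :
    headSum M (E.potential W₁ W₂) f = (∑ m ∈ W₁.support, W₁ m • head k M (E.i₁ m) f) +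
      ∑ m ∈ W₂.support, W₂ m • head k M (E.i₂ m) f := by
  rw [headSum_eq]
  change ((W₁.mapDomain E.i₁ + W₂.mapDomain E.i₂).sum fun m c => c • head k M m f) = _
  rw [Finsupp.sum_add_index' (by simp) (by simp [add_smul]),
    Finsupp.sum_mapDomain_index (by simp) (by simp [add_smul]),
    Finsupp.sum_mapDomain_index (by simp) (by simp [add_smul])]
  rfl

/-- A monomial of `W₂` has trivial first component and is killed by normalization, so an extended
cochain sees only `W₁`. Without normalization the extension would not respect the curving. -/
theorem headSum_ext₁ (W₁ : Mo₁ →₀ k) (W₂ : Mo₂ →₀ k) {φ : List Mo₁ → B₁} (hφ : IsNormalized φ) :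
    headSum B (E.potential W₁ W₂) (E.ext₁ φ) = E.ext₁ (headSum B₁ W₁ φ) := by
  rw [headSum_potential, headSum_eq, map_sum]
  have h : ∀ m, head k B (E.i₂ m) (E.ext₁ φ) = 0 := fun m => by
    funext l
    have : head k B₁ 0 φ = 0 := hφ.head_zero
    rw [head_ext₁, E.p₁_i₂, this]
    simp
  simp only [h, smul_zero, Finset.sum_const_zero, add_zero, map_smul]
  refine Finset.sum_congr rfl fun m _ => ?_
  rw [head_ext₁, E.p₁_i₁]
  simp only [E.v₂_i₁, one_mul]

theorem inner_ext₁ (W₁ : Mo₁ →₀ k) (W₂ : Mo₂ →₀ k) {φ : List Mo₁ → B₁} (hφ : IsNormalized φ) :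
    inner (mulAct E.u) (E.potential W₁ W₂) (E.ext₁ φ) = E.ext₁ (inner (mulAct E.u₁) W₁ φ) := by
  funext l
  induction l generalizing φ with
  | nil => rw [inner_nil, headSum_ext₁ E W₁ W₂ hφ, ext₁_nil, ext₁_nil, inner_nil]
  | cons a l ih =>
    have h1 : head k B₁ (E.p₁ a) (inner (mulAct E.u₁) W₁ φ) =
        head k B₁ (E.p₁ a) (headSum B₁ W₁ φ) - mergeHead (mulAct E.u₁) (E.p₁ a) φ -
          inner (mulAct E.u₁) W₁ (head k B₁ (E.p₁ a) φ) := rfl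
    have h2 : mergeHead (mulAct (k := k) E.u) a (E.ext₁ φ) l =
        E.v₂ a * E.ext₁ (mergeHead (mulAct (k := k) E.u₁) (E.p₁ a) φ) l := by
      cases l with
      | nil =>
        simp only [mergeHead_nil, ext₁_nil, mulAct_rho, E.u_eq, map_mul, ← mul_assoc, v₂_j₁]
        simp only [mul_assoc, v₂_j₁]; rfl
      | cons b l =>
        rw [mergeHead_cons, ext₁_cons, ext₁_cons, v₂_add, mul_assoc, map_add]
        rfl
    rw [inner_cons, headSum_ext₁ E W₁ W₂ hφ, h2, head_ext₁, inner_mul_left]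
    beta_reduce
    rw [ih (hφ.head (k := k) _), ext₁_cons, ext₁_cons, h1]
    simp only [map_sub, Pi.sub_apply, mul_sub]

theorem diff_ext₁ (W₁ : Mo₁ →₀ k) (W₂ : Mo₂ →₀ k) {φ : List Mo₁ → B₁} (hφ : IsNormalized φ) :
    diff (mulAct E.u) (E.potential W₁ W₂) (E.ext₁ φ) = E.ext₁ (diff (mulAct E.u₁) W₁ φ) := by
  rw [diff_eq, diff_eq, map_add, inner_ext₁ E W₁ W₂ hφ]
  congr 1
  funext l
  cases l with
  | nil => simp [ext₁_nil]
  | cons a l =>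
    have h1 : head k B₁ (E.p₁ a) (outer (mulAct (k := k) E.u₁) φ) =
        fun l => E.u₁ (.ofAdd (E.p₁ a)) * φ l := rfl
    rw [outer_cons, mulAct_lam, E.u_eq', ext₁_cons, h1, ext₁_mul_left, ← mul_assoc, v₂_j₁]
    rfl

theorem potential_swap (W₁ : Mo₁ →₀ k) (W₂ : Mo₂ →₀ k) :
    E.swap.potential W₂ W₁ = E.potential W₁ W₂ := add_comm _ _

end ExternalProduct
-- Cochains of one factor inserted into an argument of the other
namespace ExternalProduct

open ListCochain

variable {k Mo₁ Mo₂ Mo B₁ B₂ B : Type*} [CommRing k] [AddCommMonoid Mo₁]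
    [AddCommMonoid Mo₂] [AddCommMonoid Mo] [Ring B₁] [Algebra k B₁] [Ring B₂] [Algebra k B₂]
    [Ring B] [Algebra k B] (E : ExternalProduct k Mo₁ Mo₂ Mo B₁ B₂ B)

/-- The cochain `∑ φ(m + a₁ + ⋯ + aᵢ, aᵢ₊₁, …) χ(a₁, …, aᵢ)`, on functions. -/
def shuffleFun (φ : List Mo₁ → B₁) : Mo₁ → (List Mo₂ → B₂) → List Mo → B
  | m, χ, [] => E.j₂ (χ []) * E.j₁ (φ [m])
  | m, χ, a :: l => E.j₂ (χ []) * E.ext₁ (head k B₁ m φ) (a :: l) +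
      shuffleFun φ (m + E.p₁ a) (head k B₂ (E.p₂ a) χ) l

/-- The cochain `∑ φ(m + a₁ + ⋯ + aᵢ, aᵢ₊₁, …) χ(a₁, …, aᵢ)`. -/
def shuffle (m : Mo₁) : (List Mo₁ → B₁) →ₗ[k] (List Mo₂ → B₂) →ₗ[k] (List Mo → B) :=
  LinearMap.mk₂ k (fun φ χ => E.shuffleFun φ m χ)
    (fun φ φ' χ => by
      funext l
      induction l generalizing m χ with
      | nil => simp [shuffleFun, mul_add]
      | cons a l ih =>
        have := ih (m + E.p₁ a) (head k B₂ (E.p₂ a) χ)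
        simp only [Pi.add_apply] at this
        simp only [shuffleFun, map_add, Pi.add_apply, this, mul_add]
        abel)
    (fun c φ χ => by
      funext l
      induction l generalizing m χ with
      | nil => simp [shuffleFun]
      | cons a l ih =>
        have := ih (m + E.p₁ a) (head k B₂ (E.p₂ a) χ)
        simp only [Pi.smul_apply] at this
        simp only [shuffleFun, map_smul, Pi.smul_apply, this, mul_smul_comm, smul_add])
    (fun φ χ χ' => by
      funext l
      induction l generalizing m χ χ' with
      | nil => simp [shuffleFun, add_mul]
      | cons a l ih =>
        have := ih (m + E.p₁ a) (head k B₂ (E.p₂ a) χ) (head k B₂ (E.p₂ a) χ')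
        simp only [Pi.add_apply] at this
        simp only [shuffleFun, map_add, Pi.add_apply, this, add_mul]
        abel)
    (fun c φ χ => by
      funext l
      induction l generalizing m χ with
      | nil => simp [shuffleFun]
      | cons a l ih =>
        have := ih (m + E.p₁ a) (head k B₂ (E.p₂ a) χ)
        simp only [Pi.smul_apply] at this
        simp only [shuffleFun, map_smul, Pi.smul_apply, this, smul_mul_assoc, smul_add])

theorem shuffle_nil (m : Mo₁) (φ : List Mo₁ → B₁) (χ : List Mo₂ → B₂) :
    E.shuffle m φ χ [] = E.j₂ (χ []) * E.j₁ (φ [m]) := rfl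

theorem shuffle_cons (m : Mo₁) (φ : List Mo₁ → B₁) (χ : List Mo₂ → B₂) (a : Mo) (l : List Mo) :
    E.shuffle m φ χ (a :: l) = E.j₂ (χ []) * E.ext₁ (head k B₁ m φ) (a :: l) +
      E.shuffle (m + E.p₁ a) φ (head k B₂ (E.p₂ a) χ) l := rfl

theorem head_shuffle (m : Mo₁) (φ : List Mo₁ → B₁) (χ : List Mo₂ → B₂) (a : Mo) :
    head k B a (E.shuffle m φ χ) =
      (fun l => E.j₂ (χ []) * (E.v₂ a * E.ext₁ (head k B₁ (E.p₁ a) (head k B₁ m φ)) l)) +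
        E.shuffle (m + E.p₁ a) φ (head k B₂ (E.p₂ a) χ) := by
  funext l
  rw [head_apply, shuffle_cons, ext₁_cons]
  rfl

/-- A monomial of `W₁` would put the argument `1` into `χ`, and one of `W₂` would put it into `φ`
right after its first argument. Normalization leaves the insertion of `W₁` after the slot `m` and of
`W₂` into `χ`. -/
theorem headSum_shuffle (W₁ : Mo₁ →₀ k) (W₂ : Mo₂ →₀ k) (m : Mo₁) {φ : List Mo₁ → B₁}
    {χ : List Mo₂ → B₂} (hφ : IsNormalized φ) (hχ : IsNormalized χ) (l : List Mo) :
    headSum B (E.potential W₁ W₂) (E.shuffle m φ χ) l =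
      E.j₂ (χ []) * E.ext₁ (headSum B₁ W₁ (head k B₁ m φ)) l +
        E.shuffle m φ (headSum B₂ W₂ χ) l := by
  have h1 : head k B₂ 0 χ = 0 := hχ.head_zero
  have h2 : head k B₁ 0 (head k B₁ m φ) = 0 := (hφ.head m).head_zero
  rw [headSum_potential, headSum_eq, headSum_eq]
  simp only [head_shuffle, E.p₁_i₁, E.p₂_i₁, E.p₁_i₂, E.p₂_i₂, h1, h2, map_zero, add_zero,
    E.v₂_i₁, one_mul, Pi.add_apply, Finset.sum_apply, Pi.smul_apply, map_sum, map_smul,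
    Finset.mul_sum, Pi.zero_apply, mul_zero, zero_add, mul_smul_comm]

/-- A nonempty block absorbs the two components of `a` into `m` and into the first argument of `χ`.
The two extra terms correct the summand with empty block, where `a` must be merged into the
arguments of `φ` instead. -/
theorem mergeHead_shuffle (m : Mo₁) (φ : List Mo₁ → B₁) (χ : List Mo₂ → B₂) (a : Mo)
    (l : List Mo) :
    mergeHead (mulAct (k := k) E.u) a (E.shuffle m φ χ) l =
      E.shuffle (m + E.p₁ a) φ (mergeHead (mulAct (k := k) E.u₂) (E.p₂ a) χ) l -
        E.j₂ (χ []) * (E.v₂ a * E.ext₁ (head k B₁ (m + E.p₁ a) φ) l) +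
        E.j₂ (χ []) *
          (E.v₂ a * E.ext₁ (mergeHead (mulAct (k := k) E.u₁) (E.p₁ a) (head k B₁ m φ)) l) := by
  cases l with
  | nil =>
    simp only [mergeHead_nil, shuffle_nil, ext₁_nil, mulAct_rho, map_mul, head_apply, E.u_eq']
    rw [mul_assoc (E.j₂ (χ [])) (E.j₂ _)]
    change _ = E.j₂ (χ []) * (E.v₂ a * _) - _ + E.j₂ (χ []) * (E.v₂ a * (E.j₁ (φ [m]) * E.v₁ a))
    have : E.v₂ a * E.v₁ a = E.v₁ a * E.v₂ a := v₂_j₁ E a _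
    rw [← mul_assoc (E.v₂ a) _ (E.v₁ a), v₂_j₁ E a (φ [m]), mul_assoc _ (E.v₂ a), this]
    noncomm_ring
  | cons b l =>
    have h1 : head k B₂ (E.p₂ b) (mergeHead (mulAct (k := k) E.u₂) (E.p₂ a) χ) =
        head k B₂ (E.p₂ (a + b)) χ := by rw [map_add]; rfl
    have h2 : head k B₁ (E.p₁ b) (mergeHead (mulAct (k := k) E.u₁) (E.p₁ a) (head k B₁ m φ)) =
        head k B₁ (E.p₁ (a + b)) (head k B₁ m φ) := by rw [map_add]; rfl
    rw [mergeHead_cons, shuffle_cons, shuffle_cons, h1, ext₁_cons _ (mergeHead _ _ _), h2, ext₁_cons,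
      mergeHead_nil, mulAct_rho, map_mul]
    change _ = E.j₂ (χ []) * E.v₂ a * _ + _ - _ + _
    rw [v₂_add, map_add, ← add_assoc m]
    noncomm_ring

/-- Each term of the differential acts on the arguments of `χ` or on those of `φ`. The final term
removes the contribution in which the block is the whole list and the slot `m` is multiplied into
the value of `φ`. -/
theorem inner_shuffle (W₁ : Mo₁ →₀ k) (W₂ : Mo₂ →₀ k) (m : Mo₁) {φ : List Mo₁ → B₁}
    {χ : List Mo₂ → B₂} (hφ : IsNormalized φ) (hχ : IsNormalized χ) (l : List Mo) :
    inner (mulAct E.u) (E.potential W₁ W₂) (E.shuffle m φ χ) l =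
      E.shuffle m φ (inner (mulAct E.u₂) W₂ χ) l +
      E.shuffle m (headSum B₁ W₁ φ - inner (mulAct E.u₁) W₁ φ) (parSign k Mo₂ B₂ χ) l -
      E.j₁ (φ [] * E.u₁ (.ofAdd m)) * E.swap.ext₁ (parSign k Mo₂ B₂ χ) l := by
  -- Up to sign, `Φ` is the inner differential of `φ` without the insertion of `W₁` before the first
  -- argument: with first argument `m` it consists of the terms that keep `m` in front or merge it.
  set Φ := headSum B₁ W₁ φ - inner (mulAct E.u₁) W₁ φ with hΦ
  have hΦm : ∀ m, head k B₁ m Φ = mergeHead (mulAct (k := k) E.u₁) m φ +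
      inner (mulAct E.u₁) W₁ (head k B₁ m φ) := by
    intro m
    have : head k B₁ m (inner (mulAct E.u₁) W₁ φ) = head k B₁ m (headSum B₁ W₁ φ) -
      mergeHead (mulAct E.u₁) m φ - inner (mulAct E.u₁) W₁ (head k B₁ m φ) := rfl
    rw [hΦ, map_sub, this]
    abel
  have hp : ∀ χ : List Mo₂ → B₂, parSign k Mo₂ B₂ χ [] = χ [] := fun χ => by simp [parSign_apply]
  induction l generalizing m χ with
  | nil =>
    have h := congrFun (hΦm m) []
    simp only [head_apply, Pi.add_apply, mergeHead_nil, mulAct_rho, inner_nil] at h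
    rw [inner_nil, headSum_shuffle E W₁ W₂ m hφ hχ, shuffle_nil, shuffle_nil, shuffle_nil, h,
      ext₁_nil, ext₁_nil, hp, inner_nil]
    simp only [map_add, mul_add]
    change _ = _ + _ - E.j₁ _ * E.j₂ _
    rw [E.comm]
    abel
  | cons a l ih =>
    have h1 : head k B₂ (E.p₂ a) (inner (mulAct E.u₂) W₂ χ) =
        head k B₂ (E.p₂ a) (headSum B₂ W₂ χ) - mergeHead (mulAct E.u₂) (E.p₂ a) χ -
          inner (mulAct E.u₂) W₂ (head k B₂ (E.p₂ a) χ) := rfl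
    have h2 : head k B₂ (E.p₂ a) (parSign k Mo₂ B₂ χ) =
        - parSign k Mo₂ B₂ (head k B₂ (E.p₂ a) χ) := by
      funext l; simp [parSign_apply, pow_succ]
    have h3 : E.swap.ext₁ (parSign k Mo₂ B₂ χ) (a :: l) =
        - (E.v₁ a * E.swap.ext₁ (parSign k Mo₂ B₂ (head k B₂ (E.p₂ a) χ)) l) := by
      rw [ext₁_cons]
      change E.v₁ a * E.swap.ext₁ (head k B₂ (E.p₂ a) (parSign k Mo₂ B₂ χ)) l = _
      rw [h2, map_neg]; simp
    have h4 : head k B₁ (E.p₁ a) (inner (mulAct E.u₁) W₁ (head k B₁ m φ)) =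
        head k B₁ (E.p₁ a) (headSum B₁ W₁ (head k B₁ m φ)) -
          mergeHead (mulAct E.u₁) (E.p₁ a) (head k B₁ m φ) -
          inner (mulAct E.u₁) W₁ (head k B₁ (E.p₁ a) (head k B₁ m φ)) := rfl
    have h5 : head k B₁ (E.p₁ a) (mergeHead (mulAct (k := k) E.u₁) m φ) =
        head k B₁ (m + E.p₁ a) φ := rfl
    rw [inner_cons, headSum_shuffle E W₁ W₂ m hφ hχ, mergeHead_shuffle, head_shuffle, map_add,
      Pi.add_apply, ih (m + E.p₁ a) (hχ.head (k := k) _), inner_mul_left, inner_mul_left,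
      inner_ext₁ E W₁ W₂ ((hφ.head (k := k) m).head _), shuffle_cons, shuffle_cons,
      shuffle_cons, h1, h2, h3,
      hΦm m, inner_nil, hp, ext₁_cons, ext₁_cons _ (_ + _), ext₁_cons, map_add (head k B₁ _), h4,
      h5]
    simp only [map_sub, map_add, map_neg, Pi.sub_apply, Pi.add_apply, Pi.neg_apply, ofAdd_add,
      map_mul]
    change _ = _ + _ - E.j₁ _ * E.j₁ _ * (-(E.j₁ (E.u₁ (.ofAdd (E.p₁ a))) * _))
    noncomm_ring

end ExternalProduct
-- The homotopy for graded commutativity between the factors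
namespace ExternalProduct

open ListCochain

variable {k Mo₁ Mo₂ Mo B₁ B₂ B : Type*} [CommRing k] [AddCommMonoid Mo₁]
    [AddCommMonoid Mo₂] [AddCommMonoid Mo] [Ring B₁] [Algebra k B₁] [Ring B₂] [Algebra k B₂]
    [Ring B] [Algebra k B] (E : ExternalProduct k Mo₁ Mo₂ Mo B₁ B₂ B)

theorem shuffle_mul_left (m : Mo₁) (b : B₁) (φ : List Mo₁ → B₁) (χ : List Mo₂ → B₂)
    (l : List Mo) : E.shuffle m (fun l => b * φ l) χ l = E.j₁ b * E.shuffle m φ χ l := by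
  induction l generalizing m χ with
  | nil =>
    simp only [shuffle_nil, map_mul, ← mul_assoc, E.comm]
  | cons a l ih =>
    have h : head k B₁ m (fun l => b * φ l) = fun l => b * head k B₁ m φ l := rfl
    rw [shuffle_cons, shuffle_cons, ih, h, ext₁_mul_left, mul_add, ← mul_assoc, ← mul_assoc,
      E.comm]

theorem shuffle_mul_right (m : Mo₁) (b : B₂) (φ : List Mo₁ → B₁) (χ : List Mo₂ → B₂)
    (l : List Mo) : E.shuffle m φ (fun l => b * χ l) l = E.j₂ b * E.shuffle m φ χ l := by
  induction l generalizing m χ with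
  | nil => simp only [shuffle_nil, map_mul, mul_assoc]
  | cons a l ih =>
    have h : head k B₂ (E.p₂ a) (fun l => b * χ l) = fun l => b * head k B₂ (E.p₂ a) χ l := rfl
    rw [shuffle_cons, shuffle_cons, h, ih, map_mul]
    noncomm_ring

/-- The left multiplication in the differential of `φ` pulls `m` and the first components of the
block out in front. The block with `χ` and the rest with `φ` then form a cup product. -/
theorem shuffle_outer (m : Mo₁) (φ : List Mo₁ → B₁) (χ : List Mo₂ → B₂) (l : List Mo) :
    E.shuffle m (outer (mulAct (k := k) E.u₁) φ) χ l =
      E.j₁ (E.u₁ (.ofAdd m)) * cupHom k Mo B (E.swap.ext₁ χ) (E.ext₁ φ) l := by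
  have h : ∀ m, head k B₁ m (outer (mulAct (k := k) E.u₁) φ) =
      fun l => E.u₁ (.ofAdd m) * φ l := fun m => rfl
  induction l generalizing m χ with
  | nil =>
    rw [shuffle_nil, cupHom_nil, ext₁_nil, ext₁_nil, outer_cons, mulAct_lam, map_mul, ← mul_assoc,
      ← mul_assoc]
    change E.j₂ _ * _ * _ = E.j₁ _ * E.j₂ _ * _
    rw [E.comm]
  | cons a l ih =>
    rw [shuffle_cons, ih, h, ext₁_mul_left, cupHom_cons, head_ext₁, cupHom_mul_left, ext₁_nil,
      ofAdd_add, map_mul, map_mul, mul_add, ← mul_assoc, ← mul_assoc]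
    change E.j₂ _ * _ * _ + _ * E.v₁ a * _ = E.j₁ _ * E.j₂ _ * _ + _ * (E.v₁ a * _)
    rw [E.comm, mul_assoc _ (E.v₁ a)]
    rfl

theorem shuffle_mergeHead (m a : Mo₁) (φ : List Mo₁ → B₁) (χ : List Mo₂ → B₂) (l : List Mo) :
    E.shuffle m (mergeHead (mulAct (k := k) E.u₁) a φ) χ l = E.shuffle (a + m) φ χ l := by
  induction l generalizing m χ with
  | nil => rfl
  | cons b l ih => rw [shuffle_cons, shuffle_cons, ih, add_assoc]; rfl

/-- The homotopy `∑ ± φ(…, aᵢ ψ'(aᵢ₊₁, …), …)` between the two cup products, on functions. -/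
def braceFun (s : k) (ψ : List Mo₂ → B₂) : (List Mo₁ → B₁) → List Mo → B
  | φ, [] => 0
  | φ, a :: l => E.shuffle (E.p₁ a) φ (head k B₂ (E.p₂ a) ψ) l +
      s • (E.v₂ a * braceFun s ψ (head k B₁ (E.p₁ a) φ) l)

/-- The homotopy between the two cup products of cochains from the two factors. -/
def brace (s : k) : (List Mo₁ → B₁) →ₗ[k] (List Mo₂ → B₂) →ₗ[k] (List Mo → B) :=
  LinearMap.mk₂ k (fun φ ψ => E.braceFun s ψ φ)
    (fun φ φ' ψ => by
      funext l
      induction l generalizing φ φ' with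
      | nil => simp [braceFun]
      | cons a l ih =>
        have := ih (head k B₁ (E.p₁ a) φ) (head k B₁ (E.p₁ a) φ')
        simp only [Pi.add_apply] at this
        simp only [braceFun, map_add, LinearMap.add_apply, Pi.add_apply, this, mul_add, smul_add]
        abel)
    (fun c φ ψ => by
      funext l
      induction l generalizing φ with
      | nil => simp [braceFun]
      | cons a l ih =>
        have := ih (head k B₁ (E.p₁ a) φ)
        simp only [Pi.smul_apply] at this
        simp only [braceFun, map_smul, LinearMap.smul_apply, Pi.smul_apply, this, mul_smul_comm,
          smul_add, smul_comm s c])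
    (fun φ ψ ψ' => by
      funext l
      induction l generalizing φ with
      | nil => simp [braceFun]
      | cons a l ih =>
        have := ih (head k B₁ (E.p₁ a) φ)
        simp only [Pi.add_apply] at this
        simp only [braceFun, map_add, Pi.add_apply, this, mul_add, smul_add]
        abel)
    (fun c φ ψ => by
      funext l
      induction l generalizing φ with
      | nil => simp [braceFun]
      | cons a l ih =>
        have := ih (head k B₁ (E.p₁ a) φ)
        simp only [Pi.smul_apply] at this
        simp only [braceFun, map_smul, Pi.smul_apply, this, mul_smul_comm,
          smul_add, smul_comm s c])

theorem brace_nil (s : k) (φ : List Mo₁ → B₁) (ψ : List Mo₂ → B₂) : E.brace s φ ψ [] = 0 := rfl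

theorem brace_cons (s : k) (φ : List Mo₁ → B₁) (ψ : List Mo₂ → B₂) (a : Mo) (l : List Mo) :
    E.brace s φ ψ (a :: l) = E.shuffle (E.p₁ a) φ (head k B₂ (E.p₂ a) ψ) l +
      s • (E.v₂ a * E.brace s (head k B₁ (E.p₁ a) φ) ψ l) := rfl

theorem head_brace (s : k) (φ : List Mo₁ → B₁) (ψ : List Mo₂ → B₂) (a : Mo) :
    head k B a (E.brace s φ ψ) = E.shuffle (E.p₁ a) φ (head k B₂ (E.p₂ a) ψ) +
      s • (fun l => E.v₂ a * E.brace s (head k B₁ (E.p₁ a) φ) ψ l) := rfl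

theorem brace_mul_left (s : k) (b : B₁) (φ : List Mo₁ → B₁) (ψ : List Mo₂ → B₂) (l : List Mo) :
    E.brace s (fun l => b * φ l) ψ l = E.j₁ b * E.brace s φ ψ l := by
  induction l generalizing φ with
  | nil => simp [brace_nil]
  | cons a l ih =>
    have h : head k B₁ (E.p₁ a) (fun l => b * φ l) = fun l => b * head k B₁ (E.p₁ a) φ l := rfl
    rw [brace_cons, brace_cons, shuffle_mul_left, h, ih, mul_add, mul_smul_comm, ← mul_assoc,
      ← mul_assoc, v₂_j₁]

/-- By normalization an inserted monomial of `W₂` survives only as the first argument of `ψ`, and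
one of `W₁` only as an argument of `φ` preceding the block. -/
theorem headSum_brace (s : k) (W₁ : Mo₁ →₀ k) (W₂ : Mo₂ →₀ k) {φ : List Mo₁ → B₁}
    {ψ : List Mo₂ → B₂} (hφ : IsNormalized φ) (hψ : IsNormalized ψ) (l : List Mo) :
    headSum B (E.potential W₁ W₂) (E.brace s φ ψ) l =
      E.shuffle 0 φ (headSum B₂ W₂ ψ) l + s • E.brace s (headSum B₁ W₁ φ) ψ l := by
  have h1 : head k B₂ 0 ψ = 0 := hψ.head_zero
  have h2 : head k B₁ 0 φ = 0 := hφ.head_zero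
  rw [headSum_potential, headSum_eq, headSum_eq]
  simp only [head_brace, E.p₁_i₁, E.p₂_i₁, E.p₁_i₂, E.p₂_i₂, h1, h2, map_zero,
    E.v₂_i₁, one_mul, Pi.add_apply, Finset.sum_apply, Pi.smul_apply, map_sum, map_smul,
    Pi.zero_apply, mul_zero, smul_zero, zero_add, add_zero, LinearMap.zero_apply,
    LinearMap.sum_apply, LinearMap.smul_apply, Finset.smul_sum]
  rw [add_comm]
  congr 1
  exact Finset.sum_congr rfl fun m _ => smul_comm _ _ _

theorem shuffle_zero_nil {φ : List Mo₁ → B₁} (hφ : IsNormalized φ) (χ : List Mo₂ → B₂) :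
    E.shuffle 0 φ χ [] = 0 := by
  rw [shuffle_nil, hφ _ (by simp), map_zero, mul_zero]

theorem shuffle_zero_cons {φ : List Mo₁ → B₁} (hφ : IsNormalized φ) (χ : List Mo₂ → B₂) (a : Mo)
    (l : List Mo) :
    E.shuffle 0 φ χ (a :: l) = E.shuffle (E.p₁ a) φ (head k B₂ (E.p₂ a) χ) l := by
  have : head k B₁ 0 φ = 0 := hφ.head_zero
  rw [shuffle_cons, this, zero_add]
  simp

/-- The failure of `brace` to commute with the inner differentials. -/
def braceDefect (s : k) (ψ : List Mo₂ → B₂) : (List Mo₁ → B₁) → List Mo → B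
  | φ, [] => 0
  | φ, a :: l => E.j₂ (ψ []) * (E.v₂ a * E.ext₁ (head k B₁ (E.p₁ a) φ) l) -
      E.v₂ a * (E.j₂ (ψ []) * E.ext₁ (head k B₁ (E.p₁ a) φ) l) +
      E.v₂ a * E.shuffle (E.p₁ a) φ ψ l + s • (E.j₁ (φ []) * E.swap.ext₁ ψ (a :: l)) -
      s • (E.v₂ a * braceDefect s ψ (head k B₁ (E.p₁ a) φ) l)

/-- The subtracted terms record what happens at the left end of the block: the argument merged into
it may be the last one before the block or the first one of the block. -/
theorem mergeHead_brace (s : k) (φ : List Mo₁ → B₁) (ψ : List Mo₂ → B₂) (a : Mo) (l : List Mo) :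
    mergeHead (mulAct (k := k) E.u) a (E.brace s φ ψ) l =
      E.v₂ a * E.brace s (mergeHead (mulAct (k := k) E.u₁) (E.p₁ a) φ) ψ l +
      E.shuffle (E.p₁ a) φ (mergeHead (mulAct (k := k) E.u₂) (E.p₂ a) ψ) l -
      (E.j₂ (ψ []) * (E.v₂ a * E.ext₁ (head k B₁ (E.p₁ a) φ) l) -
      E.v₂ a * (E.j₂ (ψ []) * E.ext₁ (head k B₁ (E.p₁ a) φ) l) +
      E.v₂ a * E.shuffle (E.p₁ a) φ ψ l) := by
  cases l with
  | nil =>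
    simp only [mergeHead_nil, brace_nil, shuffle_nil, ext₁_nil, mulAct_rho, map_mul, head_apply,
      map_zero, mul_zero, zero_add, zero_mul]
    change 0 = E.j₂ (ψ []) * E.v₂ a * _ - _
    noncomm_ring
  | cons b l =>
    have h1 : head k B₂ (E.p₂ b) (mergeHead (mulAct (k := k) E.u₂) (E.p₂ a) ψ) =
        head k B₂ (E.p₂ (a + b)) ψ := by rw [map_add]; rfl
    have h2 : head k B₁ (E.p₁ b) (mergeHead (mulAct (k := k) E.u₁) (E.p₁ a) φ) =
        head k B₁ (E.p₁ (a + b)) φ := by rw [map_add]; rfl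
    rw [mergeHead_cons, brace_cons, brace_cons, shuffle_cons, shuffle_cons, h1, h2,
      mergeHead_nil, mulAct_rho, map_mul, shuffle_mergeHead]
    change _ = _ + (E.j₂ (ψ []) * E.v₂ a * _ + _) - _
    rw [v₂_add, map_add]
    simp only [mul_add, mul_smul_comm]
    noncomm_ring

/-- The hypotheses on `s` say that it is `(-1)` to the degree of `ψ` minus one. Terms acting away
from the ends of the block match the differentials of `φ` and `ψ`; those at the ends are collected
in `braceDefect`. -/
theorem inner_brace (s : k) (hs : s * s = 1) (W₁ : Mo₁ →₀ k) (W₂ : Mo₂ →₀ k) {φ : List Mo₁ → B₁}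
    {ψ : List Mo₂ → B₂} (hφ : IsNormalized φ) (hψ : IsNormalized ψ)
    (hψs : parSign k Mo₂ B₂ ψ = - s • ψ) (l : List Mo) :
    inner (mulAct E.u) (E.potential W₁ W₂) (E.brace s φ ψ) l =
      s • E.brace s (inner (mulAct E.u₁) W₁ φ) ψ l +
      E.brace (-s) φ (inner (mulAct E.u₂) W₂ ψ) l + E.braceDefect s ψ φ l := by
  induction l generalizing φ with
  | nil =>
    rw [inner_nil, headSum_brace E s W₁ W₂ hφ hψ, shuffle_zero_nil E hφ]
    simp [brace_nil, braceDefect]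
  | cons a l ih =>
    have h1 : head k B₂ (E.p₂ a) (inner (mulAct E.u₂) W₂ ψ) =
        head k B₂ (E.p₂ a) (headSum B₂ W₂ ψ) - mergeHead (mulAct E.u₂) (E.p₂ a) ψ -
          inner (mulAct E.u₂) W₂ (head k B₂ (E.p₂ a) ψ) := rfl
    have h2 : parSign k Mo₂ B₂ (head k B₂ (E.p₂ a) ψ) = s • head k B₂ (E.p₂ a) ψ := by
      have : head k B₂ (E.p₂ a) (parSign k Mo₂ B₂ ψ) =
        - parSign k Mo₂ B₂ (head k B₂ (E.p₂ a) ψ) := by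
        funext l; simp [parSign_apply, pow_succ]
      rw [← neg_eq_iff_eq_neg.2 this, hψs, map_smul, neg_smul, neg_neg]
    have h4 : head k B₁ (E.p₁ a) (inner (mulAct E.u₁) W₁ φ) =
        head k B₁ (E.p₁ a) (headSum B₁ W₁ φ) -
          mergeHead (mulAct E.u₁) (E.p₁ a) φ -
          inner (mulAct E.u₁) W₁ (head k B₁ (E.p₁ a) φ) := rfl
    rw [inner_cons, headSum_brace E s W₁ W₂ hφ hψ, shuffle_zero_cons E hφ, mergeHead_brace,
      head_brace, map_add, map_smul, Pi.add_apply, Pi.smul_apply, inner_mul_left,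
      inner_shuffle E W₁ W₂ _ hφ (hψ.head (k := k) _)]
    beta_reduce
    rw [ih (hφ.head (k := k) _), brace_cons, brace_cons, brace_cons, h1, h2, h4, braceDefect,
      ext₁_cons E.swap]
    simp only [map_sub, map_add, map_smul, map_neg, Pi.sub_apply, Pi.add_apply, Pi.smul_apply,
      LinearMap.sub_apply, LinearMap.add_apply, map_mul, mul_add, mul_sub, mul_smul_comm, smul_add,
      smul_sub, smul_smul, hs, one_smul, neg_smul]
    simp only [swap_v₂, swap_p₁, v₁, mul_assoc]
    abel

/-- The end terms of consecutive blocks telescope against the left multiplication in the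
differential of `ψ`. What remains is the cup product with `φ` in front of `ψ`, carrying the sign of
moving `ψ` past the arguments of `φ`. -/
theorem braceDefect_eq (s : k) (hs : s * s = 1) (φ : List Mo₁ → B₁) {ψ : List Mo₂ → B₂}
    (hψ : s • ψ [] = - ψ []) (l : List Mo) :
    E.j₂ (ψ []) * E.ext₁ φ l - s • E.brace (-s) φ (outer (mulAct (k := k) E.u₂) ψ) l +
      s • E.braceDefect s ψ φ l =
    cupHom k Mo B (E.ext₁ (fun l => (-s) ^ l.length • φ l)) (E.swap.ext₁ ψ) l := by
  have hψ' : ∀ x : B, s • (E.j₂ (ψ []) * x) = - (E.j₂ (ψ []) * x) := fun x => by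
    rw [← smul_mul_assoc, ← map_smul, hψ, map_neg, neg_mul]
  have hψ'' : ∀ x y : B, s • (x * (E.j₂ (ψ []) * y)) = - (x * (E.j₂ (ψ []) * y)) := fun x y => by
    rw [← mul_smul_comm, hψ', mul_neg]
  induction l generalizing φ with
  | nil =>
    simp [brace_nil, braceDefect, cupHom_nil, ext₁_nil]
    exact (E.comm _ _).symm
  | cons a l ih =>
    have h1 : head k B₂ (E.p₂ a) (outer (mulAct (k := k) E.u₂) ψ) =
        fun l => E.u₂ (.ofAdd (E.p₂ a)) * ψ l := rfl
    have h2 : head k B₁ (E.p₁ a) (fun l => (-s) ^ l.length • φ l) =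
        (-s) • fun l => (-s) ^ l.length • head k B₁ (E.p₁ a) φ l := by
      funext l
      simp only [head_apply, List.length_cons, pow_succ', Pi.smul_apply, smul_smul]
    rw [cupHom_cons, head_ext₁, cupHom_mul_left, h2, map_smul, map_smul, LinearMap.smul_apply,
      Pi.smul_apply, ← ih, ext₁_nil, brace_cons, h1, shuffle_mul_right, ext₁_cons E, braceDefect]
    simp only [List.length_nil, pow_zero, one_smul, mul_add, mul_sub, mul_smul_comm, smul_add,
      smul_sub, smul_smul, neg_mul, hs, neg_smul, neg_neg, hψ', hψ'', mul_neg, smul_neg]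
    change _ - (s • (E.v₂ a * _) + _) + _ = _
    abel

/-- Gerstenhaber's argument: sliding the block of `ψ` through the arguments of `φ` connects the two
orders of the cup product. On cocycles the first two terms vanish and the signed commutator is a
coboundary. -/
theorem diff_brace (s : k) (hs : s * s = 1) (W₁ : Mo₁ →₀ k) (W₂ : Mo₂ →₀ k) {φ : List Mo₁ → B₁}
    {ψ : List Mo₂ → B₂} (hφ : IsNormalized φ) (hψ : IsNormalized ψ)
    (hψs : parSign k Mo₂ B₂ ψ = - s • ψ) :
    diff (mulAct E.u) (E.potential W₁ W₂) (E.brace s φ ψ) =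
      s • E.brace s (diff (mulAct E.u₁) W₁ φ) ψ + E.brace (-s) φ (diff (mulAct E.u₂) W₂ ψ) -
      s • (cupHom k Mo B (E.swap.ext₁ ψ) (E.ext₁ φ) -
        cupHom k Mo B (E.ext₁ (fun l => (-s) ^ l.length • φ l)) (E.swap.ext₁ ψ)) := by
  have hψ0 : s • ψ [] = - ψ [] := by
    have := congrFun hψs []
    simp only [parSign_apply, List.length_nil, pow_zero, one_smul, Pi.smul_apply, neg_smul] at this
    rw [← neg_eq_iff_eq_neg.2 this]
  have hψ' : ∀ x : B, s • (E.j₂ (ψ []) * x) = - (E.j₂ (ψ []) * x) := fun x => by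
    rw [← smul_mul_assoc, ← map_smul, hψ0, map_neg, neg_mul]
  have hψ'' : ∀ x y : B, s • (x * (E.j₂ (ψ []) * y)) = - (x * (E.j₂ (ψ []) * y)) := fun x y => by
    rw [← mul_smul_comm, hψ', mul_neg]
  funext l
  simp only [Pi.sub_apply, Pi.add_apply, Pi.smul_apply]
  rw [diff_apply, inner_brace E s hs W₁ W₂ hφ hψ hψs, diff_eq, diff_eq, map_add, map_add,
    LinearMap.add_apply, Pi.add_apply, Pi.add_apply]
  suffices h : outer (mulAct (k := k) E.u) (E.brace s φ ψ) l + E.braceDefect s ψ φ l =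
      s • E.brace s (outer (mulAct (k := k) E.u₁) φ) ψ l +
        E.brace (-s) φ (outer (mulAct (k := k) E.u₂) ψ) l -
      s • (cupHom k Mo B (E.swap.ext₁ ψ) (E.ext₁ φ) l -
        cupHom k Mo B (E.ext₁ (fun l => (-s) ^ l.length • φ l)) (E.swap.ext₁ ψ) l) by
    rw [smul_add]
    linear_combination (norm := module) h
  cases l with
  | nil =>
    simp [brace_nil, braceDefect, cupHom_nil, ext₁_nil]
    rw [swap_j₁, E.comm, sub_self, smul_zero]
  | cons a l =>
    have h1 : head k B₂ (E.p₂ a) (outer (mulAct (k := k) E.u₂) ψ) =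
        fun l => E.u₂ (.ofAdd (E.p₂ a)) * ψ l := rfl
    have h3 : head k B₁ (E.p₁ a) (outer (mulAct (k := k) E.u₁) φ) =
        fun l => E.u₁ (.ofAdd (E.p₁ a)) * φ l := rfl
    have h2 : head k B₁ (E.p₁ a) (fun l => (-s) ^ l.length • φ l) =
        (-s) • fun l => (-s) ^ l.length • head k B₁ (E.p₁ a) φ l := by
      funext l
      simp only [head_apply, List.length_cons, pow_succ', Pi.smul_apply, smul_smul]
    have h4 : E.v₂ a * E.v₁ a = E.v₁ a * E.v₂ a := v₂_j₁ E a _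
    rw [cupHom_cons, cupHom_cons, head_ext₁, head_ext₁, cupHom_mul_left, cupHom_mul_left, h2,
      map_smul, map_smul, LinearMap.smul_apply, Pi.smul_apply, ← braceDefect_eq E s hs _ hψ0,
      ext₁_nil, brace_cons, brace_cons, h1, h3, shuffle_mul_right, brace_mul_left, shuffle_outer,
      ext₁_cons E, braceDefect, ext₁_nil, outer_cons, mulAct_lam, E.u_eq', ← h4]
    simp only [List.length_nil, pow_zero, one_smul, mul_add, mul_sub, mul_smul_comm, smul_add,
      smul_sub, smul_smul, neg_mul, hs, neg_smul, neg_neg, hψ', hψ'', mul_neg, smul_neg]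
    simp only [swap_v₂, swap_p₁, swap_j₁, hψ', mul_assoc]
    simp only [v₁, v₂]
    abel

end ExternalProduct

/-! ### The external cup product on Koszul complexes -/

namespace ListCochain

variable {k σ τ υ : Type*} [CommRing k] [LinearOrder σ] [LinearOrder τ] [LinearOrder υ]
  {ι₁ : σ ↪ υ} {ι₂ : τ ↪ υ}

/-- All variables of the first factor precede those of the second, so the latter never count; this
ordering keeps the comparison of Koszul complexes free of signs. -/
theorem frontSign_union (h₁ : StrictMono ι₁) (h : ∀ i j, ι₁ i < ι₂ j) (i : σ) (S₁ : Finset σ)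
    (S₂ : Finset τ) : frontSign k (ι₁ i) (S₁.map ι₁ ∪ S₂.map ι₂) = frontSign k i S₁ := by
  have : (S₁.map ι₁ ∪ S₂.map ι₂).filter (· < ι₁ i) = (S₁.filter (· < i)).map ι₁ := by
    ext x
    simp only [Finset.mem_filter, Finset.mem_union, Finset.mem_map]
    constructor
    · rintro ⟨⟨j, hj, rfl⟩ | ⟨j, hj, rfl⟩, hx⟩
      · exact ⟨j, ⟨hj, h₁.lt_iff_lt.1 hx⟩, rfl⟩
      · exact absurd hx (h i j).asymm
    · rintro ⟨j, ⟨hj, hx⟩, rfl⟩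
      exact ⟨Or.inl ⟨j, hj, rfl⟩, h₁.lt_iff_lt.2 hx⟩
  rw [frontSign, this, Finset.card_map, frontSign]

theorem frontSign_map (h₂ : StrictMono ι₂) (i : τ) (S₂ : Finset τ) :
    frontSign k (ι₂ i) (S₂.map ι₂) = frontSign k i S₂ := by
  have : (S₂.map ι₂).filter (· < ι₂ i) = (S₂.filter (· < i)).map ι₂ := by
    ext x
    simp only [Finset.mem_filter, Finset.mem_map]
    constructor
    · rintro ⟨⟨j, hj, rfl⟩, hx⟩
      exact ⟨j, ⟨hj, h₂.lt_iff_lt.1 hx⟩, rfl⟩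
    · rintro ⟨j, ⟨hj, hx⟩, rfl⟩
      exact ⟨⟨j, hj, rfl⟩, h₂.lt_iff_lt.2 hx⟩
  rw [frontSign, this, Finset.card_map, frontSign]

theorem disjoint_map_map (h : ∀ i j, ι₁ i < ι₂ j) (S₁ : Finset σ) (S₂ : Finset τ) :
    Disjoint (S₁.map ι₁) (S₂.map ι₂) := by
  rw [Finset.disjoint_left]
  intro x hx hx'
  obtain ⟨i, -, rfl⟩ := Finset.mem_map.1 hx
  obtain ⟨j, -, hj⟩ := Finset.mem_map.1 hx'
  exact (h i j).ne hj.symm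

theorem union_erase_left (h : ∀ i j, ι₁ i < ι₂ j) (i : σ) (S₁ : Finset σ) (S₂ : Finset τ) :
    (S₁.map ι₁ ∪ S₂.map ι₂).erase (ι₁ i) = (S₁.erase i).map ι₁ ∪ S₂.map ι₂ := by
  rw [Finset.erase_union_distrib, Finset.map_erase]
  congr 1
  refine Finset.erase_eq_of_notMem fun hx => ?_
  obtain ⟨j, -, hj⟩ := Finset.mem_map.1 hx
  exact (h i j).ne hj.symm

theorem union_erase_right (h : ∀ i j, ι₁ i < ι₂ j) (i : τ) (S₁ : Finset σ) (S₂ : Finset τ) :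
    (S₁.map ι₁ ∪ S₂.map ι₂).erase (ι₂ i) = S₁.map ι₁ ∪ (S₂.erase i).map ι₂ := by
  rw [Finset.erase_union_distrib, Finset.map_erase]
  congr 1
  refine Finset.erase_eq_of_notMem fun hx => ?_
  obtain ⟨j, -, hj⟩ := Finset.mem_map.1 hx
  exact (h j i).ne hj

end ListCochain

namespace ExternalProduct

open ListCochain

variable {k σ τ υ B₁ B₂ B : Type*} [CommRing k] [LinearOrder σ] [LinearOrder τ] [LinearOrder υ]
    [Ring B₁] [Algebra k B₁] [Ring B₂] [Algebra k B₂] [Ring B] [Algebra k B]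
    (E : ExternalProduct k (σ →₀ ℕ) (τ →₀ ℕ) (υ →₀ ℕ) B₁ B₂ B) {ι₁ : σ ↪ υ} {ι₂ : τ ↪ υ}
    (h₁ : StrictMono ι₁) (h₂ : StrictMono ι₂) (h : ∀ i j, ι₁ i < ι₂ j)
    (hι₁ : ∀ i, E.i₁ (Finsupp.single i 1) = Finsupp.single (ι₁ i) 1)
    (hι₂ : ∀ i, E.i₂ (Finsupp.single i 1) = Finsupp.single (ι₂ i) 1)

theorem head_i₁_ext₁ {Mo₁ Mo₂ Mo : Type*} [AddCommMonoid Mo₁] [AddCommMonoid Mo₂]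
    [AddCommMonoid Mo] (E : ExternalProduct k Mo₁ Mo₂ Mo B₁ B₂ B) (φ : List Mo₁ → B₁)
    (a : Mo₁) : head k B (E.i₁ a) (E.ext₁ φ) = E.ext₁ (head k B₁ a φ) := by
  rw [head_ext₁, E.p₁_i₁]
  simp only [v₂_i₁, one_mul]

theorem head_i₂_ext₁ {Mo₁ Mo₂ Mo : Type*} [AddCommMonoid Mo₁] [AddCommMonoid Mo₂]
    [AddCommMonoid Mo] (E : ExternalProduct k Mo₁ Mo₂ Mo B₁ B₂ B) {φ : List Mo₁ → B₁}
    (hφ : IsNormalized φ) (a : Mo₂) : head k B (E.i₂ a) (E.ext₁ φ) = 0 := by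
  have : head k B₁ 0 φ = 0 := hφ.head_zero
  rw [head_ext₁, E.p₁_i₂, this, map_zero]
  simp only [Pi.zero_apply, mul_zero]
  rfl

theorem head_ext₂ {Mo₁ Mo₂ Mo : Type*} [AddCommMonoid Mo₁] [AddCommMonoid Mo₂]
    [AddCommMonoid Mo] (E : ExternalProduct k Mo₁ Mo₂ Mo B₁ B₂ B) (ψ : List Mo₂ → B₂)
    (a : Mo₂) : head k B (E.i₂ a) (E.swap.ext₁ ψ) = E.swap.ext₁ (head k B₂ a ψ) :=
  E.swap.head_i₁_ext₁ ψ a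

include h₂ h hι₁ hι₂

/-- A variable of the first factor has trivial second component, so a normalized cochain extended
from the second factor vanishes on it. -/
theorem antisymm_ext₂ {ψ : List (τ →₀ ℕ) → B₂} (hψ : IsNormalized ψ) (S₁ : Finset σ)
    (S₂ : Finset τ) :
    antisymm k υ B (E.swap.ext₁ ψ) (S₁.map ι₁ ∪ S₂.map ι₂) =
      if S₁ = ∅ then E.j₂ (antisymm k τ B₂ ψ S₂) else 0 := by
  induction hn : S₂.card generalizing ψ S₂ with
  | zero =>
    obtain rfl := Finset.card_eq_zero.1 hn
    split_ifs with hS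
    · subst hS
      simp [antisymm_empty, ext₁_nil, swap_j₁]
    · have hT : (S₁.map ι₁ ∪ (∅ : Finset τ).map ι₂).Nonempty := by
        simpa using Finset.nonempty_of_ne_empty hS
      rw [antisymm_of_nonempty _ hT]
      refine Finset.sum_eq_zero fun x hx => ?_
      simp only [Finset.map_empty, Finset.union_empty] at hx
      obtain ⟨i, hi, rfl⟩ := Finset.mem_map.1 hx
      have := E.swap.head_i₂_ext₁ hψ (Finsupp.single i 1)
      change head k B (E.i₁ _) _ = 0 at this
      rw [← hι₁, this, map_zero, Pi.zero_apply, smul_zero]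
  | succ n ih =>
    have hS₂ : S₂.Nonempty := Finset.card_pos.1 (by omega)
    have hT : (S₁.map ι₁ ∪ S₂.map ι₂).Nonempty := by simp [hS₂]
    rw [antisymm_of_nonempty _ hT, Finset.sum_union (disjoint_map_map h S₁ S₂), Finset.sum_map,
      Finset.sum_map, Finset.sum_eq_zero, zero_add]
    · have : ∀ i ∈ S₂, antisymm k υ B (head k B (Finsupp.single (ι₂ i) 1) (E.swap.ext₁ ψ))
          ((S₁.map ι₁ ∪ S₂.map ι₂).erase (ι₂ i)) = if S₁ = ∅ then
            E.j₂ (antisymm k τ B₂ (head k B₂ (Finsupp.single i 1) ψ) (S₂.erase i)) else 0 := by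
        intro i hi
        rw [← hι₂, E.head_ext₂, union_erase_right h, ih (hψ.head _) _
          (by rw [Finset.card_erase_of_mem hi]; omega)]
      rw [Finset.sum_congr rfl fun i hi => by rw [this i hi]]
      split_ifs with hS
      · subst hS
        rw [antisymm_of_nonempty _ hS₂, map_sum]
        simp only [Finset.map_empty, Finset.empty_union, frontSign_map h₂, map_smul]
      · simp
    · intro i _
      have := E.swap.head_i₂_ext₁ hψ (Finsupp.single i 1)
      change head k B (E.i₁ _) _ = 0 at this
      rw [← hι₁, this, map_zero, Pi.zero_apply, smul_zero]

include h₁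

/-- By normalization the first factor of the cup product accepts only variables from `σ` and the
second only variables from `τ`. Only orderings with all of `S₁` before all of `S₂` contribute, and
these carry no extra sign. -/
theorem antisymm_cup_ext {φ : List (σ →₀ ℕ) → B₁} {ψ : List (τ →₀ ℕ) → B₂} (hφ : IsNormalized φ)
    (hψ : IsNormalized ψ) (S₁ : Finset σ) (S₂ : Finset τ) :
    antisymm k υ B (cupHom k (υ →₀ ℕ) B (E.ext₁ φ) (E.swap.ext₁ ψ)) (S₁.map ι₁ ∪ S₂.map ι₂) =
      E.j₁ (antisymm k σ B₁ φ S₁) * E.j₂ (antisymm k τ B₂ ψ S₂) := by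
  have hc : ∀ (φ : List (σ →₀ ℕ) → B₁) (a : υ →₀ ℕ), head k B a (cupHom k (υ →₀ ℕ) B (E.ext₁ φ) (E.swap.ext₁ ψ)) =
      postcomp (LinearMap.mulLeft k (E.j₁ (φ []))) (head k B a (E.swap.ext₁ ψ)) +
        cupHom k (υ →₀ ℕ) B (head k B a (E.ext₁ φ)) (E.swap.ext₁ ψ) := by
    intro φ a
    funext l
    rw [head_apply, cupHom_cons, ext₁_nil]
    rfl
  have hc₂ : ∀ (S₁ : Finset σ) {φ : List (σ →₀ ℕ) → B₁}, IsNormalized φ → ∀ i ∈ S₂,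
      antisymm k υ B (head k B (Finsupp.single (ι₂ i) 1)
      (cupHom k (υ →₀ ℕ) B (E.ext₁ φ) (E.swap.ext₁ ψ)))
      ((S₁.map ι₁ ∪ S₂.map ι₂).erase (ι₂ i)) = if S₁ = ∅ then E.j₁ (φ []) *
        E.j₂ (antisymm k τ B₂ (head k B₂ (Finsupp.single i 1) ψ) (S₂.erase i)) else 0 := by
    intro S₁ φ hφ i hi
    rw [← hι₂, hc, E.head_i₂_ext₁ hφ, map_zero, LinearMap.zero_apply, add_zero, antisymm_postcomp,
      E.head_ext₂, union_erase_right h, antisymm_ext₂ E h₂ h hι₁ hι₂ (hψ.head _)]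
    split_ifs <;> simp
  induction hn : S₁.card generalizing φ S₁ with
  | zero =>
    obtain rfl := Finset.card_eq_zero.1 hn
    rcases S₂.eq_empty_or_nonempty with rfl | hS₂
    · simp [antisymm_empty, ext₁_nil, cupHom_nil, swap_j₁]
    · have hT : ((∅ : Finset σ).map ι₁ ∪ S₂.map ι₂).Nonempty := by simp [hS₂]
      rw [antisymm_of_nonempty _ hT, Finset.sum_union (disjoint_map_map h _ S₂), Finset.map_empty,
        Finset.sum_empty, zero_add, Finset.sum_map]
      have := hc₂ ∅ hφ
      rw [Finset.map_empty] at this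
      rw [Finset.sum_congr rfl fun i hi => by rw [this i hi], antisymm_empty,
        antisymm_of_nonempty _ hS₂, map_sum, Finset.mul_sum]
      simp only [if_true, Finset.empty_union, frontSign_map h₂, map_smul, mul_smul_comm]
  | succ n ih =>
    have hS₁ : S₁.Nonempty := Finset.card_pos.1 (by omega)
    have hT : (S₁.map ι₁ ∪ S₂.map ι₂).Nonempty := by simp [hS₁]
    rw [antisymm_of_nonempty _ hT, Finset.sum_union (disjoint_map_map h S₁ S₂), Finset.sum_map,
      Finset.sum_map, antisymm_of_nonempty φ hS₁, map_sum, Finset.sum_mul,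
      Finset.sum_eq_zero (s := S₂) fun i hi => by
        rw [hc₂ S₁ hφ i hi, if_neg hS₁.ne_empty, smul_zero], add_zero]
    refine Finset.sum_congr rfl fun i hi => ?_
    have h0 : head k B (E.i₁ (Finsupp.single i 1)) (E.swap.ext₁ ψ) = 0 :=
      E.swap.head_i₂_ext₁ hψ (Finsupp.single i 1)
    rw [← hι₁, hc, h0, map_zero, zero_add, E.head_i₁_ext₁, union_erase_left h,
      frontSign_union h₁ h]
    rw [ih (hφ.head _) (S₁.erase i) (by rw [Finset.card_erase_of_mem hi]; omega), map_smul,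
      smul_mul_assoc]

end ExternalProduct

/-! ### Evaluation of multilinear cochains on monomials -/

namespace ListCochain

section Formula

variable {k Mo M : Type*} [CommRing k] [AddCommMonoid Mo] [AddCommGroup M] [Module k M]

theorem contractNth_zero_cons {α : Type*} (op : α → α → α) {n : ℕ} (a b : α) (w : Fin n → α) :
    Fin.contractNth 0 op (Fin.cons a (Fin.cons b w : Fin (n + 1) → α) : Fin (n + 2) → α) =
      (Fin.cons (op a b) w : Fin (n + 1) → α) := by
  funext i
  refine Fin.cases ?_ (fun i => ?_) i <;> simp [Fin.contractNth] <;> rfl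

theorem contractNth_succ_cons {α : Type*} (op : α → α → α) {n : ℕ} (i : Fin (n + 1)) (a : α)
    (w : Fin (n + 1) → α) :
    Fin.contractNth i.succ op (Fin.cons a w : Fin (n + 2) → α) =
      (Fin.cons a (Fin.contractNth i op w) : Fin (n + 1) → α) := by
  funext j
  refine Fin.cases ?_ (fun j => ?_) j
  · simp [Fin.contractNth]
  · simp only [Fin.contractNth, Fin.val_succ, Fin.cons_succ, Nat.add_lt_add_iff_right,
      Nat.add_right_cancel_iff, ← Fin.succ_castSucc]

/-- Unrolling the recursion gives the textbook sums over insertions and contractions; this is the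
bridge to the definition of the differential by multilinear maps. -/
theorem inner_ofFn (S : BiAct k Mo M) (W : Mo →₀ k) (f : List Mo → M) {n : ℕ}
    (v : Fin (n + 1) → Mo) :
    inner S W f (List.ofFn v) =
      ∑ i : Fin (n + 2), (-1 : k) ^ (i : ℕ) • ∑ m ∈ W.support, W m • f (List.ofFn (i.insertNth m v)) -
      ∑ i : Fin n, (-1 : k) ^ (i : ℕ) • f (List.ofFn (Fin.contractNth i.castSucc (· + ·) v)) -
      (-1 : k) ^ n • S.rho (v (Fin.last n)) (f (List.ofFn (Fin.init v))) := by
  induction n generalizing f with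
  | zero =>
    obtain ⟨a, w, rfl⟩ : ∃ a, ∃ w : Fin 0 → Mo, v = Fin.cons a w :=
      ⟨v 0, Fin.tail v, (Fin.cons_self_tail v).symm⟩
    rw [List.ofFn_cons, List.ofFn_zero, inner_cons, inner_nil, mergeHead_nil, headSum_apply,
      headSum_apply]
    have h1 : ∀ m, List.ofFn (Fin.insertNth (1 : Fin 2) m (Fin.cons a w : Fin 1 → Mo)) = [a, m] := by
      intro m
      have := Fin.insertNth_succ_cons (0 : Fin 1) m a w
      rw [show (1 : Fin 2) = Fin.succ 0 from rfl, this]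
      simp
    have h2 : Fin.init (Fin.cons a w : Fin 1 → Mo) = w := Subsingleton.elim _ _
    rw [Fin.sum_univ_two, h2, List.ofFn_zero]
    simp only [h1, Fin.insertNth_zero', List.ofFn_cons, List.ofFn_zero, Fin.val_zero, pow_zero,
      Fin.val_one, pow_one, one_smul, neg_smul, Finset.univ_eq_empty, Finset.sum_empty, sub_zero,
      head_apply]
    change _ = _ - S.rho a (f [])
    abel
  | succ n ih =>
    obtain ⟨a, w, rfl⟩ : ∃ a, ∃ w : Fin (n + 1) → Mo, v = Fin.cons a w :=
      ⟨v 0, Fin.tail v, (Fin.cons_self_tail v).symm⟩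
    have h1 : mergeHead S a f (List.ofFn w) =
        f (List.ofFn (Fin.contractNth 0 (· + ·) (Fin.cons a w : Fin (n + 2) → Mo))) := by
      obtain ⟨b, w, rfl⟩ : ∃ b, ∃ w' : Fin n → Mo, w = Fin.cons b w' :=
        ⟨w 0, Fin.tail w, (Fin.cons_self_tail w).symm⟩
      rw [contractNth_zero_cons, List.ofFn_cons, List.ofFn_cons, mergeHead_cons]
    have h2 : Fin.init (Fin.cons a w : Fin (n + 2) → Mo) = Fin.cons a (Fin.init w) := by
      funext j
      refine Fin.cases ?_ (fun j => ?_) j <;> rfl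
    rw [List.ofFn_cons, inner_cons, ih, h1, h2, Fin.sum_univ_succ (n := n + 2),
      Fin.sum_univ_succ (n := n), headSum_apply]
    simp only [Fin.insertNth_zero', Fin.insertNth_succ_cons, List.ofFn_cons, head_apply,
      Fin.val_zero, pow_zero, one_smul, Fin.val_succ, pow_succ, mul_neg, mul_one, neg_smul,
      Finset.sum_neg_distrib, ← Fin.succ_castSucc, contractNth_succ_cons, Fin.castSucc_zero,
      ← Fin.succ_last, Fin.cons_succ]
    abel

end Formula

end ListCochain

section Evaluation

open ListCochain MvPolynomial

variable {k υ B : Type*} [CommRing k] [Ring B] [Algebra k B]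

variable (k υ B) in
/-- The values of a cochain on monomials. -/
def evalMonomials : CompactCochains k (MvPolynomial υ k) B →ₗ[k] (List (υ →₀ ℕ) → B) where
  toFun x l := x l.length (fun i => monomial (l.get i) 1)
  map_add' x y := funext fun l => rfl
  map_smul' c x := funext fun l => rfl

theorem evalMonomials_apply (x : CompactCochains k (MvPolynomial υ k) B) (l : List (υ →₀ ℕ)) :
    evalMonomials k υ B x l = x l.length (fun i => monomial (l.get i) 1) := rfl

theorem evalMonomials_of_ne {p : ℕ} (φ : Cochain k (MvPolynomial υ k) B p)
    {l : List (υ →₀ ℕ)} (hl : l.length ≠ p) :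
    evalMonomials k υ B (DirectSum.of _ p φ) l = 0 := by
  rw [evalMonomials_apply, DirectSum.of_eq_of_ne _ _ _ hl]
  rfl

theorem evalMonomials_ofFn (x : CompactCochains k (MvPolynomial υ k) B) {p : ℕ}
    (v : Fin p → (υ →₀ ℕ)) :
    evalMonomials k υ B x (List.ofFn v) = x p (fun i => monomial (v i) 1) := by
  have key : ∀ (n : ℕ) (h : n = p) (g : Fin n → (υ →₀ ℕ)), (∀ i, g i = v (Fin.cast h i)) →
      x n (fun i => monomial (g i) 1) = x p (fun i => monomial (v i) 1) := by
    rintro n rfl g hg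
    exact congrArg _ (funext fun i => by rw [hg]; rfl)
  exact key _ List.length_ofFn _ fun i => List.get_ofFn _ _

theorem evalMonomials_of_ofFn {p : ℕ} (φ : Cochain k (MvPolynomial υ k) B p)
    (v : Fin p → (υ →₀ ℕ)) :
    evalMonomials k υ B (DirectSum.of _ p φ) (List.ofFn v) = φ (fun i => monomial (v i) 1) := by
  rw [evalMonomials_ofFn, DirectSum.of_eq_same]

theorem exists_eq_ofFn {α : Type*} {l : List α} {p : ℕ} (hl : l.length = p) :
    ∃ v : Fin p → α, l = List.ofFn v := by
  subst hl
  exact ⟨l.get, (List.ofFn_get l).symm⟩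

theorem evalMonomials_injective : Function.Injective (evalMonomials k υ B) := by
  rw [injective_iff_map_eq_zero]
  intro x hx
  refine DFinsupp.ext fun p => ?_
  refine Module.Basis.ext_multilinear (fun _ : Fin p => basisMonomials υ k) fun v => ?_
  have := congrFun hx (List.ofFn v)
  rw [evalMonomials_ofFn] at this
  rw [coe_basisMonomials]
  exact this

theorem exists_multilinear_monomials {M : Type*} [AddCommGroup M] [Module k M] (p : ℕ)
    (f : (Fin p → (υ →₀ ℕ)) → M) :
    ∃ φ : MultilinearMap k (fun _ : Fin p => MvPolynomial υ k) M,
      ∀ v, φ (fun i => monomial (v i) 1) = f v := by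
  induction p with
  | zero =>
    refine ⟨MultilinearMap.constOfIsEmpty k _ (f default), fun v => ?_⟩
    rw [Subsingleton.elim v default]
    rfl
  | succ p ih =>
    choose φ hφ using fun a => ih (fun v => f (Fin.cons a v))
    refine ⟨LinearMap.uncurryLeft ((basisMonomials υ k).constr k φ), fun v => ?_⟩
    have h1 := (basisMonomials υ k).constr_basis k φ (v 0)
    rw [coe_basisMonomials] at h1
    rw [LinearMap.uncurryLeft_apply, h1]
    refine (hφ (v 0) (Fin.tail v)).trans ?_
    rw [Fin.cons_self_tail]

theorem exists_evalMonomials_eq (f : List (υ →₀ ℕ) → B) (n : ℕ) (hf : ∀ l, n ≤ l.length → f l = 0) :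
    ∃ x, evalMonomials k υ B x = f := by
  have h : ∀ p : ℕ, ∃ φ : Cochain k (MvPolynomial υ k) B p, ∀ v : Fin p → (υ →₀ ℕ),
      φ (fun i => monomial (v i) 1) = f (List.ofFn v) := fun p =>
    exists_multilinear_monomials p (fun v => f (List.ofFn v))
  choose φ hφ using h
  refine ⟨∑ p ∈ Finset.range n, DirectSum.of (Cochain k (MvPolynomial υ k) B) p (φ p), ?_⟩
  funext l
  obtain ⟨v, hv⟩ := exists_eq_ofFn (rfl : l.length = _)
  rw [map_sum, Finset.sum_apply]
  rcases lt_or_ge l.length n with h | h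
  · rw [Finset.sum_eq_single l.length]
    · generalize l.length = p at *
      subst hv
      rw [evalMonomials_of_ofFn]
      exact hφ _ _
    · intro p _ hp
      exact evalMonomials_of_ne _ (Ne.symm hp)
    · intro h'
      exact absurd (Finset.mem_range.2 h) h'
  · rw [hf l h]
    exact Finset.sum_eq_zero fun p hp => evalMonomials_of_ne _ (by
      have := Finset.mem_range.1 hp; omega)

theorem exists_evalMonomials_bound (x : CompactCochains k (MvPolynomial υ k) B) :
    ∃ n : ℕ, ∀ l, n ≤ l.length → evalMonomials k υ B x l = 0 := by
  induction x using DirectSum.induction_on with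
  | zero => exact ⟨0, fun l _ => by simp⟩
  | add x y hx hy =>
    obtain ⟨n, hn⟩ := hx
    obtain ⟨m, hm⟩ := hy
    exact ⟨n + m, fun l hl => by
      rw [map_add, Pi.add_apply, hn l (by omega), hm l (by omega), add_zero]⟩
  | of p φ => exact ⟨p + 1, fun l hl => evalMonomials_of_ne _ (by omega)⟩

theorem evalMonomials_one : evalMonomials k υ B 1 [] = 1 := rfl

theorem evalMonomials_mul (x y : CompactCochains k (MvPolynomial υ k) B) :
    evalMonomials k υ B (x * y) =
      cupHom k (υ →₀ ℕ) B (evalMonomials k υ B x) (evalMonomials k υ B y) := by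
  induction x using DirectSum.induction_on with
  | zero => simp
  | add x x' hx hx' => simp only [add_mul, map_add, hx, hx', LinearMap.add_apply]
  | of p φ =>
    induction y using DirectSum.induction_on with
    | zero => simp
    | add y y' hy hy' => simp only [mul_add, map_add, hy, hy']
    | of q ψ =>
      funext l
      rw [of_mul_of, cupHom_eq_sum]
      by_cases hl : l.length = p + q
      · obtain ⟨v, hv⟩ := exists_eq_ofFn (l := l.take p) (p := p) (by simp [hl])
        obtain ⟨w, hw⟩ := exists_eq_ofFn (l := l.drop p) (p := q) (by simp [hl])
        have hlvw : l = List.ofFn (Fin.append v w) := by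
          rw [List.ofFn_fin_append, ← hv, ← hw, List.take_append_drop]
        rw [Finset.sum_eq_single p]
        · rw [hv, hw, evalMonomials_of_ofFn, evalMonomials_of_ofFn, hlvw, evalMonomials_of_ofFn,
            cup_apply]
          simp only [Fin.append_left, Fin.append_right]
        · intro i hi hip
          rw [evalMonomials_of_ne φ, zero_mul]
          have := Finset.mem_range.1 hi
          simp only [List.length_take]
          omega
        · intro h
          exact absurd (Finset.mem_range.2 (by omega)) h
      · rw [evalMonomials_of_ne _ hl, Finset.sum_eq_zero]
        intro i hi
        by_cases h : (l.take i).length = p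
        · rw [evalMonomials_of_ne ψ, mul_zero]
          intro h'
          refine hl ?_
          rw [← h, ← h', ← List.length_append, List.take_append_drop]
        · rw [evalMonomials_of_ne φ h, zero_mul]

theorem evalMonomials_signInv (x : CompactCochains k (MvPolynomial υ k) B) :
    evalMonomials k υ B (signInv k _ B x) = parSign k (υ →₀ ℕ) B (evalMonomials k υ B x) := by
  induction x using DirectSum.induction_on with
  | zero => simp
  | add x y hx hy => simp only [map_add, hx, hy]
  | of p φ =>
    funext l
    rw [signInv_of, map_smul, parSign_apply, Pi.smul_apply]
    by_cases hl : l.length = p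
    · rw [hl]
    · rw [evalMonomials_of_ne φ hl, smul_zero, smul_zero]

/-- The images of the monomials under a morphism from a polynomial algebra. -/
def monomialHom (η : MvPolynomial υ k →ₐ[k] B) : Multiplicative (υ →₀ ℕ) →* B where
  toFun a := η (monomial a.toAdd 1)
  map_one' := by
    rw [toAdd_one, ← C_apply, map_one, map_one]
  map_mul' a b := by
    rw [← map_mul, monomial_mul, one_mul, toAdd_mul]

theorem monomialHom_apply (η : MvPolynomial υ k →ₐ[k] B) (a : υ →₀ ℕ) :
    monomialHom η (.ofAdd a) = η (monomial a 1) := rfl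

variable (η : MvPolynomial υ k →ₐ[k] B)

theorem evalMonomials_structureCochain_mul (x : CompactCochains k (MvPolynomial υ k) B) :
    evalMonomials k υ B (structureCochain η * x) =
      outer (mulAct (k := k) (monomialHom η)) (evalMonomials k υ B x) := by
  have h1 : ∀ l : List (υ →₀ ℕ), l.length ≠ 1 → evalMonomials k υ B (structureCochain η) l = 0 :=
    fun l hl => evalMonomials_of_ne _ hl
  rw [evalMonomials_mul]
  funext l
  cases l with
  | nil => rw [cupHom_nil, h1 _ (by simp), zero_mul, outer_nil]
  | cons a l =>
    rw [cupHom_eq_sum, Finset.sum_eq_single 1]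
    · rfl
    · intro i hi hi1
      have := Finset.mem_range.1 hi
      rw [h1 _ (by simp only [List.length_take]; omega), zero_mul]
    · intro h
      exact absurd (Finset.mem_range.2 (by simp)) h

theorem evalMonomials_mul_structureCochain (x : CompactCochains k (MvPolynomial υ k) B) {n : ℕ}
    (v : Fin (n + 1) → (υ →₀ ℕ)) :
    evalMonomials k υ B (x * structureCochain η) (List.ofFn v) =
      evalMonomials k υ B x (List.ofFn (Fin.init v)) * η (monomial (v (Fin.last n)) 1) := by
  have h1 : ∀ l : List (υ →₀ ℕ), l.length ≠ 1 → evalMonomials k υ B (structureCochain η) l = 0 :=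
    fun l hl => evalMonomials_of_ne _ hl
  have h2 : List.ofFn v = List.ofFn (Fin.init v) ++ [v (Fin.last n)] := by
    rw [List.ofFn_succ_last]; rfl
  have h3 : (List.ofFn (Fin.init v)).length = n := List.length_ofFn
  rw [evalMonomials_mul, cupHom_eq_sum, h2, Finset.sum_eq_single n]
  · rw [List.take_left' h3, List.drop_left' h3]
    rfl
  · intro i hi hin
    have := Finset.mem_range.1 hi
    rw [h1, mul_zero]
    simp only [List.length_append, List.length_drop, List.length_cons, List.length_nil, h3] at this ⊢
    omega
  · intro h
    exact absurd (Finset.mem_range.2 (by simp [h3])) h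

theorem evalMonomials_braceProduct {p : ℕ} (φ : Cochain k (MvPolynomial υ k) B p) {n : ℕ}
    (v : Fin (n + 1) → (υ →₀ ℕ)) :
    evalMonomials k υ B (braceProduct k _ B (DirectSum.of _ p φ)) (List.ofFn v) =
      ∑ i : Fin n, (-1 : k) ^ (i : ℕ) • evalMonomials k υ B (DirectSum.of _ p φ)
        (List.ofFn (Fin.contractNth i.castSucc (· + ·) v)) := by
  rw [braceProduct_of, map_sum, Finset.sum_apply]
  by_cases h : n = p
  · subst h
    refine Finset.sum_congr rfl fun i _ => ?_
    rw [map_smul, Pi.smul_apply, evalMonomials_of_ofFn, evalMonomials_of_ofFn, contract_apply]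
    congr 2
    funext j
    simp only [Fin.contractNth]
    split_ifs
    · rfl
    · rw [monomial_mul, one_mul]
    · rfl
  · rw [Finset.sum_eq_zero, Finset.sum_eq_zero]
    · intro i _
      rw [evalMonomials_of_ne, smul_zero]
      rwa [List.length_ofFn]
    · intro i _
      rw [map_smul, Pi.smul_apply, evalMonomials_of_ne, smul_zero]
      rw [List.length_ofFn]
      omega

theorem evalMonomials_curvingDifferential (W : MvPolynomial υ k) {p : ℕ}
    (φ : Cochain k (MvPolynomial υ k) B p) {n : ℕ} (v : Fin n → (υ →₀ ℕ)) :
    evalMonomials k υ B (curvingDifferential k B W (DirectSum.of _ p φ)) (List.ofFn v) =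
      ∑ i : Fin (n + 1), (-1 : k) ^ (i : ℕ) • ∑ m ∈ ((basisMonomials υ k).repr W).support,
        (basisMonomials υ k).repr W m • evalMonomials k υ B (DirectSum.of _ p φ)
          (List.ofFn (i.insertNth m v : Fin (n + 1) → (υ →₀ ℕ))) := by
  rw [curvingDifferential_of, map_sum, Finset.sum_apply]
  by_cases h : p = n + 1
  · subst h
    refine Finset.sum_congr rfl fun i _ => ?_
    rw [map_smul, Pi.smul_apply]
    congr 1
    have h1 := evalMonomials_of_ofFn (insert W i φ) v
    refine h1.trans ?_
    -- The cochain is linear in the slot receiving `W`, so `W` may be replaced by its expansion in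
    -- monomials.
    let L : MvPolynomial υ k →ₗ[k] B :=
      { toFun := fun x => insert x i φ (fun i => monomial (v i) 1)
        map_add' := fun x y => by
          have := Cochain.map_update_add φ (i.insertNth 0 fun i => monomial (v i) 1) i x y
          simp only [Fin.update_insertNth] at this
          exact this
        map_smul' := fun c x => by
          have := Cochain.map_update_smul φ (i.insertNth 0 fun i => monomial (v i) 1) i c x
          simp only [Fin.update_insertNth] at this
          exact this }
    have h2 : L W = ∑ m ∈ ((basisMonomials υ k).repr W).support,
        (basisMonomials υ k).repr W m • L (monomial m 1) := by
      conv_lhs => rw [← (basisMonomials υ k).linearCombination_repr W,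
        Finsupp.linearCombination_apply, Finsupp.sum, map_sum]
      simp only [map_smul, coe_basisMonomials]
    refine h2.trans (Finset.sum_congr rfl fun m _ => ?_)
    rw [evalMonomials_of_ofFn]
    refine congrArg _ (congrArg φ ?_ : φ (i.insertNth (monomial m 1) fun i => monomial (v i) 1) = _)
    funext j
    refine Fin.succAboveCases i ?_ (fun j => ?_) j <;> simp
  · rw [Finset.sum_eq_zero, Finset.sum_eq_zero]
    · intro i _
      rw [Finset.sum_eq_zero, smul_zero]
      intro m _
      rw [evalMonomials_of_ne, smul_zero]
      rw [List.length_ofFn]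
      omega
    · intro i _
      rw [map_smul, Pi.smul_apply, evalMonomials_of_ne, smul_zero]
      rw [List.length_ofFn]
      have := i.isLt
      omega

/-- The left multiplication by the structure cochain is `outer`; the curving, the contractions and
the right multiplication together are the closed form of `inner`. -/
theorem evalMonomials_curvedDifferential (W : MvPolynomial υ k)
    (x : CompactCochains k (MvPolynomial υ k) B) :
    evalMonomials k υ B (curvedDifferential η W x) =
      diff (mulAct (monomialHom η)) ((basisMonomials υ k).repr W) (evalMonomials k υ B x) := by
  induction x using DirectSum.induction_on with
  | zero => simp
  | add x y hx hy => simp only [map_add, hx, hy]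
  | of p φ =>
    set X := DirectSum.of (Cochain k (MvPolynomial υ k) B) p φ with hX
    have h : curvedDifferential η W X = structureCochain η * X +
        (curvingDifferential k B W X - braceProduct k _ B X -
          signInv k _ B X * structureCochain η) := by
      simp only [curvedDifferential, hochschildDifferential, LinearMap.add_apply,
        LinearMap.sub_apply, LinearMap.comp_apply, LinearMap.mulLeft_apply,
        LinearMap.mulRight_apply]
      abel
    rw [diff_eq, h, map_add, map_sub, map_sub, evalMonomials_structureCochain_mul]
    congr 1
    funext l
    obtain ⟨v, hv⟩ := exists_eq_ofFn (rfl : l.length = _)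
    generalize l.length = n at v hv
    subst hv
    simp only [Pi.sub_apply]
    rw [evalMonomials_curvingDifferential]
    cases n with
    | zero =>
      have h1 : evalMonomials k υ B (signInv k _ B X * structureCochain η) [] = 0 := by
        rw [evalMonomials_mul, cupHom_nil, structureCochain, evalMonomials_of_ne _ (by simp),
          mul_zero]
      have h2 : evalMonomials k υ B (braceProduct k _ B X) [] = 0 := by
        rw [braceProduct_of, map_sum, Finset.sum_apply]
        refine Finset.sum_eq_zero fun i _ => ?_
        rw [map_smul, Pi.smul_apply, evalMonomials_of_ne _ (by simp), smul_zero]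
      rw [List.ofFn_zero, h1, h2, inner_nil, headSum_apply, hX]
      simp
    | succ n =>
      rw [evalMonomials_mul_structureCochain, evalMonomials_braceProduct, inner_ofFn,
        evalMonomials_signInv, parSign_apply, List.length_ofFn]
      simp only [mulAct_rho, smul_mul_assoc, monomialHom_apply, hX]

end Evaluation

/-! ### Cochains of bounded degree and the degree filtration -/

namespace ListCochain

section Bounded

variable {k Mo M : Type*} [CommRing k] [AddCommMonoid Mo] [AddCommGroup M] [Module k M]

variable (k Mo M) in
/-- The functions vanishing on lists of length at least `n`, normalized if `nrm` holds. -/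
def truncated (nrm : Prop) (n : ℕ) : Submodule k (List Mo → M) where
  carrier := {f | (∀ l, n ≤ l.length → f l = 0) ∧ (nrm → IsNormalized f)}
  zero_mem' := ⟨fun _ _ => rfl, fun _ _ _ => rfl⟩
  add_mem' hf hg := ⟨fun l hl => by rw [Pi.add_apply, hf.1 l hl, hg.1 l hl, add_zero],
    fun h l hl => by rw [Pi.add_apply, hf.2 h l hl, hg.2 h l hl, add_zero]⟩
  smul_mem' c f hf := ⟨fun l hl => by rw [Pi.smul_apply, hf.1 l hl, smul_zero],
    fun h l hl => by rw [Pi.smul_apply, hf.2 h l hl, smul_zero]⟩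

theorem truncated_mono (nrm : Prop) : Monotone (truncated k Mo M nrm) := fun _ _ h _ hf =>
  ⟨fun l hl => hf.1 l (h.trans hl), hf.2⟩

theorem truncated_zero (nrm : Prop) : truncated k Mo M nrm 0 = ⊥ := by
  rw [eq_bot_iff]
  exact fun f hf => funext fun l => hf.1 l (Nat.zero_le _)

variable (k Mo M) in
/-- The functions of bounded degree, normalized if `nrm` holds. -/
def bounded (nrm : Prop) : Submodule k (List Mo → M) where
  carrier := {f | ∃ n, f ∈ truncated k Mo M nrm n}
  zero_mem' := ⟨0, zero_mem _⟩
  add_mem' := by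
    rintro f g ⟨n, hn⟩ ⟨m, hm⟩
    exact ⟨n + m, add_mem (truncated_mono nrm (Nat.le_add_right n m) hn)
      (truncated_mono nrm (Nat.le_add_left m n) hm)⟩
  smul_mem' c f := by
    rintro ⟨n, hn⟩
    exact ⟨n, Submodule.smul_mem _ c hn⟩

variable (k Mo M) in
/-- The filtration of the functions of bounded degree by the degree. -/
def filtration (nrm : Prop) (n : ℕ) : Submodule k (bounded k Mo M nrm) :=
  (truncated k Mo M nrm n).comap (bounded k Mo M nrm).subtype

theorem filtration_mono (nrm : Prop) : Monotone (filtration k Mo M nrm) := fun _ _ h _ hf =>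
  truncated_mono (k := k) nrm h hf

theorem filtration_zero (nrm : Prop) : filtration k Mo M nrm 0 = ⊥ := by
  rw [eq_bot_iff]
  intro f hf
  have : (f : List Mo → M) ∈ truncated k Mo M nrm 0 := hf
  rw [truncated_zero, Submodule.mem_bot] at this
  exact Subtype.ext this

theorem exists_mem_filtration {nrm : Prop} (f : bounded k Mo M nrm) :
    ∃ n, f ∈ filtration k Mo M nrm n := f.2

theorem parSign_mem_truncated {nrm : Prop} {n : ℕ} {f : List Mo → M}
    (hf : f ∈ truncated k Mo M nrm n) : parSign k Mo M f ∈ truncated k Mo M nrm n :=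
  ⟨fun l hl => by rw [parSign_apply, hf.1 l hl, smul_zero],
    fun h l hl => by rw [parSign_apply, hf.2 h l hl, smul_zero]⟩

variable (S : BiAct k Mo M)

theorem diff_mem_truncated (W : Mo →₀ k) {nrm : Prop} {n : ℕ} {f : List Mo → M}
    (hf : f ∈ truncated k Mo M nrm n) : diff S W f ∈ truncated k Mo M nrm (n + 1) := by
  refine ⟨fun l hl => ?_, fun h => (hf.2 h).diff S W⟩
  rw [diff_congr S W (g := 0) (fun l' h => hf.1 l' (by omega)) (fun l' h _ => hf.1 l' (by omega)),
    map_zero]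
  rfl

/-- The difference is the curving part, which lowers the degree. The Hochschild part alone raises
the filtration, and this part is the one that the homotopies contract. -/
theorem diff_sub_mem_truncated (W : Mo →₀ k) {nrm : Prop} {n : ℕ} {f : List Mo → M}
    (hf : f ∈ truncated k Mo M nrm n) :
    diff S W f - diff S 0 f ∈ truncated k Mo M nrm n := by
  refine ⟨fun l hl => ?_, fun h l hl => ?_⟩
  · rw [Pi.sub_apply, diff_eq_diff_zero S W fun l' h => hf.1 l' (by omega), sub_self]
  · rw [Pi.sub_apply, (hf.2 h).diff S W l hl, (hf.2 h).diff S 0 l hl, sub_self]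

/-- The curved differential on functions of bounded degree. -/
def boundedDiff (W : Mo →₀ k) (nrm : Prop) : bounded k Mo M nrm →ₗ[k] bounded k Mo M nrm :=
  (diff S W).restrict fun _ ⟨n, hn⟩ => ⟨n + 1, diff_mem_truncated S W hn⟩

variable (k Mo M) in
/-- The parity sign on functions of bounded degree. -/
def boundedSign (nrm : Prop) : bounded k Mo M nrm →ₗ[k] bounded k Mo M nrm :=
  (parSign k Mo M).restrict fun _ ⟨n, hn⟩ => ⟨n, parSign_mem_truncated hn⟩

theorem boundedSign_boundedSign (nrm : Prop) (f : bounded k Mo M nrm) :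
    boundedSign k Mo M nrm (boundedSign k Mo M nrm f) = f := Subtype.ext (parSign_parSign _)

theorem boundedDiff_boundedSign (W : Mo →₀ k) (nrm : Prop) (f : bounded k Mo M nrm) :
    boundedDiff S W nrm (boundedSign k Mo M nrm f) =
      - boundedSign k Mo M nrm (boundedDiff S W nrm f) := Subtype.ext (diff_parSign S W _)

theorem boundedDiff_zero_zero (nrm : Prop) (f : bounded k Mo M nrm) :
    boundedDiff S 0 nrm (boundedDiff S 0 nrm f) = 0 := Subtype.ext (diff_zero_diff_zero S _)

theorem boundedDiff_boundedDiff (W : Mo →₀ k) (nrm : Prop)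
    (hW : ∀ x, ∑ m ∈ W.support, W m • S.lam m x = ∑ m ∈ W.support, W m • S.rho m x)
    (f : bounded k Mo M nrm) : boundedDiff S W nrm (boundedDiff S W nrm f) = 0 := by
  refine Subtype.ext (funext fun l => ?_)
  exact (diff_diff S W f l).trans (by rw [hW, sub_self]; rfl)

theorem boundedDiff_mem_filtration (W : Mo →₀ k) {nrm : Prop} {n : ℕ} {f : bounded k Mo M nrm}
    (hf : f ∈ filtration k Mo M nrm n) : boundedDiff S W nrm f ∈ filtration k Mo M nrm (n + 1) :=
  diff_mem_truncated S W hf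

theorem boundedSign_mem_filtration {nrm : Prop} {n : ℕ} {f : bounded k Mo M nrm}
    (hf : f ∈ filtration k Mo M nrm n) : boundedSign k Mo M nrm f ∈ filtration k Mo M nrm n :=
  parSign_mem_truncated hf

theorem boundedDiff_sub_mem_filtration (W : Mo →₀ k) {nrm : Prop} {n : ℕ} {f : bounded k Mo M nrm}
    (hf : f ∈ filtration k Mo M nrm n) :
    (boundedDiff S W nrm - boundedDiff S 0 nrm) f ∈ filtration k Mo M nrm n :=
  diff_sub_mem_truncated S W hf

end Bounded

section Homotopy

variable {k σ M : Type} [Field k] [LinearOrder σ] [Fintype σ] [AddCommGroup M] [Module k M]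
  (S : BiAct k (σ →₀ ℕ) M)

variable (k σ M) in
/-- The restriction to the Koszul complex of functions of bounded degree. -/
def boundedAntisymm (nrm : Prop) : bounded k (σ →₀ ℕ) M nrm →ₗ[k] (Finset σ → M) :=
  antisymm k σ M ∘ₗ (bounded k (σ →₀ ℕ) M nrm).subtype

/-- The Koszul homotopy preserves boundedness and lowers the filtration because it lowers the degree
by exactly one. For the same reason it anticommutes with the parity sign. -/
theorem exists_bounded_homotopy (nrm : Prop) :
    ∃ h : bounded k (σ →₀ ℕ) M nrm →ₗ[k] bounded k (σ →₀ ℕ) M nrm,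
      (∀ n, ∀ f ∈ filtration k (σ →₀ ℕ) M nrm (n + 1), h f ∈ filtration k (σ →₀ ℕ) M nrm n) ∧
      (∀ f, h (boundedSign k (σ →₀ ℕ) M nrm f) = - boundedSign k (σ →₀ ℕ) M nrm (h f)) ∧
      (∀ f, boundedAntisymm k σ M nrm f = 0 →
        boundedDiff S 0 nrm (h f) + h (boundedDiff S 0 nrm f) = f) ∧
      (∀ f, boundedAntisymm k σ M nrm
        (boundedDiff S 0 nrm (h f) + h (boundedDiff S 0 nrm f)) = 0) := by
  obtain ⟨h, h1, h2, h3, h4⟩ := exists_koszul_homotopy S nrm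
  have hF : ∀ n, ∀ f ∈ truncated k (σ →₀ ℕ) M nrm (n + 1),
      h f ∈ truncated k (σ →₀ ℕ) M nrm n := fun n f hf =>
    ⟨fun l hl => h1 f l fun l' hl' => hf.1 l' (by omega), h2 f hf.2⟩
  let H : bounded k (σ →₀ ℕ) M nrm →ₗ[k] bounded k (σ →₀ ℕ) M nrm :=
    h.restrict fun f ⟨n, hn⟩ => ⟨n, hF n f (truncated_mono nrm (Nat.le_succ n) hn)⟩
  refine ⟨H, fun n f hf => hF n f hf, fun f => Subtype.ext (funext fun l => ?_),
    fun f hf => Subtype.ext (h3 f (fun hn => ?_) hf), fun f => h4 f (fun hn => ?_)⟩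
  · change h (parSign k _ M (f : List (σ →₀ ℕ) → M)) l =
      - ((-1 : k) ^ l.length • h (f : List (σ →₀ ℕ) → M) l)
    -- The value of `h` at `l` depends only on lists of length `l.length + 1`, where `parSign` is
    -- multiplication by a constant.
    have := h1 (parSign k _ M (f : List (σ →₀ ℕ) → M) - (-1 : k) ^ (l.length + 1) • (f : List (σ →₀ ℕ) → M)) l (by
      intro l' hl'
      rw [Pi.sub_apply, parSign_apply, hl', Pi.smul_apply, sub_self])
    rw [map_sub, map_smul, Pi.sub_apply, sub_eq_zero] at this
    rw [this, pow_succ, Pi.smul_apply]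
    module
  · obtain ⟨n, hn'⟩ := f.2
    exact hn'.2 hn
  · obtain ⟨n, hn'⟩ := f.2
    exact hn'.2 hn

theorem antisymm_mem_truncated {nrm : Prop} {n : ℕ} {f : List (σ →₀ ℕ) → M}
    (hf : f ∈ truncated k (σ →₀ ℕ) M nrm n) (T : Finset σ) (hT : n ≤ T.card) :
    antisymm k σ M f T = 0 := by
  rw [antisymm_congr (g := 0) (fun l hl => hf.1 l (by omega)), map_zero]
  rfl

-- With finitely many variables the Koszul complex ends in degree `Fintype.card σ`, so the section
-- automatically takes values in cochains of bounded degree.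
variable (k σ M) in
theorem exists_bounded_section (nrm : Prop) :
    ∃ j : (Finset σ → M) →ₗ[k] bounded k (σ →₀ ℕ) M nrm,
      (∀ u, boundedAntisymm k σ M nrm (j u) = u) ∧
      ∀ n u, (∀ T : Finset σ, n ≤ T.card → u T = 0) → j u ∈ filtration k (σ →₀ ℕ) M nrm n := by
  obtain ⟨j, h1, h2, h3⟩ := exists_antisymm_section k σ M
  have h4 : ∀ n u, (∀ T : Finset σ, n ≤ T.card → u T = 0) →
      j u ∈ truncated k (σ →₀ ℕ) M nrm n := fun n u hu =>
    ⟨fun l hl => h3 u l fun T hT => hu T (by omega), fun _ => h2 u⟩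
  exact ⟨j.codRestrict _ fun u => ⟨Fintype.card σ + 1, h4 _ u fun T hT => absurd hT (by
    have := T.card_le_univ; omega)⟩, h1, h4⟩

theorem boundedAntisymm_boundedDiff {nrm : Prop} {f : bounded k (σ →₀ ℕ) M nrm}
    (hf : boundedAntisymm k σ M nrm f = 0) :
    boundedAntisymm k σ M nrm (boundedDiff S 0 nrm f) = 0 := by
  change antisymm k σ M (diff S 0 _) = 0
  exact (antisymm_diff S _).trans ((congrArg _ hf).trans (map_zero _))

/-- The inclusion of the normalized functions of bounded degree. -/
def normalizedInclusion (k Mo M : Type*) [CommRing k] [AddCommMonoid Mo] [AddCommGroup M]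
    [Module k M] : bounded k Mo M True →ₗ[k] bounded k Mo M False :=
  Submodule.inclusion fun _ ⟨n, hn⟩ => ⟨n, hn.1, False.elim⟩

/-- Normalized cochains compute the same cohomology as all cochains. -/
theorem exact_cone_normalizedInclusion (W : (σ →₀ ℕ) →₀ k)
    (hW : ∀ x, ∑ m ∈ W.support, W m • S.lam m x = ∑ m ∈ W.support, W m • S.rho m x)
    (x : bounded k (σ →₀ ℕ) M True) (y : bounded k (σ →₀ ℕ) M False)
    (hx : boundedDiff S W True x = 0)
    (hxy : normalizedInclusion k (σ →₀ ℕ) M x = boundedDiff S W False y) :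
    ∃ x' y', boundedDiff S W True x' = x ∧
      normalizedInclusion k (σ →₀ ℕ) M x' - boundedDiff S W False y' = y := by
  obtain ⟨hX, hX1, -, hX3, hX4⟩ := exists_bounded_homotopy S True
  obtain ⟨hY, hY1, -, hY3, -⟩ := exists_bounded_homotopy S False
  obtain ⟨j, hj, hjF⟩ := exists_bounded_section k σ M True
  exact exact_cone_of_retract (boundedDiff S W True) (boundedDiff S 0 True)
    (boundedDiff S W True - boundedDiff S 0 True) (boundedDiff S W False) (boundedDiff S 0 False)
    (boundedDiff S W False - boundedDiff S 0 False) (normalizedInclusion k (σ →₀ ℕ) M) hX hY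
    (boundedAntisymm k σ M True) (boundedAntisymm k σ M False) j
    (fun x => by rw [LinearMap.sub_apply]; abel) (fun x => by rw [LinearMap.sub_apply]; abel)
    (boundedDiff_boundedDiff S W True hW) (boundedDiff_boundedDiff S W False hW)
    (boundedDiff_zero_zero S True) (fun _ => rfl) (fun _ => rfl) (fun _ => rfl) hj
    (fun y hy => boundedAntisymm_boundedDiff S hy) hX3 hX4 hY3
    (filtration k (σ →₀ ℕ) M True) (filtration k (σ →₀ ℕ) M False) (filtration_zero True)
    (filtration_zero False) (filtration_mono True) (filtration_mono False)
    exists_mem_filtration exists_mem_filtration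
    (fun n x hx => boundedDiff_mem_filtration S 0 hx)
    (fun n x hx => boundedDiff_sub_mem_filtration S W hx)
    (fun n x hx => boundedDiff_sub_mem_filtration S W hx) hX1 hY1
    (fun n x hx => ⟨hx.1, False.elim⟩)
    (fun n y hy => hjF n _ fun T hT => antisymm_mem_truncated hy T hT) x y hx hxy

end Homotopy

end ListCochain

/-! ### The external cup product is a quasi-isomorphism -/

namespace ListCochain

variable {k Mo B : Type*} [CommRing k] [AddCommMonoid Mo] [Ring B] [Algebra k B]

/-- Degree at most `p` and degree less than `q` add up to degree less than `p + q`, which explains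
the asymmetric indices. -/
theorem cupHom_mem_truncated {nrm : Prop} {p q : ℕ} {f g : List Mo → B}
    (hf : f ∈ truncated k Mo B nrm (p + 1)) (hg : g ∈ truncated k Mo B nrm q) :
    cupHom k Mo B f g ∈ truncated k Mo B nrm (p + q) := by
  refine ⟨fun l hl => ?_, fun h => (hf.2 h).cupHom (hg.2 h)⟩
  rw [cupHom_eq_sum]
  refine Finset.sum_eq_zero fun i hi => ?_
  have := Finset.mem_range.1 hi
  rcases lt_or_ge p i with h | h
  · rw [hf.1 _ (by rw [List.length_take]; omega), zero_mul]
  · rw [hg.1 _ (by rw [List.length_drop]; omega), mul_zero]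

variable (k Mo B) in
/-- The cup product of functions of bounded degree. -/
def boundedCup (nrm : Prop) :
    bounded k Mo B nrm →ₗ[k] bounded k Mo B nrm →ₗ[k] bounded k Mo B nrm :=
  LinearMap.mk₂ k
    (fun f g => ⟨cupHom k Mo B f g, by
      obtain ⟨⟨f, n, hf⟩, ⟨g, m, hg⟩⟩ := f, g
      exact ⟨n + m, cupHom_mem_truncated (truncated_mono nrm (Nat.le_succ n) hf) hg⟩⟩)
    (fun f f' g => Subtype.ext (by simp))
    (fun c f g => Subtype.ext (by simp))
    (fun f g g' => Subtype.ext (by simp))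
    (fun c f g => Subtype.ext (by simp))

end ListCochain

namespace ExternalProduct

open ListCochain

section Basic

variable {k Mo₁ Mo₂ Mo B₁ B₂ B : Type*} [CommRing k] [AddCommMonoid Mo₁]
    [AddCommMonoid Mo₂] [AddCommMonoid Mo] [Ring B₁] [Algebra k B₁] [Ring B₂] [Algebra k B₂]
    [Ring B] [Algebra k B] (E : ExternalProduct k Mo₁ Mo₂ Mo B₁ B₂ B)

theorem ext₁_mem_truncated {nrm : Prop} {n : ℕ} {φ : List Mo₁ → B₁}
    (hφ : φ ∈ truncated k Mo₁ B₁ nrm n) : E.ext₁ φ ∈ truncated k Mo B nrm n :=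
  ⟨fun l hl => by rw [ext₁_apply, hφ.1 _ (by rwa [List.length_map]), map_zero, zero_mul],
    fun h => E.isNormalized_ext₁ (hφ.2 h)⟩

/-- Extension of normalized cochains of bounded degree from the first factor. -/
def boundedExt : bounded k Mo₁ B₁ True →ₗ[k] bounded k Mo B True :=
  E.ext₁.restrict fun _ ⟨n, hn⟩ => ⟨n, E.ext₁_mem_truncated hn⟩

theorem isNormalized_coe {k Mo M : Type*} [CommRing k] [AddCommMonoid Mo] [AddCommGroup M]
    [Module k M] (f : bounded k Mo M True) : IsNormalized (f : List Mo → M) := by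
  obtain ⟨f, n, hf⟩ := f
  exact hf.2 trivial

theorem boundedDiff_boundedExt (W₁ : Mo₁ →₀ k) (W₂ : Mo₂ →₀ k) (φ : bounded k Mo₁ B₁ True) :
    boundedDiff (mulAct E.u) (E.potential W₁ W₂) True (E.boundedExt φ) =
      E.boundedExt (boundedDiff (mulAct E.u₁) W₁ True φ) :=
  Subtype.ext (E.diff_ext₁ W₁ W₂ (isNormalized_coe φ))

theorem boundedSign_boundedExt (φ : bounded k Mo₁ B₁ True) :
    boundedSign k Mo B True (E.boundedExt φ) = E.boundedExt (boundedSign k Mo₁ B₁ True φ) :=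
  Subtype.ext (E.parSign_ext₁ _)

theorem boundedExt_boundedCup (φ χ : bounded k Mo₁ B₁ True) :
    E.boundedExt (boundedCup k Mo₁ B₁ True φ χ) =
      boundedCup k Mo B True (E.boundedExt φ) (E.boundedExt χ) :=
  Subtype.ext (E.ext₁_cupHom _ _)

/-- The external cup product. -/
def externalCup : bounded k Mo₁ B₁ True ⊗[k] bounded k Mo₂ B₂ True →ₗ[k] bounded k Mo B True :=
  TensorProduct.lift ((boundedCup k Mo B True).compl₁₂ E.boundedExt E.swap.boundedExt)

theorem externalCup_tmul (φ : bounded k Mo₁ B₁ True) (ψ : bounded k Mo₂ B₂ True) :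
    E.externalCup (φ ⊗ₜ ψ) = boundedCup k Mo B True (E.boundedExt φ) (E.swap.boundedExt ψ) := rfl

theorem boundedDiff_boundedCup {W : Mo →₀ k} (f g : bounded k Mo B True) :
    boundedDiff (mulAct E.u) W True (boundedCup k Mo B True f g) =
      boundedCup k Mo B True (boundedDiff (mulAct E.u) W True f) g +
      boundedCup k Mo B True (boundedSign k Mo B True f) (boundedDiff (mulAct E.u) W True g) :=
  Subtype.ext (diff_cupHom E.u W _ _)

/-- The differential on the tensor product of the complexes of normalized cochains. -/
def externalDiff (W₁ : Mo₁ →₀ k) (W₂ : Mo₂ →₀ k) :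
    bounded k Mo₁ B₁ True ⊗[k] bounded k Mo₂ B₂ True →ₗ[k]
      bounded k Mo₁ B₁ True ⊗[k] bounded k Mo₂ B₂ True :=
  tensorDiff (boundedSign k Mo₁ B₁ True) (boundedDiff (mulAct E.u₁) W₁ True)
    (boundedDiff (mulAct E.u₂) W₂ True)

theorem externalCup_externalDiff (W₁ : Mo₁ →₀ k) (W₂ : Mo₂ →₀ k)
    (z : bounded k Mo₁ B₁ True ⊗[k] bounded k Mo₂ B₂ True) :
    E.externalCup (E.externalDiff W₁ W₂ z) =
      boundedDiff (mulAct E.u) (E.potential W₁ W₂) True (E.externalCup z) := by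
  induction z with
  | zero => simp
  | add z w hz hw => simp only [map_add, hz, hw]
  | tmul φ ψ =>
    have h := E.swap.boundedDiff_boundedExt W₂ W₁ ψ
    rw [potential_swap] at h
    rw [externalDiff, tensorDiff_tmul, map_add, externalCup_tmul, externalCup_tmul,
      externalCup_tmul, boundedDiff_boundedCup, boundedDiff_boundedExt, boundedSign_boundedExt]
    exact congrArg₂ _ rfl (congrArg _ h.symm)

/-- The tensor product filtration. -/
def externalFiltration (n : ℕ) :
    Submodule k (bounded k Mo₁ B₁ True ⊗[k] bounded k Mo₂ B₂ True) :=
  Submodule.span k {z | ∃ p q φ ψ, p + q = n ∧ φ ∈ filtration k Mo₁ B₁ True (p + 1) ∧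
    ψ ∈ filtration k Mo₂ B₂ True q ∧ φ ⊗ₜ ψ = z}

/-- As for cup products, `p + 1` in the first factor means degree at most `p`. The tensor then has
total degree less than `n`, and step zero of the filtration is zero. -/
theorem tmul_mem_externalFiltration {p q : ℕ} {φ : bounded k Mo₁ B₁ True}
    {ψ : bounded k Mo₂ B₂ True} (hφ : φ ∈ filtration k Mo₁ B₁ True (p + 1))
    (hψ : ψ ∈ filtration k Mo₂ B₂ True q) {n : ℕ} (hn : p + q = n) :
    φ ⊗ₜ ψ ∈ externalFiltration (k := k) (Mo₁ := Mo₁) (Mo₂ := Mo₂) (B₁ := B₁) (B₂ := B₂) n :=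
  Submodule.subset_span ⟨p, q, φ, ψ, hn, hφ, hψ, rfl⟩

theorem map_mem_of_externalFiltration {Y : Type*} [AddCommMonoid Y] [Module k Y] {n : ℕ}
    (F : bounded k Mo₁ B₁ True ⊗[k] bounded k Mo₂ B₂ True →ₗ[k] Y) (V : Submodule k Y)
    (hF : ∀ p q φ ψ, p + q = n → φ ∈ filtration k Mo₁ B₁ True (p + 1) →
      ψ ∈ filtration k Mo₂ B₂ True q → F (φ ⊗ₜ ψ) ∈ V)
    {z : bounded k Mo₁ B₁ True ⊗[k] bounded k Mo₂ B₂ True} (hz : z ∈ externalFiltration n) :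
    F z ∈ V := by
  have : externalFiltration n ≤ V.comap F := by
    rw [externalFiltration, Submodule.span_le]
    rintro _ ⟨p, q, φ, ψ, h, hφ, hψ, rfl⟩
    exact hF p q φ ψ h hφ hψ
  exact this hz

theorem externalFiltration_zero :
    externalFiltration (k := k) (Mo₁ := Mo₁) (Mo₂ := Mo₂) (B₁ := B₁) (B₂ := B₂) 0 = ⊥ := by
  rw [eq_bot_iff]
  intro z hz
  refine map_mem_of_externalFiltration
    (LinearMap.id : bounded k Mo₁ B₁ True ⊗[k] bounded k Mo₂ B₂ True →ₗ[k] _) ⊥ (fun p q φ ψ h _ hψ => ?_) hz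
  obtain rfl : q = 0 := by omega
  rw [filtration_zero, Submodule.mem_bot] at hψ
  simp [hψ]

theorem externalFiltration_mono :
    Monotone (externalFiltration (k := k) (Mo₁ := Mo₁) (Mo₂ := Mo₂) (B₁ := B₁) (B₂ := B₂)) := by
  intro n m h z hz
  refine map_mem_of_externalFiltration
    (LinearMap.id : bounded k Mo₁ B₁ True ⊗[k] bounded k Mo₂ B₂ True →ₗ[k] _) _ (fun p q φ ψ hpq hφ hψ => ?_) hz
  exact tmul_mem_externalFiltration hφ (filtration_mono True (show q ≤ q + (m - n) by omega) hψ)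
    (by omega)

theorem exists_mem_externalFiltration
    (z : bounded k Mo₁ B₁ True ⊗[k] bounded k Mo₂ B₂ True) :
    ∃ n, z ∈ externalFiltration n := by
  induction z with
  | zero => exact ⟨0, zero_mem _⟩
  | add z w hz hw =>
    obtain ⟨n, hn⟩ := hz
    obtain ⟨m, hm⟩ := hw
    exact ⟨n + m, add_mem (externalFiltration_mono (by omega) hn)
      (externalFiltration_mono (by omega) hm)⟩
  | tmul φ ψ =>
    obtain ⟨n, hn⟩ := exists_mem_filtration φ
    obtain ⟨m, hm⟩ := exists_mem_filtration ψ
    exact ⟨n + m, tmul_mem_externalFiltration (filtration_mono True (Nat.le_succ n) hn) hm rfl⟩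

end Basic

section Split

variable {k σ τ υ B₁ B₂ B : Type} [Field k] [LinearOrder σ] [LinearOrder τ] [LinearOrder υ]
    [Ring B₁] [Algebra k B₁] [Ring B₂] [Algebra k B₂] [Ring B] [Algebra k B]

/-- The variables and the coefficients split as a disjoint union and as a tensor product. -/
structure IsSplit (E : ExternalProduct k (σ →₀ ℕ) (τ →₀ ℕ) (υ →₀ ℕ) B₁ B₂ B) (ι₁ : σ ↪ υ)
    (ι₂ : τ ↪ υ) : Prop where
  strictMono₁ : StrictMono ι₁
  strictMono₂ : StrictMono ι₂
  lt : ∀ i j, ι₁ i < ι₂ j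
  single₁ : ∀ i, E.i₁ (Finsupp.single i 1) = Finsupp.single (ι₁ i) 1
  single₂ : ∀ i, E.i₂ (Finsupp.single i 1) = Finsupp.single (ι₂ i) 1
  cover : ∀ x, (∃ i, ι₁ i = x) ∨ ∃ i, ι₂ i = x
  bijective : Function.Bijective
    (TensorProduct.lift ((LinearMap.mul k B).compl₁₂ E.j₁.toLinearMap E.j₂.toLinearMap))

variable {E : ExternalProduct k (σ →₀ ℕ) (τ →₀ ℕ) (υ →₀ ℕ) B₁ B₂ B} {ι₁ : σ ↪ υ} {ι₂ : τ ↪ υ}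
  [Fintype σ] [Fintype τ] [Fintype υ]

theorem IsSplit.exists_union (hE : E.IsSplit ι₁ ι₂) (T : Finset υ) :
    ∃ (S₁ : Finset σ) (S₂ : Finset τ), S₁.map ι₁ ∪ S₂.map ι₂ = T := by
  refine ⟨T.preimage ι₁ ι₁.injective.injOn, T.preimage ι₂ ι₂.injective.injOn, ?_⟩
  ext x
  simp only [Finset.mem_union, Finset.mem_map, Finset.mem_preimage]
  constructor
  · rintro (⟨i, hi, rfl⟩ | ⟨i, hi, rfl⟩) <;> exact hi
  · intro hx
    rcases hE.cover x with ⟨i, rfl⟩ | ⟨i, rfl⟩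
    · exact Or.inl ⟨i, hx, rfl⟩
    · exact Or.inr ⟨i, hx, rfl⟩

set_option maxHeartbeats 1600000 in
/-- The external cup product of normalized cochains is a quasi-isomorphism. -/
theorem IsSplit.exact_cone_externalCup (hE : E.IsSplit ι₁ ι₂) (W₁ : (σ →₀ ℕ) →₀ k)
    (W₂ : (τ →₀ ℕ) →₀ k)
    (hW₁ : ∀ x, boundedDiff (mulAct E.u₁) W₁ True (boundedDiff (mulAct E.u₁) W₁ True x) = 0)
    (hW₂ : ∀ x, boundedDiff (mulAct E.u₂) W₂ True (boundedDiff (mulAct E.u₂) W₂ True x) = 0)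
    (hW : ∀ x, boundedDiff (mulAct E.u) (E.potential W₁ W₂) True
      (boundedDiff (mulAct E.u) (E.potential W₁ W₂) True x) = 0)
    (x : bounded k (σ →₀ ℕ) B₁ True ⊗[k] bounded k (τ →₀ ℕ) B₂ True)
    (y : bounded k (υ →₀ ℕ) B True) (hx : E.externalDiff W₁ W₂ x = 0)
    (hxy : E.externalCup x = boundedDiff (mulAct E.u) (E.potential W₁ W₂) True y) :
    ∃ x' y', E.externalDiff W₁ W₂ x' = x ∧
      E.externalCup x' - boundedDiff (mulAct E.u) (E.potential W₁ W₂) True y' = y := by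
  obtain ⟨h₁, hF₁, hσ₁, hh₁, hR₁⟩ := exists_bounded_homotopy (mulAct (k := k) E.u₁) True
  obtain ⟨h₂, hF₂, -, hh₂, hR₂⟩ := exists_bounded_homotopy (mulAct (k := k) E.u₂) True
  obtain ⟨hY, hFY, -, hhY, -⟩ := exists_bounded_homotopy (mulAct (k := k) E.u) True
  obtain ⟨j₁, hj₁, hjF₁⟩ := exists_bounded_section k σ B₁ True
  obtain ⟨j₂, hj₂, hjF₂⟩ := exists_bounded_section k τ B₂ True
  -- Identifying `B₁ ⊗ B₂` with `B` makes the tensor product of the Koszul complexes of the factors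
  -- the Koszul complex of the product; its elements are functions of pairs of subsets with values
  -- in `B`.
  let μ := LinearEquiv.ofBijective _ hE.bijective
  have hμ : ∀ a b, μ (a ⊗ₜ b) = E.j₁ a * E.j₂ b := fun a b => rfl
  let J₁ : Finset σ → B₁ →ₗ[k] bounded k (σ →₀ ℕ) B₁ True := fun S =>
    j₁ ∘ₗ LinearMap.single k (fun _ : Finset σ => B₁) S
  let J₂ : Finset τ → B₂ →ₗ[k] bounded k (τ →₀ ℕ) B₂ True := fun S =>
    j₂ ∘ₗ LinearMap.single k (fun _ : Finset τ => B₂) S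
  let K := Finset σ → Finset τ → B
  -- There are finitely many pairs of subsets. Each value in `B` is split by `μ.symm` and lifted
  -- with the sections of the two factors.
  let j : K →ₗ[k] bounded k (σ →₀ ℕ) B₁ True ⊗[k] bounded k (τ →₀ ℕ) B₂ True :=
    ∑ S₁ : Finset σ, ∑ S₂ : Finset τ, TensorProduct.map (J₁ S₁) (J₂ S₂) ∘ₗ μ.symm.toLinearMap ∘ₗ
      LinearMap.proj (R := k) (φ := fun _ => B) S₂ ∘ₗ
        LinearMap.proj (R := k) (φ := fun _ => Finset τ → B) S₁
  have hj : ∀ u, j u = ∑ S₁ : Finset σ, ∑ S₂ : Finset τ,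
      TensorProduct.map (J₁ S₁) (J₂ S₂) (μ.symm (u S₁ S₂)) := fun u => by
    simp only [j, LinearMap.sum_apply]
    rfl
  let RY : bounded k (υ →₀ ℕ) B True →ₗ[k] K := LinearMap.pi fun S₁ => LinearMap.pi fun S₂ =>
    LinearMap.proj (R := k) (φ := fun _ => B) (S₁.map ι₁ ∪ S₂.map ι₂) ∘ₗ
      boundedAntisymm k υ B True
  have hRY : ∀ y S₁ S₂, RY y S₁ S₂ = boundedAntisymm k υ B True y (S₁.map ι₁ ∪ S₂.map ι₂) :=
    fun _ _ _ => rfl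
  have hRY0 : ∀ y, RY y = 0 → boundedAntisymm k υ B True y = 0 := by
    intro y hy
    funext T
    obtain ⟨S₁, S₂, rfl⟩ := hE.exists_union T
    exact congrFun (congrFun hy S₁) S₂
  let RX : bounded k (σ →₀ ℕ) B₁ True ⊗[k] bounded k (τ →₀ ℕ) B₂ True →ₗ[k] K :=
    RY ∘ₗ E.externalCup
  have hRX : ∀ φ ψ S₁ S₂, RX (φ ⊗ₜ ψ) S₁ S₂ =
      μ (boundedAntisymm k σ B₁ True φ S₁ ⊗ₜ boundedAntisymm k τ B₂ True ψ S₂) := by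
    intro φ ψ S₁ S₂
    exact antisymm_cup_ext E hE.strictMono₁ hE.strictMono₂ hE.lt hE.single₁ hE.single₂
      (isNormalized_coe φ) (isNormalized_coe ψ) S₁ S₂
  let e₁ := LinearMap.id - (boundedDiff (mulAct (k := k) E.u₁) 0 True ∘ₗ h₁ +
    h₁ ∘ₗ boundedDiff (mulAct (k := k) E.u₁) 0 True)
  let e₂ := LinearMap.id - (boundedDiff (mulAct (k := k) E.u₂) 0 True ∘ₗ h₂ +
    h₂ ∘ₗ boundedDiff (mulAct (k := k) E.u₂) 0 True)
  -- The projection kills the kernel of the Koszul restriction, so it depends only on the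
  -- antisymmetrized values. Splitting these by subsets allows the comparison with `j` on tensors.
  have he₁ : ∀ φ, e₁ φ = ∑ S₁ : Finset σ, e₁ (J₁ S₁ (boundedAntisymm k σ B₁ True φ S₁)) := by
    intro φ
    have h := hh₁ (φ - j₁ (boundedAntisymm k σ B₁ True φ)) (by rw [map_sub, hj₁, sub_self])
    have h' : e₁ (φ - j₁ (boundedAntisymm k σ B₁ True φ)) = 0 := by
      exact sub_eq_zero.2 h.symm
    rw [map_sub, sub_eq_zero] at h'
    rw [h', ← map_sum]
    congr 1
    change _ = ∑ S₁, j₁ (Pi.single S₁ _)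
    rw [← map_sum, Finset.univ_sum_single]
  have he₂ : ∀ φ, e₂ φ = ∑ S₁ : Finset τ, e₂ (J₂ S₁ (boundedAntisymm k τ B₂ True φ S₁)) := by
    intro φ
    have h := hh₂ (φ - j₂ (boundedAntisymm k τ B₂ True φ)) (by rw [map_sub, hj₂, sub_self])
    have h' : e₂ (φ - j₂ (boundedAntisymm k τ B₂ True φ)) = 0 := by
      exact sub_eq_zero.2 h.symm
    rw [map_sub, sub_eq_zero] at h'
    rw [h', ← map_sum]
    congr 1
    change _ = ∑ S₁, j₂ (Pi.single S₁ _)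
    rw [← map_sum, Finset.univ_sum_single]
  have he : ∀ z, TensorProduct.map e₁ e₂ z = TensorProduct.map e₁ e₂ (j (RX z)) := by
    intro z
    induction z with
    | zero => simp
    | add z w hz hw => simp only [map_add, hz, hw]
    | tmul φ ψ =>
      rw [TensorProduct.map_tmul, he₁, he₂, hj, map_sum, TensorProduct.sum_tmul]
      refine Finset.sum_congr rfl fun S₁ _ => ?_
      rw [map_sum, TensorProduct.tmul_sum]
      refine Finset.sum_congr rfl fun S₂ _ => ?_
      rw [hRX, LinearEquiv.symm_apply_apply]
      rfl
  have hRe₁ : ∀ φ, boundedAntisymm k σ B₁ True (e₁ φ) = boundedAntisymm k σ B₁ True φ := by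
    intro φ
    change boundedAntisymm k σ B₁ True (φ - (_ + _)) = _
    rw [map_sub, sub_eq_self]
    exact hR₁ φ
  have hRe₂ : ∀ φ, boundedAntisymm k τ B₂ True (e₂ φ) = boundedAntisymm k τ B₂ True φ := by
    intro φ
    change boundedAntisymm k τ B₂ True (φ - (_ + _)) = _
    rw [map_sub, sub_eq_self]
    exact hR₂ φ
  have hRe : ∀ z, RX (TensorProduct.map e₁ e₂ z) = RX z := by
    intro z
    induction z with
    | zero => simp
    | add z w hz hw => simp only [map_add, hz, hw]
    | tmul φ ψ =>
      funext S₁ S₂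
      rw [TensorProduct.map_tmul, hRX, hRX, hRe₁, hRe₂]
  -- The homotopies of the factors combine to one contracting the tensor product onto the image of
  -- `e₁ ⊗ e₂`, which by `he` factors through `RX`.
  let hX := tensorHomotopy (boundedSign k (σ →₀ ℕ) B₁ True) (boundedDiff (mulAct (k := k) E.u₁) 0 True)
    h₁ h₂
  have hhX : ∀ z, E.externalDiff 0 0 (hX z) + hX (E.externalDiff 0 0 z) =
      z - TensorProduct.map e₁ e₂ z := fun z =>
    tensorHomotopy_spec _ _ _ _ _ (boundedDiff_zero_zero _ True)
      (boundedDiff_boundedSign _ 0 True) (boundedSign_boundedSign True) hσ₁ z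
  have hp0 : E.potential 0 0 = 0 := by simp [potential]
  have hRhX : ∀ z, RX (E.externalDiff 0 0 (hX z) + hX (E.externalDiff 0 0 z)) = 0 := fun z => by
    rw [hhX, map_sub, hRe, sub_self]
  have hΨb : ∀ z, E.externalCup (E.externalDiff 0 0 z) =
      boundedDiff (mulAct E.u) 0 True (E.externalCup z) := fun z => by
    rw [externalCup_externalDiff, hp0]
  let d₁ : bounded k (σ →₀ ℕ) B₁ True →ₗ[k] bounded k (σ →₀ ℕ) B₁ True :=
    boundedDiff (mulAct E.u₁) W₁ True - boundedDiff (mulAct E.u₁) 0 True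
  let d₂ : bounded k (τ →₀ ℕ) B₂ True →ₗ[k] bounded k (τ →₀ ℕ) B₂ True :=
    boundedDiff (mulAct E.u₂) W₂ True - boundedDiff (mulAct E.u₂) 0 True
  let dX : bounded k (σ →₀ ℕ) B₁ True ⊗[k] bounded k (τ →₀ ℕ) B₂ True →ₗ[k]
      bounded k (σ →₀ ℕ) B₁ True ⊗[k] bounded k (τ →₀ ℕ) B₂ True :=
    tensorDiff (boundedSign k (σ →₀ ℕ) B₁ True) d₁ d₂
  have hdX : ∀ φ ψ, dX (φ ⊗ₜ ψ) = d₁ φ ⊗ₜ ψ + boundedSign k (σ →₀ ℕ) B₁ True φ ⊗ₜ d₂ ψ :=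
    fun _ _ => rfl
  have hDX : ∀ z, E.externalDiff W₁ W₂ z = E.externalDiff 0 0 z + dX z := by
    intro z
    induction z with
    | zero => simp only [map_zero, add_zero]
    | add z w hz hw => simp only [map_add, hz, hw]; abel
    | tmul φ ψ =>
      simp only [hdX, d₁, d₂, LinearMap.sub_apply, externalDiff, tensorDiff_tmul,
        TensorProduct.sub_tmul, TensorProduct.tmul_sub]
      abel
  refine exact_cone_of_retract (E.externalDiff W₁ W₂) (E.externalDiff 0 0)
    dX
    (boundedDiff (mulAct E.u) (E.potential W₁ W₂) True) (boundedDiff (mulAct E.u) 0 True)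
    (boundedDiff (mulAct E.u) (E.potential W₁ W₂) True - boundedDiff (mulAct E.u) 0 True)
    E.externalCup hX hY RX RY j
    hDX
    (fun x => by rw [LinearMap.sub_apply]; abel)
    (tensorDiff_tensorDiff _ _ _ hW₁ hW₂ (boundedDiff_boundedSign _ _ True)) hW
    (tensorDiff_tensorDiff _ _ _ (boundedDiff_zero_zero _ True) (boundedDiff_zero_zero _ True)
      (boundedDiff_boundedSign _ _ True))
    hΨb (E.externalCup_externalDiff W₁ W₂) (fun _ => rfl) ?_ ?_ ?_ hRhX
    (fun y hy => hhY y (hRY0 y hy))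
    externalFiltration (filtration k (υ →₀ ℕ) B True) externalFiltration_zero
    (filtration_zero True) externalFiltration_mono (filtration_mono True)
    exists_mem_externalFiltration exists_mem_filtration ?_ ?_
    (fun n x hx => boundedDiff_sub_mem_filtration _ _ hx) ?_ hFY ?_ ?_ x y hx hxy
  · intro u
    funext S₁ S₂
    have hmap : ∀ T₁ T₂ z, RX (TensorProduct.map (J₁ T₁) (J₂ T₂) z) S₁ S₂ =
        if T₁ = S₁ ∧ T₂ = S₂ then μ z else 0 := by
      intro T₁ T₂ z
      induction z with
      | zero => rw [map_zero, map_zero, map_zero, ite_self]; rfl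
      | add z w hz hw =>
        rw [map_add, map_add, map_add, Pi.add_apply, Pi.add_apply, hz, hw]
        split_ifs
        · rfl
        · rw [add_zero]
      | tmul a b =>
        rw [TensorProduct.map_tmul, hRX]
        change μ (boundedAntisymm k σ B₁ True (j₁ (Pi.single T₁ a)) S₁ ⊗ₜ
          boundedAntisymm k τ B₂ True (j₂ (Pi.single T₂ b)) S₂) = _
        rw [hj₁, hj₂]
        by_cases h1 : T₁ = S₁
        · by_cases h2 : T₂ = S₂
          · subst h1 h2; simp
          · rw [Pi.single_eq_of_ne (Ne.symm h2), TensorProduct.tmul_zero, if_neg (by tauto), map_zero]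
        · rw [Pi.single_eq_of_ne (Ne.symm h1), TensorProduct.zero_tmul, if_neg (by tauto), map_zero]
    rw [hj, map_sum, Finset.sum_apply, Finset.sum_apply, Finset.sum_eq_single S₁ _ (by simp)]
    · rw [map_sum, Finset.sum_apply, Finset.sum_apply, Finset.sum_eq_single S₂ _ (by simp)]
      · rw [hmap, if_pos ⟨rfl, rfl⟩, LinearEquiv.apply_symm_apply]
      · intro T₂ _ h
        rw [hmap, if_neg (by tauto)]
    · intro T₁ _ h
      rw [map_sum, Finset.sum_apply, Finset.sum_apply]
      refine Finset.sum_eq_zero fun T₂ _ => ?_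
      rw [hmap, if_neg (by tauto)]
  · intro y hy
    have := boundedAntisymm_boundedDiff (mulAct (k := k) E.u) (hRY0 y hy)
    funext S₁ S₂
    exact congrFun this _
  · intro z hz
    rw [hhX, he, hz, map_zero, map_zero]
    exact sub_zero z
  · intro n z hz
    refine map_mem_of_externalFiltration (E.externalDiff 0 0) _ (fun p q φ ψ h hφ hψ => ?_) hz
    rw [externalDiff, tensorDiff_tmul]
    exact add_mem (tmul_mem_externalFiltration (boundedDiff_mem_filtration _ _ hφ) hψ (by omega))
      (tmul_mem_externalFiltration (boundedSign_mem_filtration hφ)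
        (boundedDiff_mem_filtration _ _ hψ) (by omega))
  · intro n z hz
    refine map_mem_of_externalFiltration dX _
      (fun p q φ ψ h hφ hψ => ?_) hz
    rw [hdX]
    exact add_mem (tmul_mem_externalFiltration (boundedDiff_sub_mem_filtration _ _ hφ) hψ h)
      (tmul_mem_externalFiltration (boundedSign_mem_filtration hφ)
        (boundedDiff_sub_mem_filtration _ _ hψ) h)
  · intro n z hz
    refine map_mem_of_externalFiltration hX _ (fun p q φ ψ h hφ hψ => ?_) hz
    rw [tensorHomotopy_tmul]
    refine add_mem ?_ ?_
    · have h1 := hF₁ p φ hφ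
      cases p with
      | zero =>
        rw [filtration_zero, Submodule.mem_bot] at h1
        rw [h1, TensorProduct.zero_tmul]
        exact zero_mem _
      | succ p => exact tmul_mem_externalFiltration h1 hψ (by omega)
    · cases q with
      | zero =>
        rw [filtration_zero, Submodule.mem_bot] at hψ
        rw [hψ, map_zero, TensorProduct.tmul_zero]
        exact zero_mem _
      | succ q =>
        have hσφ := boundedSign_mem_filtration hφ
        exact tmul_mem_externalFiltration (sub_mem hσφ (add_mem
          (boundedDiff_mem_filtration _ _ (hF₁ _ _ hσφ))
          (hF₁ _ _ (boundedDiff_mem_filtration _ _ hσφ)))) (hF₂ _ _ hψ) (by omega)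
  · intro n z hz
    refine map_mem_of_externalFiltration E.externalCup _ (fun p q φ ψ h hφ hψ => ?_) hz
    subst h
    exact cupHom_mem_truncated (E.ext₁_mem_truncated hφ) (E.swap.ext₁_mem_truncated hψ)
  · intro n y hy
    rw [hj]
    refine sum_mem fun S₁ _ => sum_mem fun S₂ _ => ?_
    -- A pair of subsets lives in degree `S₁.card + S₂.card`. If this is at least `n`, the Koszul
    -- component of an element of filtration `n` vanishes.
    rcases lt_or_ge (S₁.card + S₂.card) n with h | h
    · induction μ.symm (RY y S₁ S₂) with
      | zero => rw [map_zero]; exact zero_mem _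
      | add z w hz hw => rw [map_add]; exact add_mem hz hw
      | tmul a b =>
        refine externalFiltration_mono h ?_
        refine tmul_mem_externalFiltration (p := S₁.card) (q := S₂.card + 1)
          (hjF₁ _ _ fun T hT => ?_) (hjF₂ _ _ fun T hT => ?_) (by omega)
        · exact Pi.single_eq_of_ne (by rintro rfl; omega) _
        · exact Pi.single_eq_of_ne (by rintro rfl; omega) _
    · have h0 : RY y S₁ S₂ = 0 := antisymm_mem_truncated hy _ (by
        rw [Finset.card_union_of_disjoint, Finset.card_map, Finset.card_map]
        · exact h
        · rw [Finset.disjoint_left]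
          intro x hx hx'
          obtain ⟨a, -, rfl⟩ := Finset.mem_map.1 hx
          obtain ⟨b, -, hb⟩ := Finset.mem_map.1 hx'
          exact (hE.lt a b).ne hb.symm)
      rw [h0, map_zero, map_zero]
      exact zero_mem _

end Split

end ExternalProduct

/-! ### The Künneth theorem over a field -/

section Kunneth

variable {k X₁ X₂ Y H₁ H₂ H : Type*} [Field k] [CharZero k] [AddCommGroup X₁] [Module k X₁]
  [AddCommGroup X₂] [Module k X₂] [AddCommGroup Y] [Module k Y] [AddCommGroup H₁] [Module k H₁]
  [AddCommGroup H₂] [Module k H₂] [AddCommGroup H] [Module k H]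

/-- A projection to the cocycles which induces the identity on cohomology. -/
theorem exists_cocycle_projection (σ D : X₁ →ₗ[k] X₁) (hD : ∀ x, D (D x) = 0)
    (hσ : ∀ x, D (σ x) = - σ (D x)) (hσσ : ∀ x, σ (σ x) = x) :
    ∃ (t : X₁ →ₗ[k] X₁) (e : X₁ →ₗ[k] LinearMap.ker D), (∀ x, t (σ x) = - σ (t x)) ∧
      (∀ x, (e x : X₁) = x - (D (t x) + t (D x))) ∧ ∀ x, e (D x) = 0 := by
  obtain ⟨t, ht, htσ⟩ := exists_odd_inverse σ D hσ hσσ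
  refine ⟨t, (LinearMap.id - (D ∘ₗ t + t ∘ₗ D)).codRestrict _ fun x => ?_, htσ, fun x => rfl,
    fun x => Subtype.ext ?_⟩
  · change D x - (D (t (D x)) + t (D (D x))) = 0
    rw [ht, hD, map_zero, add_zero, sub_self]
  · rw [LinearMap.mem_ker]
    change D (x - (D (t x) + t (D x))) = 0
    rw [map_sub, map_add, hD, ht, zero_add, sub_self]

/-- The Künneth theorem for complexes graded by parity over a field. -/
theorem kunneth_bijective (σ₁ D₁ : X₁ →ₗ[k] X₁) (σ₂ D₂ : X₂ →ₗ[k] X₂) (D : Y →ₗ[k] Y)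
    (Ψ : X₁ ⊗[k] X₂ →ₗ[k] Y)
    (hD₁ : ∀ x, D₁ (D₁ x) = 0) (hσ₁ : ∀ x, D₁ (σ₁ x) = - σ₁ (D₁ x)) (hσσ₁ : ∀ x, σ₁ (σ₁ x) = x)
    (hD₂ : ∀ x, D₂ (D₂ x) = 0) (hσ₂ : ∀ x, D₂ (σ₂ x) = - σ₂ (D₂ x)) (hσσ₂ : ∀ x, σ₂ (σ₂ x) = x)
    (hΨ : ∀ z, Ψ (tensorDiff σ₁ D₁ D₂ z) = D (Ψ z))
    (hcone : ∀ x y, tensorDiff σ₁ D₁ D₂ x = 0 → Ψ x = D y →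
      ∃ x' y', tensorDiff σ₁ D₁ D₂ x' = x ∧ Ψ x' - D y' = y)
    (c₁ : LinearMap.ker D₁ →ₗ[k] H₁) (c₂ : LinearMap.ker D₂ →ₗ[k] H₂) (c : LinearMap.ker D →ₗ[k] H)
    (hc₁ : Function.Surjective c₁) (hc₂ : Function.Surjective c₂) (hc : Function.Surjective c)
    (hc₁0 : ∀ z, c₁ z = 0 ↔ ∃ x, D₁ x = z) (hc₂0 : ∀ z, c₂ z = 0 ↔ ∃ x, D₂ x = z)
    (hc0 : ∀ z, c z = 0 ↔ ∃ x, D x = z)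
    (F : H₁ ⊗[k] H₂ →ₗ[k] H)
    (hF : ∀ (z₁ : LinearMap.ker D₁) (z₂ : LinearMap.ker D₂) (h : Ψ (z₁ ⊗ₜ z₂) ∈ LinearMap.ker D),
      F (c₁ z₁ ⊗ₜ c₂ z₂) = c ⟨Ψ (z₁ ⊗ₜ z₂), h⟩) :
    Function.Bijective F := by
  -- The projections `e₁` and `e₂` to cocycles are homotopic to the identity and kill coboundaries,
  -- so tensors of cocycles compute the cohomology of the tensor complex.
  obtain ⟨t₁, e₁, htσ₁, he₁, heD₁⟩ := exists_cocycle_projection σ₁ D₁ hD₁ hσ₁ hσσ₁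
  obtain ⟨t₂, e₂, -, he₂, heD₂⟩ := exists_cocycle_projection σ₂ D₂ hD₂ hσ₂ hσσ₂
  let ι := TensorProduct.map (LinearMap.ker D₁).subtype (LinearMap.ker D₂).subtype
  have hι : ∀ v, tensorDiff σ₁ D₁ D₂ (ι v) = 0 := by
    intro v
    induction v with
    | zero => rw [map_zero, map_zero]
    | add v w hv hw => rw [map_add, map_add, hv, hw, add_zero]
    | tmul a b =>
      change D₁ a ⊗ₜ (b : X₂) + σ₁ a ⊗ₜ D₂ b = 0
      rw [LinearMap.mem_ker.1 a.2, LinearMap.mem_ker.1 b.2, TensorProduct.zero_tmul,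
        TensorProduct.tmul_zero, add_zero]
  have hιD : ∀ v, Ψ (ι v) ∈ LinearMap.ker D := fun v => by
    rw [LinearMap.mem_ker, ← hΨ, hι, map_zero]
  have hFι : ∀ v, F (TensorProduct.map c₁ c₂ v) = c ⟨Ψ (ι v), hιD v⟩ := by
    intro v
    induction v with
    | zero =>
      simp only [map_zero]
      exact (map_zero c).symm
    | add v w hv hw =>
      rw [map_add, map_add, hv, hw, ← map_add]
      congr 1
      refine Subtype.ext ?_
      change _ = Ψ (ι (v + w))
      rw [map_add, map_add]
      rfl
    | tmul a b => exact hF a b _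
  have hhom : ∀ z, tensorDiff σ₁ D₁ D₂ z = 0 →
      ∃ w, tensorDiff σ₁ D₁ D₂ w = z - ι (TensorProduct.map e₁ e₂ z) := by
    intro z hz
    refine ⟨tensorHomotopy σ₁ D₁ t₁ t₂ z, ?_⟩
    have h := tensorHomotopy_spec σ₁ D₁ t₁ D₂ t₂ hD₁ hσ₁ hσσ₁ htσ₁ z
    rw [hz, map_zero, add_zero] at h
    rw [h]
    congr 1
    change _ = (ι ∘ₗ TensorProduct.map e₁ e₂) z
    rw [← TensorProduct.map_comp]
    congr 2
    · ext x; exact (he₁ x).symm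
    · ext x; exact (he₂ x).symm
  constructor
  · rw [injective_iff_map_eq_zero]
    intro u hu
    -- The element `u` is lifted to a tensor of cocycles. Its image under `Ψ` is a coboundary, so by
    -- exactness of the cone the lift is a coboundary of the tensor complex, and applying `c₁ ∘ e₁`
    -- and `c₂ ∘ e₂` to it gives both `u` and zero.
    obtain ⟨s₁, hs₁⟩ := c₁.exists_rightInverse_of_surjective (LinearMap.range_eq_top.2 hc₁)
    obtain ⟨s₂, hs₂⟩ := c₂.exists_rightInverse_of_surjective (LinearMap.range_eq_top.2 hc₂)
    have hs : TensorProduct.map c₁ c₂ (TensorProduct.map s₁ s₂ u) = u := by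
      rw [← LinearMap.comp_apply, ← TensorProduct.map_comp, hs₁, hs₂, TensorProduct.map_id]
      rfl
    have h1 := hFι (TensorProduct.map s₁ s₂ u)
    rw [hs, hu] at h1
    obtain ⟨y, hy⟩ := (hc0 _).1 h1.symm
    obtain ⟨x', -, hx', -⟩ := hcone _ y (hι _) hy.symm
    have he₁' : (c₁ ∘ₗ e₁) ∘ₗ (LinearMap.ker D₁).subtype = c₁ := by
      ext z
      change c₁ (e₁ z) = c₁ z
      rw [← sub_eq_zero, ← map_sub, hc₁0]
      refine ⟨- t₁ z, ?_⟩
      rw [AddSubgroupClass.coe_sub, he₁, LinearMap.mem_ker.1 z.2, map_zero, map_neg]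
      abel
    have he₂' : (c₂ ∘ₗ e₂) ∘ₗ (LinearMap.ker D₂).subtype = c₂ := by
      ext z
      change c₂ (e₂ z) = c₂ z
      rw [← sub_eq_zero, ← map_sub, hc₂0]
      refine ⟨- t₂ z, ?_⟩
      rw [AddSubgroupClass.coe_sub, he₂, LinearMap.mem_ker.1 z.2, map_zero, map_neg]
      abel
    have h2 : TensorProduct.map (c₁ ∘ₗ e₁) (c₂ ∘ₗ e₂) (ι (TensorProduct.map s₁ s₂ u)) = u := by
      rw [← LinearMap.comp_apply (TensorProduct.map (c₁ ∘ₗ e₁) (c₂ ∘ₗ e₂)),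
        ← TensorProduct.map_comp, he₁', he₂', hs]
    rw [← h2, ← hx']
    clear hx' h2
    induction x' with
    | zero => rw [map_zero, map_zero]
    | add v w hv hw => rw [map_add, map_add, hv, hw, add_zero]
    | tmul a b =>
      rw [tensorDiff_tmul, map_add, TensorProduct.map_tmul, TensorProduct.map_tmul]
      simp only [LinearMap.comp_apply, heD₁, heD₂, map_zero, TensorProduct.zero_tmul,
        TensorProduct.tmul_zero, add_zero]
  · intro h
    obtain ⟨z, rfl⟩ := hc h
    -- Exactness of the cone at `(0, z)` represents `z` by `Ψ` of a tensor cocycle, which is then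
    -- moved into the tensors of cocycles by the homotopy.
    obtain ⟨x', y', hx', hy'⟩ := hcone 0 z (map_zero _) (by
      rw [map_zero, LinearMap.mem_ker.1 z.2])
    obtain ⟨w, hw⟩ := hhom x' hx'
    refine ⟨TensorProduct.map c₁ c₂ (TensorProduct.map e₁ e₂ x'), ?_⟩
    rw [hFι, ← sub_eq_zero, ← map_sub, hc0]
    refine ⟨y' - Ψ w, ?_⟩
    rw [map_sub, ← hΨ, hw, map_sub, AddSubgroupClass.coe_sub, ← hy']
    abel

end Kunneth

/-! ### Parity and normalized representatives of cohomology classes -/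

open ListCochain MvPolynomial

namespace ExternalProduct

variable {k Mo₁ Mo₂ Mo B₁ B₂ B : Type*} [CommRing k] [AddCommMonoid Mo₁]
    [AddCommMonoid Mo₂] [AddCommMonoid Mo] [Ring B₁] [Algebra k B₁] [Ring B₂] [Algebra k B₂]
    [Ring B] [Algebra k B] (E : ExternalProduct k Mo₁ Mo₂ Mo B₁ B₂ B)

/-- The block uses as many arguments as `χ` takes, and `φ` takes the others together with one slot
for the block. The degree bound ensures that the homotopy below is a compact type cochain. -/
theorem shuffle_eq_zero (m : Mo₁) {φ : List Mo₁ → B₁} {χ : List Mo₂ → B₂} {n p : ℕ}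
    (hφ : ∀ l, n + 1 ≤ l.length → φ l = 0) (hχ : ∀ l, p ≤ l.length → χ l = 0) (l : List Mo)
    (hl : n + p ≤ l.length + 1) : E.shuffle m φ χ l = 0 := by
  induction l generalizing m χ p with
  | nil =>
    rw [List.length_nil] at hl
    rw [shuffle_nil]
    rcases Nat.eq_zero_or_pos p with rfl | hp
    · rw [hχ [] (Nat.zero_le _), map_zero, zero_mul]
    · rw [hφ [m] (by simp; omega), map_zero, mul_zero]
  | cons a l ih =>
    rw [List.length_cons] at hl
    cases p with
    | zero =>
      obtain rfl : χ = 0 := funext fun l => hχ l (Nat.zero_le _)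
      rw [map_zero]; rfl
    | succ p =>
      rw [shuffle_cons, ih (χ := head k B₂ (E.p₂ a) χ) (p := p) _
        (fun l h => hχ (_ :: l) (by simpa using h)) (by omega), ext₁_apply,
        head_apply, hφ _ (by simp; omega), map_zero, zero_mul, mul_zero, add_zero]

theorem brace_eq_zero (s : k) {φ : List Mo₁ → B₁} {ψ : List Mo₂ → B₂} {n p : ℕ}
    (hφ : ∀ l, n ≤ l.length → φ l = 0) (hψ : ∀ l, p ≤ l.length → ψ l = 0) (l : List Mo)
    (hl : n + p ≤ l.length) : E.brace s φ ψ l = 0 := by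
  induction l generalizing φ n with
  | nil => exact E.brace_nil s φ ψ
  | cons a l ih =>
    rw [List.length_cons] at hl
    cases n with
    | zero =>
      obtain rfl : φ = 0 := funext fun l => hφ l (Nat.zero_le _)
      rw [map_zero]; rfl
    | succ n =>
      rw [brace_cons, E.shuffle_eq_zero (χ := head k B₂ (E.p₂ a) ψ) (n := n) (p := p) _ hφ
          (fun l h => hψ (_ :: l) (by rw [List.length_cons]; omega)) l (by omega),
        ih (φ := head k B₁ (E.p₁ a) φ) (n := n) (fun l h => hφ (_ :: l) (by simpa using h)) (by omega)]
      simp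

end ExternalProduct

namespace Cohomology

section General

variable {k A B : Type*} [CommRing k] [Ring A] [Algebra k A] [Ring B] [Algebra k B]
  (η : A →ₐ[k] B) (W : A)

theorem signInv_eq_sub (y : CompactCochains k A B) :
    signInv k A B y = cochainProj k A B 0 y - cochainProj k A B 1 y := by
  induction y using DirectSum.induction_on with
  | zero => simp
  | add x y hx hy => simp only [map_add, hx, hy]; abel
  | of p φ =>
    rw [signInv_of, cochainProj_of, cochainProj_of]
    rcases Nat.even_or_odd p with hp | hp
    · have : (p : ZMod 2) = 0 := (ZMod.natCast_eq_zero_iff_even).2 hp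
      simp [this, hp.neg_one_pow]
    · have : (p : ZMod 2) = 1 := (ZMod.natCast_eq_one_iff_odd).2 hp
      simp [this, hp.neg_one_pow]

theorem eq_zero_or_eq_one (d : ZMod 2) : d = 0 ∨ d = 1 := by revert d; decide

/-- The parity automorphism of cohomology. -/
def paritySign : Cohomology η W →ₗ[k] Cohomology η W := parityProj η W 0 - parityProj η W 1

theorem paritySign_mk (z : cocycles η W) :
    paritySign η W (mk η W z) = mk η W ⟨signInv k A B z, signInv_mem_cocycles η W z.2⟩ := by
  change parityProj η W 0 (mk η W z) - parityProj η W 1 (mk η W z) = _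
  rw [parityProj_mk, parityProj_mk, ← map_sub]
  congr 1
  exact Subtype.ext (signInv_eq_sub _).symm

/-- The sign `(-1)^d`. -/
def paritySgn (k : Type*) [CommRing k] (d : ZMod 2) : k := if d = 0 then 1 else -1

theorem paritySgn_mul_self (d : ZMod 2) : paritySgn k d * paritySgn k d = 1 := by
  rw [paritySgn]; split_ifs <;> simp

theorem paritySign_of_mem {d : ZMod 2} {x : Cohomology η W} (hx : x ∈ parity η W d) :
    paritySign η W x = paritySgn k d • x := by
  change parityProj η W 0 x - parityProj η W 1 x = _
  rw [parityProj_of_mem η W hx, parityProj_of_mem η W hx, paritySgn]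
  rcases eq_zero_or_eq_one d with rfl | rfl <;> simp

/-- Once `2` is invertible, the parity parts are the eigenspaces of the parity automorphism; this
form of homogeneity is easy to check on cocycles. -/
theorem mem_of_paritySign [Invertible (2 : k)] {d : ZMod 2} {x : Cohomology η W}
    (hx : paritySign η W x = paritySgn k d • x) : x ∈ parity η W d := by
  have h1 := sum_parityProj η W x
  have h2 : parityProj η W 0 x - parityProj η W 1 x = _ := hx
  have h3 : (Finset.univ : Finset (ZMod 2)) = {0, 1} := rfl
  rw [h3, Finset.sum_pair (by decide)] at h1
  have h4 : (2 : k) • x = (2 : k) • parityProj η W d x := by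
    rcases eq_zero_or_eq_one d with rfl | rfl
    · rw [paritySgn, if_pos rfl, one_smul] at h2
      linear_combination (norm := module) (-1 : k) • h1 - h2
    · rw [paritySgn, if_neg (by decide), neg_one_smul] at h2
      linear_combination (norm := module) (-1 : k) • h1 + h2
  have h5 := congrArg (fun y => (⅟2 : k) • y) h4
  simp only [smul_smul, invOf_mul_self, one_smul] at h5
  rw [h5]
  exact parityProj_mem η W d x

end General

end Cohomology

open ListCochain MvPolynomial

section Class

variable {k υ B : Type} [Field k] [LinearOrder υ] [Fintype υ] [Ring B] [Algebra k B]

theorem sum_repr_smul_monomialHom (η : MvPolynomial υ k →ₐ[k] B) (W : MvPolynomial υ k) :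
    ∑ m ∈ ((basisMonomials υ k).repr W).support,
      (basisMonomials υ k).repr W m • monomialHom η (.ofAdd m) = η W := by
  conv_rhs => rw [← (basisMonomials υ k).linearCombination_repr W, Finsupp.linearCombination_apply,
    Finsupp.sum, map_sum]
  refine Finset.sum_congr rfl fun m _ => ?_
  rw [map_smul, monomialHom_apply, coe_basisMonomials]

variable (η : MvPolynomial υ k →ₐ[k] B) (W : MvPolynomial υ k)

/-- The two sides are left and right multiplication by the image of `W`. Its centrality is what
makes the curved differential square to zero. -/
theorem sum_lam_eq_sum_rho (hc : ∀ b, η W * b = b * η W) (x : B) :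
    ∑ m ∈ ((basisMonomials υ k).repr W).support,
      (basisMonomials υ k).repr W m • (mulAct (k := k) (monomialHom η)).lam m x =
    ∑ m ∈ ((basisMonomials υ k).repr W).support,
      (basisMonomials υ k).repr W m • (mulAct (k := k) (monomialHom η)).rho m x := by
  have h1 : _ * x = _ * x := congrArg (· * x) (sum_repr_smul_monomialHom η W)
  have h2 : x * _ = x * _ := congrArg (x * ·) (sum_repr_smul_monomialHom η W)
  rw [Finset.sum_mul] at h1
  rw [Finset.mul_sum] at h2
  refine (Finset.sum_congr rfl fun m _ => (smul_mul_assoc _ _ _).symm).trans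
    (h1.trans ((hc x).trans (h2.symm.trans (Finset.sum_congr rfl fun m _ => mul_smul_comm _ _ _))))

/-- The curved differential on normalized functions on lists of monomials. -/
abbrev monomialDiff : bounded k (υ →₀ ℕ) B True →ₗ[k] bounded k (υ →₀ ℕ) B True :=
  boundedDiff (mulAct (monomialHom η)) ((basisMonomials υ k).repr W) True

variable (k υ B) in
/-- Compact type cochains as functions of bounded degree on lists of monomials. -/
def monomialEquiv : CompactCochains k (MvPolynomial υ k) B ≃ₗ[k] bounded k (υ →₀ ℕ) B False :=
  LinearEquiv.ofBijective
    ((evalMonomials k υ B).codRestrict _ fun x => by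
      obtain ⟨n, hn⟩ := exists_evalMonomials_bound (k := k) (υ := υ) (B := B) x
      exact ⟨n, hn, False.elim⟩)
    ⟨fun x y h => evalMonomials_injective (congrArg Subtype.val h), fun f => by
      obtain ⟨n, hn⟩ := f.2
      obtain ⟨x, hx⟩ := exists_evalMonomials_eq (k := k) (f : List (υ →₀ ℕ) → B) n hn.1
      exact ⟨x, Subtype.ext hx⟩⟩

theorem monomialEquiv_curvedDifferential (x : CompactCochains k (MvPolynomial υ k) B) :
    monomialEquiv k υ B (curvedDifferential η W x) =
      boundedDiff (mulAct (monomialHom η)) ((basisMonomials υ k).repr W) False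
        (monomialEquiv k υ B x) :=
  Subtype.ext (evalMonomials_curvedDifferential η W x)

variable (k υ B) in
/-- The cochain given by a normalized function on lists of monomials. -/
def normalizedCochain : bounded k (υ →₀ ℕ) B True →ₗ[k] CompactCochains k (MvPolynomial υ k) B :=
  (monomialEquiv k υ B).symm.toLinearMap ∘ₗ normalizedInclusion k (υ →₀ ℕ) B

theorem monomialEquiv_normalizedCochain (f : bounded k (υ →₀ ℕ) B True) :
    monomialEquiv k υ B (normalizedCochain k υ B f) = normalizedInclusion k (υ →₀ ℕ) B f :=
  (monomialEquiv k υ B).apply_symm_apply _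

theorem evalMonomials_normalizedCochain (f : bounded k (υ →₀ ℕ) B True) :
    evalMonomials k υ B (normalizedCochain k υ B f) = f :=
  congrArg Subtype.val (monomialEquiv_normalizedCochain f)

theorem curvedDifferential_normalizedCochain (f : bounded k (υ →₀ ℕ) B True) :
    curvedDifferential η W (normalizedCochain k υ B f) =
      normalizedCochain k υ B (monomialDiff η W f) :=
  evalMonomials_injective (by
    rw [evalMonomials_curvedDifferential, evalMonomials_normalizedCochain,
      evalMonomials_normalizedCochain]
    rfl)

theorem signInv_normalizedCochain (f : bounded k (υ →₀ ℕ) B True) :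
    signInv k _ B (normalizedCochain k υ B f) =
      normalizedCochain k υ B (boundedSign k (υ →₀ ℕ) B True f) :=
  evalMonomials_injective (by
    rw [evalMonomials_signInv, evalMonomials_normalizedCochain, evalMonomials_normalizedCochain]
    rfl)

theorem normalizedCochain_boundedCup (f g : bounded k (υ →₀ ℕ) B True) :
    normalizedCochain k υ B (boundedCup k (υ →₀ ℕ) B True f g) =
      normalizedCochain k υ B f * normalizedCochain k υ B g :=
  evalMonomials_injective (by
    rw [evalMonomials_mul, evalMonomials_normalizedCochain, evalMonomials_normalizedCochain,
      evalMonomials_normalizedCochain]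
    rfl)

theorem normalizedCochain_mem_cocycles (z : LinearMap.ker (monomialDiff η W)) :
    normalizedCochain k υ B z ∈ cocycles η W := by
  rw [mem_cocycles, curvedDifferential_normalizedCochain, LinearMap.mem_ker.1 z.2, map_zero]

/-- The class of a normalized cocycle. -/
def normalizedClass : LinearMap.ker (monomialDiff η W) →ₗ[k] Cohomology η W :=
  (Cohomology.mk η W).toLinearMap ∘ₗ
    (normalizedCochain k υ B ∘ₗ (LinearMap.ker (monomialDiff η W)).subtype).codRestrict
      (cocycles η W).toSubmodule (normalizedCochain_mem_cocycles η W)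

theorem normalizedClass_apply (z : LinearMap.ker (monomialDiff η W)) :
    normalizedClass η W z = Cohomology.mk η W ⟨normalizedCochain k υ B z,
      normalizedCochain_mem_cocycles η W z⟩ := rfl

variable {W} (hc : ∀ b, η W * b = b * η W)
include hc

/-- Exactness of the cone of the normalized inclusion at `(0, z)` writes a cocycle `z` as a
normalized cocycle plus a coboundary. -/
theorem normalizedClass_surjective : Function.Surjective (normalizedClass η W) := by
  intro c
  obtain ⟨z, rfl⟩ := Cohomology.mk_surjective η W c
  obtain ⟨x', y', h1, h2⟩ := exact_cone_normalizedInclusion (mulAct (monomialHom η))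
    ((basisMonomials υ k).repr W) (sum_lam_eq_sum_rho η W hc) 0 (monomialEquiv k υ B z)
    (map_zero _) (by
      rw [← monomialEquiv_curvedDifferential, (mem_cocycles η W).1 z.2, map_zero, map_zero])
  refine ⟨⟨x', h1⟩, ?_⟩
  rw [normalizedClass_apply, ← sub_eq_zero, ← map_sub, Cohomology.mk_eq_zero]
  refine ⟨(monomialEquiv k υ B).symm y', (monomialEquiv k υ B).injective ?_⟩
  rw [monomialEquiv_curvedDifferential, LinearEquiv.apply_symm_apply, AddSubgroupClass.coe_sub,
    map_sub, ← h2, monomialEquiv_normalizedCochain]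
  abel

/-- If a normalized cocycle bounds an arbitrary cochain, exactness of the cone supplies a normalized
primitive. -/
theorem normalizedClass_eq_zero (z : LinearMap.ker (monomialDiff η W)) :
    normalizedClass η W z = 0 ↔ ∃ x, monomialDiff η W x = z := by
  rw [normalizedClass_apply, Cohomology.mk_eq_zero]
  constructor
  · rintro ⟨y, hy⟩
    obtain ⟨x', y', h1, h2⟩ := exact_cone_normalizedInclusion (mulAct (monomialHom η))
      ((basisMonomials υ k).repr W) (sum_lam_eq_sum_rho η W hc) z (monomialEquiv k υ B y) z.2 (by
        rw [← monomialEquiv_curvedDifferential, hy, monomialEquiv_normalizedCochain])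
    exact ⟨x', h1⟩
  · rintro ⟨x, hx⟩
    exact ⟨normalizedCochain k υ B x, by rw [curvedDifferential_normalizedCochain, hx]⟩

theorem monomialDiff_monomialDiff (x : bounded k (υ →₀ ℕ) B True) :
    monomialDiff η W (monomialDiff η W x) = 0 :=
  boundedDiff_boundedDiff _ _ True (sum_lam_eq_sum_rho η W hc) x

omit hc

theorem boundedCup_mem_ker (z w : LinearMap.ker (monomialDiff η W)) :
    boundedCup k (υ →₀ ℕ) B True z w ∈ LinearMap.ker (monomialDiff η W) := by
  have := diff_cupHom (monomialHom η) ((basisMonomials υ k).repr W)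
    ((z : bounded k (υ →₀ ℕ) B True) : List (υ →₀ ℕ) → B) (w : bounded k (υ →₀ ℕ) B True)
  refine Subtype.ext (this.trans ?_)
  rw [show diff (mulAct (monomialHom η)) ((basisMonomials υ k).repr W)
      ((z : bounded k (υ →₀ ℕ) B True) : List (υ →₀ ℕ) → B) = 0 from congrArg Subtype.val z.2,
    show diff (mulAct (monomialHom η)) ((basisMonomials υ k).repr W)
      ((w : bounded k (υ →₀ ℕ) B True) : List (υ →₀ ℕ) → B) = 0 from congrArg Subtype.val w.2]
  simp

theorem normalizedClass_boundedCup (z w : LinearMap.ker (monomialDiff η W)) :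
    normalizedClass η W ⟨_, boundedCup_mem_ker η z w⟩ =
      normalizedClass η W z * normalizedClass η W w := by
  rw [normalizedClass_apply, normalizedClass_apply, normalizedClass_apply, ← map_mul]
  congr 1
  exact Subtype.ext (normalizedCochain_boundedCup _ _)

theorem boundedSign_mem_ker (z : LinearMap.ker (monomialDiff η W)) :
    boundedSign k (υ →₀ ℕ) B True z ∈ LinearMap.ker (monomialDiff η W) := by
  rw [LinearMap.mem_ker, boundedDiff_boundedSign, LinearMap.mem_ker.1 z.2, map_zero, neg_zero]

theorem normalizedClass_boundedSign (z : LinearMap.ker (monomialDiff η W)) :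
    normalizedClass η W ⟨_, boundedSign_mem_ker η z⟩ =
      Cohomology.paritySign η W (normalizedClass η W z) := by
  rw [normalizedClass_apply, normalizedClass_apply, Cohomology.paritySign_mk]
  congr 1
  exact Subtype.ext (signInv_normalizedCochain _).symm

/-- Homogeneous classes have homogeneous normalized representatives. -/
theorem exists_homogeneous_representative [CharZero k] (hc : ∀ b, η W * b = b * η W) {d : ZMod 2}
    {a : Cohomology η W} (ha : a ∈ Cohomology.parity η W d) :
    ∃ z : LinearMap.ker (monomialDiff η W), normalizedClass η W z = a ∧
      boundedSign k (υ →₀ ℕ) B True z =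
        Cohomology.paritySgn k d • (z : bounded k (υ →₀ ℕ) B True) := by
  obtain ⟨z, rfl⟩ := normalizedClass_surjective η hc a
  -- A representative is averaged with its signed image under the parity automorphism; on a
  -- homogeneous class this changes nothing.
  refine ⟨(2 : k)⁻¹ • (z + Cohomology.paritySgn k d • ⟨_, boundedSign_mem_ker η z⟩), ?_, ?_⟩
  · rw [map_smul, map_add, map_smul, normalizedClass_boundedSign,
      Cohomology.paritySign_of_mem η W ha, smul_smul, Cohomology.paritySgn_mul_self, one_smul,
      ← two_smul k, smul_smul, inv_mul_cancel₀ two_ne_zero, one_smul]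
  · simp only [Submodule.coe_smul, Submodule.coe_add, map_smul, map_add, boundedSign_boundedSign]
    have := Cohomology.paritySgn_mul_self (k := k) d
    rw [smul_comm _ (2 : k)⁻¹, smul_add (Cohomology.paritySgn k d), smul_smul
      (Cohomology.paritySgn k d), this, one_smul, add_comm]

/-- The normalized cochain `1`. -/
theorem exists_normalizedClass_eq_one : ∃ z : LinearMap.ker (monomialDiff η W),
    ((z : bounded k (υ →₀ ℕ) B True) : List (υ →₀ ℕ) → B) = evalMonomials k υ B 1 ∧
      normalizedClass η W z = 1 := by
  have h : ∀ l : List (υ →₀ ℕ), l ≠ [] → evalMonomials k υ B 1 l = 0 := fun l hl =>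
    evalMonomials_of_ne (p := 0) _ (by simpa using hl)
  have h' : evalMonomials k υ B 1 ∈ bounded k (υ →₀ ℕ) B True :=
    ⟨1, fun l hl => h l (by rintro rfl; simp at hl), fun _ l hl => h l (by rintro rfl; simp at hl)⟩
  have h1 : curvedDifferential η W 1 = 0 := (cocycles η W).one_mem
  refine ⟨⟨⟨_, h'⟩, Subtype.ext ?_⟩, rfl, ?_⟩
  · change diff _ _ (evalMonomials k υ B 1) = 0
    rw [← evalMonomials_curvedDifferential, h1, map_zero]
  · rw [normalizedClass_apply, ← map_one (Cohomology.mk η W)]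
    congr 1
    exact Subtype.ext (evalMonomials_injective (evalMonomials_normalizedCochain _))

end Class

/-! ### Cohomology of an external product of two curved algebras -/

open ListCochain MvPolynomial

namespace ExternalProduct

variable {k σ τ υ B₁ B₂ B : Type} [Field k] [CharZero k] [LinearOrder σ] [LinearOrder τ]
  [LinearOrder υ] [Fintype σ] [Fintype τ] [Fintype υ] [Ring B₁] [Algebra k B₁] [Ring B₂]
  [Algebra k B₂] [Ring B] [Algebra k B]
  {η₁ : MvPolynomial σ k →ₐ[k] B₁} {η₂ : MvPolynomial τ k →ₐ[k] B₂} {η : MvPolynomial υ k →ₐ[k] B}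
  {W₁ : MvPolynomial σ k} {W₂ : MvPolynomial τ k} {W : MvPolynomial υ k}

/-- The external product comes from curved polynomial algebras with coefficients. -/
structure IsCurved (E : ExternalProduct k (σ →₀ ℕ) (τ →₀ ℕ) (υ →₀ ℕ) B₁ B₂ B)
    (η₁ : MvPolynomial σ k →ₐ[k] B₁) (η₂ : MvPolynomial τ k →ₐ[k] B₂)
    (η : MvPolynomial υ k →ₐ[k] B) (W₁ : MvPolynomial σ k) (W₂ : MvPolynomial τ k)
    (W : MvPolynomial υ k) : Prop where
  u₁ : E.u₁ = monomialHom η₁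
  u₂ : E.u₂ = monomialHom η₂
  u : E.u = monomialHom η
  repr : (basisMonomials υ k).repr W =
    E.potential ((basisMonomials σ k).repr W₁) ((basisMonomials τ k).repr W₂)
  central₁ : ∀ b, η₁ W₁ * b = b * η₁ W₁
  central₂ : ∀ b, η₂ W₂ * b = b * η₂ W₂
  central : ∀ b, η W * b = b * η W

variable {E : ExternalProduct k (σ →₀ ℕ) (τ →₀ ℕ) (υ →₀ ℕ) B₁ B₂ B}

theorem IsCurved.swap (hE : E.IsCurved η₁ η₂ η W₁ W₂ W) : E.swap.IsCurved η₂ η₁ η W₂ W₁ W :=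
  ⟨hE.u₂, hE.u₁, hE.u, by rw [hE.repr, potential_swap], hE.central₂, hE.central₁, hE.central⟩

theorem IsCurved.monomialDiff_boundedExt (hE : E.IsCurved η₁ η₂ η W₁ W₂ W)
    (φ : bounded k (σ →₀ ℕ) B₁ True) :
    monomialDiff η W (E.boundedExt φ) = E.boundedExt (monomialDiff η₁ W₁ φ) := by
  have := E.boundedDiff_boundedExt ((basisMonomials σ k).repr W₁) ((basisMonomials τ k).repr W₂) φ
  rwa [hE.u, hE.u₁, ← hE.repr] at this

theorem IsCurved.boundedExt_mem_ker (hE : E.IsCurved η₁ η₂ η W₁ W₂ W)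
    (z : LinearMap.ker (monomialDiff η₁ W₁)) :
    E.boundedExt z ∈ LinearMap.ker (monomialDiff η W) := by
  rw [LinearMap.mem_ker, hE.monomialDiff_boundedExt, LinearMap.mem_ker.1 z.2, map_zero]

/-- The extension of classes from the first factor. -/
theorem IsCurved.exists_extension (hE : E.IsCurved η₁ η₂ η W₁ W₂ W) :
    ∃ L : Cohomology η₁ W₁ →ₐ[k] Cohomology η W,
      (∀ z, L (normalizedClass η₁ W₁ z) =
        normalizedClass η W ⟨E.boundedExt z, hE.boundedExt_mem_ker z⟩) ∧
      ∀ d, ∀ a ∈ Cohomology.parity η₁ W₁ d, L a ∈ Cohomology.parity η W d := by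
  have hs := normalizedClass_surjective η₁ hE.central₁
  -- The map on classes is defined through a linear choice of normalized representatives. It does
  -- not depend on the choice, since extension is a chain map.
  obtain ⟨s, hs'⟩ := (normalizedClass η₁ W₁).exists_rightInverse_of_surjective
    (LinearMap.range_eq_top.2 hs)
  let e : LinearMap.ker (monomialDiff η₁ W₁) →ₗ[k] LinearMap.ker (monomialDiff η W) :=
    E.boundedExt.restrict fun z hz => hE.boundedExt_mem_ker ⟨z, hz⟩
  let L : Cohomology η₁ W₁ →ₗ[k] Cohomology η W := normalizedClass η W ∘ₗ e ∘ₗ s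
  have hL : ∀ z, L (normalizedClass η₁ W₁ z) = normalizedClass η W (e z) := by
    intro z
    change normalizedClass η W (e (s _)) = _
    rw [← sub_eq_zero, ← map_sub, normalizedClass_eq_zero η hE.central]
    obtain ⟨x, hx⟩ := (normalizedClass_eq_zero η₁ hE.central₁ (s (normalizedClass η₁ W₁ z) - z)).1
      (by
        have h : normalizedClass η₁ W₁ (s (normalizedClass η₁ W₁ z)) = normalizedClass η₁ W₁ z :=
          LinearMap.congr_fun hs' _
        have h' := map_sub (normalizedClass η₁ W₁) (s (normalizedClass η₁ W₁ z)) z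
        rw [h, sub_self] at h'
        exact h')
    exact ⟨E.boundedExt x, by rw [hE.monomialDiff_boundedExt, hx]; exact map_sub E.boundedExt _ _⟩
  refine ⟨AlgHom.ofLinearMap L ?_ ?_, hL, ?_⟩
  · obtain ⟨z, hz, hz1⟩ := exists_normalizedClass_eq_one (k := k) η₁ (W := W₁)
    obtain ⟨w, hw, hw1⟩ := exists_normalizedClass_eq_one (k := k) η (W := W)
    rw [← hz1, hL, ← hw1]
    congr 1
    refine Subtype.ext (Subtype.ext ?_)
    rw [hw]
    change E.ext₁ ((z : bounded k (σ →₀ ℕ) B₁ True) : List (σ →₀ ℕ) → B₁) = _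
    rw [hz]
    funext l
    cases l with
    | nil => rw [ext₁_nil, evalMonomials_one, evalMonomials_one, map_one]
    | cons a l =>
      have h1 : evalMonomials k υ B 1 (a :: l) = 0 := evalMonomials_of_ne (p := 0) _ (by simp)
      have h2 : evalMonomials k σ B₁ 1 (E.p₁ a :: l.map E.p₁) = 0 :=
        evalMonomials_of_ne (p := 0) _ (by simp)
      rw [h1, ext₁_apply, List.map_cons, h2, map_zero, zero_mul]
  · intro a b
    obtain ⟨z, rfl⟩ := hs a
    obtain ⟨w, rfl⟩ := hs b
    rw [← normalizedClass_boundedCup, hL, hL, hL, ← normalizedClass_boundedCup]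
    congr 1
    exact Subtype.ext (E.boundedExt_boundedCup _ _)
  · intro d a ha
    obtain ⟨z, rfl, hz⟩ := exists_homogeneous_representative η₁ hE.central₁ ha
    letI : Invertible (2 : k) := invertibleOfNonzero two_ne_zero
    refine Cohomology.mem_of_paritySign η W ?_
    change Cohomology.paritySign η W (L _) = _ • L _
    rw [hL, ← normalizedClass_boundedSign, ← map_smul]
    congr 1
    refine Subtype.ext ?_
    change boundedSign k (υ →₀ ℕ) B True (E.boundedExt z) = _ • E.boundedExt z
    rw [boundedSign_boundedExt, hz, map_smul]

/-- Classes from the two factors commute in the graded sense. -/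
theorem IsCurved.graded_comm (hE : E.IsCurved η₁ η₂ η W₁ W₂ W)
    {d e : ZMod 2} (z : LinearMap.ker (monomialDiff η₁ W₁)) (w : LinearMap.ker (monomialDiff η₂ W₂))
    (hz : boundedSign k (σ →₀ ℕ) B₁ True z =
      Cohomology.paritySgn k d • (z : bounded k (σ →₀ ℕ) B₁ True))
    (hw : boundedSign k (τ →₀ ℕ) B₂ True w =
      Cohomology.paritySgn k e • (w : bounded k (τ →₀ ℕ) B₂ True)) :
    normalizedClass η W ⟨E.swap.boundedExt w, hE.swap.boundedExt_mem_ker w⟩ *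
        normalizedClass η W ⟨E.boundedExt z, hE.boundedExt_mem_ker z⟩ =
      (if d = 1 ∧ e = 1 then -1 else 1 : k) •
        (normalizedClass η W ⟨E.boundedExt z, hE.boundedExt_mem_ker z⟩ *
        normalizedClass η W ⟨E.swap.boundedExt w, hE.swap.boundedExt_mem_ker w⟩) := by
  set φ : List (σ →₀ ℕ) → B₁ := ((z : bounded k (σ →₀ ℕ) B₁ True) : List (σ →₀ ℕ) → B₁) with hφ
  set ψ : List (τ →₀ ℕ) → B₂ := ((w : bounded k (τ →₀ ℕ) B₂ True) : List (τ →₀ ℕ) → B₂) with hψ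
  -- This is the sign of the shifted degree of `ψ`, as the homotopy formula requires.
  set s : k := - Cohomology.paritySgn k e with hs
  have hss : s * s = 1 := by rw [hs, neg_mul_neg, Cohomology.paritySgn_mul_self]
  have hψs : parSign k (τ →₀ ℕ) B₂ ψ = - s • ψ := by
    rw [hs, neg_neg]
    exact congrArg Subtype.val hw
  have hφs : parSign k (σ →₀ ℕ) B₁ φ = Cohomology.paritySgn k d • φ := congrArg Subtype.val hz
  -- Since `φ` has parity `d`, the length-dependent sign in the homotopy formula collapses to the
  -- constant Koszul sign of the two parities.
  have hφ' : (fun l : List (σ →₀ ℕ) => (-s) ^ l.length • φ l) =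
      (if d = 1 ∧ e = 1 then -1 else 1 : k) • φ := by
    rw [hs, neg_neg, Cohomology.paritySgn]
    rcases Cohomology.eq_zero_or_eq_one e with rfl | rfl
    · funext l
      simp
    · refine Eq.trans (b := parSign k (σ →₀ ℕ) B₁ φ) rfl ?_
      rw [hφs, Cohomology.paritySgn]
      rcases Cohomology.eq_zero_or_eq_one d with rfl | rfl <;> simp
  have h := E.diff_brace s hss ((basisMonomials σ k).repr W₁) ((basisMonomials τ k).repr W₂)
    (isNormalized_coe (z : bounded k (σ →₀ ℕ) B₁ True))
    (isNormalized_coe (w : bounded k (τ →₀ ℕ) B₂ True)) hψs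
  have hz0 : diff (mulAct E.u₁) ((basisMonomials σ k).repr W₁) φ = 0 := by
    rw [hE.u₁]; exact congrArg Subtype.val z.2
  have hw0 : diff (mulAct E.u₂) ((basisMonomials τ k).repr W₂) ψ = 0 := by
    rw [hE.u₂]; exact congrArg Subtype.val w.2
  rw [← hφ, ← hψ, hz0, hw0, hφ', map_zero, map_zero, LinearMap.zero_apply, smul_zero, add_zero,
    zero_sub, hE.u, ← hE.repr, map_smul, map_smul, LinearMap.smul_apply] at h
  obtain ⟨n, hn⟩ := (z : bounded k (σ →₀ ℕ) B₁ True).2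
  obtain ⟨m, hm⟩ := (w : bounded k (τ →₀ ℕ) B₂ True).2
  -- The homotopy has bounded degree and so comes from a compact type cochain. It need not be
  -- normalized, because the coboundary is taken among all cochains.
  obtain ⟨x, hx⟩ := exists_evalMonomials_eq (k := k) (E.brace s φ ψ) (n + m)
    (fun l hl => E.brace_eq_zero s hn.1 hm.1 l hl)
  rw [normalizedClass_apply, normalizedClass_apply, ← map_mul, ← map_mul, ← map_smul,
    ← sub_eq_zero, ← map_sub, Cohomology.mk_eq_zero]
  refine ⟨- s • x, evalMonomials_injective ?_⟩
  rw [evalMonomials_curvedDifferential, map_smul, hx, map_smul, h, smul_neg, neg_smul, neg_neg,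
    smul_smul, hss, one_smul]
  change _ = evalMonomials k υ B (normalizedCochain k υ B _ * normalizedCochain k υ B _ -
    _ • (normalizedCochain k υ B _ * normalizedCochain k υ B _))
  rw [map_sub, map_smul, evalMonomials_mul, evalMonomials_mul, evalMonomials_normalizedCochain,
    evalMonomials_normalizedCochain]
  rfl

/-- The cohomology of an external product is the graded tensor product of the cohomologies of the
factors. -/
theorem IsCurved.exists_bijective (hE : E.IsCurved η₁ η₂ η W₁ W₂ W) {ι₁ : σ ↪ υ} {ι₂ : τ ↪ υ}
    (hS : E.IsSplit ι₁ ι₂) :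
    ∃ (L₁ : Cohomology η₁ W₁ →ₐ[k] Cohomology η W) (L₂ : Cohomology η₂ W₂ →ₐ[k] Cohomology η W),
      (∀ d, ∀ a ∈ Cohomology.parity η₁ W₁ d, L₁ a ∈ Cohomology.parity η W d) ∧
      (∀ d, ∀ a ∈ Cohomology.parity η₂ W₂ d, L₂ a ∈ Cohomology.parity η W d) ∧
      (∀ d e, ∀ a ∈ Cohomology.parity η₁ W₁ d, ∀ b ∈ Cohomology.parity η₂ W₂ e,
        L₂ b * L₁ a = (if d = 1 ∧ e = 1 then -1 else 1 : k) • (L₁ a * L₂ b)) ∧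
      Function.Bijective (TensorProduct.lift ((LinearMap.mul k (Cohomology η W)).compl₁₂
        L₁.toLinearMap L₂.toLinearMap)) := by
  obtain ⟨L₁, hL₁, hp₁⟩ := hE.exists_extension
  obtain ⟨L₂, hL₂, hp₂⟩ := hE.swap.exists_extension
  refine ⟨L₁, L₂, hp₁, hp₂, fun d e a ha b hb => ?_, ?_⟩
  · obtain ⟨z, rfl, hz⟩ := exists_homogeneous_representative η₁ hE.central₁ ha
    obtain ⟨w, rfl, hw⟩ := exists_homogeneous_representative η₂ hE.central₂ hb
    rw [hL₁, hL₂]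
    exact hE.graded_comm z w hz hw
  · have hcone := hS.exact_cone_externalCup ((basisMonomials σ k).repr W₁)
      ((basisMonomials τ k).repr W₂)
    have hΨ := E.externalCup_externalDiff ((basisMonomials σ k).repr W₁)
      ((basisMonomials τ k).repr W₂)
    rw [externalDiff, hE.u₁, hE.u₂, hE.u, ← hE.repr] at hcone hΨ
    refine kunneth_bijective (boundedSign k (σ →₀ ℕ) B₁ True) (monomialDiff η₁ W₁)
      (boundedSign k (τ →₀ ℕ) B₂ True) (monomialDiff η₂ W₂) (monomialDiff η W) E.externalCup
      (monomialDiff_monomialDiff η₁ hE.central₁) (boundedDiff_boundedSign _ _ True)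
      (boundedSign_boundedSign True)
      (monomialDiff_monomialDiff η₂ hE.central₂) (boundedDiff_boundedSign _ _ True)
      (boundedSign_boundedSign True) hΨ
      (hcone (monomialDiff_monomialDiff η₁ hE.central₁) (monomialDiff_monomialDiff η₂ hE.central₂)
        (monomialDiff_monomialDiff η hE.central))
      (normalizedClass η₁ W₁) (normalizedClass η₂ W₂) (normalizedClass η W)
      (normalizedClass_surjective η₁ hE.central₁) (normalizedClass_surjective η₂ hE.central₂)
      (normalizedClass_surjective η hE.central) (normalizedClass_eq_zero η₁ hE.central₁)
      (normalizedClass_eq_zero η₂ hE.central₂) (normalizedClass_eq_zero η hE.central) _ ?_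
    intro z w h
    change L₁ (normalizedClass η₁ W₁ z) * L₂ (normalizedClass η₂ W₂ w) = _
    rw [hL₁, hL₂, ← normalizedClass_boundedCup]
    rfl

end ExternalProduct

/-! ### Crossed products with diagonal symmetries -/

open ListCochain MvPolynomial

section TorusAction

variable {σ τ υ : Type}

theorem torus_smul_rename (l : Torus υ) (ι : σ → υ) (f : MvPolynomial σ ℂ) :
    l • rename ι f = rename ι ((l ∘ ι : Torus σ) • f) := by
  rw [torus_smul_def, torus_smul_def, aeval_rename, ← AlgHom.comp_apply (rename ι)]
  congr 1
  refine MvPolynomial.algHom_ext fun i => ?_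
  simp [MvPolynomial.algHom_C]

theorem subgroup_smul_def {G : Subgroup (Torus σ)} (l : G) (f : MvPolynomial σ ℂ) :
    l • f = (l : Torus σ) • f := rfl

/-- The potential commutes with polynomials, and with group elements because they fix it. -/
theorem crossedInclusion_comm {G : Subgroup (Torus σ)} {W : MvPolynomial σ ℂ}
    (hG : G ≤ symmetryGroup W) (b : SkewMonoidAlgebra (MvPolynomial σ ℂ) G) :
    crossedInclusion ℂ (MvPolynomial σ ℂ) G W * b = b * crossedInclusion ℂ (MvPolynomial σ ℂ) G W := by
  rw [crossedInclusion_apply]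
  induction b using SkewMonoidAlgebra.induction_on with
  | zero => rw [mul_zero, zero_mul]
  | single g a =>
    have : g • W = W := hG g.2
    rw [SkewMonoidAlgebra.single_mul_single, SkewMonoidAlgebra.single_mul_single, one_smul, this,
      one_mul, mul_one, mul_comm]
  | add a b ha hb => rw [mul_add, add_mul, ha, hb]

variable {ι₁ : σ ↪ υ} {ι₂ : τ ↪ υ} {G₁ : Subgroup (Torus σ)} {G₂ : Subgroup (Torus τ)}
  {G : Subgroup (Torus υ)}

/-- The extension of diagonal symmetries by the identity. -/
def extendSymmetry (ι₁ : σ ↪ υ) (ι₂ : τ ↪ υ) (hne : ∀ i j, ι₁ i ≠ ι₂ j)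
    (hG : ∀ l : Torus υ, l ∈ G ↔ (l ∘ ι₁ ∈ G₁ ∧ l ∘ ι₂ ∈ G₂)) : G₁ →* G where
  toFun g := ⟨Function.extend ι₁ (g : Torus σ) 1, (hG _).2 ⟨by
    rw [Function.extend_comp ι₁.injective]; exact g.2, by
    rw [show Function.extend ι₁ (g : Torus σ) 1 ∘ ι₂ = 1 from funext fun j =>
      Function.extend_apply' _ _ _ (by rintro ⟨i, hi⟩; exact hne i j hi)]
    exact G₂.one_mem⟩⟩
  map_one' := Subtype.ext (Function.extend_one _)
  map_mul' g h := Subtype.ext (by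
    change Function.extend ι₁ ((g : Torus σ) * (h : Torus σ)) 1 = _
    have := Function.extend_mul ι₁ (g : Torus σ) (h : Torus σ) (1 : Torus υ) 1
    rwa [one_mul] at this)

variable (hne : ∀ i j, ι₁ i ≠ ι₂ j) (hG : ∀ l : Torus υ, l ∈ G ↔ (l ∘ ι₁ ∈ G₁ ∧ l ∘ ι₂ ∈ G₂))

theorem extendSymmetry_comp (g : G₁) :
    (extendSymmetry ι₁ ι₂ hne hG g : Torus υ) ∘ ι₁ = g :=
  Function.extend_comp ι₁.injective _ _

theorem extendSymmetry_comp' (g : G₁) :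
    (extendSymmetry ι₁ ι₂ hne hG g : Torus υ) ∘ ι₂ = 1 :=
  funext fun j => Function.extend_apply' _ _ _ (by rintro ⟨i, hi⟩; exact hne i j hi)

theorem extendSymmetry_smul_rename (g : G₁) (a : MvPolynomial σ ℂ) :
    extendSymmetry ι₁ ι₂ hne hG g • rename ι₁ a = rename ι₁ (g • a) := by
  rw [subgroup_smul_def, torus_smul_rename, extendSymmetry_comp, subgroup_smul_def]

theorem extendSymmetry_smul_rename' (g : G₁) (a : MvPolynomial τ ℂ) :
    extendSymmetry ι₁ ι₂ hne hG g • rename ι₂ a = rename ι₂ a := by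
  rw [subgroup_smul_def, torus_smul_rename, extendSymmetry_comp', one_smul]

/-- The inclusion of the crossed product of the first factor. -/
def crossedExtension : SkewMonoidAlgebra (MvPolynomial σ ℂ) G₁ →ₐ[ℂ]
    SkewMonoidAlgebra (MvPolynomial υ ℂ) G :=
  SkewMonoidAlgebra.liftNCAlgHom
    ((crossedInclusion ℂ (MvPolynomial υ ℂ) G).comp (rename ι₁))
    ((SkewMonoidAlgebra.of (MvPolynomial υ ℂ) G).comp (extendSymmetry ι₁ ι₂ hne hG))
    (fun {x y} => by
      change SkewMonoidAlgebra.single 1 (rename ι₁ (y • x)) *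
          SkewMonoidAlgebra.single (extendSymmetry ι₁ ι₂ hne hG y) 1 =
        SkewMonoidAlgebra.single (extendSymmetry ι₁ ι₂ hne hG y) 1 *
          SkewMonoidAlgebra.single 1 (rename ι₁ x)
      rw [SkewMonoidAlgebra.single_mul_single, SkewMonoidAlgebra.single_mul_single, one_mul,
        mul_one, one_smul, mul_one, one_mul, extendSymmetry_smul_rename])

theorem crossedExtension_single (g : G₁) (a : MvPolynomial σ ℂ) :
    crossedExtension hne hG (.single g a) =
      .single (extendSymmetry ι₁ ι₂ hne hG g) (rename ι₁ a) := by
  refine (SkewMonoidAlgebra.liftNC_single _ _ _ _).trans ?_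
  change SkewMonoidAlgebra.single 1 (rename ι₁ a) *
    SkewMonoidAlgebra.single (extendSymmetry ι₁ ι₂ hne hG g) 1 = _
  rw [SkewMonoidAlgebra.single_mul_single, one_mul, one_smul, mul_one]

variable (hG' : ∀ l : Torus υ, l ∈ G ↔ (l ∘ ι₂ ∈ G₂ ∧ l ∘ ι₁ ∈ G₁)) (hne' : ∀ i j, ι₂ i ≠ ι₁ j)

theorem crossedExtension_mul (g : G₁) (a : MvPolynomial σ ℂ) (h : G₂) (b : MvPolynomial τ ℂ) :
    crossedExtension hne hG (.single g a) * crossedExtension hne' hG' (.single h b) =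
      .single (extendSymmetry ι₁ ι₂ hne hG g * extendSymmetry ι₂ ι₁ hne' hG' h)
        (rename ι₁ a * rename ι₂ b) := by
  rw [crossedExtension_single, crossedExtension_single, SkewMonoidAlgebra.single_mul_single,
    extendSymmetry_smul_rename']

/-- Symmetries of one factor fix the variables of the other, and diagonal symmetries commute among
themselves. -/
theorem crossedExtension_comm (x : SkewMonoidAlgebra (MvPolynomial σ ℂ) G₁)
    (y : SkewMonoidAlgebra (MvPolynomial τ ℂ) G₂) :
    crossedExtension hne hG x * crossedExtension hne' hG' y =
      crossedExtension hne' hG' y * crossedExtension hne hG x := by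
  induction x using SkewMonoidAlgebra.induction_on with
  | zero => rw [map_zero, mul_zero, zero_mul]
  | add x x' hx hx' => rw [map_add, mul_add, add_mul, hx, hx']
  | single g a =>
    induction y using SkewMonoidAlgebra.induction_on with
    | zero => rw [map_zero, mul_zero, zero_mul]
    | add y y' hy hy' => rw [map_add, mul_add, add_mul, hy, hy']
    | single h b =>
      rw [crossedExtension_mul, crossedExtension_mul, mul_comm (rename ι₁ a)]
      congr 1
      exact Subtype.ext (mul_comm _ _)

theorem mapDomain_add_mapDomain (hcov : ∀ x, (∃ i, ι₁ i = x) ∨ ∃ i, ι₂ i = x) (a : υ →₀ ℕ)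
    (hne : ∀ i j, ι₁ i ≠ ι₂ j) :
    Finsupp.mapDomain ι₁ (a.comapDomain ι₁ ι₁.injective.injOn) +
      Finsupp.mapDomain ι₂ (a.comapDomain ι₂ ι₂.injective.injOn) = a := by
  ext x
  rw [Finsupp.add_apply]
  rcases hcov x with ⟨i, rfl⟩ | ⟨i, rfl⟩
  · rw [Finsupp.mapDomain_apply ι₁.injective, Finsupp.mapDomain_notin_range, add_zero,
      Finsupp.comapDomain_apply]
    rintro ⟨j, hj⟩
    exact hne i j hj.symm
  · rw [Finsupp.mapDomain_apply ι₂.injective, Finsupp.mapDomain_notin_range, zero_add,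
      Finsupp.comapDomain_apply]
    rintro ⟨j, hj⟩
    exact hne j i hj

theorem comapDomain_mapDomain_of_ne (hne : ∀ i j, ι₁ i ≠ ι₂ j) (a : τ →₀ ℕ) :
    (Finsupp.mapDomain ι₂ a).comapDomain ι₁ ι₁.injective.injOn = 0 := by
  ext i
  rw [Finsupp.comapDomain_apply, Finsupp.mapDomain_notin_range]
  · rfl
  · rintro ⟨j, hj⟩
    exact hne i j hj.symm

theorem comapDomain_mapDomain (a : σ →₀ ℕ) :
    (Finsupp.mapDomain ι₁ a).comapDomain ι₁ ι₁.injective.injOn = a := by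
  ext i
  rw [Finsupp.comapDomain_apply, Finsupp.mapDomain_apply ι₁.injective]

/-- The external product of crossed products of polynomial rings. -/
def crossedProduct (hcov : ∀ x, (∃ i, ι₁ i = x) ∨ ∃ i, ι₂ i = x) :
    ExternalProduct ℂ (σ →₀ ℕ) (τ →₀ ℕ) (υ →₀ ℕ) (SkewMonoidAlgebra (MvPolynomial σ ℂ) G₁)
      (SkewMonoidAlgebra (MvPolynomial τ ℂ) G₂) (SkewMonoidAlgebra (MvPolynomial υ ℂ) G) where
  p₁ := Finsupp.comapDomain.addMonoidHom ι₁.injective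
  p₂ := Finsupp.comapDomain.addMonoidHom ι₂.injective
  i₁ := Finsupp.mapDomain.addMonoidHom ι₁
  i₂ := Finsupp.mapDomain.addMonoidHom ι₂
  p₁_i₁ a := comapDomain_mapDomain a
  p₂_i₁ a := comapDomain_mapDomain_of_ne (ι₁ := ι₂) (ι₂ := ι₁) (fun i j => (hne j i).symm) a
  p₁_i₂ a := comapDomain_mapDomain_of_ne hne a
  p₂_i₂ a := comapDomain_mapDomain a
  u₁ := monomialHom (crossedInclusion ℂ (MvPolynomial σ ℂ) G₁)
  u₂ := monomialHom (crossedInclusion ℂ (MvPolynomial τ ℂ) G₂)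
  u := monomialHom (crossedInclusion ℂ (MvPolynomial υ ℂ) G)
  j₁ := crossedExtension hne hG
  j₂ := crossedExtension (fun i j => (hne j i).symm) (fun l => (hG l).trans and_comm)
  comm x y := crossedExtension_comm _ _ _ _ x y
  u_eq a := by
    rw [monomialHom_apply, monomialHom_apply, monomialHom_apply, crossedInclusion_apply,
      crossedInclusion_apply, crossedInclusion_apply, crossedExtension_mul,
      map_one (extendSymmetry _ _ _ _), map_one (extendSymmetry _ _ _ _), mul_one, rename_monomial, rename_monomial, monomial_mul, mul_one]
    refine congrArg (fun m => SkewMonoidAlgebra.single 1 (monomial m (1 : ℂ))) ?_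
    exact (mapDomain_add_mapDomain hcov a hne).symm

end TorusAction

/-! ### Splitting crossed products and potentials in two sets of variables -/

open ListCochain MvPolynomial

section

variable {σ τ υ : Type}

theorem repr_monomial (m : σ →₀ ℕ) :
    (basisMonomials σ ℂ).repr (monomial m 1) = Finsupp.single m 1 := by
  have : monomial m (1 : ℂ) = basisMonomials σ ℂ m := by rw [coe_basisMonomials]
  rw [this, Module.Basis.repr_self]

theorem repr_rename (ι : σ → υ) (W : MvPolynomial σ ℂ) :
    (basisMonomials υ ℂ).repr (rename ι W) =
      ((basisMonomials σ ℂ).repr W).mapDomain (Finsupp.mapDomain ι) := by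
  have : (basisMonomials υ ℂ).repr.toLinearMap ∘ₗ (rename ι).toLinearMap =
      Finsupp.lmapDomain ℂ ℂ (Finsupp.mapDomain ι) ∘ₗ (basisMonomials σ ℂ).repr.toLinearMap := by
    refine (basisMonomials σ ℂ).ext fun m => ?_
    simp only [LinearMap.comp_apply, LinearEquiv.coe_coe, coe_basisMonomials,
      AlgHom.toLinearMap_apply, rename_monomial, repr_monomial, Finsupp.lmapDomain_apply,
      Finsupp.mapDomain_single]
  exact LinearMap.congr_fun this W

/-- The basis of a crossed product given by monomials and group elements. -/
def crossedBasis (G : Subgroup (Torus σ)) :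
    Module.Basis ((σ →₀ ℕ) × G) ℂ (SkewMonoidAlgebra (MvPolynomial σ ℂ) G) :=
  (basisMonomials σ ℂ).smulTower
    (SkewMonoidAlgebra.basisSingleOne (k := MvPolynomial σ ℂ) (G := G))

theorem crossedBasis_apply (G : Subgroup (Torus σ)) (m : σ →₀ ℕ) (g : G) :
    crossedBasis G (m, g) = .single g (monomial m 1) := by
  rw [crossedBasis, Module.Basis.smulTower_apply, coe_basisMonomials]
  change monomial m (1 : ℂ) • SkewMonoidAlgebra.single g (1 : MvPolynomial σ ℂ) = _
  rw [SkewMonoidAlgebra.smul_single, smul_eq_mul, mul_one]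

variable {ι₁ : σ ↪ υ} {ι₂ : τ ↪ υ} {G₁ : Subgroup (Torus σ)} {G₂ : Subgroup (Torus τ)}
  {G : Subgroup (Torus υ)}
  (hne : ∀ i j, ι₁ i ≠ ι₂ j) (hG : ∀ l : Torus υ, l ∈ G ↔ (l ∘ ι₁ ∈ G₁ ∧ l ∘ ι₂ ∈ G₂))
  (hG' : ∀ l : Torus υ, l ∈ G ↔ (l ∘ ι₂ ∈ G₂ ∧ l ∘ ι₁ ∈ G₁)) (hne' : ∀ i j, ι₂ i ≠ ι₁ j)
  (hcov : ∀ x, (∃ i, ι₁ i = x) ∨ ∃ i, ι₂ i = x)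

/-- Pairs of monomials and symmetries of the factors correspond to those of the product. -/
def crossedIndexEquiv : ((σ →₀ ℕ) × G₁) × ((τ →₀ ℕ) × G₂) ≃ (υ →₀ ℕ) × G where
  toFun x := (Finsupp.mapDomain ι₁ x.1.1 + Finsupp.mapDomain ι₂ x.2.1,
    extendSymmetry ι₁ ι₂ hne hG x.1.2 * extendSymmetry ι₂ ι₁ hne' hG' x.2.2)
  invFun y := ((y.1.comapDomain ι₁ ι₁.injective.injOn, ⟨_, ((hG _).1 y.2.2).1⟩),
    (y.1.comapDomain ι₂ ι₂.injective.injOn, ⟨_, ((hG _).1 y.2.2).2⟩))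
  left_inv := by
    rintro ⟨⟨a, g⟩, ⟨b, h⟩⟩
    have h1 := extendSymmetry_comp hne hG g
    have h2 := extendSymmetry_comp' hne hG g
    have h3 := extendSymmetry_comp hne' hG' h
    have h4 := extendSymmetry_comp' hne' hG' h
    refine Prod.ext (Prod.ext ?_ (Subtype.ext ?_)) (Prod.ext ?_ (Subtype.ext ?_))
    · change Finsupp.comapDomain ι₁ _ _ = a
      rw [Finsupp.comapDomain_add_of_injective ι₁.injective, comapDomain_mapDomain,
        comapDomain_mapDomain_of_ne hne, add_zero]
    · change (extendSymmetry ι₁ ι₂ hne hG g : Torus υ) ∘ ι₁ *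
        (extendSymmetry ι₂ ι₁ hne' hG' h : Torus υ) ∘ ι₁ = g
      rw [h1, h4, mul_one]
    · change Finsupp.comapDomain ι₂ _ _ = b
      rw [Finsupp.comapDomain_add_of_injective ι₂.injective, comapDomain_mapDomain,
        comapDomain_mapDomain_of_ne hne', zero_add]
    · change (extendSymmetry ι₁ ι₂ hne hG g : Torus υ) ∘ ι₂ *
        (extendSymmetry ι₂ ι₁ hne' hG' h : Torus υ) ∘ ι₂ = h
      rw [h2, h3, one_mul]
  right_inv := by
    rintro ⟨a, g⟩
    refine Prod.ext (mapDomain_add_mapDomain hcov a hne) (Subtype.ext (funext fun x => ?_))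
    rcases hcov x with ⟨i, rfl⟩ | ⟨i, rfl⟩
    · have h1 := congrFun (extendSymmetry_comp hne hG ⟨_, ((hG _).1 g.2).1⟩) i
      have h4 := congrFun (extendSymmetry_comp' hne' hG' ⟨_, ((hG _).1 g.2).2⟩) i
      exact (congrArg₂ (· * ·) h1 h4).trans (mul_one _)
    · have h1 := congrFun (extendSymmetry_comp' hne hG ⟨_, ((hG _).1 g.2).1⟩) i
      have h4 := congrFun (extendSymmetry_comp hne' hG' ⟨_, ((hG _).1 g.2).2⟩) i
      exact (congrArg₂ (· * ·) h1 h4).trans (one_mul _)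

-- Products of a basis of the first crossed product with one of the second are the basis of pairs
-- (monomial, symmetry): both the exponents and the symmetry split uniquely along the two sets of
-- variables.
include hcov in
theorem crossedExtension_bijective : Function.Bijective (TensorProduct.lift
    ((LinearMap.mul ℂ (SkewMonoidAlgebra (MvPolynomial υ ℂ) G)).compl₁₂
      (crossedExtension hne hG).toLinearMap (crossedExtension hne' hG').toLinearMap)) := by
  have : TensorProduct.lift
      ((LinearMap.mul ℂ (SkewMonoidAlgebra (MvPolynomial υ ℂ) G)).compl₁₂
        (crossedExtension hne hG).toLinearMap (crossedExtension hne' hG').toLinearMap) =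
      (((crossedBasis G₁).tensorProduct (crossedBasis G₂)).equiv (crossedBasis G)
        (crossedIndexEquiv hne hG hG' hne' hcov)).toLinearMap := by
    refine ((crossedBasis G₁).tensorProduct (crossedBasis G₂)).ext ?_
    rintro ⟨⟨a, g⟩, ⟨b, h⟩⟩
    rw [LinearEquiv.coe_coe, Module.Basis.equiv_apply, Module.Basis.tensorProduct_apply]
    refine Eq.trans ?_ (crossedBasis_apply G _ _).symm
    rw [crossedBasis_apply, crossedBasis_apply]
    refine (crossedExtension_mul hne hG hG' hne' g _ h _).trans ?_
    rw [rename_monomial, rename_monomial, monomial_mul, mul_one]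
  rw [this]
  exact LinearEquiv.bijective _

variable [LinearOrder σ] [LinearOrder τ] [LinearOrder υ] [Fintype σ] [Fintype τ] [Fintype υ]

/-- The cohomology of an external sum of potentials in two disjoint sets of variables. -/
theorem exists_cohomology_extensions {ι₁ : σ ↪ υ} {ι₂ : τ ↪ υ} (h₁ : StrictMono ι₁)
    (h₂ : StrictMono ι₂) (hlt : ∀ i j, ι₁ i < ι₂ j)
    (hcov : ∀ x, (∃ i, ι₁ i = x) ∨ ∃ i, ι₂ i = x) {G₁ : Subgroup (Torus σ)}
    {G₂ : Subgroup (Torus τ)} {G : Subgroup (Torus υ)}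
    (hG : ∀ l : Torus υ, l ∈ G ↔ (l ∘ ι₁ ∈ G₁ ∧ l ∘ ι₂ ∈ G₂)) {W₁ : MvPolynomial σ ℂ}
    {W₂ : MvPolynomial τ ℂ} {W : MvPolynomial υ ℂ} (hW : W = rename ι₁ W₁ + rename ι₂ W₂)
    (hW₁ : G₁ ≤ symmetryGroup W₁) (hW₂ : G₂ ≤ symmetryGroup W₂) :
    ∃ (L₁ : HHc ℂ (MvPolynomial σ ℂ) G₁ W₁ →ₐ[ℂ] HHc ℂ (MvPolynomial υ ℂ) G W)
      (L₂ : HHc ℂ (MvPolynomial τ ℂ) G₂ W₂ →ₐ[ℂ] HHc ℂ (MvPolynomial υ ℂ) G W),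
      (∀ d, ∀ a ∈ HHcParity ℂ (MvPolynomial σ ℂ) G₁ W₁ d,
        L₁ a ∈ HHcParity ℂ (MvPolynomial υ ℂ) G W d) ∧
      (∀ d, ∀ a ∈ HHcParity ℂ (MvPolynomial τ ℂ) G₂ W₂ d,
        L₂ a ∈ HHcParity ℂ (MvPolynomial υ ℂ) G W d) ∧
      (∀ d e, ∀ a ∈ HHcParity ℂ (MvPolynomial σ ℂ) G₁ W₁ d,
        ∀ b ∈ HHcParity ℂ (MvPolynomial τ ℂ) G₂ W₂ e,
        L₂ b * L₁ a = (if d = 1 ∧ e = 1 then -1 else 1 : ℂ) • (L₁ a * L₂ b)) ∧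
      Function.Bijective (TensorProduct.lift
        ((LinearMap.mul ℂ (HHc ℂ (MvPolynomial υ ℂ) G W)).compl₁₂
          L₁.toLinearMap L₂.toLinearMap)) := by
  have hne : ∀ i j, ι₁ i ≠ ι₂ j := fun i j => (hlt i j).ne
  have hGW : G ≤ symmetryGroup W := by
    intro l hl
    have h1 : (l ∘ ι₁) • W₁ = W₁ := hW₁ ((hG l).1 hl).1
    have h2 : (l ∘ ι₂) • W₂ = W₂ := hW₂ ((hG l).1 hl).2
    change l • W = W
    rw [hW, smul_add, torus_smul_rename, torus_smul_rename, h1, h2]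
  have hE : (crossedProduct hne hG hcov).IsCurved (crossedInclusion ℂ (MvPolynomial σ ℂ) G₁)
      (crossedInclusion ℂ (MvPolynomial τ ℂ) G₂) (crossedInclusion ℂ (MvPolynomial υ ℂ) G)
      W₁ W₂ W :=
    { u₁ := rfl
      u₂ := rfl
      u := rfl
      repr := by
        rw [hW, map_add, repr_rename, repr_rename]
        rfl
      central₁ := crossedInclusion_comm hW₁
      central₂ := crossedInclusion_comm hW₂
      central := crossedInclusion_comm hGW }
  have hS : (crossedProduct hne hG hcov).IsSplit ι₁ ι₂ :=
    { strictMono₁ := h₁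
      strictMono₂ := h₂
      lt := hlt
      single₁ := fun i => Finsupp.mapDomain_single
      single₂ := fun i => Finsupp.mapDomain_single
      cover := hcov
      bijective := crossedExtension_bijective _ _ _ _ hcov }
  exact hE.exists_bijective hS

end

/-! ### Splitting off the first factor of a graded tensor product -/

section ConsTensor

variable {k : Type} [CommRing k] {r : ℕ} {A : Fin (r + 1) → Type} [∀ i, AddCommGroup (A i)]
  [∀ i, Module k (A i)]

variable (k A) in
/-- Splitting off the first factor of a tensor product. -/
def consTensor : (⨂[k] i, A i) →ₗ[k] A 0 ⊗[k] (⨂[k] i : Fin r, A i.succ) :=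
  PiTensorProduct.lift (LinearMap.uncurryLeft
    { toFun := fun x => (TensorProduct.mk k (A 0) (⨂[k] i : Fin r, A i.succ) x).compMultilinearMap
        (PiTensorProduct.tprod k)
      map_add' := fun x y => by ext; simp [TensorProduct.add_tmul]
      map_smul' := fun c x => by ext; simp [TensorProduct.smul_tmul'] })

theorem consTensor_tprod (a : ∀ i, A i) :
    consTensor k A (PiTensorProduct.tprod k a) =
      a 0 ⊗ₜ PiTensorProduct.tprod k (fun i : Fin r => a i.succ) :=
  PiTensorProduct.lift.tprod _

theorem consTensor_bijective : Function.Bijective (consTensor k A) := by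
  let g : A 0 ⊗[k] (⨂[k] i : Fin r, A i.succ) →ₗ[k] ⨂[k] i, A i :=
    TensorProduct.lift (PiTensorProduct.lift.toLinearMap ∘ₗ (PiTensorProduct.tprod k).curryLeft)
  have hg : ∀ x (b : ∀ i : Fin r, A i.succ), g (x ⊗ₜ PiTensorProduct.tprod k b) =
      PiTensorProduct.tprod k (Fin.cons x b : ∀ i, A i) := fun x b =>
    (PiTensorProduct.lift.tprod (φ := (PiTensorProduct.tprod k).curryLeft x) b)
  have h1 : g ∘ₗ consTensor k A = LinearMap.id := by
    refine PiTensorProduct.ext (MultilinearMap.ext fun a => ?_)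
    change g (consTensor k A (PiTensorProduct.tprod k a)) = PiTensorProduct.tprod k a
    rw [consTensor_tprod, hg]
    congr 1
    exact Fin.cons_self_tail a
  have h2 : consTensor k A ∘ₗ g = LinearMap.id := by
    refine TensorProduct.ext (LinearMap.ext fun x => PiTensorProduct.ext
      (MultilinearMap.ext fun b => ?_))
    change consTensor k A (g (x ⊗ₜ PiTensorProduct.tprod k b)) = x ⊗ₜ PiTensorProduct.tprod k b
    rw [hg, consTensor_tprod]
    rfl
  exact Function.bijective_iff_has_inverse.2 ⟨g, LinearMap.congr_fun h1, LinearMap.congr_fun h2⟩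

end ConsTensor

section Sign

variable {k : Type*} [CommRing k]

theorem sign_add_left (d d' e : ZMod 2) : (if d + d' = 1 ∧ e = 1 then -1 else 1 : k) =
    (if d = 1 ∧ e = 1 then -1 else 1) * (if d' = 1 ∧ e = 1 then -1 else 1) := by
  have h2 : (1 + 1 : ZMod 2) = 0 := rfl
  rcases Cohomology.eq_zero_or_eq_one d with rfl | rfl <;>
    rcases Cohomology.eq_zero_or_eq_one d' with rfl | rfl <;>
    rcases Cohomology.eq_zero_or_eq_one e with rfl | rfl <;> simp [h2]

theorem prod_sign {ι : Type*} (s : Finset ι) (p : ι → ZMod 2) (e : ZMod 2) :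
    ∏ i ∈ s, (if p i = 1 ∧ e = 1 then -1 else 1 : k) =
      if ∑ i ∈ s, p i = 1 ∧ e = 1 then -1 else 1 := by
  classical
  induction s using Finset.induction_on with
  | empty => simp
  | insert i s hi ih => rw [Finset.prod_insert hi, Finset.sum_insert hi, ih, sign_add_left]

/-- Pairs `j < i` with `j = 0` contribute the sign of moving the first right-hand factor past all
later left-hand factors; the other pairs belong to the tails. -/
theorem koszulSign_succ {r : ℕ} (p q : Fin (r + 1) → ZMod 2) :
    koszulSign k p q = (if ∑ i : Fin r, p i.succ = 1 ∧ q 0 = 1 then -1 else 1) *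
      koszulSign k (fun i : Fin r => p i.succ) (fun i : Fin r => q i.succ) := by
  have h0 : (Finset.univ.filter fun j : Fin (r + 1) => j < 0) = ∅ := by simp
  have h : ∀ i : Fin r, (Finset.univ.filter fun j : Fin (r + 1) => j < i.succ) =
      Insert.insert 0 ((Finset.univ.filter fun j : Fin r => j < i).map (Fin.succEmb r)) := by
    intro i
    ext j
    refine Fin.cases ?_ (fun j => ?_) j
    · simp
    · simp
  rw [koszulSign, Fin.prod_univ_succ, h0, Finset.prod_empty, one_mul, ← prod_sign,
    koszulSign, ← Finset.prod_mul_distrib]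
  refine Finset.prod_congr rfl fun i _ => ?_
  rw [h, Finset.prod_insert (by simp), Finset.prod_map]
  rfl

end Sign

namespace GradedPiTensor

variable {k : Type} [CommRing k] {r : ℕ} {A : Fin (r + 1) → Type} [∀ i, Ring (A i)]
  [∀ i, Algebra k (A i)] (𝒜 : ∀ i, ZMod 2 → Submodule k (A i)) [∀ i, GradedAlgebra (𝒜 i)]
  {H : Type} [Ring H] [Algebra k H] (ℋ : ZMod 2 → Submodule k H) [GradedAlgebra ℋ]

/-- A graded algebra generated by two graded commuting factors, the second of which is a graded
tensor product, is a graded tensor product. -/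
theorem exists_of_cons (L₁ : A 0 →ₐ[k] H)
    (L₂ : GradedPiTensor (fun i : Fin r => 𝒜 i.succ) →ₐ[k] H)
    (h₁ : ∀ d, ∀ a ∈ 𝒜 0 d, L₁ a ∈ ℋ d)
    (h₂ : ∀ d, ∀ a ∈ parityPart (fun i : Fin r => 𝒜 i.succ) d, L₂ a ∈ ℋ d)
    (hc : ∀ d e, ∀ a ∈ 𝒜 0 d, ∀ b ∈ parityPart (fun i : Fin r => 𝒜 i.succ) e,
      L₂ b * L₁ a = (if d = 1 ∧ e = 1 then -1 else 1 : k) • (L₁ a * L₂ b))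
    (hb : Function.Bijective (TensorProduct.lift
      ((LinearMap.mul k H).compl₁₂ L₁.toLinearMap L₂.toLinearMap))) :
    ∃ Φ : GradedPiTensor 𝒜 →ₐ[k] H, Function.Bijective Φ ∧
      ∀ d, ∀ x ∈ parityPart 𝒜 d, Φ x ∈ ℋ d := by
  let F : A 0 ⊗[k] GradedPiTensor (fun i : Fin r => 𝒜 i.succ) →ₗ[k] H :=
    TensorProduct.lift ((LinearMap.mul k H).compl₁₂ L₁.toLinearMap L₂.toLinearMap)
  let c : GradedPiTensor 𝒜 →ₗ[k] A 0 ⊗[k] GradedPiTensor (fun i : Fin r => 𝒜 i.succ) :=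
    consTensor k A
  let Φ : GradedPiTensor 𝒜 →ₗ[k] H := F ∘ₗ c
  have hΦ : ∀ a, Φ (tprod 𝒜 a) =
      L₁ (a 0) * L₂ (tprod (fun i : Fin r => 𝒜 i.succ) (fun i => a i.succ)) := fun a => by
    have h : c (tprod 𝒜 a) = a 0 ⊗ₜ tprod (fun i : Fin r => 𝒜 i.succ) (fun i => a i.succ) :=
      consTensor_tprod a
    exact congrArg F h
  have hmem : ∀ (p : Fin (r + 1) → ZMod 2) (a : ∀ i, A i), (∀ i, a i ∈ 𝒜 i (p i)) →
      tprod (fun i : Fin r => 𝒜 i.succ) (fun i => a i.succ) ∈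
        parityPart (fun i : Fin r => 𝒜 i.succ) (∑ i : Fin r, p i.succ) := fun p a ha =>
    Submodule.subset_span ⟨fun i => p i.succ, _, rfl, fun i => ha i.succ, rfl⟩
  have hmul : ∀ x y, Φ (x * y) = Φ x * Φ y := by
    intro x y
    induction x using induction_on with
    | zero => rw [zero_mul, map_zero, zero_mul]
    | add x x' hx hx' => rw [add_mul, map_add, map_add, add_mul, hx, hx']
    | smul c x hx => rw [smul_mul_assoc, map_smul, map_smul, smul_mul_assoc, hx]
    | tmul p a ha =>
      induction y using induction_on with
      | zero => rw [mul_zero, map_zero, mul_zero]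
      | add y y' hy hy' => rw [mul_add, map_add, map_add, mul_add, hy, hy']
      | smul c y hy => rw [mul_smul_comm, map_smul, map_smul, mul_smul_comm, hy]
      | tmul q b hb =>
        have h1 := tprod_mul_tprod (fun i : Fin r => 𝒜 i.succ) (fun i => p i.succ)
          (fun i => q i.succ) (fun i => a i.succ) (fun i => b i.succ) (fun i => ha i.succ)
          (fun i => hb i.succ)
        -- Graded commutation moves the tail of `a` past the head of `b`. The sign produced is the
        -- factor of the Koszul sign that belongs to the first place.
        have h2 := hc _ _ _ (hb 0) _ (hmem p a ha)
        rw [tprod_mul_tprod 𝒜 p q a b ha hb, map_smul, hΦ, hΦ, hΦ, koszulSign_succ, mul_assoc,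
          ← mul_assoc (L₂ _), h2, if_congr and_comm rfl rfl, smul_mul_assoc, mul_smul_comm,
          mul_assoc (L₁ (b 0)), ← map_mul L₂, h1, map_smul L₂, mul_smul_comm, mul_smul_comm,
          smul_smul, ← mul_assoc, ← map_mul]
        rfl
  refine ⟨AlgHom.ofLinearMap Φ ?_ hmul, hb.comp consTensor_bijective, fun d x hx => ?_⟩
  · rw [one_def, hΦ]
    change L₁ 1 * L₂ 1 = 1
    rw [map_one, map_one, one_mul]
  · change Φ x ∈ ℋ d
    induction hx using Submodule.span_induction with
    | mem x h =>
      obtain ⟨p, a, rfl, ha, rfl⟩ := h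
      rw [hΦ, Fin.sum_univ_succ]
      exact SetLike.mul_mem_graded (h₁ _ _ (ha 0)) (h₂ _ _ (hmem p a ha))
    | zero => rw [map_zero]; exact zero_mem _
    | add x y _ _ hx hy => rw [map_add]; exact add_mem hx hy
    | smul c x _ hx => rw [map_smul]; exact Submodule.smul_mem _ _ hx

end GradedPiTensor

/-! ### The case without variables -/

open ListCochain MvPolynomial

section NoVariables

variable {υ : Type} [IsEmpty υ]

/-- Without variables the only monomial is `1`, so normalized cochains live in degree zero. -/
theorem apply_eq_zero_of_isEmpty {k B : Type} [Field k] [Ring B] [Algebra k B]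
    (f : bounded k (υ →₀ ℕ) B True) {l : List (υ →₀ ℕ)} (hl : l ≠ []) :
    (f : List (υ →₀ ℕ) → B) l = 0 := by
  obtain ⟨f, n, hf⟩ := f
  refine hf.2 trivial l ?_
  obtain ⟨a, l, rfl⟩ := List.exists_cons_of_ne_nil hl
  rw [Subsingleton.elim a 0]
  exact List.mem_cons_self

theorem monomialDiff_eq_zero_of_isEmpty {k B : Type} [Field k] [LinearOrder υ] [Fintype υ]
    [Ring B] [Algebra k B] (η : MvPolynomial υ k →ₐ[k] B) (W : MvPolynomial υ k)
    (f : bounded k (υ →₀ ℕ) B True) : monomialDiff η W f = 0 := by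
  refine Subtype.ext (funext fun l => ?_)
  by_cases hl : l = []
  · subst hl
    have h1 := diff_eq_diff_zero (mulAct (k := k) (monomialHom η)) ((basisMonomials υ k).repr W)
      (f := (f : List (υ →₀ ℕ) → B)) (l := []) fun l' h' =>
        apply_eq_zero_of_isEmpty f (by rintro rfl; simp at h')
    have h2 := diff_congr (mulAct (k := k) (monomialHom η)) 0
      (f := (f : List (υ →₀ ℕ) → B)) (g := 0) (l := []) (fun l' h' => by simp at h')
      (fun _ _ h => absurd rfl h)
    rw [map_zero] at h2
    exact h1.trans h2
  · exact apply_eq_zero_of_isEmpty _ hl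

theorem crossed_eq_algebraMap_of_isEmpty (G : Subgroup (Torus υ))
    (b : SkewMonoidAlgebra (MvPolynomial υ ℂ) G) :
    ∃ c : ℂ, b = algebraMap ℂ (SkewMonoidAlgebra (MvPolynomial υ ℂ) G) c := by
  induction b using SkewMonoidAlgebra.induction_on with
  | zero => exact ⟨0, (map_zero _).symm⟩
  | single g a =>
    obtain ⟨c, rfl⟩ := MvPolynomial.C_surjective υ a
    exact ⟨c, by rw [Subsingleton.elim g 1]; rfl⟩
  | add a b ha hb =>
    obtain ⟨⟨c, rfl⟩, d, rfl⟩ := And.intro ha hb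
    exact ⟨c + d, (map_add _ _ _).symm⟩

/-- The polynomial ring is the ground field and the group is trivial, so normalized cochains are the
scalars in degree zero, with zero differential. -/
theorem algebraMap_bijective_of_isEmpty (G : Subgroup (Torus υ)) {W : MvPolynomial υ ℂ}
    (hG : G ≤ symmetryGroup W) :
    Function.Bijective (algebraMap ℂ (HHc ℂ (MvPolynomial υ ℂ) G W)) := by
  letI : Fintype υ := Fintype.ofIsEmpty
  letI : LinearOrder υ := LinearOrder.lift' (isEmptyElim : υ → ℕ) fun x => isEmptyElim x
  let B := SkewMonoidAlgebra (MvPolynomial υ ℂ) G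
  let η : MvPolynomial υ ℂ →ₐ[ℂ] B := crossedInclusion ℂ (MvPolynomial υ ℂ) G
  have hc : ∀ b, η W * b = b * η W := crossedInclusion_comm hG
  obtain ⟨z₁, h1, h1'⟩ := exists_normalizedClass_eq_one (W := W) η
  have hsmul : ∀ z : LinearMap.ker (monomialDiff η W), ∃ c : ℂ, z = c • z₁ := by
    intro z
    obtain ⟨c, h⟩ := crossed_eq_algebraMap_of_isEmpty G
      (((z : bounded ℂ (υ →₀ ℕ) B True) : List (υ →₀ ℕ) → B) [])
    refine ⟨c, Subtype.ext (Subtype.ext (funext fun l => ?_))⟩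
    by_cases hl : l = []
    · subst hl
      change _ = c • (((z₁ : bounded ℂ (υ →₀ ℕ) B True) :
        List (υ →₀ ℕ) → B) [])
      rw [h, h1, evalMonomials_one, Algebra.algebraMap_eq_smul_one]
    · rw [apply_eq_zero_of_isEmpty _ hl, apply_eq_zero_of_isEmpty _ hl]
  have hne : (1 : HHc ℂ (MvPolynomial υ ℂ) G W) ≠ 0 := by
    intro h
    rw [← h1', normalizedClass_eq_zero η hc] at h
    obtain ⟨x, hx⟩ := h
    rw [monomialDiff_eq_zero_of_isEmpty] at hx
    have := congrFun (h1.symm.trans (congrArg Subtype.val hx.symm)) []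
    rw [evalMonomials_one] at this
    exact one_ne_zero this
  refine ⟨?_, fun a => ?_⟩
  · haveI : Nontrivial (HHc ℂ (MvPolynomial υ ℂ) G W) := ⟨⟨1, 0, hne⟩⟩
    exact (algebraMap ℂ (HHc ℂ (MvPolynomial υ ℂ) G W)).injective
  · obtain ⟨z, rfl⟩ := normalizedClass_surjective η hc a
    obtain ⟨c, rfl⟩ := hsmul z
    exact ⟨c, by rw [map_smul, h1', Algebra.algebraMap_eq_smul_one]⟩

end NoVariables

namespace GradedPiTensor

variable {k : Type} [CommRing k] {ι : Type} [Fintype ι] [LinearOrder ι] [IsEmpty ι] {A : ι → Type}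
  [∀ i, Ring (A i)] [∀ i, Algebra k (A i)] (𝒜 : ∀ i, ZMod 2 → Submodule k (A i))
  [∀ i, GradedAlgebra (𝒜 i)] {H : Type} [Ring H] [Algebra k H] (ℋ : ZMod 2 → Submodule k H)
  [GradedAlgebra ℋ]

/-- The empty graded tensor product is the ground ring. -/
theorem exists_of_isEmpty (hb : Function.Bijective (algebraMap k H)) :
    ∃ Φ : GradedPiTensor 𝒜 →ₐ[k] H, Function.Bijective Φ ∧
      ∀ d, ∀ x ∈ parityPart 𝒜 d, Φ x ∈ ℋ d := by
  let e : GradedPiTensor 𝒜 ≃ₗ[k] k := PiTensorProduct.isEmptyEquiv ι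
  have he : ∀ a, e (tprod 𝒜 a) = 1 := fun a => PiTensorProduct.isEmptyEquiv_apply_tprod ι a
  have hs : ∀ x, ∃ c : k, x = c • (1 : GradedPiTensor 𝒜) := fun x =>
    ⟨e x, e.injective (by rw [map_smul, one_def, he, smul_eq_mul, mul_one])⟩
  have h1 : Algebra.linearMap k H (e 1) = 1 := by
    rw [one_def, he, Algebra.linearMap_apply, map_one]
  refine ⟨AlgHom.ofLinearMap (Algebra.linearMap k H ∘ₗ e.toLinearMap) h1 ?_,
    hb.comp e.bijective, fun d x hx => ?_⟩
  · intro x y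
    obtain ⟨⟨c, rfl⟩, d, rfl⟩ := And.intro (hs x) (hs y)
    change Algebra.linearMap k H (e _) = Algebra.linearMap k H (e _) * Algebra.linearMap k H (e _)
    rw [smul_mul_smul_comm, one_mul, map_smul, map_smul, map_smul, map_smul, map_smul, map_smul,
      h1, smul_mul_smul_comm, one_mul]
  · change Algebra.linearMap k H (e x) ∈ ℋ d
    induction hx using Submodule.span_induction with
    | mem x h =>
      obtain ⟨p, a, rfl, ha, rfl⟩ := h
      rw [he, Algebra.linearMap_apply, map_one, Finset.univ_eq_empty, Finset.sum_empty]
      exact SetLike.one_mem_graded ℋ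
    | zero => rw [map_zero, map_zero]; exact zero_mem _
    | add x y _ _ hx hy => rw [map_add, map_add]; exact add_mem hx hy
    | smul c x _ hx => rw [map_smul, map_smul]; exact Submodule.smul_mem _ _ hx

end GradedPiTensor

/-! ### Induction on the number of summands -/

theorem productGroup_le_symmetryGroup {r : ℕ} {N : Fin r → ℕ}
    {W : ∀ s, MvPolynomial (Fin (N s)) ℂ} {G : ∀ s, Subgroup (Torus (Fin (N s)))}
    (hG : ∀ s, G s ≤ symmetryGroup (W s)) :
    productGroup G ≤ symmetryGroup (directSumPotential W) := by
  intro l hl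
  change l • directSumPotential W = directSumPotential W
  rw [directSumPotential, Finset.smul_sum]
  refine Finset.sum_congr rfl fun s _ => ?_
  rw [torus_smul_rename]
  exact congrArg _ (hG s (hl s))

/-- The sum of the remaining potentials, with the product of their groups, is again a polynomial
with a group of diagonal symmetries fixing it. The two-factor theorem thus applies to the first
summand and the rest. -/
theorem exists_gradedPiTensor_algHom (r : ℕ) (N : Fin r → ℕ)
    (W : ∀ s, MvPolynomial (Fin (N s)) ℂ) (G : ∀ s, Subgroup (Torus (Fin (N s))))
    (hG : ∀ s, G s ≤ symmetryGroup (W s)) :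
    ∃ Φ : GradedPiTensor (fun s => HHcParity ℂ (MvPolynomial (Fin (N s)) ℂ) (G s) (W s)) →ₐ[ℂ]
        HHc ℂ (MvPolynomial (Σ s, Fin (N s)) ℂ) (productGroup G) (directSumPotential W),
      Function.Bijective Φ ∧ ∀ d, ∀ x ∈ GradedPiTensor.parityPart
          (fun s => HHcParity ℂ (MvPolynomial (Fin (N s)) ℂ) (G s) (W s)) d,
        Φ x ∈ HHcParity ℂ (MvPolynomial (Σ s, Fin (N s)) ℂ) (productGroup G)
          (directSumPotential W) d := by
  induction r with
  | zero =>
    exact GradedPiTensor.exists_of_isEmpty _ _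
      (algebraMap_bijective_of_isEmpty _ (productGroup_le_symmetryGroup hG))
  | succ r ih =>
    obtain ⟨Ψ, hΨ, hΨ'⟩ := ih (fun s => N s.succ) (fun s => W s.succ) (fun s => G s.succ)
      (fun s => hG s.succ)
    -- The lexicographic order puts the variables of the first summand before all others, as the
    -- comparison of Koszul signs demands.
    letI : LinearOrder (Σ s : Fin r, Fin (N s.succ)) := Sigma.Lex.linearOrder
    letI : LinearOrder (Σ s, Fin (N s)) := Sigma.Lex.linearOrder
    let ι₁ : Fin (N 0) ↪ Σ s, Fin (N s) := ⟨fun i => ⟨0, i⟩, fun i j h => eq_of_heq (Sigma.mk.inj_iff.1 h).2⟩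
    let ι₂ : (Σ s : Fin r, Fin (N s.succ)) ↪ Σ s, Fin (N s) :=
      ⟨fun x => ⟨x.1.succ, x.2⟩, by
        rintro ⟨s, i⟩ ⟨t, j⟩ h
        obtain ⟨h1, h2⟩ := Sigma.mk.inj_iff.1 h
        obtain rfl := Fin.succ_injective _ h1
        exact congrArg (Sigma.mk s) (eq_of_heq h2)⟩
    obtain ⟨L₁, L₂, hL₁, hL₂, hcomm, hbij⟩ := exists_cohomology_extensions
      (ι₁ := ι₁) (ι₂ := ι₂) (fun i j h => Sigma.Lex.right _ _ h)
      (by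
        rintro ⟨s, i⟩ ⟨t, j⟩ h
        rcases Sigma.lex_iff.1 h with h | ⟨h, h'⟩
        · exact Sigma.Lex.left _ _ (Fin.succ_lt_succ_iff.2 h)
        · obtain rfl : s = t := h
          exact Sigma.Lex.right _ _ h')
      (fun i j => Sigma.Lex.left _ _ (Fin.succ_pos _))
      (by
        rintro ⟨s, i⟩
        induction s using Fin.cases with
        | zero => exact Or.inl ⟨i, rfl⟩
        | succ s => exact Or.inr ⟨⟨s, i⟩, rfl⟩)
      (G₁ := G 0) (G₂ := productGroup fun s => G s.succ) (G := productGroup G)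
      (fun l => Fin.forall_fin_succ) (W₁ := W 0) (W₂ := directSumPotential fun s => W s.succ)
      (W := directSumPotential W)
      (by
        rw [directSumPotential, directSumPotential, Fin.sum_univ_succ, map_sum]
        refine congrArg₂ _ rfl (Finset.sum_congr rfl fun s _ => ?_)
        rw [rename_rename]
        rfl)
      (hG 0) (productGroup_le_symmetryGroup fun s => hG s.succ)
    refine GradedPiTensor.exists_of_cons _ _ L₁ (L₂.comp Ψ) hL₁
      (fun d a ha => hL₂ d _ (hΨ' d a ha)) (fun d e a ha b hb => hcomm d e a ha _ (hΨ' e b hb)) ?_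
    let E := TensorProduct.congr (LinearEquiv.refl ℂ (HHc ℂ (MvPolynomial (Fin (N 0)) ℂ) (G 0) (W 0)))
      (LinearEquiv.ofBijective Ψ.toLinearMap hΨ)
    -- Precomposing with the isomorphism from the induction hypothesis on the second tensor factor
    -- preserves bijectivity.
    convert hbij.comp E.bijective using 1
    rw [← LinearEquiv.coe_coe, ← LinearMap.coe_comp]
    congr 1
    exact TensorProduct.ext' fun _ _ => rfl

end TwistedHochschild

end

theorem mainTheorem10 (r : ℕ) (N : Fin r → ℕ) (W : ∀ s, MvPolynomial (Fin (N s)) ℂ)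
    (hW : ∀ s, TwistedHochschild.IsElementaryInvertible (W s))
    (G : ∀ s, Subgroup (TwistedHochschild.Torus (Fin (N s)))) (hfin : ∀ s, Finite (G s))
    (hG : ∀ s, G s ≤ TwistedHochschild.symmetryGroup (W s)) :
    ∃ Φ : TwistedHochschild.HHc ℂ (MvPolynomial (Σ s, Fin (N s)) ℂ)
          (TwistedHochschild.productGroup G) (TwistedHochschild.directSumPotential W) ≃ₐ[ℂ]
        TwistedHochschild.GradedPiTensor (fun s =>
          TwistedHochschild.HHcParity ℂ (MvPolynomial (Fin (N s)) ℂ) (G s) (W s)),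
      ∀ d : ZMod 2,
        (TwistedHochschild.HHcParity ℂ (MvPolynomial (Σ s, Fin (N s)) ℂ)
          (TwistedHochschild.productGroup G) (TwistedHochschild.directSumPotential W) d).map
            Φ.toLinearMap =
        TwistedHochschild.GradedPiTensor.parityPart (fun s =>
          TwistedHochschild.HHcParity ℂ (MvPolynomial (Fin (N s)) ℂ) (G s) (W s)) d := by
  obtain ⟨Ψ, hΨ, hmem⟩ := TwistedHochschild.exists_gradedPiTensor_algHom r N W G hG
  refine ⟨(AlgEquiv.ofBijective Ψ hΨ).symm, fun d => le_antisymm ?_ fun y hy =>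
    ⟨Ψ y, hmem d y hy, (AlgEquiv.ofBijective Ψ hΨ).symm_apply_apply y⟩⟩
  rintro _ ⟨x, hx, rfl⟩
  obtain ⟨y, rfl⟩ := hΨ.2 x
  change (AlgEquiv.ofBijective Ψ hΨ).symm (AlgEquiv.ofBijective Ψ hΨ y) ∈ _
  rw [AlgEquiv.symm_apply_apply]
  -- A bijection that preserves parity also reflects it: the part of `y` of parity `d` has the same
  -- image as `y`, because all other parts map to parities absent from `Ψ y`.
  have h : Ψ (TwistedHochschild.GradedPiTensor.parityProj _ d y) = Ψ y := by
    have h1 := TwistedHochschild.Cohomology.parityProj_of_mem _ _ (d := d) hx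
    rw [if_pos rfl] at h1
    conv_rhs => rw [← h1, ← TwistedHochschild.GradedPiTensor.sum_parityProj _ y, map_sum, map_sum]
    rw [Finset.sum_eq_single d]
    · rw [TwistedHochschild.Cohomology.parityProj_of_mem _ _ (hmem d _
        (TwistedHochschild.GradedPiTensor.parityProj_mem _ d y)), if_pos rfl]
    · intro e _ he
      rw [TwistedHochschild.Cohomology.parityProj_of_mem _ _ (hmem e _
        (TwistedHochschild.GradedPiTensor.parityProj_mem _ e y)), if_neg he]
    · exact fun h => absurd (Finset.mem_univ d) h
  rw [← hΨ.1 h]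
  exact TwistedHochschild.GradedPiTensor.parityProj_mem _ d y
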